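/- **Conventions.** Fix a commutative ring $R$ and $n\in\mathbb N$. A *perversity* is a Goresky–MacPherson $n$-perversity, i.e. a map $p:\{0,\dots,n\}\to\mathbb N$ with $p(0)=p(1)=p(2)=0$ and $p(i)\le p(i+1)\le p(i)+1$ for $i\ge 1$; perversities are ordered pointwise, $0$ is the smallest and $t$ the largest one. A *perverse cochain complex* is a functor $C_\bullet$ from the poset of perversities to cochain complexes of $R$-modules; quasi-isomorphisms are the maps inducing isomorphisms on cohomology in every perversity. A *pDGA* $A_\bullet$ is a perverse cochain complex with a unit $1\in A_0^0$ and natural, associative, unital products $A_p^i\otimes A_q^j\to A_r^{i+j}$ for $p+q\le r$ for which $d$ is a derivation; it is *commutative* if $ab=(-1)^{|a||b|}ba$. Perverse DG $A$-bimodules are defined in the same way. The dual bimodule $DA$ is $(DA)_p^i=\operatorname{Hom}_R(A_{t-p}^{-i},R)$ with $(d\varphi)(x)=-(-1)^{|\varphi|}\varphi(dx)$, $(a\varphi)(x)=(-1)^{|a|(|\varphi|+|x|)}\varphi(xa)$ and $(\varphi a)(x)=\varphi(ax)$. For a perverse DG bimodule $M_\bullet$, $HC^c_r(A,M)$ is the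 module of *normalized Hochschild cochains* of degree $c$ and perverse degree $r$: families $f$ of $R$-multilinear maps $(a_1,\dots,a_k)\mapsto f[a_1|\dots|a_k]\in M_q^{\,c+\sum(|a_i|-1)}$ ($k\ge 0$, $a_i\in A_{r_i}$, $r+r_1+\dots+r_k\le q$), natural in all perversities and vanishing if some $a_i=1$. With $\varepsilon_i=\sum_{j<i}(|a_j|-1)$ the differential is $$\begin{aligned}Df[a_1|\dots|a_k]={}&d(f[a_1|\dots|a_k])+\sum_{i=1}^k(-1)^{\varepsilon_i+|f|}f[a_1|\dots|da_i|\dots|a_k]-(-1)^{(|a_1|+1)|f|}a_1f[a_2|\dots|a_k]\\&+(-1)^{\varepsilon_k+|f|}f[a_1|\dots|a_{k-1}]a_k-\sum_{i=2}^k(-1)^{\varepsilon_i+|f|}f[a_1|\dots|a_{i-1}a_i|\dots|a_k],\end{aligned}$$ and $HH^*_\bullet(A,M)$ is the cohomology; $HH^*_\bullet(A)=HH^*_\bullet(A,A)$. Equivalently, $HC(A,M)=\operatorname{Hom}_{A^e}(\mathbb B(A),M)$ for the normalized two-sided bar construction $\mathbb B(A)=A\boxtimes T(s\bar A)\boxtimes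 A$, $\bar A=A/R1$. With $\bar\varepsilon_i=\sum_{j\le i}(|a_j|-1)$, $HC(A)=HC(A,A)$ acts on $HC(A,M)$ by $$f.g\,[a_1|\dots|a_k]=\sum_{i=0}^k(-1)^{|g|\bar\varepsilon_i}f[a_1|\dots|a_i]\,g[a_{i+1}|\dots|a_k];$$ for $M=A$ this is the cup product $f\cup g$. The Gerstenhaber bracket is $[f,g]=f\circ g-(-1)^{(|f|-1)(|g|-1)}g\circ f$ with $$f\circ g\,[a_1|\dots|a_k]=\sum_{0\le i\le j\le k}(-1)^{(|g|-1)\bar\varepsilon_i}f[a_1|\dots|a_i|g[a_{i+1}|\dots|a_j]|a_{j+1}|\dots|a_k].$$ A *perverse Gerstenhaber algebra* is a perverse graded module with a unital, associative, graded commutative product $\cup$ and a bracket of degree $-1$, both natural and of perverse degree $0$, satisfying $[a,b]=-(-1)^{(|a|-1)(|b|-1)}[b,a]$, $[[a,b],c]=[a,[b,c]]-(-1)^{(|a|-1)(|b|-1)}[b,[a,c]]$ and $[a,b\cup c]=[a,b]\cup c+(-1)^{(|a|-1)|b|}b\cup[a,c]$. It is a *perverse BV algebra* if it is equipped with an operator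 $\Delta$ of degree $-1$ and perverse degree $0$ such that $\Delta\circ\Delta=0$ and $(-1)^{|a|}[a,b]=\Delta(a\cup b)-\Delta(a)\cup b-(-1)^{|a|}a\cup\Delta(b)$. The operator $B^\vee$ on $HC(A,DA)$ is the dual of the Connes boundary: identify $f\in HC(A,DA)$ with the linear form $\bar f(a_0[a_1|\dots|a_k])=(-1)^{|a_0|\sum_{j\ge1}(|a_j|-1)}f[a_1|\dots|a_k](a_0)$ on Hochschild chains, and put $$(B^\vee\bar f)(a_0[a_1|\dots|a_k])=-(-1)^{|f|}\sum_{i=0}^k(-1)^{\sum_{j<i}(|a_j|-1)\sum_{j\ge i}(|a_j|-1)}\bar f(1[a_i|\dots|a_k|a_0|\dots|a_{i-1}]).$$ A pDGA $A_\bullet$ is a *perverse derived Poincaré duality algebra* (pDPDA) if, in the derived category of perverse DG $A$-bimodules, it is isomorphic to its dual $DA_\bullet$ by an isomorphism $\theta$ of perverse degree $0$ and of some degree $m\in\mathbb Z$; thus $\theta$ is represented by quasi-isomorphisms of bimodules $A\leftarrow P\to DA$ of degrees $0$ and $m$. **Theorem D.** Let $A_\bullet$ be a commutative pDPDA whose bar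 construction $\mathbb B(A)_\bullet$ is cofibrant as a perverse DG $A$-bimodule (bimodule morphisms $\mathbb B(A)\to N$ lift along every surjective quasi-isomorphism $E\to N$ of perverse DG bimodules). Then $HH^*_\bullet(A)$, with the unit, cup product and bracket induced from cochains, is a perverse Gerstenhaber algebra, and it extends to a perverse BV algebra. More precisely, a cocycle $\zeta\in(DA)^m_0$ representing $\theta(1)\in H^m(DA)_0$ exists for some isomorphism $\theta$ as above, and for every such $\theta$, of any degree $m$, and every such $\zeta$: 1. $g_\zeta:A\to DA$, $a\mapsto a\zeta$, is a quasi-isomorphism of degree $m$; 2. the lift of $\zeta$ through the multiplication map, $c=g_\zeta\circ q_A\in HC^m_0(A,DA)$, where $q_A:\mathbb B(A)\to A$ is $q_A(a[\,]b)=ab$ and $q_A(a[a_1|\dots|a_k]b)=0$ for $k>0$, is a cocycle, and $B^\vee(c)=0$ as a normalized cochain; 3. $f\mapsto f.c$ induces isomorphisms $\Phi:HH^i_p(A)\to HH^{i+m}_p(A,DA)$, $B^\vee$ induces an operator on $HH^*_\bullet(A,DA)$, and $\Delta=\Phi^{-1}\circ B^\vee\circ\Phi$ makes $HH^*_\bullet(A)$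 a perverse BV algebra. -/

import Mathlib

universe u

/-! ### Goresky–MacPherson perversities -/

/-- A Goresky–MacPherson `n`-perversity: a map `{0, …, n} → ℕ` vanishing on `0, 1, 2` with
`p i ≤ p (i+1) ≤ p i + 1` for `1 ≤ i ≤ n - 1`. -/
@[ext] structure GMPerversity (n : ℕ) where
  toFun : Fin (n + 1) → ℕ
  zero_of_le_two : ∀ i : Fin (n + 1), (i : ℕ) ≤ 2 → toFun i = 0
  step : ∀ i j : Fin (n + 1), 1 ≤ (i : ℕ) → (j : ℕ) = i + 1 →
    toFun i ≤ toFun j ∧ toFun j ≤ toFun i + 1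

namespace GMPerversity

variable {n : ℕ}

instance : PartialOrder (GMPerversity n) :=
  PartialOrder.lift GMPerversity.toFun fun _ _ h => GMPerversity.ext h

/-- The zero perversity. -/
def zero (n : ℕ) : GMPerversity n := ⟨fun _ => 0, fun _ _ => rfl, fun _ _ _ _ => by simp⟩

/-- The top perversity, `t i = i - 2` for `i ≥ 2` and `t 0 = t 1 = 0`. -/
def top (n : ℕ) : GMPerversity n :=
  ⟨fun i => (i : ℕ) - 2, fun _ h => by simp [h], fun _ _ _ h => by omega⟩

theorem le_top (p : GMPerversity n) : p ≤ top n := by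
  have key : ∀ (k : ℕ) (hk : k < n + 1), p.toFun ⟨k, hk⟩ ≤ k - 2 := by
    intro k
    induction k with
    | zero => intro hk; exact (p.zero_of_le_two ⟨0, hk⟩ (Nat.zero_le 2)).le
    | succ k ih =>
      intro hk
      by_cases h2 : k + 1 ≤ 2
      · simp [p.zero_of_le_two ⟨k + 1, hk⟩ h2]
      · have h := (p.step ⟨k, by omega⟩ ⟨k + 1, hk⟩ (by simp; omega) rfl).2
        have h' := ih (by omega)
        omega
  exact fun i => key i i.2

theorem zero_le (p : GMPerversity n) : zero n ≤ p := fun _ => Nat.zero_le _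

/-- The complementary perversity `t - p`. -/
def compl (p : GMPerversity n) : GMPerversity n where
  toFun i := (top n).toFun i - p.toFun i
  zero_of_le_two i hi := by simp [(top n).zero_of_le_two i hi]
  step i j hi hij := by
    have h1 := p.step i j hi hij
    have h2 : p.toFun i ≤ (top n).toFun i := le_top p i
    have h3 : p.toFun j ≤ (top n).toFun j := le_top p j
    have hti : (top n).toFun i = (i : ℕ) - 2 := rfl
    have htj : (top n).toFun j = (j : ℕ) - 2 := rfl
    have h4 : (j : ℕ) ≤ 2 → p.toFun j = 0 := p.zero_of_le_two j
    omega

theorem compl_le {p q : GMPerversity n} (h : p ≤ q) : compl q ≤ compl p :=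
  fun i => Nat.sub_le_sub_left (h i) _

theorem compl_add_le {p q r : GMPerversity n} (h : p.toFun + q.toFun ≤ r.toFun) :
    (compl r).toFun + p.toFun ≤ (compl q).toFun := by
  intro i
  have h1 := h i
  have h2 : r.toFun i ≤ (top n).toFun i := le_top r i
  simp only [Pi.add_apply, compl] at h1 ⊢
  omega

theorem add_compl_le {p q r : GMPerversity n} (h : p.toFun + q.toFun ≤ r.toFun) :
    q.toFun + (compl r).toFun ≤ (compl p).toFun := by
  intro i
  have h1 := h i
  have h2 : r.toFun i ≤ (top n).toFun i := le_top r i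
  simp only [Pi.add_apply, compl] at h1 ⊢
  omega

theorem add_le_of_le_left {p p' q r : GMPerversity n} (h : p ≤ p')
    (h' : p'.toFun + q.toFun ≤ r.toFun) : p.toFun + q.toFun ≤ r.toFun :=
  fun i => (Nat.add_le_add_right (h i) _).trans (h' i)

theorem add_le_of_le_right {p q q' r : GMPerversity n} (h : q ≤ q')
    (h' : p.toFun + q'.toFun ≤ r.toFun) : p.toFun + q.toFun ≤ r.toFun :=
  fun i => (Nat.add_le_add_left (h i) _).trans (h' i)

/-- The smallest GM-perversity which is `≥ x` (pointwise infimum of all of them), whenever there is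
one; the zero perversity otherwise.  So `p ⊕ q` is `hull (p + q)`. -/
noncomputable def hull (x : Fin (n + 1) → ℕ) : GMPerversity n where
  toFun i := sInf {m | ∃ q : GMPerversity n, x ≤ q.toFun ∧ q.toFun i = m}
  zero_of_le_two i hi := by
    by_cases h : ∃ q : GMPerversity n, x ≤ q.toFun
    · obtain ⟨q, hq⟩ := h
      exact Nat.le_zero.mp (Nat.sInf_le ⟨q, hq, q.zero_of_le_two i hi⟩)
    · convert Nat.sInf_empty
      ext m; simp only [Set.mem_ofPred_eq, Set.mem_empty_iff_false, iff_false]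
      rintro ⟨q, hq, -⟩; exact h ⟨q, hq⟩
  step i j hi hij := by
    by_cases h : ∃ q : GMPerversity n, x ≤ q.toFun
    · obtain ⟨q, hq⟩ := h
      constructor
      · have hne : {m | ∃ q : GMPerversity n, x ≤ q.toFun ∧ q.toFun j = m}.Nonempty :=
          ⟨_, q, hq, rfl⟩
        obtain ⟨r, hr, hrj⟩ := Nat.sInf_mem hne
        rw [← hrj]
        exact le_trans (Nat.sInf_le ⟨r, hr, rfl⟩) (r.step i j hi hij).1
      · have hne : {m | ∃ q : GMPerversity n, x ≤ q.toFun ∧ q.toFun i = m}.Nonempty :=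
          ⟨_, q, hq, rfl⟩
        obtain ⟨r, hr, hri⟩ := Nat.sInf_mem hne
        rw [← hri]
        exact le_trans (Nat.sInf_le ⟨r, hr, rfl⟩) (r.step i j hi hij).2
    · have e : ∀ k : Fin (n + 1),
          {m | ∃ q : GMPerversity n, x ≤ q.toFun ∧ q.toFun k = m} = ∅ := by
        intro k; ext m
        simp only [Set.mem_ofPred_eq, Set.mem_empty_iff_false, iff_false]
        rintro ⟨q, hq, -⟩; exact h ⟨q, hq⟩
      simp [e]

end GMPerversity

/-! ### Perverse cochain complexes -/

/-- A perverse cochain complex of `R`-modules of rank `n`: a functor from the poset of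
GM `n`-perversities to cochain complexes. -/
structure PerverseComplex (R : Type u) [CommRing R] (n : ℕ) where
  X : GMPerversity n → ℤ → Type u
  [addCommGroup : ∀ p i, AddCommGroup (X p i)]
  [module : ∀ p i, Module R (X p i)]
  /-- the structure morphisms -/
  res : ∀ {p q : GMPerversity n} {i : ℤ}, p ≤ q → X p i →ₗ[R] X q i
  /-- the differential, of degree `+1` -/
  d : ∀ {p : GMPerversity n} {i j : ℤ}, i + 1 = j → X p i →ₗ[R] X p j
  res_refl : ∀ {p : GMPerversity n} {i : ℤ} (x : X p i), res le_rfl x = x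
  res_trans : ∀ {p q r : GMPerversity n} {i : ℤ} (h : p ≤ q) (h' : q ≤ r) (x : X p i),
    res h' (res h x) = res (h.trans h') x
  d_d : ∀ {p : GMPerversity n} {i j k : ℤ} (h : i + 1 = j) (h' : j + 1 = k) (x : X p i),
    d h' (d h x) = 0
  d_res : ∀ {p q : GMPerversity n} {i j : ℤ} (h : p ≤ q) (e : i + 1 = j) (x : X p i),
    d e (res h x) = res h (d e x)

attribute [instance] PerverseComplex.addCommGroup PerverseComplex.module

/-- A family of maps of degree `m` (commuting with the differentials up to a sign) induces
isomorphisms `H^i(C_p) → H^(i+m)(C'_p)` for every perversity `p` and every degree `i`. -/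
def PerverseComplex.IsQuasiIso {R : Type u} [CommRing R] {n : ℕ} (C C' : PerverseComplex R n)
    (m : ℤ)
    (w : ∀ (p : GMPerversity n) {i j : ℤ}, i + m = j → C.X p i →ₗ[R] C'.X p j) : Prop :=
  ∀ (p : GMPerversity n) (i j : ℤ) (e : i + m = j),
    (∀ x : C.X p i, C.d rfl x = 0 → (∃ y : C'.X p (j - 1), w p e x = C'.d (by omega) y) →
      ∃ z : C.X p (i - 1), x = C.d (by omega) z) ∧
    (∀ y : C'.X p j, C'.d rfl y = 0 →
      ∃ x : C.X p i, C.d rfl x = 0 ∧ ∃ z : C'.X p (j - 1), y = w p e x + C'.d (by omega) z)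

/-! ### Perverse differential graded algebras and bimodules -/

/-- A perverse differential graded algebra: a perverse cochain complex with a unital associative
product `A_p^i ⊗ A_q^j → A_r^(i+j)` for `p + q ≤ r` (that is, a product
`A_p^i ⊗ A_q^j → A_(p ⊕ q)^(i+j)` followed by structure morphisms), natural in the perversities, for
which the differential is a derivation. -/
structure PDGA (R : Type u) [CommRing R] (n : ℕ) extends PerverseComplex R n where
  mul : ∀ {p q r : GMPerversity n} {i j k : ℤ}, p.toFun + q.toFun ≤ r.toFun → i + j = k →
    X p i →ₗ[R] X q j →ₗ[R] X r k
  one : X (GMPerversity.zero n) 0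
  mul_res : ∀ {p p' q q' r r' : GMPerversity n} {i j k : ℤ} (hp : p ≤ p') (hq : q ≤ q')
    (hr : r ≤ r') (h : p.toFun + q.toFun ≤ r.toFun) (h' : p'.toFun + q'.toFun ≤ r'.toFun)
    (e : i + j = k) (a : X p i) (b : X q j),
    mul h' e (res hp a) (res hq b) = res hr (mul h e a b)
  one_mul : ∀ {p : GMPerversity n} {i : ℤ} (h : (GMPerversity.zero n).toFun + p.toFun ≤ p.toFun)
    (e : 0 + i = i) (a : X p i), mul h e one a = a
  mul_one : ∀ {p : GMPerversity n} {i : ℤ} (h : p.toFun + (GMPerversity.zero n).toFun ≤ p.toFun)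
    (e : i + 0 = i) (a : X p i), mul h e a one = a
  mul_assoc : ∀ {p q r s s' t : GMPerversity n} {i j k x y z : ℤ}
    (h₁ : p.toFun + q.toFun ≤ s.toFun) (h₂ : s.toFun + r.toFun ≤ t.toFun)
    (h₃ : q.toFun + r.toFun ≤ s'.toFun) (h₄ : p.toFun + s'.toFun ≤ t.toFun)
    (e₁ : i + j = x) (e₂ : x + k = z) (e₃ : j + k = y) (e₄ : i + y = z)
    (a : X p i) (b : X q j) (c : X r k),
    mul h₂ e₂ (mul h₁ e₁ a b) c = mul h₄ e₄ a (mul h₃ e₃ b c)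
  leibniz : ∀ {p q r : GMPerversity n} {i i' j j' k k' : ℤ} (h : p.toFun + q.toFun ≤ r.toFun)
    (e : i + j = k) (ei : i + 1 = i') (ej : j + 1 = j') (ek : k + 1 = k')
    (e₁ : i' + j = k') (e₂ : i + j' = k') (a : X p i) (b : X q j),
    d ek (mul h e a b) = mul h e₁ (d ei a) b + i.negOnePow • mul h e₂ a (d ej b)

/-- Graded commutativity, `a b = (-1)^(|a||b|) b a`. -/
def PDGA.IsCommutative {R : Type u} [CommRing R] {n : ℕ} (A : PDGA R n) : Prop :=
  ∀ {p q r : GMPerversity n} {i j k : ℤ} (h : p.toFun + q.toFun ≤ r.toFun)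
    (h' : q.toFun + p.toFun ≤ r.toFun) (e : i + j = k) (e' : j + i = k)
    (a : A.X p i) (b : A.X q j), A.mul h e a b = (i * j).negOnePow • A.mul h' e' b a

/-- Perverse differential graded `A`-bimodules. -/
structure PBimod {R : Type u} [CommRing R] {n : ℕ} (A : PDGA R n)
    extends PerverseComplex R n where
  lsmul : ∀ {p q r : GMPerversity n} {i j k : ℤ}, p.toFun + q.toFun ≤ r.toFun → i + j = k →
    A.X p i →ₗ[R] X q j →ₗ[R] X r k
  rsmul : ∀ {p q r : GMPerversity n} {i j k : ℤ}, p.toFun + q.toFun ≤ r.toFun → i + j = k →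
    X p i →ₗ[R] A.X q j →ₗ[R] X r k
  lsmul_res : ∀ {p p' q q' r r' : GMPerversity n} {i j k : ℤ} (hp : p ≤ p') (hq : q ≤ q')
    (hr : r ≤ r') (h : p.toFun + q.toFun ≤ r.toFun) (h' : p'.toFun + q'.toFun ≤ r'.toFun)
    (e : i + j = k) (a : A.X p i) (x : X q j),
    lsmul h' e (A.res hp a) (res hq x) = res hr (lsmul h e a x)
  rsmul_res : ∀ {p p' q q' r r' : GMPerversity n} {i j k : ℤ} (hp : p ≤ p') (hq : q ≤ q')
    (hr : r ≤ r') (h : p.toFun + q.toFun ≤ r.toFun) (h' : p'.toFun + q'.toFun ≤ r'.toFun)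
    (e : i + j = k) (x : X p i) (a : A.X q j),
    rsmul h' e (res hp x) (A.res hq a) = res hr (rsmul h e x a)
  one_lsmul : ∀ {p : GMPerversity n} {i : ℤ}
    (h : (GMPerversity.zero n).toFun + p.toFun ≤ p.toFun) (e : 0 + i = i) (x : X p i),
    lsmul h e A.one x = x
  rsmul_one : ∀ {p : GMPerversity n} {i : ℤ}
    (h : p.toFun + (GMPerversity.zero n).toFun ≤ p.toFun) (e : i + 0 = i) (x : X p i),
    rsmul h e x A.one = x
  mul_lsmul : ∀ {p q r s s' t : GMPerversity n} {i j k x y z : ℤ}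
    (h₁ : p.toFun + q.toFun ≤ s.toFun) (h₂ : s.toFun + r.toFun ≤ t.toFun)
    (h₃ : q.toFun + r.toFun ≤ s'.toFun) (h₄ : p.toFun + s'.toFun ≤ t.toFun)
    (e₁ : i + j = x) (e₂ : x + k = z) (e₃ : j + k = y) (e₄ : i + y = z)
    (a : A.X p i) (b : A.X q j) (c : X r k),
    lsmul h₂ e₂ (A.mul h₁ e₁ a b) c = lsmul h₄ e₄ a (lsmul h₃ e₃ b c)
  lsmul_rsmul : ∀ {p q r s s' t : GMPerversity n} {i j k x y z : ℤ}
    (h₁ : p.toFun + q.toFun ≤ s.toFun) (h₂ : s.toFun + r.toFun ≤ t.toFun)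
    (h₃ : q.toFun + r.toFun ≤ s'.toFun) (h₄ : p.toFun + s'.toFun ≤ t.toFun)
    (e₁ : i + j = x) (e₂ : x + k = z) (e₃ : j + k = y) (e₄ : i + y = z)
    (a : A.X p i) (b : X q j) (c : A.X r k),
    rsmul h₂ e₂ (lsmul h₁ e₁ a b) c = lsmul h₄ e₄ a (rsmul h₃ e₃ b c)
  rsmul_mul : ∀ {p q r s s' t : GMPerversity n} {i j k x y z : ℤ}
    (h₁ : p.toFun + q.toFun ≤ s.toFun) (h₂ : s.toFun + r.toFun ≤ t.toFun)
    (h₃ : q.toFun + r.toFun ≤ s'.toFun) (h₄ : p.toFun + s'.toFun ≤ t.toFun)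
    (e₁ : i + j = x) (e₂ : x + k = z) (e₃ : j + k = y) (e₄ : i + y = z)
    (a : X p i) (b : A.X q j) (c : A.X r k),
    rsmul h₂ e₂ (rsmul h₁ e₁ a b) c = rsmul h₄ e₄ a (A.mul h₃ e₃ b c)
  d_lsmul : ∀ {p q r : GMPerversity n} {i i' j j' k k' : ℤ} (h : p.toFun + q.toFun ≤ r.toFun)
    (e : i + j = k) (ei : i + 1 = i') (ej : j + 1 = j') (ek : k + 1 = k')
    (e₁ : i' + j = k') (e₂ : i + j' = k') (a : A.X p i) (x : X q j),
    d ek (lsmul h e a x) = lsmul h e₁ (A.d ei a) x + i.negOnePow • lsmul h e₂ a (d ej x)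
  d_rsmul : ∀ {p q r : GMPerversity n} {i i' j j' k k' : ℤ} (h : p.toFun + q.toFun ≤ r.toFun)
    (e : i + j = k) (ei : i + 1 = i') (ej : j + 1 = j') (ek : k + 1 = k')
    (e₁ : i' + j = k') (e₂ : i + j' = k') (x : X p i) (a : A.X q j),
    d ek (rsmul h e x a) = rsmul h e₁ (d ei x) a + i.negOnePow • rsmul h e₂ x (A.d ej a)

/-- Morphisms of perverse DG `A`-bimodules of degree `m` and perverse degree `0`, i.e. cocycles of
degree `m` and perverse degree `0` of the internal Hom over `A^e`. -/
structure BimodHom {R : Type u} [CommRing R] {n : ℕ} {A : PDGA R n} (M N : PBimod A)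
    (m : ℤ) where
  map : ∀ (p : GMPerversity n) {i j : ℤ}, i + m = j → M.X p i →ₗ[R] N.X p j
  map_res : ∀ {p q : GMPerversity n} {i j : ℤ} (h : p ≤ q) (e : i + m = j) (x : M.X p i),
    map q e (M.res h x) = N.res h (map p e x)
  map_d : ∀ {p : GMPerversity n} {i i' j j' : ℤ} (e : i + m = j) (e' : i' + m = j')
    (ei : i + 1 = i') (ej : j + 1 = j') (x : M.X p i),
    N.d ej (map p e x) = m.negOnePow • map p e' (M.d ei x)
  map_lsmul : ∀ {p q r : GMPerversity n} {i j j' k k' : ℤ} (h : p.toFun + q.toFun ≤ r.toFun)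
    (e : i + j = k) (ej : j + m = j') (ek : k + m = k') (e' : i + j' = k')
    (a : A.X p i) (x : M.X q j),
    map r ek (M.lsmul h e a x) = (m * i).negOnePow • N.lsmul h e' a (map q ej x)
  map_rsmul : ∀ {p q r : GMPerversity n} {i i' j k k' : ℤ} (h : p.toFun + q.toFun ≤ r.toFun)
    (e : i + j = k) (ei : i + m = i') (ek : k + m = k') (e' : i' + j = k')
    (x : M.X p i) (a : A.X q j),
    map r ek (M.rsmul h e x a) = N.rsmul h e' (map p ei x) a

/-- Quasi-isomorphisms of bimodules. -/
def BimodHom.IsQuasiIso {R : Type u} [CommRing R] {n : ℕ} {A : PDGA R n} {M N : PBimod A}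
    {m : ℤ} (w : BimodHom M N m) : Prop :=
  PerverseComplex.IsQuasiIso M.toPerverseComplex N.toPerverseComplex m w.map

namespace PDGA

variable {R : Type u} [CommRing R] {n : ℕ} (A : PDGA R n)

/-- `A` as a bimodule over itself. -/
def self : PBimod A where
  toPerverseComplex := A.toPerverseComplex
  lsmul := A.mul
  rsmul := A.mul
  lsmul_res := A.mul_res
  rsmul_res := A.mul_res
  one_lsmul := A.one_mul
  rsmul_one := A.mul_one
  mul_lsmul := A.mul_assoc
  lsmul_rsmul := A.mul_assoc
  rsmul_mul := A.mul_assoc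
  d_lsmul := A.leibniz
  d_rsmul := A.leibniz

/-- The unit of `A` in perverse degree `p`. -/
def unit (p : GMPerversity n) : A.X p 0 := A.res (GMPerversity.zero_le p) A.one

theorem mul_res_left {p p' q r : GMPerversity n} {i j k : ℤ} (hp : p ≤ p')
    (h : p.toFun + q.toFun ≤ r.toFun) (h' : p'.toFun + q.toFun ≤ r.toFun) (e : i + j = k)
    (a : A.X p i) (b : A.X q j) : A.mul h' e (A.res hp a) b = A.mul h e a b := by
  simpa [A.res_refl] using A.mul_res hp le_rfl le_rfl h h' e a b

theorem mul_res_right {p q q' r : GMPerversity n} {i j k : ℤ} (hq : q ≤ q')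
    (h : p.toFun + q.toFun ≤ r.toFun) (h' : p.toFun + q'.toFun ≤ r.toFun) (e : i + j = k)
    (a : A.X p i) (b : A.X q j) : A.mul h' e a (A.res hq b) = A.mul h e a b := by
  simpa [A.res_refl] using A.mul_res le_rfl hq le_rfl h h' e a b

theorem res_mul {p q r r' : GMPerversity n} {i j k : ℤ} (hr : r ≤ r')
    (h : p.toFun + q.toFun ≤ r.toFun) (h' : p.toFun + q.toFun ≤ r'.toFun) (e : i + j = k)
    (a : A.X p i) (b : A.X q j) : A.res hr (A.mul h e a b) = A.mul h' e a b := by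
  simpa [A.res_refl] using (A.mul_res le_rfl le_rfl hr h h' e a b).symm

/-- The linear map `a ↦ (φ ↦ (x ↦ φ (x a)))` on duals. -/
def dualLeft {p q r : GMPerversity n} {i j k : ℤ} (h : p.toFun + q.toFun ≤ r.toFun)
    (e : -k + i = -j) :
    A.X p i →ₗ[R] (A.X q.compl (-j) →ₗ[R] R) →ₗ[R] (A.X r.compl (-k) →ₗ[R] R) :=
  LinearMap.mk₂ R (fun a φ => φ.comp ((A.mul (GMPerversity.compl_add_le h) e).flip a))
    (fun a b φ => by ext x; simp) (fun c a φ => by ext x; simp)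
    (fun a φ ψ => by ext x; simp) (fun c a φ => by ext x; simp)

/-- The linear map `φ ↦ (a ↦ (x ↦ φ (a x)))` on duals. -/
def dualRight {p q r : GMPerversity n} {i j k : ℤ} (h : p.toFun + q.toFun ≤ r.toFun)
    (e : j + -k = -i) :
    (A.X p.compl (-i) →ₗ[R] R) →ₗ[R] A.X q j →ₗ[R] (A.X r.compl (-k) →ₗ[R] R) :=
  LinearMap.mk₂ R (fun φ a => φ.comp (A.mul (GMPerversity.add_compl_le h) e a))
    (fun φ ψ a => by ext x; simp) (fun c φ a => by ext x; simp)
    (fun φ a b => by ext x; simp) (fun c φ a => by ext x; simp)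

theorem dualLeft_apply {p q r : GMPerversity n} {i j k : ℤ}
    (h : p.toFun + q.toFun ≤ r.toFun) (e : -k + i = -j) (a : A.X p i)
    (φ : A.X q.compl (-j) →ₗ[R] R) (x : A.X r.compl (-k)) :
    A.dualLeft h e a φ x = φ (A.mul (GMPerversity.compl_add_le h) e x a) := rfl

theorem dualRight_apply {p q r : GMPerversity n} {i j k : ℤ}
    (h : p.toFun + q.toFun ≤ r.toFun) (e : j + -k = -i) (φ : A.X p.compl (-i) →ₗ[R] R)
    (a : A.X q j) (x : A.X r.compl (-k)) :
    A.dualRight h e φ a x = φ (A.mul (GMPerversity.add_compl_le h) e a x) := rfl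

/-- The linear dual `DA`, with `(DA)_p^i = Hom_R(A_(t-p)^(-i), R)`, differential
`(dφ)(x) = -(-1)^|φ| φ(dx)`, left action `(aφ)(x) = (-1)^(|a|(|φ|+|x|)) φ(xa)` (the sign is
`(-1)^|a|` since `|φ| + |x| = -|a|`) and right action `(φa)(x) = φ(ax)`. -/
def dual : PBimod A where
  X p i := A.X p.compl (-i) →ₗ[R] R
  res h := LinearMap.lcomp R R (A.res (GMPerversity.compl_le h))
  d {_ i j} h := -(i.negOnePow •
    LinearMap.lcomp R R (A.d (i := -j) (j := -i) (by omega)))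
  lsmul {_ _ _ i _ _} h e := i.negOnePow • A.dualLeft h (by omega)
  rsmul h e := A.dualRight h (by omega)
  res_refl φ := by ext x; simp [A.res_refl]
  res_trans h h' φ := by ext x; simp [A.res_trans]
  d_d h h' φ := by ext x; simp [A.d_d]
  d_res h e φ := by ext x; simp [A.d_res]
  lsmul_res hp hq hr h h' e a φ := by
    ext x
    have h₁ := GMPerversity.add_le_of_le_left (GMPerversity.compl_le hr) (GMPerversity.compl_add_le h)
    have h₂ := le_trans (GMPerversity.compl_add_le h') (GMPerversity.compl_le hq)
    simp only [LinearMap.smul_apply, LinearMap.lcomp_apply, dualLeft_apply]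
    rw [A.res_mul _ _ h₂, A.mul_res_right hp h₁, A.mul_res_left _ h₁]
  rsmul_res hp hq hr h h' e φ a := by
    ext x
    have h₁ := GMPerversity.add_le_of_le_right (GMPerversity.compl_le hr) (GMPerversity.add_compl_le h)
    have h₂ := le_trans (GMPerversity.add_compl_le h') (GMPerversity.compl_le hp)
    simp only [LinearMap.lcomp_apply, dualRight_apply]
    rw [A.res_mul _ _ h₂, A.mul_res_left hq h₁, A.mul_res_right _ h₁]
  one_lsmul h e φ := by
    ext x
    simp only [LinearMap.smul_apply, dualLeft_apply, A.mul_one]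
    simp
  rsmul_one h e φ := by
    ext x
    simp only [dualRight_apply, A.one_mul]
  mul_lsmul {p q r s s' t i j k x y z} h₁ h₂ h₃ h₄ e₁ e₂ e₃ e₄ a b φ := by
    ext c
    have hx : x.negOnePow = i.negOnePow * j.negOnePow := by rw [← e₁, Int.negOnePow_add]
    simp only [LinearMap.smul_apply, dualLeft_apply]
    rw [A.mul_assoc (GMPerversity.compl_add_le h₄) (GMPerversity.compl_add_le h₃) h₁
      (GMPerversity.compl_add_le h₂) (by omega) (by omega) e₁ (by omega), smul_smul, hx]
  lsmul_rsmul {p q r s s' t i j k x y z} h₁ h₂ h₃ h₄ e₁ e₂ e₃ e₄ a φ b := by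
    ext c
    simp only [LinearMap.smul_apply, dualLeft_apply, dualRight_apply]
    rw [A.mul_assoc (GMPerversity.add_compl_le h₂) (GMPerversity.compl_add_le h₁)
      (GMPerversity.compl_add_le h₄) (GMPerversity.add_compl_le h₃) (x := -x) (y := -y)
      (by omega) (by omega) (by omega) (by omega)]
  rsmul_mul {p q r s s' t i j k x y z} h₁ h₂ h₃ h₄ e₁ e₂ e₃ e₄ φ a b := by
    ext c
    simp only [dualRight_apply]
    rw [A.mul_assoc h₃ (GMPerversity.add_compl_le h₄) (GMPerversity.add_compl_le h₂)
      (GMPerversity.add_compl_le h₁) (y := -x) e₃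
      (by omega) (by omega) (by omega)]
  d_lsmul {p q r i i' j j' k k'} h e ei ej ek e₁ e₂ a φ := by
    ext x
    have hl := A.leibniz (GMPerversity.compl_add_le h) (i := -k') (j := i) (k := -j')
      (i' := -k) (j' := i') (k' := -j)
      (by omega) (by omega) ei (by omega) (by omega) (by omega) x a
    simp only [LinearMap.smul_apply, LinearMap.neg_apply, LinearMap.add_apply,
      LinearMap.lcomp_apply, dualLeft_apply, hl, map_add, smul_neg, smul_add]
    obtain rfl : i' = i + 1 := ei.symm
    obtain rfl : k' = i + j + 1 := by omega
    obtain rfl : k = i + j := e.symm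
    rcases Int.even_or_odd i with hi | hi <;> rcases Int.even_or_odd j with hj | hj <;>
      simp [Int.negOnePow_add, Int.negOnePow_even, Int.negOnePow_odd, hi, hj]
  d_rsmul {p q r i i' j j' k k'} h e ei ej ek e₁ e₂ φ a := by
    ext x
    have hl := A.leibniz (GMPerversity.add_compl_le h) (i := j) (j := -k') (k := -i')
      (i' := j') (j' := -k) (k' := -i)
      (by omega) ej (by omega) (by omega) (by omega) (by omega) a x
    simp only [LinearMap.smul_apply, LinearMap.neg_apply, LinearMap.add_apply,
      LinearMap.lcomp_apply, dualRight_apply, hl, map_add, smul_add]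
    obtain rfl : k' = i + j + 1 := by omega
    obtain rfl : k = i + j := e.symm
    rcases Int.even_or_odd i with hi | hi <;> rcases Int.even_or_odd j with hj | hj <;>
      simp [Int.negOnePow_add, Int.negOnePow_even, Int.negOnePow_odd, hi, hj]

/-! ### Hochschild cochains -/

/-- A homogeneous element of `A`, together with its perverse degree and its degree. -/
structure Letter where
  per : GMPerversity n
  deg : ℤ
  val : A.X per deg

variable {A}

/-- The letter `d a`. -/
def Letter.diff (a : A.Letter) : A.Letter := ⟨a.per, a.deg + 1, A.d rfl a.val⟩

open Classical in
/-- The letter `a b`, in the smallest perverse degree in which this product is defined (and `0` if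
there is none). -/
noncomputable def Letter.mul (a b : A.Letter) : A.Letter :=
  ⟨GMPerversity.hull (a.per.toFun + b.per.toFun), a.deg + b.deg,
    if h : a.per.toFun + b.per.toFun ≤ (GMPerversity.hull (a.per.toFun + b.per.toFun)).toFun
    then A.mul h rfl a.val b.val else 0⟩

/-- The sum of the perverse degrees of the letters of a word. -/
def perSum (l : List A.Letter) : Fin (n + 1) → ℕ := (l.map fun a => a.per.toFun).sum

/-- The degree `∑ (|a_i| - 1)` of `[a_1|…|a_k]` in the tensor algebra on the suspension of `A`. -/
def wordDeg (l : List A.Letter) : ℤ := (l.map fun a => a.deg - 1).sum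

variable (A)

/-- Families of functions `[a_1|…|a_k] ↦ f [a_1|…|a_k] ∈ M_q^j`. -/
abbrev RawCochain (M : PBimod A) : Type u :=
  ∀ (_ : List A.Letter) (q : GMPerversity n) (j : ℤ), M.X q j

variable {A}

/-- `f` is a normalized Hochschild cochain of perverse degree `r` and degree `c` with coefficients
in `M`, i.e. an element of
`lim_{r ≤ q - p} ∏_{j - i = c} Hom_R (T(s Ā)_p^i, M_q^j)` with
`T(s Ā)_p = ⨁_k colim_{r_1 + … + r_k ≤ p} s Ā_{r_1} ⊗ ⋯ ⊗ s Ā_{r_k}` and `Ā = A / R 1`.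
Such an element is the same thing as a family of `R`-multilinear maps
`f : A_{r_1}^{i_1} × ⋯ × A_{r_k}^{i_k} → M_q^j`, for `r + r_1 + … + r_k ≤ q` and
`j = c + ∑ (i_l - 1)`, natural in `r_1, …, r_k` and `q` and vanishing if an argument is `1`.  By
convention the value is `0` for the other `q` and `j`. -/
structure IsCochain (M : PBimod A) (r : GMPerversity n) (c : ℤ) (f : A.RawCochain M) : Prop where
  support : ∀ l q j, ¬ (r.toFun + perSum l ≤ q.toFun ∧ j = c + wordDeg l) → f l q j = 0
  map_add : ∀ (l₁ l₂ : List A.Letter) (p : GMPerversity n) (i : ℤ) (a b : A.X p i) q j,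
    f (l₁ ++ ⟨p, i, a + b⟩ :: l₂) q j = f (l₁ ++ ⟨p, i, a⟩ :: l₂) q j + f (l₁ ++ ⟨p, i, b⟩ :: l₂) q j
  map_smul : ∀ (l₁ l₂ : List A.Letter) (p : GMPerversity n) (i : ℤ) (s : R) (a : A.X p i) q j,
    f (l₁ ++ ⟨p, i, s • a⟩ :: l₂) q j = s • f (l₁ ++ ⟨p, i, a⟩ :: l₂) q j
  map_res : ∀ (l₁ l₂ : List A.Letter) (p p' : GMPerversity n) (i : ℤ) (h : p ≤ p') (a : A.X p i)
    (q : GMPerversity n) (j : ℤ),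
    r.toFun + perSum (l₁ ++ ⟨p', i, A.res h a⟩ :: l₂) ≤ q.toFun →
    f (l₁ ++ ⟨p', i, A.res h a⟩ :: l₂) q j = f (l₁ ++ ⟨p, i, a⟩ :: l₂) q j
  res_map : ∀ (l : List A.Letter) (q q' : GMPerversity n) (h : q ≤ q') (j : ℤ),
    r.toFun + perSum l ≤ q.toFun → M.res h (f l q j) = f l q' j
  normalized : ∀ (l₁ l₂ : List A.Letter) q j,
    f (l₁ ++ ⟨GMPerversity.zero n, 0, A.one⟩ :: l₂) q j = 0

/-- The module `HC^c_r(A, M)` of normalized Hochschild cochains. -/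
def HC (M : PBimod A) (r : GMPerversity n) (c : ℤ) : Submodule R (A.RawCochain M) where
  carrier := {f | IsCochain M r c f}
  zero_mem' := by constructor <;> intros <;> simp
  add_mem' {f g} hf hg :=
    { support := fun l q j h => by simp [hf.support l q j h, hg.support l q j h]
      map_add := fun l₁ l₂ p i a b q j => by
        simp only [Pi.add_apply, hf.map_add, hg.map_add]; abel
      map_smul := fun l₁ l₂ p i s a q j => by
        simp only [Pi.add_apply, hf.map_smul, hg.map_smul, smul_add]
      map_res := fun l₁ l₂ p p' i h a q j h' => by
        simp only [Pi.add_apply, hf.map_res l₁ l₂ p p' i h a q j h', hg.map_res l₁ l₂ p p' i h a q j h']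
      res_map := fun l q q' h j h' => by
        simp only [Pi.add_apply, _root_.map_add, hf.res_map l q q' h j h', hg.res_map l q q' h j h']
      normalized := fun l₁ l₂ q j => by simp [hf.normalized, hg.normalized] }
  smul_mem' s f hf :=
    { support := fun l q j h => by simp [hf.support l q j h]
      map_add := fun l₁ l₂ p i a b q j => by simp only [Pi.smul_apply, hf.map_add, smul_add]
      map_smul := fun l₁ l₂ p i t a q j => by
        simp only [Pi.smul_apply, hf.map_smul]; rw [smul_comm]
      map_res := fun l₁ l₂ p p' i h a q j h' => by
        simp only [Pi.smul_apply, hf.map_res l₁ l₂ p p' i h a q j h']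
      res_map := fun l q q' h j h' => by
        simp only [Pi.smul_apply, _root_.map_smul, hf.res_map l q q' h j h']
      normalized := fun l₁ l₂ q j => by simp [hf.normalized] }

open Classical in
/-- The product `a x ∈ M_q^j`; `0` if the perverse degrees or the degrees do not fit. -/
noncomputable def lact (M : PBimod A) {p p' : GMPerversity n} {i i' : ℤ} (a : A.X p i)
    (x : M.X p' i') (q : GMPerversity n) (j : ℤ) : M.X q j :=
  if h : p.toFun + p'.toFun ≤ q.toFun ∧ i + i' = j then M.lsmul h.1 h.2 a x else 0

open Classical in
/-- The product `x a ∈ M_q^j`; `0` if the perverse degrees or the degrees do not fit. -/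
noncomputable def ract (M : PBimod A) {p p' : GMPerversity n} {i i' : ℤ} (x : M.X p i)
    (a : A.X p' i') (q : GMPerversity n) (j : ℤ) : M.X q j :=
  if h : p.toFun + p'.toFun ≤ q.toFun ∧ i + i' = j then M.rsmul h.1 h.2 x a else 0

/-- The value `f l` of a cochain of perverse degree `r` and degree `c` on the word `l`, in the
smallest perverse degree in which it is defined. -/
noncomputable def val {M : PBimod A} (r : GMPerversity n) (c : ℤ) (f : A.RawCochain M)
    (l : List A.Letter) : M.X (GMPerversity.hull (r.toFun + perSum l)) (c + wordDeg l) :=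
  f l _ _

/-- With `i` counted from `0` and `ε = ∑_{j<i} (|a_j| - 1)`, the term
`(-1)^(ε + c) f [a_0|…|d a_i|…]`. -/
def termDiff {M : PBimod A} (c : ℤ) (f : A.RawCochain M) (l : List A.Letter)
    (q : GMPerversity n) (j : ℤ) (i : ℕ) : M.X q j :=
  match l.drop i with
  | a :: t => (wordDeg (l.take i) + c).negOnePow • f (l.take i ++ a.diff :: t) q j
  | [] => 0

/-- With `i` counted from `0` and `ε = ∑_{j≤i} (|a_j| - 1)`, the term
`(-1)^(ε + c) f [a_0|…|a_i a_(i+1)|…]`. -/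
noncomputable def termMul {M : PBimod A} (c : ℤ) (f : A.RawCochain M) (l : List A.Letter)
    (q : GMPerversity n) (j : ℤ) (i : ℕ) : M.X q j :=
  match l.drop i with
  | a :: b :: t => (wordDeg (l.take i ++ [a]) + c).negOnePow • f (l.take i ++ a.mul b :: t) q j
  | _ => 0

/-- The term `(-1)^((|a_1|+1) c) a_1 f [a_2|…|a_k]`. -/
noncomputable def termLeft {M : PBimod A} (r : GMPerversity n) (c : ℤ) (f : A.RawCochain M)
    (l : List A.Letter) (q : GMPerversity n) (j : ℤ) : M.X q j :=
  match l with
  | a :: t => ((a.deg + 1) * c).negOnePow • lact M a.val (val r c f t) q j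
  | [] => 0

/-- The term `(-1)^(ε + c) f [a_1|…|a_(k-1)] a_k`, with `ε = ∑_{j<k} (|a_j| - 1)`. -/
noncomputable def termRight {M : PBimod A} (r : GMPerversity n) (c : ℤ) (f : A.RawCochain M)
    (l : List A.Letter) (q : GMPerversity n) (j : ℤ) : M.X q j :=
  match l.getLast? with
  | some a => (wordDeg l.dropLast + c).negOnePow • ract M (val r c f l.dropLast) a.val q j
  | none => 0

theorem lact_add (M : PBimod A) {p p' : GMPerversity n} {i i' : ℤ} (a : A.X p i)
    (x y : M.X p' i') (q : GMPerversity n) (j : ℤ) :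
    lact M a (x + y) q j = lact M a x q j + lact M a y q j := by
  unfold lact; split <;> simp

theorem lact_smul (M : PBimod A) {p p' : GMPerversity n} {i i' : ℤ} (a : A.X p i)
    (s : R) (x : M.X p' i') (q : GMPerversity n) (j : ℤ) :
    lact M a (s • x) q j = s • lact M a x q j := by
  unfold lact; split <;> simp

theorem ract_add (M : PBimod A) {p p' : GMPerversity n} {i i' : ℤ} (a : A.X p' i')
    (x y : M.X p i) (q : GMPerversity n) (j : ℤ) :
    ract M (x + y) a q j = ract M x a q j + ract M y a q j := by
  unfold ract; split <;> simp

theorem ract_smul (M : PBimod A) {p p' : GMPerversity n} {i i' : ℤ} (a : A.X p' i')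
    (s : R) (x : M.X p i) (q : GMPerversity n) (j : ℤ) :
    ract M (s • x) a q j = s • ract M x a q j := by
  unfold ract; split <;> simp

theorem val_add {M : PBimod A} (r : GMPerversity n) (c : ℤ) (f g : A.RawCochain M)
    (l : List A.Letter) : val r c (f + g) l = val r c f l + val r c g l := rfl

theorem val_smul {M : PBimod A} (r : GMPerversity n) (c : ℤ) (s : R) (f : A.RawCochain M)
    (l : List A.Letter) : val r c (s • f) l = s • val r c f l := rfl

theorem termDiff_add {M : PBimod A} (c : ℤ) (f g : A.RawCochain M) (l : List A.Letter)
    (q : GMPerversity n) (j : ℤ) (i : ℕ) :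
    termDiff c (f + g) l q j i = termDiff c f l q j i + termDiff c g l q j i := by
  unfold termDiff; split <;> simp

theorem termDiff_smul {M : PBimod A} (c : ℤ) (s : R) (f : A.RawCochain M) (l : List A.Letter)
    (q : GMPerversity n) (j : ℤ) (i : ℕ) :
    termDiff c (s • f) l q j i = s • termDiff c f l q j i := by
  unfold termDiff; split <;> simp [smul_comm _ s]

theorem termMul_add {M : PBimod A} (c : ℤ) (f g : A.RawCochain M) (l : List A.Letter)
    (q : GMPerversity n) (j : ℤ) (i : ℕ) :
    termMul c (f + g) l q j i = termMul c f l q j i + termMul c g l q j i := by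
  unfold termMul; split <;> simp

theorem termMul_smul {M : PBimod A} (c : ℤ) (s : R) (f : A.RawCochain M) (l : List A.Letter)
    (q : GMPerversity n) (j : ℤ) (i : ℕ) :
    termMul c (s • f) l q j i = s • termMul c f l q j i := by
  unfold termMul; split <;> simp [smul_comm _ s]

theorem termLeft_add {M : PBimod A} (r : GMPerversity n) (c : ℤ) (f g : A.RawCochain M) (l : List A.Letter)
    (q : GMPerversity n) (j : ℤ)  :
    termLeft r c (f + g) l q j = termLeft r c f l q j + termLeft r c g l q j := by
  unfold termLeft; split <;> simp [val_add, lact_add]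

theorem termLeft_smul {M : PBimod A} (r : GMPerversity n) (c : ℤ) (s : R) (f : A.RawCochain M) (l : List A.Letter)
    (q : GMPerversity n) (j : ℤ)  :
    termLeft r c (s • f) l q j = s • termLeft r c f l q j := by
  unfold termLeft; split <;> simp [val_smul, lact_smul, smul_comm _ s]

theorem termRight_add {M : PBimod A} (r : GMPerversity n) (c : ℤ) (f g : A.RawCochain M) (l : List A.Letter)
    (q : GMPerversity n) (j : ℤ)  :
    termRight r c (f + g) l q j = termRight r c f l q j + termRight r c g l q j := by
  unfold termRight; split <;> simp [val_add, ract_add]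

theorem termRight_smul {M : PBimod A} (r : GMPerversity n) (c : ℤ) (s : R) (f : A.RawCochain M) (l : List A.Letter)
    (q : GMPerversity n) (j : ℤ)  :
    termRight r c (s • f) l q j = s • termRight r c f l q j := by
  unfold termRight; split <;> simp [val_smul, ract_smul, smul_comm _ s]

/-- The Hochschild differential `D = d_0 + d_1` on cochains of perverse degree `r` and degree `c`:
with `ε_i = ∑_{j<i} (|a_j| - 1)`,
`d_0 f [a_1|…|a_k] = d (f [a_1|…|a_k]) + ∑_{i=1}^k (-1)^(ε_i + c) f [a_1|…|d a_i|…|a_k]`,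
`d_1 f [a_1|…|a_k] = -(-1)^((|a_1|+1) c) a_1 f [a_2|…|a_k] + (-1)^(ε_k + c) f [a_1|…|a_(k-1)] a_k
  - ∑_{i=2}^k (-1)^(ε_i + c) f [a_1|…|a_(i-1) a_i|…|a_k]`. -/
noncomputable def hochD (M : PBimod A) (r : GMPerversity n) (c : ℤ) :
    A.RawCochain M →ₗ[R] A.RawCochain M where
  toFun f l q j :=
    M.d (sub_add_cancel j 1) (f l q (j - 1))
    + ∑ i ∈ Finset.range l.length, termDiff c f l q j i
    - termLeft r c f l q j + termRight r c f l q j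
    - ∑ i ∈ Finset.range l.length, termMul c f l q j i
  map_add' f g := by
    funext l q j
    simp only [Pi.add_apply, _root_.map_add, termDiff_add, termMul_add, termLeft_add,
      termRight_add, Finset.sum_add_distrib]
    abel
  map_smul' s f := by
    funext l q j
    simp only [Pi.smul_apply, _root_.map_smul, termDiff_smul, termMul_smul, termLeft_smul,
      termRight_smul, RingHom.id_apply, smul_add, smul_sub, Finset.smul_sum]

/-! ### Hochschild cohomology -/

/-- The cocycles of `HC^c_r(A, M)`. -/
noncomputable abbrev cocycles (M : PBimod A) (r : GMPerversity n) (c : ℤ) :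
    Submodule R (A.RawCochain M) := HC M r c ⊓ LinearMap.ker (hochD M r c)

/-- The coboundaries of `HC^c_r(A, M)`. -/
noncomputable abbrev coboundaries (M : PBimod A) (r : GMPerversity n) (c : ℤ) :
    Submodule R (A.RawCochain M) := (HC M r (c - 1)).map (hochD M r (c - 1))

/-- The Hochschild cohomology `HH^c_r(A, M)`. -/
abbrev HH (M : PBimod A) (r : GMPerversity n) (c : ℤ) : Type u :=
  cocycles M r c ⧸ (coboundaries M r c).comap (cocycles M r c).subtype

/-- The class of a cocycle. -/
noncomputable def cls {M : PBimod A} {r : GMPerversity n} {c : ℤ} (f : A.RawCochain M)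
    (hf : f ∈ cocycles M r c) : HH M r c :=
  Submodule.Quotient.mk ⟨f, hf⟩

open Classical in
/-- The restriction of a cochain to the perverse degrees in which cochains of perverse degree `s`
are defined; this is the structure morphism `HC_r(A, M) → HC_s(A, M)` for `r ≤ s`. -/
noncomputable def trunc {M : PBimod A} (s : GMPerversity n) (f : A.RawCochain M) :
    A.RawCochain M :=
  fun l q j => if s.toFun + perSum l ≤ q.toFun then f l q j else 0

/-- The action `f . g` of a cochain `f` of perverse degree `r` and degree `c` with coefficients in
`A` on a cochain `g` of perverse degree `r'` and degree `c'` with coefficients in `M`, that is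
`[a_1|…|a_k] ↦ ∑_{0 ≤ i ≤ k} (-1)^(c' ε_i) f [a_1|…|a_i] g [a_(i+1)|…|a_k]` with
`ε_i = ∑_{j≤i} (|a_j| - 1)`.  For `M = A` this is the cup product. -/
noncomputable def act (M : PBimod A) (r r' : GMPerversity n) (c c' : ℤ) (f : A.RawCochain A.self)
    (g : A.RawCochain M) : A.RawCochain M :=
  fun l q j => ∑ i ∈ Finset.range (l.length + 1),
    (c' * wordDeg (l.take i)).negOnePow •
      lact M (val (M := A.self) r c f (l.take i)) (val r' c' g (l.drop i)) q j

/-- The letter `g [a_1|…|a_k]`, for a cochain `g` of perverse degree `r` and degree `c`. -/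
noncomputable def cochainLetter (r : GMPerversity n) (c : ℤ) (g : A.RawCochain A.self)
    (l : List A.Letter) : A.Letter :=
  ⟨GMPerversity.hull (r.toFun + perSum l), c + wordDeg l, val (M := A.self) r c g l⟩

/-- The product `f ∘ g` for a cochain `g` of perverse degree `r'` and degree `c'`, that is
`[a_1|…|a_k] ↦ ∑_{0 ≤ i ≤ i' ≤ k} (-1)^((c' - 1) ε_i)
  f [a_1|…|a_i|g [a_(i+1)|…|a_i']|a_(i'+1)|…|a_k]` with `ε_i = ∑_{j≤i} (|a_j| - 1)`. -/
noncomputable def circ (r' : GMPerversity n) (c' : ℤ) (f g : A.RawCochain A.self) :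
    A.RawCochain A.self :=
  fun l q j => ∑ i ∈ Finset.range (l.length + 1), ∑ i' ∈ Finset.Icc i l.length,
    ((c' - 1) * wordDeg (l.take i)).negOnePow •
      f (l.take i ++ cochainLetter r' c' g ((l.take i').drop i) :: l.drop i') q j

/-- The Gerstenhaber bracket `[f, g] = f ∘ g - (-1)^((c-1)(c'-1)) g ∘ f`. -/
noncomputable def bracket (r r' : GMPerversity n) (c c' : ℤ) (f g : A.RawCochain A.self) :
    A.RawCochain A.self :=
  circ r' c' f g - ((c - 1) * (c' - 1)).negOnePow • circ r c g f

variable (A)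

/-- The augmentation `q_A : A ⊗ T(s Ā) ⊗ A → A`, equal to the product on `A ⊗ A` and vanishing in
positive length, as a Hochschild cochain: `[] ↦ 1` and `[a_1|…|a_k] ↦ 0` for `k > 0`. -/
def augmentation : A.RawCochain A.self := fun l q j =>
  match l with
  | [] => if h : j = 0 then h ▸ A.unit q else 0
  | _ :: _ => 0

/-- The map `g_ζ : A → DA`, `a ↦ a ζ`, where `ζ` has degree `m` and perverse degree `0`. -/
def gMap {m : ℤ} (ζ : A.dual.X (GMPerversity.zero n) m) (p : GMPerversity n) {i j : ℤ}
    (e : i + m = j) : A.self.X p i →ₗ[R] A.dual.X p j :=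
  (A.dual.lsmul (p := p) (q := GMPerversity.zero n) (r := p) (add_zero p.toFun).le e).flip ζ

/-- The Hochschild cochain `g_ζ ∘ q_A` with coefficients in `DA`. -/
def lift {m : ℤ} (ζ : A.dual.X (GMPerversity.zero n) m) : A.RawCochain A.dual := fun l q j =>
  A.gMap ζ q (sub_add_cancel j m) (A.augmentation l q (j - m))

variable {A}

/-- The linear map `a ↦ f [l₁|a|l₂]`. -/
def IsCochain.insert {M : PBimod A} {r : GMPerversity n} {c : ℤ} {f : A.RawCochain M}
    (hf : IsCochain M r c f) (l₁ l₂ : List A.Letter) (p : GMPerversity n) (i : ℤ)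
    (q : GMPerversity n) (j : ℤ) : A.X p i →ₗ[R] M.X q j where
  toFun a := f (l₁ ++ ⟨p, i, a⟩ :: l₂) q j
  map_add' a b := hf.map_add l₁ l₂ p i a b q j
  map_smul' s a := hf.map_smul l₁ l₂ p i s a q j

variable (A) in
/-- Evaluation of linear forms of degree `0` and of the top perverse degree at `1`. -/
def evalOne : A.dual.X (GMPerversity.top n) 0 →ₗ[R] R :=
  LinearMap.applyₗ (R := R) (M := A.X (GMPerversity.top n).compl 0)
    (A.unit (GMPerversity.top n).compl)

/-- The dual `B^∨` of the Connes boundary map on cochains with coefficients in `DA`.  A cochain `f`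
of degree `c` corresponds to the linear form
`f̄ (a_0[a_1|…|a_k]) = (-1)^(|a_0| ∑_{j≥1} (|a_j| - 1)) f [a_1|…|a_k] (a_0)` on Hochschild chains,
and `B^∨ f̄ = -(-1)^c f̄ ∘ B` with
`B (a_0[a_1|…|a_k]) = ∑_{i=0}^k (-1)^(σ_i τ_i) 1[a_i|…|a_k|a_0|…|a_(i-1)]`,
`σ_i = ∑_{j<i} (|a_j| - 1)`, `τ_i = ∑_{j≥i} (|a_j| - 1)`.  Below `l = [a_1|…|a_k]`, `a_0` has
degree `-j`, and the summand of index `i < k` is that of `1[a_(i+1)|…|a_k|a_0|…|a_i]` while the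
one of index `k` is that of `1[a_0|…|a_k]`. -/
noncomputable def Bdual (r : GMPerversity n) (c : ℤ) (f : A.RawCochain A.dual)
    (hf : IsCochain A.dual r c f) : A.RawCochain A.dual := fun l q j =>
  (c + 1 + -j * wordDeg l).negOnePow • ∑ i ∈ Finset.range (l.length + 1),
    ((-j - 1 + wordDeg (l.take i)) * wordDeg (l.drop i)).negOnePow •
      (A.evalOne ∘ₗ hf.insert (l.drop i) (l.take i) q.compl (-j) (GMPerversity.top n) 0 :
        A.X q.compl (-j) →ₗ[R] R)

/-! ### Cofibrancy of the bar construction and Poincaré duality -/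

variable (A)

/-- The two-sided bar construction `𝔹(A) = A ⊗ T(s Ā) ⊗ A` is a cofibrant perverse DG `A`-bimodule:
morphisms of perverse DG bimodules `𝔹(A) → B` lift along every surjective quasi-isomorphism
`E → B`.  Since `Hom_(A^e)(𝔹(A), M) = HC(A, M)`, the morphisms of perverse DG bimodules
`𝔹(A) → M` are the cocycles of `HC(A, M)` of degree `0` and perverse degree `0`. -/
def BarCofibrant : Prop :=
  ∀ (E B : PBimod A) (π : BimodHom E B 0),
    (∀ (p : GMPerversity n) (i j : ℤ) (e : i + 0 = j), Function.Surjective (π.map p e)) →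
    π.IsQuasiIso →
    ∀ f ∈ cocycles B (GMPerversity.zero n) 0, ∃ g ∈ cocycles E (GMPerversity.zero n) 0,
      ∀ l q j, π.map q (add_zero j) (g l q j) = f l q j

/-- An isomorphism of degree `m` between `A` and `DA` in the derived category of perverse DG
`A`-bimodules, represented by quasi-isomorphisms `A ← P → DA`. -/
structure DerivedDuality (m : ℤ) where
  P : PBimod A
  q : BimodHom P A.self 0
  w : BimodHom P A.dual m
  q_quasiIso : q.IsQuasiIso
  w_quasiIso : w.IsQuasiIso

/-- Perverse derived Poincaré duality algebras: `A` is isomorphic to its dual `DA` in the derived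
category of `A`-bimodules, up to a shift of degree. -/
def IsPDPDA : Prop := ∃ m : ℤ, Nonempty (A.DerivedDuality m)

/-- `ζ` is a cocycle representing the image of `1` under the isomorphism
`H(A) ≅ H(DA)` induced by `A ← P → DA`. -/
def DerivedDuality.Represents {A : PDGA R n} {m : ℤ} (θ : A.DerivedDuality m)
    (ζ : A.dual.X (GMPerversity.zero n) m) : Prop :=
  ∃ (z : θ.P.X (GMPerversity.zero n) 0) (y : A.X (GMPerversity.zero n) (-1))
    (x : A.dual.X (GMPerversity.zero n) (m - 1)),
    θ.P.d (zero_add 1) z = 0 ∧ θ.q.map _ (add_zero 0) z = A.one + A.d (neg_add_cancel 1) y ∧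
    θ.w.map _ (zero_add m) z = ζ + A.dual.d (sub_add_cancel m 1) x

end PDGA

/-! ### Perverse Gerstenhaber and Batalin–Vilkovisky algebras -/

/-- A perverse Gerstenhaber algebra structure on a perverse graded module `V`. -/
structure PerverseGerstenhaber (R : Type u) [CommRing R] (n : ℕ)
    (V : GMPerversity n → ℤ → Type u) [∀ p i, AddCommGroup (V p i)] [∀ p i, Module R (V p i)] where
  res : ∀ {p q : GMPerversity n} {i : ℤ}, p ≤ q → V p i →ₗ[R] V q i
  res_refl : ∀ {p : GMPerversity n} {i : ℤ} (x : V p i), res le_rfl x = x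
  res_trans : ∀ {p q r : GMPerversity n} {i : ℤ} (h : p ≤ q) (h' : q ≤ r) (x : V p i),
    res h' (res h x) = res (h.trans h') x
  one : V (GMPerversity.zero n) 0
  cup : ∀ {p q r : GMPerversity n} {i j k : ℤ}, p.toFun + q.toFun ≤ r.toFun → i + j = k →
    V p i →ₗ[R] V q j →ₗ[R] V r k
  cup_res : ∀ {p p' q q' r r' : GMPerversity n} {i j k : ℤ} (hp : p ≤ p') (hq : q ≤ q')
    (hr : r ≤ r') (h : p.toFun + q.toFun ≤ r.toFun) (h' : p'.toFun + q'.toFun ≤ r'.toFun)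
    (e : i + j = k) (a : V p i) (b : V q j),
    cup h' e (res hp a) (res hq b) = res hr (cup h e a b)
  one_cup : ∀ {p : GMPerversity n} {i : ℤ} (h : (GMPerversity.zero n).toFun + p.toFun ≤ p.toFun)
    (e : 0 + i = i) (a : V p i), cup h e one a = a
  cup_one : ∀ {p : GMPerversity n} {i : ℤ} (h : p.toFun + (GMPerversity.zero n).toFun ≤ p.toFun)
    (e : i + 0 = i) (a : V p i), cup h e a one = a
  cup_assoc : ∀ {p q r s s' t : GMPerversity n} {i j k x y z : ℤ}
    (h₁ : p.toFun + q.toFun ≤ s.toFun) (h₂ : s.toFun + r.toFun ≤ t.toFun)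
    (h₃ : q.toFun + r.toFun ≤ s'.toFun) (h₄ : p.toFun + s'.toFun ≤ t.toFun)
    (e₁ : i + j = x) (e₂ : x + k = z) (e₃ : j + k = y) (e₄ : i + y = z)
    (a : V p i) (b : V q j) (c : V r k),
    cup h₂ e₂ (cup h₁ e₁ a b) c = cup h₄ e₄ a (cup h₃ e₃ b c)
  cup_comm : ∀ {p q r : GMPerversity n} {i j k : ℤ} (h : p.toFun + q.toFun ≤ r.toFun)
    (h' : q.toFun + p.toFun ≤ r.toFun) (e : i + j = k) (e' : j + i = k) (a : V p i) (b : V q j),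
    cup h e a b = (i * j).negOnePow • cup h' e' b a
  /-- the bracket, of degree `-1` -/
  bracket : ∀ {p q r : GMPerversity n} {i j k : ℤ}, p.toFun + q.toFun ≤ r.toFun →
    i + j = k + 1 → V p i →ₗ[R] V q j →ₗ[R] V r k
  bracket_res : ∀ {p p' q q' r r' : GMPerversity n} {i j k : ℤ} (hp : p ≤ p') (hq : q ≤ q')
    (hr : r ≤ r') (h : p.toFun + q.toFun ≤ r.toFun) (h' : p'.toFun + q'.toFun ≤ r'.toFun)
    (e : i + j = k + 1) (a : V p i) (b : V q j),
    bracket h' e (res hp a) (res hq b) = res hr (bracket h e a b)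
  bracket_skew : ∀ {p q r : GMPerversity n} {i j k : ℤ} (h : p.toFun + q.toFun ≤ r.toFun)
    (h' : q.toFun + p.toFun ≤ r.toFun) (e : i + j = k + 1) (e' : j + i = k + 1)
    (a : V p i) (b : V q j),
    bracket h e a b = -(((i - 1) * (j - 1)).negOnePow • bracket h' e' b a)
  jacobi : ∀ {p q r s₁ s₂ s₃ t : GMPerversity n} {i j k x y z w : ℤ}
    (h₁ : p.toFun + q.toFun ≤ s₁.toFun) (h₁' : s₁.toFun + r.toFun ≤ t.toFun)
    (h₂ : q.toFun + r.toFun ≤ s₂.toFun) (h₂' : p.toFun + s₂.toFun ≤ t.toFun)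
    (h₃ : p.toFun + r.toFun ≤ s₃.toFun) (h₃' : q.toFun + s₃.toFun ≤ t.toFun)
    (e₁ : i + j = x + 1) (e₁' : x + k = w + 1) (e₂ : j + k = y + 1) (e₂' : i + y = w + 1)
    (e₃ : i + k = z + 1) (e₃' : j + z = w + 1) (a : V p i) (b : V q j) (c : V r k),
    bracket h₁' e₁' (bracket h₁ e₁ a b) c = bracket h₂' e₂' a (bracket h₂ e₂ b c)
      - ((i - 1) * (j - 1)).negOnePow • bracket h₃' e₃' b (bracket h₃ e₃ a c)
  leibniz : ∀ {p q r s₁ s₂ s₃ t : GMPerversity n} {i j k x y z w : ℤ}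
    (h₁ : q.toFun + r.toFun ≤ s₁.toFun) (h₁' : p.toFun + s₁.toFun ≤ t.toFun)
    (h₂ : p.toFun + q.toFun ≤ s₂.toFun) (h₂' : s₂.toFun + r.toFun ≤ t.toFun)
    (h₃ : p.toFun + r.toFun ≤ s₃.toFun) (h₃' : q.toFun + s₃.toFun ≤ t.toFun)
    (e₁ : j + k = x) (e₁' : i + x = w + 1) (e₂ : i + j = y + 1) (e₂' : y + k = w)
    (e₃ : i + k = z + 1) (e₃' : j + z = w) (a : V p i) (b : V q j) (c : V r k),
    bracket h₁' e₁' a (cup h₁ e₁ b c) = cup h₂' e₂' (bracket h₂ e₂ a b) c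
      + ((i - 1) * j).negOnePow • cup h₃' e₃' b (bracket h₃ e₃ a c)

/-- A Batalin–Vilkovisky operator on a perverse Gerstenhaber algebra: an operator `Δ` of degree `-1`
and perverse degree `0` with `Δ² = 0` and
`(-1)^|a| [a, b] = Δ(a ∪ b) - Δ(a) ∪ b - (-1)^|a| a ∪ Δ(b)`.  A perverse BV algebra is a perverse
Gerstenhaber algebra with such an operator. -/
structure PerverseGerstenhaber.BVOperator {R : Type u} [CommRing R] {n : ℕ}
    {V : GMPerversity n → ℤ → Type u} [∀ p i, AddCommGroup (V p i)] [∀ p i, Module R (V p i)]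
    (G : PerverseGerstenhaber R n V) where
  Δ : ∀ {p : GMPerversity n} {i k : ℤ}, i = k + 1 → V p i →ₗ[R] V p k
  Δ_res : ∀ {p q : GMPerversity n} {i k : ℤ} (h : p ≤ q) (e : i = k + 1) (a : V p i),
    Δ e (G.res h a) = G.res h (Δ e a)
  Δ_Δ : ∀ {p : GMPerversity n} {i j k : ℤ} (e : i = j + 1) (e' : j = k + 1) (a : V p i),
    Δ e' (Δ e a) = 0
  bv : ∀ {p q r : GMPerversity n} {i i' j j' k k' : ℤ} (h : p.toFun + q.toFun ≤ r.toFun)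
    (ei : i = i' + 1) (ej : j = j' + 1) (ek : k = k' + 1) (e : i + j = k) (e₁ : i' + j = k')
    (e₂ : i + j' = k') (e' : i + j = k' + 1) (a : V p i) (b : V q j),
    i.negOnePow • G.bracket h e' a b =
      Δ ek (G.cup h e a b) - G.cup h e₁ (Δ ei a) b - i.negOnePow • G.cup h e₂ a (Δ ej b)

namespace PDGA

variable {R : Type u} [CommRing R] {n : ℕ} (A : PDGA R n)

/-- `G` is the perverse Gerstenhaber algebra `HH^*_•(A)`: its structure morphisms, its unit, its
product and its bracket are induced by those of Hochschild cochains. -/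
structure IsHochschildGerstenhaber (G : PerverseGerstenhaber R n (HH A.self)) : Prop where
  res : ∀ (p q : GMPerversity n) (i : ℤ) (h : p ≤ q) (f : A.RawCochain A.self)
    (hf : f ∈ cocycles A.self p i),
    ∃ hf' : trunc q f ∈ cocycles A.self q i, G.res h (cls f hf) = cls (trunc q f) hf'
  one : ∃ hf : A.augmentation ∈ cocycles A.self (GMPerversity.zero n) 0,
    G.one = cls A.augmentation hf
  cup : ∀ (p q r : GMPerversity n) (i j k : ℤ) (h : p.toFun + q.toFun ≤ r.toFun)
    (e : i + j = k) (f g : A.RawCochain A.self) (hf : f ∈ cocycles A.self p i)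
    (hg : g ∈ cocycles A.self q j),
    ∃ hfg : trunc r (act A.self p q i j f g) ∈ cocycles A.self r k,
      G.cup h e (cls f hf) (cls g hg) = cls (trunc r (act A.self p q i j f g)) hfg
  bracket : ∀ (p q r : GMPerversity n) (i j k : ℤ) (h : p.toFun + q.toFun ≤ r.toFun)
    (e : i + j = k + 1) (f g : A.RawCochain A.self) (hf : f ∈ cocycles A.self p i)
    (hg : g ∈ cocycles A.self q j),
    ∃ hfg : trunc r (bracket p q i j f g) ∈ cocycles A.self r k,
      G.bracket h e (cls f hf) (cls g hg) = cls (trunc r (bracket p q i j f g)) hfg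

/-- `Φ` is the action `f ↦ f . c` of `HH^*_•(A)` on the class of the cochain `c` with coefficients
in `DA`, of degree `m` and perverse degree `0`. -/
def IsActionOn {m : ℤ} (c : A.RawCochain A.dual)
    (Φ : ∀ {p : GMPerversity n} {i j : ℤ}, i + m = j → HH A.self p i ≃ₗ[R] HH A.dual p j) : Prop :=
  ∀ (p : GMPerversity n) (i j : ℤ) (e : i + m = j) (f : A.RawCochain A.self)
    (hf : f ∈ cocycles A.self p i),
    ∃ hfc : act A.dual p (GMPerversity.zero n) i m f c ∈ cocycles A.dual p j,
      Φ e (cls f hf) = cls (act A.dual p (GMPerversity.zero n) i m f c) hfc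

/-- `b` is the operator on `HH^*_•(A, DA)` induced by `B^∨`. -/
def IsInducedByBdual
    (b : ∀ {p : GMPerversity n} {i k : ℤ}, i = k + 1 → HH A.dual p i →ₗ[R] HH A.dual p k) : Prop :=
  ∀ (p : GMPerversity n) (i k : ℤ) (e : i = k + 1) (f : A.RawCochain A.dual)
    (hf : f ∈ cocycles A.dual p i),
    ∃ hb : Bdual p i f hf.1 ∈ cocycles A.dual p k, b e (cls f hf) = cls (Bdual p i f hf.1) hb

end PDGA

universe v w

attribute [reducible] PDGA.self

/-! ### Signs -/

/-- The sign `(-1)^k` for `k` modulo `2`. -/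
def sg (k : ZMod 2) : ℤ := if k = 0 then 1 else -1

theorem zmod_two_eq_zero : (2 : ZMod 2) = 0 := rfl

@[simp] theorem sg_zero : sg 0 = 1 := rfl

@[simp] theorem sg_one : sg 1 = -1 := rfl

theorem sg_add (a b : ZMod 2) : sg (a + b) = sg a * sg b := by revert a b; decide

theorem sg_mul_self (a : ZMod 2) : sg a * sg a = 1 := by revert a; decide

theorem zmod_two_cases (k : ZMod 2) : k = 0 ∨ k = 1 := by revert k; decide

theorem negOnePow_smul {M : Type*} [AddCommGroup M] (c : ℤ) (x : M) :
    c.negOnePow • x = sg (c : ZMod 2) • x := by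
  rcases Int.even_or_odd c with h | h
  · have h0 : (c : ZMod 2) = 0 := (ZMod.intCast_zmod_eq_zero_iff_dvd c 2).2 h.two_dvd
    rw [Int.negOnePow_even c h, h0]; simp
  · have h0 : (c : ZMod 2) = 1 := by
      obtain ⟨k, rfl⟩ := h
      push_cast
      rw [show (2 : ZMod 2) = 0 from rfl]; simp
    rw [Int.negOnePow_odd c h, h0]; simp

theorem sg_smul_smul {M : Type*} [AddCommGroup M] (a b : ZMod 2) (x : M) :
    sg a • sg b • x = sg (a + b) • x := by rw [smul_smul, sg_add]

theorem sg_smul_sg_smul {M : Type*} [AddCommGroup M] (a : ZMod 2) (x : M) :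
    sg a • sg a • x = x := by rw [smul_smul, sg_mul_self, one_smul]

/-! ### Sums over deconcatenations of a word -/

section Split

variable {α : Type u} {β : Type w} {N : Type v} [AddCommMonoid N]

/-- The sum of `F u v` over all pairs of words with `u ++ v = l`. -/
def splitSum (F : List α → List α → N) : List α → N
  | [] => F [] []
  | a :: l => F [] (a :: l) + splitSum (fun u v => F (a :: u) v) l

@[simp] theorem splitSum_nil (F : List α → List α → N) : splitSum F [] = F [] [] := rfl

theorem splitSum_cons (F : List α → List α → N) (a : α) (l : List α) :
    splitSum F (a :: l) = F [] (a :: l) + splitSum (fun u v => F (a :: u) v) l := rfl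

theorem splitSum_eq_range (F : List α → List α → N) (l : List α) :
    splitSum F l = ∑ i ∈ Finset.range (l.length + 1), F (l.take i) (l.drop i) := by
  induction l generalizing F with
  | nil => simp
  | cons a l ih =>
    rw [splitSum_cons, ih, List.length_cons, Finset.sum_range_succ' _ (l.length + 1), add_comm]
    simp

theorem splitSum_congr {F G : List α → List α → N} {l : List α}
    (h : ∀ u v, u ++ v = l → F u v = G u v) : splitSum F l = splitSum G l := by
  induction l generalizing F G with
  | nil => exact h [] [] rfl
  | cons a l ih =>
    rw [splitSum_cons, splitSum_cons, h [] _ rfl, ih fun u v e => h (a :: u) v (by simp [e])]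

theorem splitSum_add (F G : List α → List α → N) (l : List α) :
    splitSum (fun u v => F u v + G u v) l = splitSum F l + splitSum G l := by
  simp only [splitSum_eq_range, Finset.sum_add_distrib]

@[simp] theorem splitSum_zero (l : List α) : splitSum (fun _ _ => (0 : N)) l = 0 := by
  simp [splitSum_eq_range]

theorem splitSum_eq_zero {F : List α → List α → N} {l : List α}
    (h : ∀ u v, u ++ v = l → F u v = 0) : splitSum F l = 0 := by
  rw [splitSum_congr h, splitSum_zero]

theorem map_splitSum {N' G : Type*} [AddCommMonoid N'] [FunLike G N N'] [AddMonoidHomClass G N N']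
    (φ : G) (F : List α → List α → N) (l : List α) :
    φ (splitSum F l) = splitSum (fun u v => φ (F u v)) l := by
  simp only [splitSum_eq_range, map_sum]

theorem splitSum_zsmul {N : Type v} [AddCommGroup N] (k : ℤ) (F : List α → List α → N)
    (l : List α) : splitSum (fun u v => k • F u v) l = k • splitSum F l := by
  simp only [splitSum_eq_range, Finset.smul_sum]

theorem splitSum_neg {N : Type v} [AddCommGroup N] (F : List α → List α → N)
    (l : List α) : splitSum (fun u v => - F u v) l = - splitSum F l := by
  simp only [splitSum_eq_range, Finset.sum_neg_distrib]

theorem splitSum_sub {N : Type v} [AddCommGroup N] (F G : List α → List α → N) (l : List α) :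
    splitSum (fun u v => F u v - G u v) l = splitSum F l - splitSum G l := by
  simp only [splitSum_eq_range, Finset.sum_sub_distrib]

theorem splitSum_smul {R : Type*} [CommRing R] {N : Type v} [AddCommGroup N] [Module R N] (k : R)
    (F : List α → List α → N) (l : List α) :
    splitSum (fun u v => k • F u v) l = k • splitSum F l := by
  simp only [splitSum_eq_range, Finset.smul_sum]

theorem splitSum_map (φ : β → α) (F : List α → List α → N) (l : List β) :
    splitSum F (l.map φ) = splitSum (fun u v => F (u.map φ) (v.map φ)) l := by
  simp only [splitSum_eq_range, List.length_map, List.map_take, List.map_drop]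

theorem splitSum_comm (F : List α → List α → List β → List β → N) (l : List α) (l' : List β) :
    splitSum (fun u v => splitSum (fun u' v' => F u v u' v') l') l =
      splitSum (fun u' v' => splitSum (fun u v => F u v u' v') l) l' := by
  simp only [splitSum_eq_range]; exact Finset.sum_comm

theorem splitSum_assoc (F : List α → List α → List α → N) (l : List α) :
    splitSum (fun x t => splitSum (fun u v => F u v t) x) l =
      splitSum (fun u y => splitSum (fun v t => F u v t) y) l := by
  induction l generalizing F with
  | nil => rfl
  | cons a l ih =>
    simp only [splitSum_cons, splitSum_nil, splitSum_add]
    rw [ih, add_assoc]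

theorem splitSum_append_cons (F : List α → List α → N) (l₁ l₂ : List α) (x : α) :
    splitSum F (l₁ ++ x :: l₂) = splitSum (fun u v => F u (v ++ x :: l₂)) l₁
      + splitSum (fun u v => F (l₁ ++ x :: u) v) l₂ := by
  induction l₁ generalizing F with
  | nil => rfl
  | cons a l ih => rw [List.cons_append, splitSum_cons, ih, splitSum_cons, ← add_assoc]; rfl

theorem splitSum_concat (F : List α → List α → N) (l : List α) (x : α) :
    splitSum F (l ++ [x]) = splitSum (fun u v => F u (v ++ [x])) l + F (l ++ [x]) [] := by
  rw [splitSum_append_cons]; rfl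

/-- Only the splittings with empty second word contribute. -/
theorem splitSum_of_right_nil {F : List α → List α → N} (h : ∀ u a v, F u (a :: v) = 0)
    (l : List α) : splitSum F l = F l [] := by
  induction l generalizing F with
  | nil => rfl
  | cons a l ih => rw [splitSum_cons, ih fun u => h (a :: u), h, zero_add]

/-- Only the splittings with empty first word contribute. -/
theorem splitSum_of_left_nil {F : List α → List α → N} (h : ∀ a u v, F (a :: u) v = 0)
    (l : List α) : splitSum F l = F [] l := by
  cases l with
  | nil => rfl
  | cons a l => rw [splitSum_cons, splitSum_eq_zero fun u v _ => h a u v, add_zero]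

/-- The sum of `F u v t` over all triples of words with `u ++ v ++ t = l`. -/
def splitSum₃ (F : List α → List α → List α → N) (l : List α) : N :=
  splitSum (fun u y => splitSum (fun v t => F u v t) y) l

theorem splitSum₃_congr {F G : List α → List α → List α → N} {l : List α}
    (h : ∀ u v t, u ++ (v ++ t) = l → F u v t = G u v t) : splitSum₃ F l = splitSum₃ G l :=
  splitSum_congr fun u _ e => splitSum_congr fun v t e' => h u v t (by rw [e', e])

theorem splitSum₃_eq_zero {F : List α → List α → List α → N} {l : List α}
    (h : ∀ u v t, u ++ (v ++ t) = l → F u v t = 0) : splitSum₃ F l = 0 :=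
  splitSum_eq_zero fun u _ e => splitSum_eq_zero fun v t e' => h u v t (by rw [e', e])

theorem splitSum₃_add (F G : List α → List α → List α → N) (l : List α) :
    splitSum₃ (fun u v t => F u v t + G u v t) l = splitSum₃ F l + splitSum₃ G l := by
  simp only [splitSum₃, splitSum_add]

theorem splitSum₃_zsmul {N : Type v} [AddCommGroup N] (k : ℤ) (F : List α → List α → List α → N)
    (l : List α) : splitSum₃ (fun u v t => k • F u v t) l = k • splitSum₃ F l := by
  simp only [splitSum₃, splitSum_zsmul]

theorem splitSum₃_neg {N : Type v} [AddCommGroup N] (F : List α → List α → List α → N)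
    (l : List α) : splitSum₃ (fun u v t => - F u v t) l = - splitSum₃ F l := by
  simp only [splitSum₃, splitSum_neg]

theorem splitSum₃_sub {N : Type v} [AddCommGroup N] (F G : List α → List α → List α → N)
    (l : List α) :
    splitSum₃ (fun u v t => F u v t - G u v t) l = splitSum₃ F l - splitSum₃ G l := by
  simp only [splitSum₃, splitSum_sub]

theorem splitSum₃_smul {R : Type*} [CommRing R] {N : Type v} [AddCommGroup N] [Module R N] (k : R)
    (F : List α → List α → List α → N) (l : List α) :
    splitSum₃ (fun u v t => k • F u v t) l = k • splitSum₃ F l := by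
  simp only [splitSum₃, splitSum_smul]

theorem map_splitSum₃ {N' G : Type*} [AddCommMonoid N'] [FunLike G N N'] [AddMonoidHomClass G N N']
    (φ : G) (F : List α → List α → List α → N) (l : List α) :
    φ (splitSum₃ F l) = splitSum₃ (fun u v t => φ (F u v t)) l := by
  simp only [splitSum₃, map_splitSum]

theorem splitSum₃_map (φ : β → α) (F : List α → List α → List α → N) (l : List β) :
    splitSum₃ F (l.map φ) = splitSum₃ (fun u v t => F (u.map φ) (v.map φ) (t.map φ)) l := by
  simp only [splitSum₃, splitSum_map]

theorem splitSum₃_append_cons (F : List α → List α → List α → N) (l₁ l₂ : List α) (x : α) :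
    splitSum₃ F (l₁ ++ x :: l₂) = splitSum₃ (fun u v t => F u v (t ++ x :: l₂)) l₁
      + splitSum (fun u v => splitSum (fun v' t => F u (v ++ x :: v') t) l₂) l₁
      + splitSum₃ (fun u v t => F (l₁ ++ x :: u) v t) l₂ := by
  simp only [splitSum₃, splitSum_append_cons, splitSum_add]

/-- The sum over all splittings into five words. -/
def splitSum₅ (F : List α → List α → List α → List α → List α → N) (l : List α) : N :=
  splitSum₃ (fun u v y => splitSum₃ (fun p q r => F u v p q r) y) l

theorem splitSum₅_eq_zero {F : List α → List α → List α → List α → List α → N} {l : List α}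
    (h : ∀ u v p q r, u ++ (v ++ (p ++ (q ++ r))) = l → F u v p q r = 0) : splitSum₅ F l = 0 :=
  splitSum₃_eq_zero fun u v _ e => splitSum₃_eq_zero fun p q r e' => h u v p q r (by rw [e', e])

theorem splitSum₃_left (F : List α → List α → List α → List α → List α → N) (l : List α) :
    splitSum₃ (fun y q r => splitSum₃ (fun u v p => F u v p q r) y) l = splitSum₅ F l := by
  simp only [splitSum₅, splitSum₃]
  have h : ∀ y w : List α, splitSum (fun q r => splitSum (fun u y => splitSum (fun v p =>
      F u v p q r) y) y) w = splitSum (fun u y => splitSum (fun v p => splitSum (fun q r =>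
      F u v p q r) w) y) y := fun y w => by
    rw [splitSum_comm]
    exact splitSum_congr fun u y _ => splitSum_comm _ _ _
  simp only [h]
  rw [splitSum_assoc (fun u y w => splitSum (fun v p => splitSum (fun q r => F u v p q r) w) y)]
  refine splitSum_congr fun u y _ => ?_
  rw [splitSum_assoc (fun v p w => splitSum (fun q r => F u v p q r) w)]

theorem splitSum₃_mid (F : List α → List α → List α → List α → List α → N) (l : List α) :
    splitSum₃ (fun u y r => splitSum₃ (fun v p q => F u v p q r) y) l = splitSum₅ F l := by
  simp only [splitSum₅, splitSum₃]
  refine splitSum_congr fun u _ _ => ?_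
  rw [splitSum_assoc]
  refine splitSum_congr fun v _ _ => ?_
  rw [splitSum_assoc]

theorem splitSum₃_left_right (F : List α → List α → List α → List α → List α → N) (l : List α) :
    splitSum₃ (fun x p y => splitSum (fun u v => splitSum (fun q r => F u v p q r) y) x) l =
      splitSum₅ F l := by
  simp only [splitSum₅, splitSum₃]
  have h : ∀ x z : List α, splitSum (fun p y => splitSum (fun u v => splitSum (fun q r =>
      F u v p q r) y) x) z = splitSum (fun u v => splitSum (fun p y => splitSum (fun q r =>
      F u v p q r) y) z) x := fun x z => splitSum_comm _ _ _
  simp only [h]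
  exact splitSum_assoc (fun u v z => splitSum (fun p y => splitSum (fun q r => F u v p q r) y) z) l

end Split

/-! ### Differential graded algebras with a sign operator -/

/-- A `ℤ/2`-graded differential algebra, whose grading is recorded by the operator `tw`, equal to
`(-1)^(|a| - 1)` on elements of degree `|a|`. -/
structure DGAlg (R : Type v) (A : Type u) [CommRing R] [AddCommGroup A] [Module R A] where
  mul : A →ₗ[R] A →ₗ[R] A
  one : A
  d : A →ₗ[R] A
  tw : A →ₗ[R] A
  mul_assoc : ∀ a b c, mul (mul a b) c = mul a (mul b c)
  one_mul : ∀ a, mul one a = a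
  mul_one : ∀ a, mul a one = a
  tw_tw : ∀ a, tw (tw a) = a
  tw_mul : ∀ a b, tw (mul a b) = -mul (tw a) (tw b)
  tw_one : tw one = -one
  d_tw : ∀ a, d (tw a) = -tw (d a)
  d_mul : ∀ a b, d (mul a b) = mul (d a) b - mul (tw a) (d b)

/-- Differential bimodules over a `ℤ/2`-graded differential algebra; `sgn` is `(-1)^|x|`. -/
structure DGBimod {R : Type v} {A : Type u} [CommRing R] [AddCommGroup A] [Module R A]
    (𝒜 : DGAlg R A) (N : Type w) [AddCommGroup N] [Module R N] where
  lm : A →ₗ[R] N →ₗ[R] N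
  rm : N →ₗ[R] A →ₗ[R] N
  d : N →ₗ[R] N
  sgn : N →ₗ[R] N
  mul_lm : ∀ a b x, lm (𝒜.mul a b) x = lm a (lm b x)
  lm_rm : ∀ a x b, rm (lm a x) b = lm a (rm x b)
  rm_mul : ∀ x a b, rm (rm x a) b = rm x (𝒜.mul a b)
  one_lm : ∀ x, lm 𝒜.one x = x
  rm_one : ∀ x, rm x 𝒜.one = x
  d_lm : ∀ a x, d (lm a x) = lm (𝒜.d a) x - lm (𝒜.tw a) (d x)
  d_rm : ∀ x a, d (rm x a) = rm (d x) a + rm (sgn x) (𝒜.d a)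

/-- Functions on words which are linear in each letter. -/
structure MLin (R : Type v) {A : Type u} {N : Type w} [CommRing R] [AddCommGroup A] [Module R A]
    [AddCommGroup N] [Module R N] (f : List A → N) : Prop where
  add : ∀ u v a b, f (u ++ (a + b) :: v) = f (u ++ a :: v) + f (u ++ b :: v)
  smul : ∀ u v (s : R) a, f (u ++ (s • a) :: v) = s • f (u ++ a :: v)

namespace MLin

variable {R : Type v} {A : Type u} {N : Type w} [CommRing R] [AddCommGroup A] [Module R A]
    [AddCommGroup N] [Module R N] {f g : List A → N}

/-- The linear map `a ↦ f [u|a|v]`. -/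
def lin (hf : MLin R f) (u v : List A) : A →ₗ[R] N where
  toFun a := f (u ++ a :: v)
  map_add' := hf.add u v
  map_smul' := hf.smul u v

theorem lin_apply (hf : MLin R f) (u v : List A) (a : A) : hf.lin u v a = f (u ++ a :: v) := rfl

theorem zero (hf : MLin R f) (u v : List A) : f (u ++ 0 :: v) = 0 := map_zero (hf.lin u v)

theorem neg (hf : MLin R f) (u v : List A) (a : A) : f (u ++ (-a) :: v) = -f (u ++ a :: v) :=
  map_neg (hf.lin u v) a

theorem sub (hf : MLin R f) (u v : List A) (a b : A) :
    f (u ++ (a - b) :: v) = f (u ++ a :: v) - f (u ++ b :: v) := map_sub (hf.lin u v) a b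

theorem zsmul (hf : MLin R f) (u v : List A) (k : ℤ) (a : A) :
    f (u ++ (k • a) :: v) = k • f (u ++ a :: v) := map_zsmul (hf.lin u v) k a

theorem of_lin (h : ∀ u v, ∃ φ : A →ₗ[R] N, ∀ a, f (u ++ a :: v) = φ a) : MLin R f where
  add u v a b := by obtain ⟨φ, h⟩ := h u v; simp [h]
  smul u v s a := by obtain ⟨φ, h⟩ := h u v; simp [h]

theorem fadd (hf : MLin R f) (hg : MLin R g) : MLin R (f + g) :=
  of_lin fun u v => ⟨hf.lin u v + hg.lin u v, fun _ => rfl⟩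

theorem fsub (hf : MLin R f) (hg : MLin R g) : MLin R (f - g) :=
  of_lin fun u v => ⟨hf.lin u v - hg.lin u v, fun _ => rfl⟩

theorem fsmul (s : R) (hf : MLin R f) : MLin R (s • f) :=
  of_lin fun u v => ⟨s • hf.lin u v, fun _ => rfl⟩

theorem fzsmul (s : ℤ) (hf : MLin R f) : MLin R (s • f) :=
  of_lin fun u v => ⟨s • hf.lin u v, fun _ => rfl⟩

theorem comp {N' : Type*} [AddCommGroup N'] [Module R N'] (φ : N →ₗ[R] N') (hf : MLin R f) :
    MLin R (fun l => φ (f l)) := of_lin fun u v => ⟨φ ∘ₗ hf.lin u v, fun _ => rfl⟩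

theorem map (φ : A →ₗ[R] A) (hf : MLin R f) : MLin R (fun l => f (l.map φ)) :=
  of_lin fun u v => ⟨hf.lin (u.map φ) (v.map φ) ∘ₗ φ, fun a => by simp [lin]⟩

theorem fzero : MLin R (fun _ : List A => (0 : N)) := of_lin fun _ _ => ⟨0, fun _ => rfl⟩

theorem prepend (hf : MLin R f) (w : List A) : MLin R (fun l => f (w ++ l)) where
  add u v a b := by simpa using hf.add (w ++ u) v a b
  smul u v s a := by simpa using hf.smul (w ++ u) v s a

theorem append (hf : MLin R f) (w : List A) : MLin R (fun l => f (l ++ w)) where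
  add u v a b := by simpa using hf.add u (v ++ w) a b
  smul u v s a := by simpa using hf.smul u (v ++ w) s a

theorem splitSum {F : List A → List A → N} (h₁ : ∀ v, MLin R fun u => F u v)
    (h₂ : ∀ u, MLin R fun v => F u v) : MLin R (splitSum F) where
  add u v a b := by
    simp only [splitSum_append_cons, fun p q => (h₂ p).add q v a b, fun p q => (h₁ q).add u p a b,
      splitSum_add]
    abel
  smul u v s a := by
    simp only [splitSum_append_cons, fun p q => (h₂ p).smul q v s a, fun p q => (h₁ q).smul u p s a,
      splitSum_smul, smul_add]

theorem splitSum₃ {F : List A → List A → List A → N} (h₁ : ∀ v t, MLin R fun u => F u v t)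
    (h₂ : ∀ u t, MLin R fun v => F u v t) (h₃ : ∀ u v, MLin R fun t => F u v t) :
    MLin R (splitSum₃ F) := by
  refine splitSum (fun y => ?_) fun u => splitSum (h₂ u) (h₃ u)
  exact of_lin fun p q => ⟨∑ i ∈ Finset.range (y.length + 1),
    (h₁ (y.take i) (y.drop i)).lin p q, fun a => by
      simp [splitSum_eq_range, lin]⟩

end MLin

namespace DGAlg

variable {R : Type v} {A : Type u} [CommRing R] [AddCommGroup A] [Module R A] (𝒜 : DGAlg R A)

/-- The powers of the sign operator. -/
def twz (k : ZMod 2) : A →ₗ[R] A := if k = 0 then LinearMap.id else 𝒜.tw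

/-- The powers of the sign operator on words. -/
def twl (k : ZMod 2) (l : List A) : List A := l.map (𝒜.twz k)

@[simp] theorem twz_zero (a : A) : 𝒜.twz 0 a = a := rfl

@[simp] theorem twz_one (a : A) : 𝒜.twz 1 a = 𝒜.tw a := rfl

@[simp] theorem twl_zero (l : List A) : 𝒜.twl 0 l = l := List.map_id l

@[simp] theorem twl_nil (k : ZMod 2) : 𝒜.twl k [] = [] := rfl

@[simp] theorem twl_cons (k : ZMod 2) (a : A) (l : List A) :
    𝒜.twl k (a :: l) = 𝒜.twz k a :: 𝒜.twl k l := rfl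

@[simp] theorem twl_append (k : ZMod 2) (l l' : List A) :
    𝒜.twl k (l ++ l') = 𝒜.twl k l ++ 𝒜.twl k l' := List.map_append

theorem twz_twz (a b : ZMod 2) (x : A) : 𝒜.twz a (𝒜.twz b x) = 𝒜.twz (a + b) x := by
  rcases zmod_two_cases a with rfl | rfl <;> rcases zmod_two_cases b with rfl | rfl <;>
    simp [𝒜.tw_tw, CharTwo.add_self_eq_zero]

theorem twl_twl (a b : ZMod 2) (l : List A) : 𝒜.twl a (𝒜.twl b l) = 𝒜.twl (a + b) l := by
  simp [twl, twz_twz]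

theorem twz_mul (k : ZMod 2) (a b : A) :
    𝒜.twz k (𝒜.mul a b) = sg k • 𝒜.mul (𝒜.twz k a) (𝒜.twz k b) := by
  rcases zmod_two_cases k with rfl | rfl <;> simp [𝒜.tw_mul]

theorem d_twz (k : ZMod 2) (a : A) : 𝒜.d (𝒜.twz k a) = sg k • 𝒜.twz k (𝒜.d a) := by
  rcases zmod_two_cases k with rfl | rfl <;> simp [𝒜.d_tw]

theorem twz_oneA (k : ZMod 2) : 𝒜.twz k 𝒜.one = sg k • 𝒜.one := by
  rcases zmod_two_cases k with rfl | rfl <;> simp [𝒜.tw_one]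

/-- `A` as a bimodule over itself. -/
def selfBimod : DGBimod 𝒜 A where
  lm := 𝒜.mul
  rm := 𝒜.mul
  d := 𝒜.d
  sgn := -𝒜.tw
  mul_lm := 𝒜.mul_assoc
  lm_rm := 𝒜.mul_assoc
  rm_mul := 𝒜.mul_assoc
  one_lm := 𝒜.one_mul
  rm_one := 𝒜.mul_one
  d_lm := 𝒜.d_mul
  d_rm a b := by rw [𝒜.d_mul]; simp [sub_eq_add_neg]

/-- The cochain `f` with values in `A` has degree `e + 1` modulo `2`. -/
def Par (e : ZMod 2) (f : List A → A) : Prop := ∀ l, 𝒜.tw (f l) = sg e • f (𝒜.twl 1 l)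

variable {𝒜} in
theorem Par.twz {e : ZMod 2} {f : List A → A} (h : 𝒜.Par e f) (k : ZMod 2) (l : List A) :
    𝒜.twz k (f l) = sg (k * e) • f (𝒜.twl k l) := by
  rcases zmod_two_cases k with rfl | rfl <;> simp [h l]

variable {N N₁ N₂ N₃ N₁₂ N₂₃ : Type*} [AddCommGroup N] [Module R N]
  [AddCommGroup N₁] [Module R N₁] [AddCommGroup N₂] [Module R N₂] [AddCommGroup N₃] [Module R N₃]
  [AddCommGroup N₁₂] [Module R N₁₂] [AddCommGroup N₂₃] [Module R N₂₃]

/-- The product of cochains induced by a bilinear map, where the second cochain has degree `k`. -/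
def conv (β : N₁ →ₗ[R] N₂ →ₗ[R] N) (k : ZMod 2) (f : List A → N₁) (g : List A → N₂) : List A → N :=
  splitSum fun u v => β (f (𝒜.twl k u)) (g v)

/-- The composition product `f ∘ g` where `g` has degree `e + 1`. -/
def circ (e : ZMod 2) (f : List A → N) (g : List A → A) : List A → N :=
  splitSum₃ fun u v t => f (𝒜.twl e u ++ g v :: t)

/-- The cochain `[a] ↦ a`. -/
def id1 (l : List A) : A :=
  match l with
  | [a] => a
  | _ => 0

@[simp] theorem id1_nil : id1 ([] : List A) = 0 := rfl
@[simp] theorem id1_single (a : A) : id1 [a] = a := rfl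
@[simp] theorem id1_cons_cons (a b : A) (l : List A) : id1 (a :: b :: l) = 0 := rfl

/-- The cochain `[a] ↦ d a`, `[a|b] ↦ (-1)^|a| a b`. -/
def mm : List A → A := fun l => 𝒜.d (id1 l) - 𝒜.conv 𝒜.mul 1 id1 id1 l

variable {𝒜} in
/-- The Hochschild differential on cochains of degree `c`. -/
def hD (ℬ : DGBimod 𝒜 N) (c : ZMod 2) (f : List A → N) : List A → N := fun l =>
  ℬ.d (f l) + sg c • 𝒜.circ 1 f 𝒜.mm l - 𝒜.conv ℬ.lm c id1 f l + sg c • 𝒜.conv ℬ.rm 1 f id1 l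

/-- The brace `f {g, h}` where `g` and `h` have degree `e + 1` and `e' + 1`. -/
def brace (e e' : ZMod 2) (f : List A → N) (g h : List A → A) : List A → N :=
  splitSum₅ fun u v p q r => f (𝒜.twl (e + e') u ++ g (𝒜.twl e' v) ::
    (𝒜.twl e' p ++ h q :: r))

/-! Linearity. -/

theorem mlin_id1 : MLin R (id1 : List A → A) :=
  MLin.of_lin fun u v => by
    match u, v with
    | [], [] => exact ⟨LinearMap.id, fun a => rfl⟩
    | [], b :: v => exact ⟨0, fun a => rfl⟩
    | [b], v => exact ⟨0, fun a => by simp [id1]⟩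
    | b :: c :: u, v => exact ⟨0, fun a => by simp [id1]⟩

variable {𝒜}

theorem mlin_twl {f : List A → N} (hf : MLin R f) (k : ZMod 2) : MLin R fun l => f (𝒜.twl k l) :=
  hf.map (𝒜.twz k)

theorem mlin_conv (β : N₁ →ₗ[R] N₂ →ₗ[R] N) (k : ZMod 2) {f : List A → N₁} {g : List A → N₂}
    (hf : MLin R f) (hg : MLin R g) : MLin R (𝒜.conv β k f g) :=
  MLin.splitSum (fun v => (mlin_twl hf k).comp (β.flip (g v))) fun u => hg.comp (β (f (𝒜.twl k u)))

theorem mlin_circ (e : ZMod 2) {f : List A → N} {g : List A → A}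
    (hf : MLin R f) (hg : MLin R g) : MLin R (𝒜.circ e f g) :=
  MLin.splitSum₃ (fun v t => mlin_twl (hf.append (g v :: t)) e)
    (fun u t => hg.comp (hf.lin (𝒜.twl e u) t))
    fun u v => by simpa using hf.prepend (𝒜.twl e u ++ [g v])

theorem mlin_mm : MLin R 𝒜.mm := (mlin_id1.comp 𝒜.d).fsub (mlin_conv _ _ mlin_id1 mlin_id1)

theorem mlin_hD (ℬ : DGBimod 𝒜 N) (c : ZMod 2) {f : List A → N} (hf : MLin R f) :
    MLin R (hD ℬ c f) :=
  (((hf.comp ℬ.d).fadd ((mlin_circ 1 hf mlin_mm).fzsmul (sg c))).fsub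
    (mlin_conv ℬ.lm c mlin_id1 hf)).fadd ((mlin_conv ℬ.rm 1 hf mlin_id1).fzsmul (sg c))

/-! Additivity of the operations. -/

theorem conv_add_left (β : N₁ →ₗ[R] N₂ →ₗ[R] N) (k : ZMod 2) (f f' : List A → N₁) (g : List A → N₂) :
    𝒜.conv β k (f + f') g = 𝒜.conv β k f g + 𝒜.conv β k f' g := by
  funext l; simp [conv, splitSum_add]

theorem conv_sub_left (β : N₁ →ₗ[R] N₂ →ₗ[R] N) (k : ZMod 2) (f f' : List A → N₁) (g : List A → N₂) :
    𝒜.conv β k (f - f') g = 𝒜.conv β k f g - 𝒜.conv β k f' g := by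
  funext l; simp [conv, splitSum_sub]

theorem conv_zsmul_left (β : N₁ →ₗ[R] N₂ →ₗ[R] N) (k : ZMod 2) (s : ℤ) (f : List A → N₁)
    (g : List A → N₂) : 𝒜.conv β k (s • f) g = s • 𝒜.conv β k f g := by
  funext l; simp [conv, splitSum_zsmul]

theorem conv_smul_left (β : N₁ →ₗ[R] N₂ →ₗ[R] N) (k : ZMod 2) (s : R) (f : List A → N₁)
    (g : List A → N₂) : 𝒜.conv β k (s • f) g = s • 𝒜.conv β k f g := by
  funext l; simp [conv, splitSum_smul]

theorem conv_add_right (β : N₁ →ₗ[R] N₂ →ₗ[R] N) (k : ZMod 2) (f : List A → N₁) (g g' : List A → N₂) :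
    𝒜.conv β k f (g + g') = 𝒜.conv β k f g + 𝒜.conv β k f g' := by
  funext l; simp [conv, splitSum_add]

theorem conv_sub_right (β : N₁ →ₗ[R] N₂ →ₗ[R] N) (k : ZMod 2) (f : List A → N₁) (g g' : List A → N₂) :
    𝒜.conv β k f (g - g') = 𝒜.conv β k f g - 𝒜.conv β k f g' := by
  funext l; simp [conv, splitSum_sub]

theorem conv_zsmul_right (β : N₁ →ₗ[R] N₂ →ₗ[R] N) (k : ZMod 2) (s : ℤ) (f : List A → N₁)
    (g : List A → N₂) : 𝒜.conv β k f (s • g) = s • 𝒜.conv β k f g := by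
  funext l; simp [conv, splitSum_zsmul]

theorem conv_smul_right (β : N₁ →ₗ[R] N₂ →ₗ[R] N) (k : ZMod 2) (s : R) (f : List A → N₁)
    (g : List A → N₂) : 𝒜.conv β k f (s • g) = s • 𝒜.conv β k f g := by
  funext l; simp [conv, splitSum_smul]

theorem circ_add_left (e : ZMod 2) (f f' : List A → N) (g : List A → A) :
    𝒜.circ e (f + f') g = 𝒜.circ e f g + 𝒜.circ e f' g := by
  funext l; simp [circ, splitSum₃_add]

theorem circ_sub_left (e : ZMod 2) (f f' : List A → N) (g : List A → A) :
    𝒜.circ e (f - f') g = 𝒜.circ e f g - 𝒜.circ e f' g := by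
  funext l; simp [circ, splitSum₃_sub]

theorem circ_zsmul_left (e : ZMod 2) (s : ℤ) (f : List A → N) (g : List A → A) :
    𝒜.circ e (s • f) g = s • 𝒜.circ e f g := by
  funext l; simp [circ, splitSum₃_zsmul]

theorem circ_smul_left (e : ZMod 2) (s : R) (f : List A → N) (g : List A → A) :
    𝒜.circ e (s • f) g = s • 𝒜.circ e f g := by
  funext l; simp [circ, splitSum₃_smul]

theorem circ_comp_left (e : ZMod 2) (φ : N →ₗ[R] N₁) (f : List A → N) (g : List A → A) (l : List A) :
    𝒜.circ e (fun l => φ (f l)) g l = φ (𝒜.circ e f g l) := by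
  simp [circ, map_splitSum₃]

theorem circ_add_right (e : ZMod 2) {f : List A → N} (hf : MLin R f) (g g' : List A → A) :
    𝒜.circ e f (g + g') = 𝒜.circ e f g + 𝒜.circ e f g' := by
  funext l; simp [circ, splitSum₃_add, hf.add]

theorem circ_sub_right (e : ZMod 2) {f : List A → N} (hf : MLin R f) (g g' : List A → A) :
    𝒜.circ e f (g - g') = 𝒜.circ e f g - 𝒜.circ e f g' := by
  funext l; simp [circ, splitSum₃_sub, hf.sub]

theorem circ_zsmul_right (e : ZMod 2) (s : ℤ) {f : List A → N} (hf : MLin R f) (g : List A → A) :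
    𝒜.circ e f (s • g) = s • 𝒜.circ e f g := by
  funext l; simp [circ, splitSum₃_zsmul, hf.zsmul]

theorem circ_smul_right (e : ZMod 2) (s : R) {f : List A → N} (hf : MLin R f) (g : List A → A) :
    𝒜.circ e f (s • g) = s • 𝒜.circ e f g := by
  funext l; simp [circ, splitSum₃_smul, hf.smul]

theorem hD_add (ℬ : DGBimod 𝒜 N) (c : ZMod 2) (f g : List A → N) :
    hD ℬ c (f + g) = hD ℬ c f + hD ℬ c g := by
  funext l
  simp only [hD, circ_add_left, conv_add_left, conv_add_right, Pi.add_apply, map_add, smul_add]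
  abel

theorem hD_zsmul (ℬ : DGBimod 𝒜 N) (c : ZMod 2) (s : ℤ) (f : List A → N) :
    hD ℬ c (s • f) = s • hD ℬ c f := by
  funext l
  simp only [hD, circ_zsmul_left, conv_zsmul_left, conv_zsmul_right, Pi.smul_apply, map_zsmul,
    smul_add, smul_sub, smul_comm s (sg c)]

theorem hD_smul (ℬ : DGBimod 𝒜 N) (c : ZMod 2) (s : R) (f : List A → N) :
    hD ℬ c (s • f) = s • hD ℬ c f := by
  funext l
  simp only [hD, circ_smul_left, conv_smul_left, conv_smul_right, Pi.smul_apply, map_smul,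
    smul_add, smul_sub, smul_comm s (sg c)]

theorem hD_sub (ℬ : DGBimod 𝒜 N) (c : ZMod 2) (f g : List A → N) :
    hD ℬ c (f - g) = hD ℬ c f - hD ℬ c g := by
  funext l
  simp only [hD, circ_sub_left, conv_sub_left, conv_sub_right, Pi.sub_apply, map_sub, smul_sub]
  abel

end DGAlg

section Split

variable {α : Type u} {N : Type v} [AddCommMonoid N]

theorem splitSum₃_splitSum_left (F : List α → List α → List α → List α → N) (l : List α) :
    splitSum₃ (fun u v t => splitSum (fun p q => F p q v t) u) l =
      splitSum (fun p y => splitSum₃ (fun q v t => F p q v t) y) l := by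
  simp only [splitSum₃]
  exact (splitSum_congr fun u y _ => splitSum_comm (fun v t p q => F p q v t) y u).trans
    (splitSum_assoc (fun p q y => splitSum (fun v t => F p q v t) y) l)

theorem splitSum₃_splitSum_right (F : List α → List α → List α → List α → N) (l : List α) :
    splitSum₃ (fun u v t => splitSum (fun p q => F u v p q) t) l =
      splitSum (fun y q => splitSum₃ (fun u v p => F u v p q) y) l := by
  simp only [splitSum₃]
  rw [splitSum_assoc]
  exact splitSum_congr fun u y _ => by rw [splitSum_assoc]

theorem splitSum₃_splitSum_comm {β : Type*} (F : List α → List α → List α → List β → List β → N)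
    (l : List α) (l' : List β) :
    splitSum₃ (fun a b c => splitSum (fun u v => F a b c u v) l') l =
      splitSum (fun u v => splitSum₃ (fun a b c => F a b c u v) l) l' := by
  simp only [splitSum₃]
  rw [splitSum_comm (fun u v a y => splitSum (fun b c => F a b c u v) y)]
  exact splitSum_congr fun a y _ => splitSum_comm (fun b c u v => F a b c u v) y l'

theorem splitSum₃_comm {β : Type*}
    (F : List α → List α → List α → List β → List β → List β → N)
    (l : List α) (l' : List β) :
    splitSum₃ (fun a b c => splitSum₃ (fun u v w => F a b c u v w) l') l =
      splitSum₃ (fun u v w => splitSum₃ (fun a b c => F a b c u v w) l) l' := by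
  simp only [splitSum₃.eq_1 _ l']
  rw [splitSum₃_splitSum_comm (fun a b c u y => splitSum (fun v w => F a b c u v w) y)]
  exact splitSum_congr fun u y _ => splitSum₃_splitSum_comm (fun a b c v w => F a b c u v w) l y

theorem splitSum₅_add (F G : List α → List α → List α → List α → List α → N) (l : List α) :
    splitSum₅ (fun u v p q r => F u v p q r + G u v p q r) l = splitSum₅ F l + splitSum₅ G l := by
  simp only [splitSum₅, splitSum₃_add]

theorem splitSum₅_zsmul {N : Type v} [AddCommGroup N] (k : ℤ)
    (F : List α → List α → List α → List α → List α → N) (l : List α) :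
    splitSum₅ (fun u v p q r => k • F u v p q r) l = k • splitSum₅ F l := by
  simp only [splitSum₅, splitSum₃_zsmul]

theorem splitSum₅_map {β : Type*} (φ : β → α)
    (F : List α → List α → List α → List α → List α → N) (l : List β) :
    splitSum₅ F (l.map φ) = splitSum₅ (fun u v p q r =>
      F (u.map φ) (v.map φ) (p.map φ) (q.map φ) (r.map φ)) l := by
  simp only [splitSum₅, splitSum₃_map]

theorem map_splitSum₅ {N' G : Type*} [AddCommMonoid N'] [FunLike G N N'] [AddMonoidHomClass G N N']
    (φ : G) (F : List α → List α → List α → List α → List α → N) (l : List α) :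
    φ (splitSum₅ F l) = splitSum₅ (fun u v p q r => φ (F u v p q r)) l := by
  simp only [splitSum₅, map_splitSum₃]

theorem splitSum₅_append_cons (F : List α → List α → List α → List α → List α → N)
    (l₁ l₂ : List α) (x : α) :
    splitSum₅ F (l₁ ++ x :: l₂) =
      splitSum₅ (fun u v p q r => F u v p q (r ++ x :: l₂)) l₁
      + splitSum₃ (fun u v y => splitSum (fun p q => splitSum (fun q' r =>
          F u v p (q ++ x :: q') r) l₂) y) l₁
      + splitSum₃ (fun u v p => splitSum₃ (fun p' q r => F u v (p ++ x :: p') q r) l₂) l₁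
      + splitSum (fun u v => splitSum (fun v' y => splitSum₃ (fun p q r =>
          F u (v ++ x :: v') p q r) y) l₂) l₁
      + splitSum₅ (fun u v p q r => F (l₁ ++ x :: u) v p q r) l₂ := by
  simp only [splitSum₅, splitSum₃_append_cons, splitSum₃_add]

section Scalars

variable {N : Type v} [AddCommGroup N] (k : ℤ)

theorem splitSum_zsmul_fun (F : List α → List α → N) :
    splitSum (fun u v => k • F u v) = k • splitSum F := funext fun l => splitSum_zsmul k F l

theorem splitSum₅_zsmul_pi (F : List α → List α → List α → List α → List α → N) (l : List α) :
    splitSum₅ (fun u v p q => k • F u v p q) l = k • splitSum₅ F l := splitSum₅_zsmul k F l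

end Scalars

section Nested

variable {F₆ : List α → List α → List α → List α → List α → List α → N}
  {F₇ : List α → List α → List α → List α → List α → List α → List α → N} {l : List α}

theorem splitSum₅_first : splitSum₅ (fun u v p q r => splitSum (fun a b => F₆ a b v p q r) u) l =
    splitSum (fun a y => splitSum₅ (fun b v p q r => F₆ a b v p q r) y) l := by
  simp only [splitSum₅]
  refine (splitSum₃_congr fun u v y _ => splitSum₃_splitSum_comm
    (fun p q r a b => F₆ a b v p q r) y u).trans ?_
  exact splitSum₃_splitSum_left (fun a b v y => splitSum₃ (fun p q r => F₆ a b v p q r) y) l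

theorem splitSum₅_third : splitSum₅ (fun u v p q r => splitSum (fun a b => F₆ u v a b q r) p) l =
    splitSum (fun x y => splitSum₃ (fun u v a => splitSum₃ (fun b q r => F₆ u v a b q r) y) x) l := by
  simp only [splitSum₅]
  refine (splitSum₃_congr fun u v y _ => splitSum₃_splitSum_left
    (fun a b q r => F₆ u v a b q r) y).trans ?_
  exact splitSum₃_splitSum_right (fun u v a y => splitSum₃ (fun b q r => F₆ u v a b q r) y) l

theorem splitSum₅_last : splitSum₅ (fun u v p q r => splitSum (fun a b => F₆ u v p q a b) r) l =
    splitSum (fun y b => splitSum₅ (fun u v p q a => F₆ u v p q a b) y) l := by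
  simp only [splitSum₅]
  refine (splitSum₃_congr fun u v y _ => splitSum₃_splitSum_right
    (fun p q a b => F₆ u v p q a b) y).trans ?_
  exact splitSum₃_splitSum_right (fun u v y b => splitSum₃ (fun p q a => F₆ u v p q a b) y) l

theorem splitSum₅_splitSum₃_first :
    splitSum₅ (fun u v p q r => splitSum₃ (fun a b c => F₇ a b c v p q r) u) l =
    splitSum₃ (fun a b y => splitSum₅ (fun c v p q r => F₇ a b c v p q r) y) l := by
  simp only [splitSum₅]
  refine (splitSum₃_congr fun u v y _ => splitSum₃_comm
    (fun p q r a b c => F₇ a b c v p q r) y u).trans ?_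
  exact splitSum₃_left (fun a b c v y => splitSum₃ (fun p q r => F₇ a b c v p q r) y) l

theorem splitSum₅_splitSum₃_third :
    splitSum₅ (fun u v p q r => splitSum₃ (fun a b c => F₇ u v a b c q r) p) l =
    splitSum₃ (fun x b y => splitSum₃ (fun u v a => splitSum₃ (fun c q r =>
      F₇ u v a b c q r) y) x) l := by
  refine (splitSum₃_congr fun u v y _ => splitSum₃_left
    (fun a b c q r => F₇ u v a b c q r) y).trans ?_
  exact (splitSum₃_left (fun u v a b y => splitSum₃ (fun c q r => F₇ u v a b c q r) y) l).symm

theorem splitSum₅_splitSum₃_last :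
    splitSum₅ (fun u v p q r => splitSum₃ (fun a b c => F₇ u v p q a b c) r) l =
    splitSum₃ (fun x b c => splitSum₅ (fun u v p q a => F₇ u v p q a b c) x) l := by
  refine (splitSum₃_congr fun u v y _ => (splitSum₃_left
    (fun p q a b c => F₇ u v p q a b c) y).symm.trans rfl).trans ?_
  exact (splitSum₃_left (fun u v y b c => splitSum₃ (fun p q a => F₇ u v p q a b c) y) l).symm

end Nested

end Split

namespace DGAlg

variable {R : Type v} {A : Type u} [CommRing R] [AddCommGroup A] [Module R A] {𝒜 : DGAlg R A}

variable {N N₁ N₂ N₃ N₁₂ N₂₃ : Type*} [AddCommGroup N] [Module R N]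
  [AddCommGroup N₁] [Module R N₁] [AddCommGroup N₂] [Module R N₂] [AddCommGroup N₃] [Module R N₃]
  [AddCommGroup N₁₂] [Module R N₁₂] [AddCommGroup N₂₃] [Module R N₂₃]

theorem _root_.MLin.zsmul₂ {f : List A → N} (hf : MLin R f) (u p r : List A) (x : A) (k : ℤ) (a : A) :
    f (u ++ x :: (p ++ (k • a) :: r)) = k • f (u ++ x :: (p ++ a :: r)) := by
  simpa using hf.zsmul (u ++ x :: p) r k a

theorem _root_.MLin.lin_apply₂ {f : List A → N} (hf : MLin R f) (u p r : List A) (x a : A) :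
    hf.lin (u ++ x :: p) r a = f (u ++ x :: (p ++ a :: r)) := by
  simp [hf.lin_apply]

theorem splitSum_lapply (F : List A → List A → N₁ →ₗ[R] N) (l : List A) (y : N₁) :
    splitSum F l y = splitSum (fun u v => F u v y) l :=
  map_splitSum (LinearMap.applyₗ (R := R) y) F l

theorem splitSum₃_lapply (F : List A → List A → List A → N₁ →ₗ[R] N) (l : List A) (y : N₁) :
    splitSum₃ F l y = splitSum₃ (fun u v t => F u v t y) l :=
  map_splitSum₃ (LinearMap.applyₗ (R := R) y) F l

theorem splitSum_twl (k : ZMod 2) (F : List A → List A → N) (l : List A) :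
    splitSum F (𝒜.twl k l) = splitSum (fun u v => F (𝒜.twl k u) (𝒜.twl k v)) l :=
  splitSum_map _ _ _

theorem splitSum₃_twl (k : ZMod 2) (F : List A → List A → List A → N) (l : List A) :
    splitSum₃ F (𝒜.twl k l) = splitSum₃ (fun u v t => F (𝒜.twl k u) (𝒜.twl k v) (𝒜.twl k t)) l :=
  splitSum₃_map _ _ _

theorem splitSum₅_lapply (F : List A → List A → List A → List A → List A → N₁ →ₗ[R] N) (l : List A)
    (y : N₁) : splitSum₅ F l y = splitSum₅ (fun u v p q r => F u v p q r y) l :=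
  map_splitSum₅ (LinearMap.applyₗ (R := R) y) F l

theorem splitSum₅_twl (k : ZMod 2) (F : List A → List A → List A → List A → List A → N) (l : List A) :
    splitSum₅ F (𝒜.twl k l) = splitSum₅ (fun u v p q r => F (𝒜.twl k u) (𝒜.twl k v) (𝒜.twl k p)
      (𝒜.twl k q) (𝒜.twl k r)) l :=
  splitSum₅_map _ _ _

theorem conv_assoc (β₁ : N₁ →ₗ[R] N₂ →ₗ[R] N₁₂) (β₂ : N₁₂ →ₗ[R] N₃ →ₗ[R] N)
    (β₃ : N₂ →ₗ[R] N₃ →ₗ[R] N₂₃) (β₄ : N₁ →ₗ[R] N₂₃ →ₗ[R] N)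
    (h : ∀ x y z, β₂ (β₁ x y) z = β₄ x (β₃ y z)) (k k' : ZMod 2) (f₁ : List A → N₁)
    (f₂ : List A → N₂) (f₃ : List A → N₃) :
    𝒜.conv β₂ k' (𝒜.conv β₁ k f₁ f₂) f₃ = 𝒜.conv β₄ (k + k') f₁ (𝒜.conv β₃ k' f₂ f₃) := by
  funext l
  simp only [conv, map_splitSum, splitSum_lapply, splitSum_twl, twl_twl, h]
  rw [splitSum_assoc]

theorem conv_circ (β : N₁ →ₗ[R] N₂ →ₗ[R] N) (k e : ZMod 2) {f : List A → N₁} (hf : MLin R f)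
    (g : List A → N₂) {h : List A → A} (hh : 𝒜.Par e h) :
    𝒜.circ e (𝒜.conv β k f g) h =
      sg (k * e) • 𝒜.conv β k (𝒜.circ e f h) g + 𝒜.conv β (k + e) f (𝒜.circ e g h) := by
  funext l
  simp only [conv, circ, Pi.add_apply, Pi.smul_apply, splitSum_append_cons, splitSum₃_add,
    splitSum_twl, twl_twl, twl_append, twl_cons, hh.twz, hf.zsmul, map_zsmul, splitSum_zsmul,
    splitSum₃_zsmul, LinearMap.smul_apply, map_splitSum₃, splitSum₃_lapply, splitSum₃_twl]
  rw [splitSum₃_splitSum_left, splitSum₃_splitSum_right, add_comm, add_comm e k]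

theorem circ_circ (e e' : ZMod 2) {f : List A → N} (hf : MLin R f) (g : List A → A) {h : List A → A}
    (hh : 𝒜.Par e' h) :
    𝒜.circ e' (𝒜.circ e f g) h = 𝒜.circ (e + e') f (𝒜.circ e' g h) + 𝒜.brace e e' f g h
      + sg (e * e') • 𝒜.brace e' e f h g := by
  funext l
  have h1 : 𝒜.circ (e + e') f (𝒜.circ e' g h) l = splitSum₃ (fun u v t =>
      splitSum₃ (fun p q r => f (𝒜.twl (e + e') u ++ g (𝒜.twl e' p ++ h q :: r) :: t)) v) l :=
    splitSum₃_congr fun u v t _ => by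
      rw [← hf.lin_apply, circ, map_splitSum₃]; rfl
  simp only [Pi.add_apply, h1]
  simp only [circ, brace, Pi.smul_apply, splitSum₃_append_cons, splitSum₃_add,
    splitSum₃_twl, splitSum_twl, twl_twl, twl_append, twl_cons, hh.twz, List.append_assoc,
    List.cons_append, hf.zsmul, splitSum₃_zsmul]
  rw [splitSum₃_left, splitSum₃_mid]
  rw [splitSum₃_left_right (fun u v p q r => f (𝒜.twl (e + e') u ++ g (𝒜.twl e' v ++ h p :: q) :: r)),
    add_comm e' e, add_comm (splitSum₅ _ l)]
  rfl

theorem brace_conv (β : N₁ →ₗ[R] N₂ →ₗ[R] N) (k e e' : ZMod 2) {f : List A → N₁} (hf : MLin R f)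
    (g : List A → N₂) {x y : List A → A} (hx : 𝒜.Par e x) (hy : 𝒜.Par e' y) :
    𝒜.brace e e' (𝒜.conv β k f g) x y =
      sg (k * (e + e')) • 𝒜.conv β k (𝒜.brace e e' f x y) g
      + sg (k * e) • 𝒜.conv β (k + e') (𝒜.circ e f x) (𝒜.circ e' g y)
      + 𝒜.conv β (k + (e + e')) f (𝒜.brace e e' g x y) := by
  funext l
  simp only [conv, circ, brace, Pi.add_apply, Pi.smul_apply, splitSum_append_cons, splitSum₅_add,
    splitSum_twl, twl_twl, twl_append, twl_cons, hx.twz, hy.twz, hf.zsmul, map_zsmul, splitSum_zsmul,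
    splitSum₅_zsmul, LinearMap.smul_apply, map_splitSum₃, splitSum₃_lapply,
    splitSum₃_twl, splitSum₅_twl, map_splitSum₅, splitSum₅_lapply]
  rw [splitSum₅_first, splitSum₅_third]
  simp only [hf.zsmul₂, map_zsmul, LinearMap.smul_apply, splitSum_zsmul_fun, splitSum₅_zsmul_pi]
  rw [splitSum₅_last (F₆ := fun u v p q a b => β (f (𝒜.twl (k + (e + e')) u ++
    x (𝒜.twl (k + e') v) :: (𝒜.twl (k + e') p ++ y (𝒜.twl k q) :: 𝒜.twl k a))) (g b))]
  simp only [sg_smul_smul]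
  have hc : splitSum (fun u v => splitSum₃ (fun u' v' t' => splitSum₃ (fun a b c =>
      β (f (𝒜.twl (k + (e + e')) a ++ x (𝒜.twl (k + e') b) :: 𝒜.twl (k + e') c))
        (g (𝒜.twl e' u' ++ y v' :: t'))) u) v) l =
      splitSum (fun u v => splitSum₃ (fun a b c => splitSum₃ (fun u' v' t' =>
      β (f (𝒜.twl (k + (e + e')) a ++ x (𝒜.twl (k + e') b) :: 𝒜.twl (k + e') c))
        (g (𝒜.twl e' u' ++ y v' :: t'))) v) u) l :=
    splitSum_congr fun u v _ => splitSum₃_comm _ v u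
  simp only [add_comm (e + e') k, add_comm e' k, add_left_comm e k e', ← mul_add]
  rw [hc]
  abel

theorem brace_circ (e e' : ZMod 2) {f : List A → N} (hf : MLin R f) {g h k : List A → A}
    (hg : MLin R g) (hpg : 𝒜.Par e g) (hph : 𝒜.Par e' h) (hk : 𝒜.Par 1 k) :
    𝒜.circ 1 (𝒜.brace e e' f g h) k
        - sg (e + e') • 𝒜.brace e e' (𝒜.circ 1 f k) g h =
      sg e' • 𝒜.brace (e + 1) e' f (𝒜.circ 1 g k) h + 𝒜.brace e (e' + 1) f g (𝒜.circ 1 h k)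
      - sg (e + e') • (𝒜.brace (e + 1) e' f (𝒜.circ e k g) h
        + sg e • 𝒜.brace e (e' + 1) f g (𝒜.circ e' k h)
        + 𝒜.circ (e + e' + 1) f (𝒜.brace e e' k g h)) := by
  funext l
  simp only [Pi.add_apply, Pi.sub_apply, Pi.smul_apply]
  have hL : 𝒜.circ 1 (𝒜.brace e e' f g h) k l =
      splitSum₃ (fun x b c => splitSum₅ (fun u v p q a => f (𝒜.twl (e + e' + 1) u ++
        g (𝒜.twl (e' + 1) v) :: (𝒜.twl (e' + 1) p ++ h (𝒜.twl 1 q) :: (𝒜.twl 1 a ++ k b :: c)))) x) l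
      + 𝒜.brace e (e' + 1) f g (𝒜.circ 1 h k) l
      + sg e' • splitSum₃ (fun x b y => splitSum₃ (fun u v a => splitSum₃ (fun c q r =>
        f (𝒜.twl (e + e' + 1) u ++ g (𝒜.twl (e' + 1) v) :: (𝒜.twl (e' + 1) a ++
          k (𝒜.twl e' b) :: (𝒜.twl e' c ++ h q :: r)))) y) x) l
      + sg e' • 𝒜.brace (e + 1) e' f (𝒜.circ 1 g k) h l
      + sg (e + e') • splitSum₃ (fun a b y => splitSum₅ (fun c v p q r =>
        f (𝒜.twl (e + e' + 1) a ++ k (𝒜.twl (e + e') b) :: (𝒜.twl (e + e') c ++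
          g (𝒜.twl e' v) :: (𝒜.twl e' p ++ h q :: r)))) y) l := by
    have h1 : 𝒜.brace e (e' + 1) f g (𝒜.circ 1 h k) l = splitSum₃ (fun a b c => splitSum₃ (fun u v x =>
        splitSum (fun p q => splitSum (fun q' r => f (𝒜.twl (e + e' + 1) u ++
          g (𝒜.twl (e' + 1) v) :: (𝒜.twl (e' + 1) p ++ h (𝒜.twl 1 q ++ k b :: q') :: r))) c) x) a) l := by
      rw [splitSum₃_left (fun u v x b c => splitSum (fun p q => splitSum (fun q' r => f (𝒜.twl (e + e' + 1) u ++
          g (𝒜.twl (e' + 1) v) :: (𝒜.twl (e' + 1) p ++ h (𝒜.twl 1 q ++ k b :: q') :: r))) c) x)]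
      refine splitSum₃_congr fun u v y _ => ?_
      rw [splitSum₃_left_right (fun p q b q' r => f (𝒜.twl (e + e' + 1) u ++
          g (𝒜.twl (e' + 1) v) :: (𝒜.twl (e' + 1) p ++ h (𝒜.twl 1 q ++ k b :: q') :: r))),
        ← splitSum₃_mid]
      refine splitSum₃_congr fun p x r _ => ?_
      beta_reduce
      rw [← hf.lin_apply₂, circ, map_splitSum₃, add_assoc]
      simp only [hf.lin_apply₂]
    have h2 : 𝒜.brace (e + 1) e' f (𝒜.circ 1 g k) h l = splitSum₃ (fun x b y => splitSum (fun u v =>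
        splitSum (fun v' z => splitSum₃ (fun p q r => f (𝒜.twl (e + e' + 1) u ++
          g (𝒜.twl (e' + 1) v ++ k (𝒜.twl e' b) :: 𝒜.twl e' v') :: (𝒜.twl e' p ++ h q :: r))) z) y) x) l := by
      rw [splitSum₃_left_right (fun u v b v' z => splitSum₃ (fun p q r => f (𝒜.twl (e + e' + 1) u ++
          g (𝒜.twl (e' + 1) v ++ k (𝒜.twl e' b) :: 𝒜.twl e' v') :: (𝒜.twl e' p ++ h q :: r))) z),
        ← splitSum₃_mid]
      refine splitSum₃_congr fun u x y _ => ?_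
      rw [splitSum₃_comm]
      refine splitSum₃_congr fun p q r _ => ?_
      simp only [circ, ← hf.lin_apply, map_splitSum₃, splitSum₃_twl, twl_twl, add_right_comm e 1 e',
        add_comm 1 e']
    rw [h1, h2]
    simp only [circ, brace, splitSum₅_append_cons, splitSum₃_add,
      splitSum_twl, splitSum₃_twl, splitSum₅_twl, twl_twl, twl_append, twl_cons, hk.twz,
      List.append_assoc, List.cons_append, _root_.mul_one, hf.zsmul, hf.zsmul₂, hg.zsmul, splitSum₃_zsmul, splitSum_zsmul, splitSum₅_zsmul]
  have hR : 𝒜.brace e e' (𝒜.circ 1 f k) g h l =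
      splitSum₃ (fun a b y => splitSum₅ (fun c v p q r =>
        f (𝒜.twl (e + e' + 1) a ++ k (𝒜.twl (e + e') b) :: (𝒜.twl (e + e') c ++
          g (𝒜.twl e' v) :: (𝒜.twl e' p ++ h q :: r)))) y) l
      + (𝒜.brace (e + 1) e' f (𝒜.circ e k g) h l
        + 𝒜.circ (e + e' + 1) f (𝒜.brace e e' k g h) l)
      + (sg e • splitSum₃ (fun x b y => splitSum₃ (fun u v a => splitSum₃ (fun c q r =>
        f (𝒜.twl (e + e' + 1) u ++ g (𝒜.twl (e' + 1) v) :: (𝒜.twl (e' + 1) a ++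
          k (𝒜.twl e' b) :: (𝒜.twl e' c ++ h q :: r)))) y) x) l
      + sg e • 𝒜.brace e (e' + 1) f g (𝒜.circ e' k h) l
      + sg (e + e') • splitSum₃ (fun x b c => splitSum₅ (fun u v p q a => f (𝒜.twl (e + e' + 1) u ++
        g (𝒜.twl (e' + 1) v) :: (𝒜.twl (e' + 1) p ++ h (𝒜.twl 1 q) :: (𝒜.twl 1 a ++ k b :: c)))) x) l) := by
    have h1 : 𝒜.brace (e + 1) e' f (𝒜.circ e k g) h l = splitSum₅ (fun u v p q r => splitSum (fun a b =>
        splitSum (fun c z => f (𝒜.twl (e + e' + 1) a ++ k (𝒜.twl (e + e') b ++ g (𝒜.twl e' v) ::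
          𝒜.twl e' c) :: (𝒜.twl e' z ++ h q :: r))) p) u) l := by
      trans splitSum₃ (fun u v y => splitSum (fun a b => splitSum (fun c z => splitSum₃ (fun p q r =>
        f (𝒜.twl (e + e' + 1) a ++ k (𝒜.twl (e + e') b ++ g (𝒜.twl e' v) ::
          𝒜.twl e' c) :: (𝒜.twl e' p ++ h q :: r))) z) y) u) l
      · rw [splitSum₃_left_right (fun a b v c z => splitSum₃ (fun p q r =>
          f (𝒜.twl (e + e' + 1) a ++ k (𝒜.twl (e + e') b ++ g (𝒜.twl e' v) ::
          𝒜.twl e' c) :: (𝒜.twl e' p ++ h q :: r))) z), ← splitSum₃_mid]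
        refine splitSum₃_congr fun u x y _ => ?_
        rw [splitSum₃_comm]
        refine splitSum₃_congr fun p q r _ => ?_
        simp only [circ, ← hf.lin_apply, map_splitSum₃, splitSum₃_twl, twl_twl, add_right_comm e 1 e']
      · refine splitSum₃_congr fun u v y _ => ?_
        rw [splitSum₃_splitSum_comm]
        refine splitSum_congr fun a b _ => (splitSum₃_splitSum_left (fun c z q r =>
          f (𝒜.twl (e + e' + 1) a ++ k (𝒜.twl (e + e') b ++ g (𝒜.twl e' v) ::
          𝒜.twl e' c) :: (𝒜.twl e' z ++ h q :: r))) y).symm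
    have h2 : 𝒜.circ (e + e' + 1) f (𝒜.brace e e' k g h) l = splitSum₅ (fun u v p q r =>
        splitSum (fun a b => splitSum (fun c z => f (𝒜.twl (e + e' + 1) a ++
          k (𝒜.twl (e + e') b ++ g (𝒜.twl e' v) :: (𝒜.twl e' p ++ h q :: c)) :: z)) r) u) l := by
      trans splitSum₃ (fun u v y => splitSum (fun a b => splitSum (fun x z => splitSum₃ (fun p q c =>
        f (𝒜.twl (e + e' + 1) a ++ k (𝒜.twl (e + e') b ++ g (𝒜.twl e' v) ::
          (𝒜.twl e' p ++ h q :: c)) :: z)) x) y) u) l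
      · rw [splitSum₃_left_right (fun a b v x z => splitSum₃ (fun p q c =>
        f (𝒜.twl (e + e' + 1) a ++ k (𝒜.twl (e + e') b ++ g (𝒜.twl e' v) ::
          (𝒜.twl e' p ++ h q :: c)) :: z)) x), ← splitSum₃_mid]
        refine splitSum₃_congr fun u x y _ => ?_
        rw [← hf.lin_apply, brace, map_splitSum₅]; rfl
      · refine splitSum₃_congr fun u v y _ => ?_
        rw [splitSum₃_splitSum_comm]
        refine splitSum_congr fun a b _ => (splitSum₃_splitSum_right (fun p q c z =>
          f (𝒜.twl (e + e' + 1) a ++ k (𝒜.twl (e + e') b ++ g (𝒜.twl e' v) ::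
          (𝒜.twl e' p ++ h q :: c)) :: z)) y).symm
    have h3 : 𝒜.brace e (e' + 1) f g (𝒜.circ e' k h) l = splitSum₅ (fun u v p q r =>
        splitSum (fun a b => splitSum (fun c z => f (𝒜.twl (e + e' + 1) u ++ g (𝒜.twl (e' + 1) v) ::
          (𝒜.twl (e' + 1) a ++ k (𝒜.twl e' b ++ h q :: c) :: z))) r) p) l := by
      refine splitSum₃_congr fun u v y _ => ?_
      rw [splitSum₃_left_right (fun a b q c z => f (𝒜.twl (e + e' + 1) u ++ g (𝒜.twl (e' + 1) v) ::
          (𝒜.twl (e' + 1) a ++ k (𝒜.twl e' b ++ h q :: c) :: z))), ← splitSum₃_mid]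
      refine splitSum₃_congr fun a x z _ => ?_
      beta_reduce
      rw [← hf.lin_apply₂, circ, map_splitSum₃, add_assoc]
      simp only [hf.lin_apply₂]
    rw [h1, h2, h3, ← splitSum₅_splitSum₃_first, ← splitSum₅_splitSum₃_third,
      ← splitSum₅_splitSum₃_last]
    simp only [circ, brace, splitSum₃_append_cons, splitSum_append_cons, splitSum₅_add, splitSum_add,
      splitSum_twl, splitSum₃_twl, twl_twl, twl_append, twl_cons, hpg.twz,
      hph.twz, List.append_assoc, List.cons_append, _root_.one_mul, hf.zsmul, hf.zsmul₂, splitSum₃_zsmul, splitSum_zsmul, splitSum₅_zsmul, add_comm 1 (e + e'), add_comm 1 e',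
      sg_smul_smul]
  rw [hL, hR]
  rcases zmod_two_cases e with rfl | rfl <;> rcases zmod_two_cases e' with rfl | rfl <;>
    simp only [sg_zero, sg_one, add_zero, zero_add, CharTwo.add_self_eq_zero, one_smul, neg_smul] <;> abel

end DGAlg

namespace DGAlg

variable {R : Type v} {A : Type u} [CommRing R] [AddCommGroup A] [Module R A] {𝒜 : DGAlg R A}

variable {N : Type*} [AddCommGroup N] [Module R N]

theorem par_id1 : 𝒜.Par 0 id1 := fun l => by
  match l with
  | [] => simp
  | [a] => simp
  | a :: b :: l => simp

theorem d_one : 𝒜.d 𝒜.one = 0 := by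
  have h := 𝒜.d_mul 𝒜.one 𝒜.one
  rw [𝒜.mul_one, 𝒜.mul_one, 𝒜.tw_one, map_neg, LinearMap.neg_apply, 𝒜.one_mul] at h
  simpa using h

theorem par_mm : 𝒜.Par 1 𝒜.mm := fun l => by
  simp only [mm, map_sub, conv, map_splitSum, 𝒜.tw_mul, splitSum_neg, splitSum_twl]
  have h : ∀ u, 𝒜.tw (id1 u) = id1 (𝒜.twl 1 u) := fun u => by simpa using par_id1 (𝒜 := 𝒜) u
  have h' : 𝒜.tw (𝒜.d (id1 l)) = -𝒜.d (id1 (𝒜.twl 1 l)) := by rw [← h, 𝒜.d_tw, neg_neg]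
  simp only [h, h', sg_one, neg_smul, one_smul, neg_sub]
  abel

theorem circ_id1 (e : ZMod 2) (g : List A → A) : 𝒜.circ e id1 g = g := by
  funext l
  rw [circ, splitSum₃, splitSum_of_left_nil, splitSum_of_right_nil]
  · simp
  · intro u a v; simp
  · intro a u v
    refine splitSum_eq_zero fun p q _ => ?_
    cases u <;> simp

theorem brace_id1 (e e' : ZMod 2) (g h : List A → A) : 𝒜.brace e e' id1 g h = 0 := by
  funext l
  refine splitSum₅_eq_zero fun u v p q r _ => ?_
  rcases u with _ | ⟨a, u⟩
  · cases p <;> simp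
  · cases u <;> simp

theorem circ_mm {e : ZMod 2} {f : List A → A} (hf : 𝒜.Par e f) :
    𝒜.circ e 𝒜.mm f = (fun l => 𝒜.d (f l)) - sg e • 𝒜.conv 𝒜.mul 1 f id1
      - 𝒜.conv 𝒜.mul (1 + e) id1 f := by
  have h : 𝒜.mm = (fun l => 𝒜.d (id1 l)) - 𝒜.conv 𝒜.mul 1 id1 id1 := rfl
  rw [h, circ_sub_left, conv_circ _ _ _ mlin_id1 _ hf, circ_id1, _root_.one_mul]
  funext l
  simp only [Pi.sub_apply, Pi.add_apply, circ_comp_left, circ_id1]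
  abel

theorem hD_selfBimod {e : ZMod 2} {f : List A → A} (hf : 𝒜.Par e f) :
    hD 𝒜.selfBimod (e + 1) f = 𝒜.circ e 𝒜.mm f - sg e • 𝒜.circ 1 f 𝒜.mm := by
  rw [circ_mm hf]
  funext l
  simp only [hD, selfBimod, Pi.sub_apply, Pi.smul_apply, sg_add, sg_one, neg_mul,
    _root_.one_mul, neg_smul, add_comm e 1]
  abel

theorem brace_comp (e e' : ZMod 2) {N' : Type*} [AddCommGroup N'] [Module R N'] (φ : N →ₗ[R] N')
    (f : List A → N) (g h : List A → A) :
    𝒜.brace e e' (fun l => φ (f l)) g h = fun l => φ (𝒜.brace e e' f g h l) := by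
  funext l; simp [brace, map_splitSum₅]

theorem brace_sub_left (e e' : ZMod 2) (f f' : List A → N) (g h : List A → A) :
    𝒜.brace e e' (f - f') g h = 𝒜.brace e e' f g h - 𝒜.brace e e' f' g h := by
  funext l
  have : -f' = fun l => (-LinearMap.id : N →ₗ[R] N) (f' l) := rfl
  rw [sub_eq_add_neg, sub_eq_add_neg]
  have h2 : -𝒜.brace e e' f' g h = 𝒜.brace e e' (-f') g h := by rw [this, brace_comp]; rfl
  rw [h2]; simp [brace, splitSum₅_add]

theorem brace_zsmul_left (e e' : ZMod 2) (s : ℤ) (f : List A → N) (g h : List A → A) :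
    𝒜.brace e e' (s • f) g h = s • 𝒜.brace e e' f g h := by
  funext l; simp [brace, splitSum₅_zsmul]

theorem brace_zsmul_mid (e e' : ZMod 2) (s : ℤ) {f : List A → N} (hf : MLin R f) (g h : List A → A) :
    𝒜.brace e e' f (s • g) h = s • 𝒜.brace e e' f g h := by
  funext l; simp [brace, splitSum₅_zsmul, hf.zsmul]

theorem brace_zsmul_right (e e' : ZMod 2) (s : ℤ) {f : List A → N} (hf : MLin R f)
    (g h : List A → A) : 𝒜.brace e e' f g (s • h) = s • 𝒜.brace e e' f g h := by
  funext l; simp [brace, splitSum₅_zsmul, hf.zsmul₂]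

theorem conv_zero_left {N₁ N₂ : Type*} [AddCommGroup N₁] [Module R N₁] [AddCommGroup N₂]
    [Module R N₂] (β : N₁ →ₗ[R] N₂ →ₗ[R] N) (k : ZMod 2) (g : List A → N₂) :
    𝒜.conv β k 0 g = 0 := by funext l; simp [conv]

theorem conv_zero_right {N₁ N₂ : Type*} [AddCommGroup N₁] [Module R N₁] [AddCommGroup N₂]
    [Module R N₂] (β : N₁ →ₗ[R] N₂ →ₗ[R] N) (k : ZMod 2) (f : List A → N₁) :
    𝒜.conv β k f 0 = 0 := by funext l; simp [conv]

theorem brace_mm {e e' : ZMod 2} {f g : List A → A} (hf : 𝒜.Par e f) (hg : 𝒜.Par e' g) :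
    𝒜.brace e e' 𝒜.mm f g = -(sg e • 𝒜.conv 𝒜.mul (1 + e') f g) := by
  have h : 𝒜.mm = (fun l => 𝒜.d (id1 l)) - 𝒜.conv 𝒜.mul 1 id1 id1 := rfl
  rw [h, brace_sub_left, brace_comp, brace_conv _ _ _ _ mlin_id1 _ hf hg, circ_id1, circ_id1,
    brace_id1, conv_zero_left, conv_zero_right, _root_.one_mul]
  funext l
  simp

/-- The Hochschild differential is a derivation of the product. -/
theorem hD_conv (ℬ : DGBimod 𝒜 N) {c : ZMod 2} (c' : ZMod 2) {f : List A → A} (hf : MLin R f)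
    (hpf : 𝒜.Par (c + 1) f) (g : List A → N) :
    hD ℬ (c + c') (𝒜.conv ℬ.lm c' f g) =
      𝒜.conv ℬ.lm c' (hD 𝒜.selfBimod c f) g + sg c • 𝒜.conv ℬ.lm (c' + 1) f (hD ℬ c' g) := by
  have e1 : hD 𝒜.selfBimod c f = (fun l => 𝒜.d (f l)) + sg c • 𝒜.circ 1 f 𝒜.mm
      - 𝒜.conv 𝒜.mul c id1 f + sg c • 𝒜.conv 𝒜.mul 1 f id1 := rfl
  have e2 : hD ℬ c' g = (fun l => ℬ.d (g l)) + sg c' • 𝒜.circ 1 g 𝒜.mm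
      - 𝒜.conv ℬ.lm c' id1 g + sg c' • 𝒜.conv ℬ.rm 1 g id1 := rfl
  have e3 : hD ℬ (c + c') (𝒜.conv ℬ.lm c' f g) = (fun l => ℬ.d (𝒜.conv ℬ.lm c' f g l))
      + sg (c + c') • 𝒜.circ 1 (𝒜.conv ℬ.lm c' f g) 𝒜.mm
      - 𝒜.conv ℬ.lm (c + c') id1 (𝒜.conv ℬ.lm c' f g)
      + sg (c + c') • 𝒜.conv ℬ.rm 1 (𝒜.conv ℬ.lm c' f g) id1 := rfl
  have e4 : (fun l => ℬ.d (𝒜.conv ℬ.lm c' f g l)) = 𝒜.conv ℬ.lm c' (fun l => 𝒜.d (f l)) g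
      + sg c • 𝒜.conv ℬ.lm (c' + 1) f (fun l => ℬ.d (g l)) := by
    funext l
    simp only [conv, map_splitSum, Pi.add_apply, Pi.smul_apply, ← splitSum_zsmul, ← splitSum_add]
    refine splitSum_congr fun u v _ => ?_
    rw [ℬ.d_lm, hpf, twl_twl, map_zsmul, LinearMap.smul_apply, sg_add, add_comm 1 c']
    simp [sub_eq_add_neg]
  rw [e1, e2, e3, e4, conv_circ _ _ _ hf _ par_mm, conv_add_left, conv_sub_left, conv_add_left,
    conv_zsmul_left, conv_zsmul_left, conv_add_right, conv_sub_right, conv_add_right,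
    conv_zsmul_right, conv_zsmul_right,
    conv_assoc 𝒜.mul ℬ.lm ℬ.lm ℬ.lm ℬ.mul_lm, conv_assoc 𝒜.mul ℬ.lm ℬ.lm ℬ.lm ℬ.mul_lm,
    conv_assoc ℬ.lm ℬ.rm ℬ.rm ℬ.lm ℬ.lm_rm, _root_.mul_one, add_comm 1 c']
  simp only [smul_add, smul_sub, sg_smul_smul]
  rcases zmod_two_cases c with rfl | rfl <;> rcases zmod_two_cases c' with rfl | rfl <;>
    simp only [sg_zero, sg_one, add_zero, zero_add, CharTwo.add_self_eq_zero, one_smul, neg_smul] <;>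
    abel

theorem hD_circ {e e' : ZMod 2} {f g : List A → A} (hf : MLin R f)
    (hpf : 𝒜.Par e f) (hpg : 𝒜.Par e' g) (hpfg : 𝒜.Par (e + e') (𝒜.circ e' f g)) :
    hD 𝒜.selfBimod (e + e' + 1) (𝒜.circ e' f g) =
      𝒜.circ e' (hD 𝒜.selfBimod (e + 1) f) g
      + sg e • 𝒜.circ (e' + 1) f (hD 𝒜.selfBimod (e' + 1) g)
      + sg e • 𝒜.conv 𝒜.mul (1 + e') f g + sg (e * e' + e') • 𝒜.conv 𝒜.mul (1 + e) g f := by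
  rw [hD_selfBimod hpfg, hD_selfBimod hpf, hD_selfBimod hpg, circ_sub_left, circ_zsmul_left,
    circ_sub_right _ hf, circ_zsmul_right _ _ hf, circ_circ e e' mlin_mm f hpg,
    circ_circ 1 e' hf _ hpg, circ_circ e' 1 hf _ par_mm, brace_mm hpf hpg, brace_mm hpg hpf]
  simp only [smul_add, smul_sub, smul_neg, sg_smul_smul]
  rcases zmod_two_cases e with rfl | rfl <;> rcases zmod_two_cases e' with rfl | rfl <;>
    simp only [sg_zero, sg_one, add_zero, zero_add, CharTwo.add_self_eq_zero, one_smul, neg_smul,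
      mul_zero, _root_.mul_one] <;>
    abel

/-- The homotopy for the compatibility of the composition product with the cup product. -/
theorem hD_brace {e e₁ e₂ : ZMod 2} {f g h : List A → A} (hf : MLin R f) (hg : MLin R g)
    (hpf : 𝒜.Par e f) (hpg : 𝒜.Par e₁ g) (hph : 𝒜.Par e₂ h)
    (hpb : 𝒜.Par (e + e₁ + e₂) (𝒜.brace e₁ e₂ f g h))
    (hDf : hD 𝒜.selfBimod (e + 1) f = 0) (hDg : hD 𝒜.selfBimod (e₁ + 1) g = 0)
    (hDh : hD 𝒜.selfBimod (e₂ + 1) h = 0) :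
    hD 𝒜.selfBimod (e + e₁ + e₂ + 1) (𝒜.brace e₁ e₂ f g h) =
      sg (e + e₁) • 𝒜.conv 𝒜.mul (1 + e₂) (𝒜.circ e₁ f g) h
      + sg ((1 + e) * e₁) • 𝒜.conv 𝒜.mul (1 + e + e₂) g (𝒜.circ e₂ f h)
      - sg (e + e₁) • 𝒜.circ (e₁ + e₂ + 1) f (𝒜.conv 𝒜.mul (1 + e₂) g h) := by
  have hbc := brace_circ e₁ e₂ hf hg hpg hph par_mm
  rw [hD_selfBimod hpf, sub_eq_zero] at hDf
  rw [hD_selfBimod hpg, sub_eq_zero] at hDg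
  rw [hD_selfBimod hph, sub_eq_zero] at hDh
  have h1 : 𝒜.brace e₁ e₂ (𝒜.circ e 𝒜.mm f) g h = sg e • 𝒜.brace e₁ e₂ (𝒜.circ 1 f 𝒜.mm) g h := by
    rw [hDf, brace_zsmul_left]
  rw [circ_mm hpf, brace_sub_left, brace_sub_left, brace_zsmul_left, brace_comp,
    brace_conv _ _ _ _ hf _ hpg hph, brace_conv _ _ _ _ mlin_id1 _ hpg hph, circ_id1, circ_id1,
    brace_id1, conv_zero_left, conv_zero_right] at h1
  rw [hDg, hDh, brace_mm hpg hph, brace_zsmul_mid _ _ _ hf, brace_zsmul_right _ _ _ hf,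
    ← neg_smul, circ_zsmul_right _ _ hf, sub_eq_iff_eq_add] at hbc
  have h2 := sub_eq_iff_eq_add.1 (sub_eq_iff_eq_add.1 h1)
  rw [hD_selfBimod hpb, circ_mm hpb, hbc, h2]
  simp only [smul_add, smul_sub, smul_neg, sg_smul_smul, smul_zero, zero_add, add_zero, neg_smul,
    add_comm (1 + e) (e₁ + e₂), add_comm (1 + e) e₂]
  rcases zmod_two_cases e with rfl | rfl <;> rcases zmod_two_cases e₁ with rfl | rfl <;>
    rcases zmod_two_cases e₂ with rfl | rfl <;>
    simp only [sg_zero, sg_one, add_zero, zero_add, CharTwo.add_self_eq_zero, one_smul, neg_smul,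
      mul_zero, _root_.mul_one, neg_neg] <;>
    abel

variable (𝒜) in
/-- The Gerstenhaber bracket of cochains of degrees `e + 1` and `e' + 1`. -/
def br (e e' : ZMod 2) (f g : List A → A) : List A → A :=
  𝒜.circ e' f g - sg (e * e') • 𝒜.circ e g f

theorem hD_br {e e' : ZMod 2} {f g : List A → A} (hf : MLin R f) (hg : MLin R g)
    (hpf : 𝒜.Par e f) (hpg : 𝒜.Par e' g) (hpfg : 𝒜.Par (e + e') (𝒜.circ e' f g))
    (hpgf : 𝒜.Par (e' + e) (𝒜.circ e g f)) :
    hD 𝒜.selfBimod (e + e' + 1) (𝒜.br e e' f g) =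
      𝒜.br (e + 1) e' (hD 𝒜.selfBimod (e + 1) f) g
      + sg e • 𝒜.br e (e' + 1) f (hD 𝒜.selfBimod (e' + 1) g) := by
  have h2 := hD_circ hg hpg hpf hpgf
  rw [add_comm e' e] at h2
  rw [br, hD_sub, hD_zsmul, hD_circ hf hpf hpg hpfg, h2, br, br]
  simp only [smul_add, smul_sub, sg_smul_smul]
  rcases zmod_two_cases e with rfl | rfl <;> rcases zmod_two_cases e' with rfl | rfl <;>
    simp only [sg_zero, sg_one, add_zero, zero_add, CharTwo.add_self_eq_zero, one_smul, neg_smul,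
      mul_zero, _root_.mul_one] <;>
    abel

theorem br_skew (e e' : ZMod 2) (f g : List A → A) :
    𝒜.br e e' f g = -(sg (e * e') • 𝒜.br e' e g f) := by
  rw [br, br, smul_sub, mul_comm e' e, sg_smul_sg_smul]; abel

theorem br_jacobi {e e' e'' : ZMod 2} {f g h : List A → A} (hf : MLin R f) (hg : MLin R g)
    (hh : MLin R h) (hpf : 𝒜.Par e f) (hpg : 𝒜.Par e' g) (hph : 𝒜.Par e'' h) :
    𝒜.br (e + e') e'' (𝒜.br e e' f g) h = 𝒜.br e (e' + e'') f (𝒜.br e' e'' g h)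
      - sg (e * e') • 𝒜.br e' (e + e'') g (𝒜.br e e'' f h) := by
  simp only [br, circ_sub_left, circ_zsmul_left, circ_sub_right _ hf, circ_sub_right _ hg,
    circ_sub_right _ hh, circ_zsmul_right _ _ hf, circ_zsmul_right _ _ hg, circ_zsmul_right _ _ hh,
    circ_circ e' e'' hf g hph, circ_circ e e'' hg f hph, circ_circ e'' e hg h hpf,
    circ_circ e' e hh g hpf, circ_circ e'' e' hf h hpg, circ_circ e e' hh f hpg]
  simp only [smul_add, smul_sub, sg_smul_smul]
  rcases zmod_two_cases e with rfl | rfl <;> rcases zmod_two_cases e' with rfl | rfl <;>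
    rcases zmod_two_cases e'' with rfl | rfl <;>
    simp only [sg_zero, sg_one, add_zero, zero_add, CharTwo.add_self_eq_zero, one_smul, neg_smul,
      mul_zero, _root_.mul_one] <;>
    abel

end DGAlg

namespace DGAlg

variable {R : Type v} {A : Type u} [CommRing R] [AddCommGroup A] [Module R A] (𝒜 : DGAlg R A)

variable {N : Type*} [AddCommGroup N] [Module R N]

/-- Normalized functions on words vanish if a letter is the unit. -/
def Norm (f : List A → N) : Prop := ∀ u v, f (u ++ 𝒜.one :: v) = 0

variable {𝒜}

theorem Norm.twz {f : List A → N} (h : 𝒜.Norm f) (hf : MLin R f) (k : ZMod 2) (u v : List A) :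
    f (u ++ 𝒜.twz k 𝒜.one :: v) = 0 := by
  rw [twz_oneA, hf.zsmul, h, smul_zero]

theorem Norm.twl {f : List A → N} (h : 𝒜.Norm f) (hf : MLin R f) (k : ZMod 2) :
    𝒜.Norm (fun l => f (𝒜.twl k l)) := fun u v => by
  simp only [twl_append, twl_cons]; exact h.twz hf k _ _

theorem Norm.add {f g : List A → N} (hf : 𝒜.Norm f) (hg : 𝒜.Norm g) : 𝒜.Norm (f + g) :=
  fun u v => by simp [hf u v, hg u v]

theorem Norm.sub {f g : List A → N} (hf : 𝒜.Norm f) (hg : 𝒜.Norm g) : 𝒜.Norm (f - g) :=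
  fun u v => by simp [hf u v, hg u v]

theorem Norm.zsmul {f : List A → N} (s : ℤ) (hf : 𝒜.Norm f) : 𝒜.Norm (s • f) :=
  fun u v => by simp [hf u v]

theorem norm_conv {N₁ N₂ : Type*} [AddCommGroup N₁] [Module R N₁] [AddCommGroup N₂]
    [Module R N₂] (β : N₁ →ₗ[R] N₂ →ₗ[R] N) (k : ZMod 2) {f : List A → N₁} {g : List A → N₂}
    (hf : MLin R f) (hnf : 𝒜.Norm f) (hng : 𝒜.Norm g) : 𝒜.Norm (𝒜.conv β k f g) := fun u v => by
  simp only [conv, splitSum_append_cons, (hnf.twl hf k) _ _, hng _ _, map_zero,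
    LinearMap.zero_apply, splitSum_zero, add_zero]

theorem norm_circ (e : ZMod 2) {f : List A → N} {g : List A → A}
    (hf : MLin R f) (hnf : 𝒜.Norm f) (hng : 𝒜.Norm g) :
    𝒜.Norm (𝒜.circ e f g) := fun u v => by
  have h1 : ∀ p x q, f (p ++ x :: (q ++ 𝒜.one :: v)) = 0 := fun p x q => by
    simpa using hnf (p ++ x :: q) v
  simp only [circ, splitSum₃_append_cons, hng _ _, hf.zero, splitSum_zero, h1, twl_append, twl_cons,
    List.append_assoc, List.cons_append, hnf.twz hf e]
  simp [splitSum₃]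

theorem norm_brace (e e' : ZMod 2) {f : List A → N} {g h : List A → A}
    (hf : MLin R f) (hnf : 𝒜.Norm f) (hng : 𝒜.Norm g) (hg : MLin R g) (hnh : 𝒜.Norm h) :
    𝒜.Norm (𝒜.brace e e' f g h) := fun u v => by
  have h1 : ∀ p x q y r, f (p ++ x :: (q ++ y :: (r ++ 𝒜.one :: v))) = 0 := fun p x q y r => by
    simpa using hnf (p ++ x :: (q ++ y :: r)) v
  have h2 : ∀ k p x q r, f (p ++ x :: (q ++ 𝒜.twz k 𝒜.one :: r)) = 0 := fun k p x q r => by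
    simpa using hnf.twz hf k (p ++ x :: q) r
  have h3 : ∀ p x q r, f (p ++ x :: (q ++ 0 :: r)) = 0 := fun p x q r => by
    simpa using hf.zero (p ++ x :: q) r
  simp only [brace, splitSum₅_append_cons, hng.twz hg, hnh _ _, hf.zero, splitSum_zero, h1, h2, h3,
    twl_append, twl_cons, List.append_assoc, List.cons_append, hnf.twz hf]
  simp [splitSum₅, splitSum₃]

theorem mm_append_one (q r : List A) :
    𝒜.mm (q ++ 𝒜.one :: r) = (if q = [] then id1 r else 0) - if r = [] then id1 (𝒜.twl 1 q) else 0 := by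
  match q, r with
  | [], [] => simp [mm, conv, splitSum_cons, d_one]
  | [], [a] => simp [mm, conv, splitSum_cons, 𝒜.tw_one, 𝒜.one_mul]
  | [], a :: b :: r =>
    simp only [mm, conv, splitSum_cons, List.nil_append]
    rw [splitSum_eq_zero]
    · simp
    · intro u v h
      cases u <;> simp
  | [a], [] => simp [mm, conv, splitSum_cons, 𝒜.mul_one]
  | [a], b :: r =>
    simp only [mm, conv, splitSum_cons, List.cons_append, List.nil_append]
    rw [splitSum_eq_zero]
    · simp
    · intro u v h
      simp
  | a :: b :: q, r =>
    have : id1 (𝒜.twl 1 (a :: b :: q)) = 0 := rfl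
    simp only [mm, conv, splitSum_cons, List.cons_append, this]
    rw [splitSum_eq_zero]
    · cases q <;> simp
    · intro u v h
      simp

theorem circ_mm_one {f : List A → N} (hf : MLin R f) (hnf : 𝒜.Norm f) (u v : List A) :
    𝒜.circ 1 f 𝒜.mm (u ++ 𝒜.one :: v) = (if v = [] then 0 else f (𝒜.twl 1 u ++ v))
      - if u = [] then 0 else f (𝒜.twl 1 u ++ v) := by
  have h1 : ∀ p x q, f (p ++ x :: (q ++ 𝒜.one :: v)) = 0 := fun p x q => by
    simpa using hnf (p ++ x :: q) v
  simp only [circ, splitSum₃_append_cons, h1, twl_append, twl_cons,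
    List.append_assoc, List.cons_append, hnf.twz hf, mm_append_one, hf.sub, splitSum_sub]
  have hz : ∀ w, f (0 :: w) = 0 := hf.zero []
  have hz' : ∀ w x y, f (w ++ x :: 0 :: y) = 0 := fun w x y => by simpa using hf.zero (w ++ [x]) y
  rw [splitSum_of_right_nil (F := fun p q => splitSum (fun v' t =>
      f (𝒜.twl 1 p ++ (if q = [] then id1 v' else 0) :: t)) v),
    splitSum_comm (fun p q v' t => f (𝒜.twl 1 p ++ (if v' = [] then id1 (𝒜.twl 1 q) else 0) :: t)),
    splitSum_of_left_nil (F := fun v' t => splitSum (fun p q =>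
      f (𝒜.twl 1 p ++ (if v' = [] then id1 (𝒜.twl 1 q) else 0) :: t)) u)]
  · have hv : splitSum (fun v' t => f (𝒜.twl 1 u ++ (if ([] : List A) = [] then id1 v' else 0) :: t)) v =
        if v = [] then 0 else f (𝒜.twl 1 u ++ v) := by
      rcases v with _ | ⟨a, v⟩
      · simp [hf.zero]
      · rw [splitSum_cons, splitSum_of_left_nil]
        · simp [hf.zero]
        · intro a u v; simp [hf.zero]
    have hu : splitSum (fun p q => f (𝒜.twl 1 p ++ (if ([] : List A) = [] then id1 (𝒜.twl 1 q) else 0) :: v)) u =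
        if u = [] then 0 else f (𝒜.twl 1 u ++ v) := by
      rcases List.eq_nil_or_concat u with rfl | ⟨u, a, rfl⟩
      · simp [hz]
      · rw [List.concat_eq_append, splitSum_concat, splitSum_of_right_nil]
        · simp [hz']
        · intro u a v; cases v <;> simp [hf.zero]
    rw [hv, hu]
    simp [splitSum₃]
  · intro a p q; simp [hf.zero]
  · intro p a q; simp [hf.zero]

theorem norm_hD (ℬ : DGBimod 𝒜 N) (c : ZMod 2) {f : List A → N} (hf : MLin R f)
    (hnf : 𝒜.Norm f) : 𝒜.Norm (hD ℬ c f) := fun u v => by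
  have h1 : 𝒜.conv ℬ.lm c id1 f (u ++ 𝒜.one :: v) = if u = [] then sg c • f v else 0 := by
    simp only [conv, splitSum_append_cons, hnf _ _, map_zero, splitSum_zero, zero_add]
    rw [splitSum_of_left_nil]
    · rcases u with _ | ⟨a, u⟩
      · simp [twz_oneA, ℬ.one_lm]
      · cases u <;> simp
    · intro a p q
      rcases u with _ | ⟨b, u⟩
      · simp
      · cases u <;> simp
  have h2 : 𝒜.conv ℬ.rm 1 f id1 (u ++ 𝒜.one :: v) = if v = [] then f (𝒜.twl 1 u) else 0 := by
    simp only [conv, splitSum_append_cons, (hnf.twl hf 1) _ _, map_zero, LinearMap.zero_apply,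
      splitSum_zero, add_zero]
    rw [splitSum_of_right_nil]
    · rcases v with _ | ⟨a, v⟩
      · simp [ℬ.rm_one]
      · cases v <;> simp
    · intro p a q
      cases q <;> simp
  rw [hD, hnf, map_zero, circ_mm_one hf hnf, h1, h2]
  rcases u with _ | ⟨a, u⟩ <;> rcases v with _ | ⟨b, v⟩ <;> simp

end DGAlg

namespace DGAlg

variable {R : Type v} {A : Type u} [CommRing R] [AddCommGroup A] [Module R A] (𝒜 : DGAlg R A)

variable {N : Type*} [AddCommGroup N] [Module R N]

/-- The linear dual as a bimodule. -/
def dualBimod : DGBimod 𝒜 (A →ₗ[R] R) where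
  lm := LinearMap.mk₂ R (fun a φ => -(φ ∘ₗ 𝒜.mul.flip (𝒜.tw a)))
    (fun a b φ => by ext; simp; ring) (fun s a φ => by ext; simp)
    (fun a φ ψ => by ext; simp; ring) (fun s a φ => by ext; simp)
  rm := LinearMap.mk₂ R (fun φ a => φ ∘ₗ 𝒜.mul a)
    (fun a b φ => by ext; simp) (fun s a φ => by ext; simp)
    (fun a φ ψ => by ext; simp) (fun s a φ => by ext; simp)
  d := LinearMap.lcomp R R (𝒜.tw ∘ₗ 𝒜.d)
  sgn := -LinearMap.lcomp R R 𝒜.tw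
  mul_lm a b φ := by ext x; simp [𝒜.tw_mul, 𝒜.mul_assoc]
  lm_rm a φ b := by ext x; simp [𝒜.mul_assoc]
  rm_mul φ a b := by ext x; simp [𝒜.mul_assoc]
  one_lm φ := by ext x; simp [𝒜.tw_one, 𝒜.mul_one]
  rm_one φ := by ext x; simp [𝒜.one_mul]
  d_lm a φ := by
    ext x
    simp [𝒜.d_mul, 𝒜.tw_mul, 𝒜.tw_tw]
  d_rm φ a := by
    ext x
    simp [𝒜.d_mul, 𝒜.tw_mul, 𝒜.tw_tw]

theorem dual_lm (a : A) (φ : A →ₗ[R] R) (x : A) :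
    𝒜.dualBimod.lm a φ x = -φ (𝒜.mul x (𝒜.tw a)) := rfl

theorem dual_rm (φ : A →ₗ[R] R) (a x : A) : 𝒜.dualBimod.rm φ a x = φ (𝒜.mul a x) := rfl

theorem dual_d (φ : A →ₗ[R] R) (x : A) : 𝒜.dualBimod.d φ x = φ (𝒜.tw (𝒜.d x)) := rfl

/-- The cochain `F` with values in the dual has degree `c` modulo `2`. -/
def ParD (c : ZMod 2) (F : List A → A →ₗ[R] R) : Prop :=
  ∀ l a, F (𝒜.twl 1 l) (𝒜.tw a) = sg (c + 1) • F l a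

/-- The dual of the Connes boundary on cochains of degree `c` with values in the dual. -/
def connes (c : ZMod 2) (F : List A → A →ₗ[R] R) (hF : MLin R F) : List A → A →ₗ[R] R := fun l =>
  sg (c + 1) • splitSum (fun u v => LinearMap.applyₗ 𝒜.one ∘ₗ hF.lin (𝒜.twl 1 v) (𝒜.twl c u)) l

variable {𝒜}

theorem connes_apply (c : ZMod 2) (F : List A → A →ₗ[R] R) (hF : MLin R F) (l : List A) (a : A) :
    𝒜.connes c F hF l a =
      sg (c + 1) • splitSum (fun u v => F (𝒜.twl 1 v ++ a :: 𝒜.twl c u) 𝒜.one) l := by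
  simp only [connes, LinearMap.smul_apply, splitSum_lapply]
  rfl

theorem id1_twl (k : ZMod 2) (l : List A) : id1 (𝒜.twl k l) = 𝒜.twz k (id1 l) := by
  match l with
  | [] => simp
  | [a] => simp
  | a :: b :: l => simp

theorem mm_append_cons (q r : List A) (a : A) :
    𝒜.mm (q ++ a :: r) = (if q = [] ∧ r = [] then 𝒜.d a else 0)
      - (if q = [] then 𝒜.mul (𝒜.tw a) (id1 r) else 0)
      - if r = [] then 𝒜.mul (𝒜.tw (id1 q)) a else 0 := by
  have h : 𝒜.conv 𝒜.mul 1 id1 id1 (q ++ a :: r) = (if q = [] then 𝒜.mul (𝒜.tw a) (id1 r) else 0)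
      + if r = [] then 𝒜.mul (𝒜.tw (id1 q)) a else 0 := by
    simp only [conv, splitSum_append_cons, id1_twl, twz_one]
    rw [splitSum_of_right_nil, splitSum_of_left_nil, add_comm]
    · congr 1
      · rcases q with _ | ⟨b, _ | ⟨b', q⟩⟩ <;> simp
      · rcases r with _ | ⟨b, r⟩ <;> simp
    · intro b u v
      rcases q with _ | ⟨b', _ | ⟨b'', q⟩⟩ <;> simp
    · intro u b v
      rcases v with _ | ⟨b', v⟩ <;> simp
  have h' : 𝒜.d (id1 (q ++ a :: r)) = if q = [] ∧ r = [] then 𝒜.d a else 0 := by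
    rcases q with _ | ⟨b, _ | ⟨b', q⟩⟩ <;> rcases r with _ | ⟨b'', r⟩ <;> simp
  rw [mm, h, h']
  abel

theorem circ_splitSum (e : ZMod 2) (F : List A → List A → N) (g : List A → A) (l : List A) :
    𝒜.circ e (splitSum F) g l = splitSum (fun u v => 𝒜.circ e (fun w => F w v) g u) l
      + splitSum (fun u v => 𝒜.circ e (fun w => F (𝒜.twl e u) w) g v) l := by
  simp only [circ, splitSum_append_cons, splitSum₃_add, splitSum_twl]
  rw [splitSum₃_splitSum_left, splitSum₃_splitSum_right, add_comm]

/-- The composition of a function on words with `mm`, near a given letter. -/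
theorem circ_mm_append_cons {f : List A → N} (hf : MLin R f) (u v : List A) (a : A) :
    𝒜.circ 1 f 𝒜.mm (u ++ a :: v) = 𝒜.circ 1 (fun w => f (w ++ a :: v)) 𝒜.mm u
      + f (𝒜.twl 1 u ++ 𝒜.d a :: v)
      - splitSum (fun p q => f (𝒜.twl 1 u ++ 𝒜.mul (𝒜.tw a) (id1 p) :: q)) v
      - splitSum (fun p q => f (𝒜.twl 1 p ++ 𝒜.mul (𝒜.tw (id1 q)) a :: v)) u
      + 𝒜.circ 1 (fun w => f (𝒜.twl 1 u ++ 𝒜.tw a :: w)) 𝒜.mm v := by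
  have h1 : splitSum (fun p q => splitSum (fun q' t => f (𝒜.twl 1 p ++
      (if q = [] ∧ q' = [] then 𝒜.d a else 0) :: t)) v) u = f (𝒜.twl 1 u ++ 𝒜.d a :: v) := by
    rw [splitSum_of_right_nil (F := fun p q => splitSum (fun q' t => f (𝒜.twl 1 p ++
      (if q = [] ∧ q' = [] then 𝒜.d a else 0) :: t)) v), splitSum_of_left_nil]
    · simp
    · intro b p q; simp [hf.zero]
    · intro p b q; simp [hf.zero]
  have h2 : splitSum (fun p q => splitSum (fun q' t => f (𝒜.twl 1 p ++
      (if q = [] then 𝒜.mul (𝒜.tw a) (id1 q') else 0) :: t)) v) u =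
      splitSum (fun p q => f (𝒜.twl 1 u ++ 𝒜.mul (𝒜.tw a) (id1 p) :: q)) v := by
    rw [splitSum_of_right_nil (F := fun p q => splitSum (fun q' t => f (𝒜.twl 1 p ++
      (if q = [] then 𝒜.mul (𝒜.tw a) (id1 q') else 0) :: t)) v)]
    · simp
    · intro p b q; simp [hf.zero]
  have h3 : splitSum (fun p q => splitSum (fun q' t => f (𝒜.twl 1 p ++
      (if q' = [] then 𝒜.mul (𝒜.tw (id1 q)) a else 0) :: t)) v) u =
      splitSum (fun p q => f (𝒜.twl 1 p ++ 𝒜.mul (𝒜.tw (id1 q)) a :: v)) u := by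
    rw [splitSum_comm (fun p q q' t => f (𝒜.twl 1 p ++
      (if q' = [] then 𝒜.mul (𝒜.tw (id1 q)) a else 0) :: t)),
      splitSum_of_left_nil (F := fun q' t => splitSum (fun p q => f (𝒜.twl 1 p ++
      (if q' = [] then 𝒜.mul (𝒜.tw (id1 q)) a else 0) :: t)) u)]
    · simp
    · intro b p q; simp [hf.zero]
  simp only [circ, splitSum₃_append_cons, mm_append_cons, hf.sub, splitSum_sub, h1, h2, h3,
    List.append_assoc, List.cons_append, twl_append, twl_cons, twz_one]
  abel

section Connes

variable {c : ZMod 2} {F : List A → A →ₗ[R] R}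

theorem ParD.one (h : 𝒜.ParD c F) (l : List A) : F (𝒜.twl 1 l) 𝒜.one = sg c • F l 𝒜.one := by
  have h := h l 𝒜.one
  rw [𝒜.tw_one, map_neg, neg_eq_iff_eq_neg, ← neg_smul] at h
  rw [h]; congr 1
  simp [sg_add]

theorem ParD.twz (h : 𝒜.ParD c F) (k : ZMod 2) (l : List A) (a : A) :
    F (𝒜.twl k l) (𝒜.twz k a) = sg (k * (c + 1)) • F l a := by
  rcases zmod_two_cases k with rfl | rfl <;> simp [h l a]

theorem connes_ends (hp : 𝒜.ParD c F) (a : A) (l : List A) :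
    splitSum (fun u v => 𝒜.conv 𝒜.dualBimod.lm c id1 F (𝒜.twl 1 v ++ a :: 𝒜.twl (c + 1) u) 𝒜.one) l =
      sg c • splitSum (fun u v =>
        𝒜.conv 𝒜.dualBimod.rm 1 F id1 (𝒜.twl 1 v ++ a :: 𝒜.twl (c + 1) u) 𝒜.one) l := by
  have h1 : ∀ u v : List A, 𝒜.conv 𝒜.dualBimod.lm c id1 F (𝒜.twl 1 v ++ a :: 𝒜.twl (c + 1) u) 𝒜.one =
      -splitSum (fun x y => F (𝒜.twl 1 y ++ a :: 𝒜.twl (c + 1) u) (𝒜.twz c (id1 x))) v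
      - if v = [] then sg (c + 1) • F u a else 0 := by
    intro u v
    simp only [conv, splitSum_append_cons, LinearMap.add_apply, splitSum_lapply, dual_lm,
      𝒜.one_mul, splitSum_twl, id1_twl, splitSum_neg, ← twz_one, twz_twz]
    rw [sub_eq_add_neg]
    congr 1
    · congr 1
      refine splitSum_congr fun x y _ => ?_
      rw [← add_assoc, add_comm (1 + c), ← add_assoc, CharTwo.add_self_eq_zero, zero_add]
    · rw [splitSum_of_left_nil]
      · rcases v with _ | ⟨b, v⟩
        · simp only [twl_nil, List.nil_append, id1_single, if_true]
          rw [add_comm 1 c, hp.twz]; rcases zmod_two_cases c with rfl | rfl <;>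
            simp [CharTwo.add_self_eq_zero]
        · cases v <;> simp
      · intro b x y
        rcases v with _ | ⟨b', v⟩
        · simp
        · cases v <;> simp
  have h2 : ∀ u v : List A, 𝒜.conv 𝒜.dualBimod.rm 1 F id1 (𝒜.twl 1 v ++ a :: 𝒜.twl (c + 1) u) 𝒜.one =
      splitSum (fun x y => F (v ++ 𝒜.tw a :: 𝒜.twl c x) (𝒜.twz (c + 1) (id1 y))) u
      + if u = [] then F v a else 0 := by
    intro u v
    simp only [conv, splitSum_append_cons, LinearMap.add_apply, splitSum_lapply, dual_rm,
      𝒜.mul_one, splitSum_twl, id1_twl, twl_twl, twl_append, twl_cons, twz_one,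
      CharTwo.add_self_eq_zero, twl_zero, add_comm c 1, ← add_assoc, zero_add]
    rw [add_comm]
    congr 1
    rw [splitSum_of_right_nil]
    · rcases u with _ | ⟨b, u⟩ <;> simp
    · intro x b y
      cases y <;> simp
  simp only [h1, h2, splitSum_add, splitSum_sub, splitSum_neg]
  have h3 : ∀ φ : List A → R, splitSum (fun u v => if v = [] then φ u else 0) l = φ l := fun φ => by
    rw [splitSum_of_right_nil] <;> simp
  have h4 : ∀ φ : List A → R, splitSum (fun u v => if u = [] then φ v else 0) l = φ l := fun φ => by
    rw [splitSum_of_left_nil] <;> simp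
  rw [h3, h4, splitSum_assoc, smul_add, ← splitSum_zsmul]
  simp only [← splitSum_zsmul]
  rw [sub_eq_add_neg, ← splitSum_neg]
  simp only [← splitSum_neg]
  congr 1
  · refine splitSum_congr fun u y _ => splitSum_congr fun x v _ => ?_
    have := hp.twz 1 (𝒜.twl 1 v ++ a :: 𝒜.twl (c + 1) u) (𝒜.twz c (id1 x))
    simp only [twl_append, twl_twl, twl_cons, twz_twz, CharTwo.add_self_eq_zero, twl_zero,
      add_comm c 1, ← add_assoc, zero_add, twz_one, _root_.one_mul] at this
    rw [add_comm c 1, this, sg_smul_smul, add_comm 1 c]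
    simp [CharTwo.add_self_eq_zero, ← add_assoc]
  · simp [sg_add]

theorem mlin_connes (hF : MLin R F) : MLin R (𝒜.connes c F hF) :=
  MLin.fzsmul _ <| MLin.splitSum
    (fun v => MLin.of_lin fun p q => ⟨LinearMap.mk₂ R (fun b a => F (𝒜.twl 1 v ++ a ::
        𝒜.twl c (p ++ b :: q)) 𝒜.one)
      (fun b b' a => by
        simpa using congrArg (· 𝒜.one) ((mlin_twl (hF.prepend (𝒜.twl 1 v ++ [a])) c).add p q b b'))
      (fun s b a => by
        simpa using congrArg (· 𝒜.one) ((mlin_twl (hF.prepend (𝒜.twl 1 v ++ [a])) c).smul p q s b))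
      (fun b a a' => by simp [hF.add]) (fun s b a => by simp [hF.smul]), fun _ => by ext; rfl⟩)
    (fun u => MLin.of_lin fun p q => ⟨LinearMap.mk₂ R (fun b a => F (𝒜.twl 1 (p ++ b :: q) ++ a ::
        𝒜.twl c u) 𝒜.one)
      (fun b b' a => by
        simpa using congrArg (· 𝒜.one) ((mlin_twl (hF.append (a :: 𝒜.twl c u)) 1).add p q b b'))
      (fun s b a => by
        simpa using congrArg (· 𝒜.one) ((mlin_twl (hF.append (a :: 𝒜.twl c u)) 1).smul p q s b))
      (fun b a a' => by rw [hF.add]; rfl) (fun s b a => by rw [hF.smul]; rfl), fun _ => by ext; rfl⟩)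

theorem norm_connes (hF : MLin R F) (hn : 𝒜.Norm F) : 𝒜.Norm (𝒜.connes c F hF) := fun u v => by
  ext a
  have h1 : ∀ w x y z, F (w ++ x :: (y ++ 𝒜.twz c 𝒜.one :: z)) = 0 := fun w x y z => by
    simpa using hn.twz hF c (w ++ x :: y) z
  simp only [connes_apply, splitSum_append_cons, twl_append, twl_cons, List.append_assoc,
    List.cons_append, h1, hn.twz hF, LinearMap.zero_apply, splitSum_zero, add_zero, smul_zero]

theorem connes_connes (hF : MLin R F) (hn : 𝒜.Norm F) :
    𝒜.connes (c + 1) (𝒜.connes c F hF) (mlin_connes hF) = 0 := by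
  funext l; ext a
  simp only [connes_apply, Pi.zero_apply, LinearMap.zero_apply]
  rw [splitSum_eq_zero, smul_zero]
  intro u v _
  rw [splitSum_eq_zero, smul_zero]
  intro p q _
  rw [hn]; rfl

/-- The dual of the Connes boundary anticommutes with the Hochschild differential. -/
theorem hD_connes (hF : MLin R F) (hp : 𝒜.ParD c F) :
    hD 𝒜.dualBimod (c + 1) (𝒜.connes c F hF) =
      -𝒜.connes (c + 1) (hD 𝒜.dualBimod c F) (mlin_hD _ _ hF) := by
  funext l; ext a
  set G : List A → R := fun w => F w 𝒜.one with hGdef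
  have hG : MLin R G := hF.comp (LinearMap.applyₗ 𝒜.one)
  have hGp : ∀ w, G w = sg c • G (𝒜.twl 1 w) := fun w => by
    simp only [G, hp.one, sg_smul_sg_smul]
  have hb : ∀ l a, 𝒜.connes c F hF l a =
      sg (c + 1) • splitSum (fun u v => G (𝒜.twl 1 v ++ a :: 𝒜.twl c u)) l := connes_apply c F hF
  have hcc : c + 1 + 1 = c := by rw [add_assoc, CharTwo.add_self_eq_zero, add_zero]
  have t2 : 𝒜.circ 1 (𝒜.connes c F hF) 𝒜.mm l a = sg (c + 1) •
      (splitSum (fun u v => 𝒜.circ 1 (fun w => G (𝒜.twl 1 v ++ a :: 𝒜.twl c w)) 𝒜.mm u) l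
      + splitSum (fun u v => 𝒜.circ 1 (fun w => G (𝒜.twl 1 w ++ a :: 𝒜.twl (c + 1) u)) 𝒜.mm v) l) := by
    have := circ_comp_left (𝒜 := 𝒜) 1 (LinearMap.applyₗ a) (𝒜.connes c F hF) 𝒜.mm l
    rw [LinearMap.applyₗ_apply_apply] at this
    rw [← this]
    simp only [LinearMap.applyₗ_apply_apply, hb]
    have h := circ_zsmul_left (𝒜 := 𝒜) 1 (sg (c + 1))
      (splitSum (fun u v => G (𝒜.twl 1 v ++ a :: 𝒜.twl c u))) 𝒜.mm
    refine (congrFun h l).trans ?_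
    rw [Pi.smul_apply, circ_splitSum]
    simp only [twl_twl]
  have t3 : 𝒜.conv 𝒜.dualBimod.lm (c + 1) id1 (𝒜.connes c F hF) l a = -(sg (c + 1) •
      splitSum (fun x y => splitSum (fun u v => G (𝒜.twl 1 v ++ 𝒜.mul a (𝒜.twz c (id1 x)) ::
        𝒜.twl c u)) y) l) := by
    simp only [conv, splitSum_lapply, dual_lm, hb, splitSum_neg, splitSum_zsmul, id1_twl]
    simp only [← 𝒜.twz_one, twz_twz, add_comm 1 (c + 1), hcc]
  have t4 : 𝒜.conv 𝒜.dualBimod.rm 1 (𝒜.connes c F hF) id1 l a = sg (c + 1) •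
      splitSum (fun x y => splitSum (fun u v => G (v ++ 𝒜.mul (id1 y) a ::
        𝒜.twl (c + 1) u)) x) l := by
    simp only [conv, splitSum_lapply, dual_rm, hb, splitSum_zsmul, splitSum_twl, twl_twl,
      CharTwo.add_self_eq_zero, twl_zero]
  have s1 : ∀ w, hD 𝒜.dualBimod c F w 𝒜.one = sg c • 𝒜.circ 1 G 𝒜.mm w
      - 𝒜.conv 𝒜.dualBimod.lm c id1 F w 𝒜.one + sg c • 𝒜.conv 𝒜.dualBimod.rm 1 F id1 w 𝒜.one := by
    intro w
    have := circ_comp_left (𝒜 := 𝒜) 1 (LinearMap.applyₗ 𝒜.one) F 𝒜.mm w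
    rw [LinearMap.applyₗ_apply_apply] at this
    simp only [hD, LinearMap.add_apply, LinearMap.sub_apply, LinearMap.smul_apply, dual_d, d_one,
      map_zero, zero_add, ← this]
    rfl
  have s2 : splitSum (fun u v => hD 𝒜.dualBimod c F (𝒜.twl 1 v ++ a :: 𝒜.twl (c + 1) u) 𝒜.one) l =
      sg c • splitSum (fun u v => 𝒜.circ 1 G 𝒜.mm (𝒜.twl 1 v ++ a :: 𝒜.twl (c + 1) u)) l := by
    simp only [s1, splitSum_add, splitSum_sub, splitSum_zsmul, connes_ends hp]
    abel
  have g1 : ∀ u v, G (v ++ 𝒜.d a :: 𝒜.twl (c + 1) u) =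
      sg c • G (𝒜.twl 1 v ++ 𝒜.tw (𝒜.d a) :: 𝒜.twl c u) := fun u v => by
    rw [hGp]; simp [twl_twl, add_comm 1 (c + 1), hcc]
  have g2 : ∀ p q v, G (v ++ 𝒜.mul (𝒜.tw a) (𝒜.twz (c + 1) (id1 p)) :: 𝒜.twl (c + 1) q) =
      -(sg c • G (𝒜.twl 1 v ++ 𝒜.mul a (𝒜.twz c (id1 p)) :: 𝒜.twl c q)) := fun p q v => by
    rw [hGp]
    simp only [twl_append, twl_cons, twl_twl, twz_mul, sg_one, twz_one, 𝒜.tw_tw, neg_smul, one_smul,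
      hG.neg, smul_neg, add_comm 1 (c + 1), hcc]
    rw [← 𝒜.twz_one, twz_twz, add_comm 1 (c + 1), hcc]
  have g3 : ∀ u v, 𝒜.circ 1 (fun w => G (w ++ a :: 𝒜.twl (c + 1) u)) 𝒜.mm (𝒜.twl 1 v) =
      -𝒜.circ 1 (fun w => G (𝒜.twl 1 w ++ a :: 𝒜.twl (c + 1) u)) 𝒜.mm v := fun u v => by
    simp only [circ, splitSum₃_twl, ← splitSum₃_neg]
    refine splitSum₃_congr fun x y z _ => ?_
    have := par_mm (𝒜 := 𝒜) y
    simp only [twl_append, twl_cons, twz_one, this, sg_one, neg_smul, one_smul, List.append_assoc,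
      List.cons_append, hG.neg, neg_neg]
  have g4 : ∀ u v, 𝒜.circ 1 (fun w => G (v ++ 𝒜.tw a :: w)) 𝒜.mm (𝒜.twl (c + 1) u) =
      -𝒜.circ 1 (fun w => G (𝒜.twl 1 v ++ a :: 𝒜.twl c w)) 𝒜.mm u := fun u v => by
    simp only [circ, splitSum₃_twl, ← splitSum₃_neg]
    refine splitSum₃_congr fun x y z _ => ?_
    have h := (par_mm (𝒜 := 𝒜)).twz c y
    have h' := (par_mm (𝒜 := 𝒜)).twz (c + 1) y
    have hz : ∀ (k : ℤ) w x y z (b : A), G (w ++ x :: (y ++ (k • b) :: z)) =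
      k • G (w ++ x :: (y ++ b :: z)) := fun k w x y z b => hG.zsmul₂ w y z x k b
    rw [hGp]
    have h'' : 𝒜.mm (𝒜.twl (c + 1) y) = sg (c + 1) • 𝒜.twz (c + 1) (𝒜.mm y) := by
      rw [h', _root_.mul_one, sg_smul_sg_smul]
    simp only [twl_append, twl_cons, twl_twl, twz_one, 𝒜.tw_tw, h'', map_zsmul, hz, add_comm 1 (c + 1), hcc, sg_add]
    rw [← 𝒜.twz_one, twz_twz, add_comm 1 (c + 1), hcc, smul_smul]
    rw [show sg c * (sg c * sg 1) = -1 by rw [← _root_.mul_assoc, sg_mul_self]; rfl, neg_smul, one_smul,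
      add_comm 1 c]
  have s3 : splitSum (fun u v => 𝒜.circ 1 G 𝒜.mm (𝒜.twl 1 v ++ a :: 𝒜.twl (c + 1) u)) l =
      -splitSum (fun u v => 𝒜.circ 1 (fun w => G (𝒜.twl 1 w ++ a :: 𝒜.twl (c + 1) u)) 𝒜.mm v) l
      + sg c • splitSum (fun u v => G (𝒜.twl 1 v ++ 𝒜.tw (𝒜.d a) :: 𝒜.twl c u)) l
      + sg c • splitSum (fun x y => splitSum (fun u v => G (𝒜.twl 1 v ++ 𝒜.mul a (𝒜.twz c (id1 x)) ::
        𝒜.twl c u)) y) l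
      - splitSum (fun x y => splitSum (fun u v => G (v ++ 𝒜.mul (id1 y) a ::
        𝒜.twl (c + 1) u)) x) l
      - splitSum (fun u v => 𝒜.circ 1 (fun w => G (𝒜.twl 1 v ++ a :: 𝒜.twl c w)) 𝒜.mm u) l := by
    rw [splitSum_assoc (fun u v y => G (v ++ 𝒜.mul (id1 y) a :: 𝒜.twl (c + 1) u)),
      ← splitSum_assoc (fun x u v => G (𝒜.twl 1 v ++ 𝒜.mul a (𝒜.twz c (id1 x)) :: 𝒜.twl c u))]
    simp only [circ_mm_append_cons hG, splitSum_add, splitSum_sub, splitSum_twl, twl_twl,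
      CharTwo.add_self_eq_zero, twl_zero, id1_twl, g1, g2, g3, g4, splitSum_zsmul, splitSum_neg,
      twz_one, 𝒜.tw_tw]
    abel
  simp only [Pi.neg_apply, LinearMap.neg_apply, connes_apply]
  rw [s2, s3, hD]
  simp only [LinearMap.add_apply, LinearMap.sub_apply, LinearMap.smul_apply, t2, t3, t4, dual_d, hb]
  rcases zmod_two_cases c with rfl | rfl <;>
    simp only [sg_zero, sg_one, zero_add, CharTwo.add_self_eq_zero, one_smul, neg_smul,
      smul_add, smul_sub, smul_neg, neg_neg] <;> abel

end Connes

end DGAlg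

namespace DGAlg

variable {R : Type v} {A : Type u} [CommRing R] [AddCommGroup A] [Module R A] (𝒜 : DGAlg R A)

variable {N : Type*} [AddCommGroup N] [Module R N]

/-- A closed graded trace of degree `m` modulo `2`. -/
structure IsTrace (m : ZMod 2) (z : A →ₗ[R] R) : Prop where
  d : ∀ a, z (𝒜.d a) = 0
  tw : ∀ a, z (𝒜.tw a) = sg (m + 1) • z a
  mul : ∀ a b, z (𝒜.mul a b) = sg (m + 1) • z (𝒜.mul b (𝒜.twz (m + 1) a))

/-- The cochain of length zero with value `x`. -/
def const0 (x : N) : List A → N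
  | [] => x
  | _ :: _ => 0

@[simp] theorem const0_nil (x : N) : const0 x ([] : List A) = x := rfl
@[simp] theorem const0_cons (x : N) (a : A) (l : List A) : const0 x (a :: l) = 0 := rfl
@[simp] theorem const0_append_cons (x : N) (u v : List A) (a : A) :
    const0 x (u ++ a :: v) = 0 := by cases u <;> rfl

variable {𝒜}

theorem circ_twl (e : ZMod 2) {e' : ZMod 2} {f : List A → N} (hf : MLin R f) {h : List A → A}
    (hh : 𝒜.Par e' h) (k : ZMod 2) (l : List A) :
    𝒜.circ e f h (𝒜.twl k l) = sg (k * e') • 𝒜.circ e (fun w => f (𝒜.twl k w)) h l := by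
  simp only [circ, splitSum₃_twl, twl_twl, ← splitSum₃_zsmul]
  refine splitSum₃_congr fun u v t _ => ?_
  have : h (𝒜.twl k v) = sg (k * e') • 𝒜.twz k (h v) := by rw [hh.twz, sg_smul_sg_smul]
  simp [this, hf.zsmul, twl_twl, add_comm e k]

theorem conv_const0 {N₁ N₂ : Type*} [AddCommGroup N₁] [Module R N₁] [AddCommGroup N₂]
    [Module R N₂] (β : N₁ →ₗ[R] N₂ →ₗ[R] N) (k : ZMod 2) (f : List A → N₁) (x : N₂) (l : List A) :
    𝒜.conv β k f (const0 x) l = β (f (𝒜.twl k l)) x := by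
  rw [conv, splitSum_of_right_nil] <;> simp

theorem hD_const0 {m : ZMod 2} {z : A →ₗ[R] R} (hz : 𝒜.IsTrace m z) :
    hD 𝒜.dualBimod m (const0 z) = 0 := by
  funext l; ext x
  have h1 : 𝒜.circ 1 (const0 z) 𝒜.mm l = 0 := splitSum₃_eq_zero fun u v t _ => by simp
  have h2 : 𝒜.conv 𝒜.dualBimod.rm 1 (const0 z) id1 l x = z (𝒜.mul (id1 l) x) := by
    rw [conv, splitSum_of_left_nil] <;> simp [dual_rm]
  rw [hD, h1, conv_const0]
  simp only [LinearMap.add_apply, LinearMap.sub_apply, LinearMap.smul_apply, dual_d, dual_lm, h2,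
    smul_zero, add_zero]
  have h3 : const0 z l (𝒜.tw (𝒜.d x)) = 0 := by
    cases l <;> simp [hz.tw, hz.d]
  rw [h3, hz.mul (id1 l), id1_twl, ← 𝒜.twz_one, twz_twz, smul_smul, sg_add, ← _root_.mul_assoc, sg_mul_self,
    add_comm 1 m]
  simp

section BV

variable {m e e' : ZMod 2} {z : A →ₗ[R] R} {f g : List A → A}

theorem IsTrace.twz (hz : 𝒜.IsTrace m z) (k : ZMod 2) (a : A) :
    z (𝒜.twz k a) = sg (k * (m + 1)) • z a := by
  rcases zmod_two_cases k with rfl | rfl <;> simp [hz.tw]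

theorem IsTrace.twl (hz : 𝒜.IsTrace m z) (hpf : 𝒜.Par e f) (k : ZMod 2) (w : List A) :
    z (f (𝒜.twl k w)) = sg (k * (e + 1 + m)) • z (f w) := by
  have h : f (𝒜.twl k w) = sg (k * e) • 𝒜.twz k (f w) := by rw [hpf.twz, sg_smul_sg_smul]
  rw [h, map_zsmul, hz.twz, sg_smul_smul]; congr 2; ring

variable (𝒜) in
/-- The homotopy for the Batalin–Vilkovisky identity; `f` and `g` have degrees `e + 1` and
`e' + 1` modulo `2`, and `z` has degree `m`. -/
def bvH (m e e' : ZMod 2) (z : A →ₗ[R] R) (f g : List A → A) (hf : MLin R f) :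
    List A → A →ₗ[R] R :=
  splitSum fun p v => 𝒜.circ e' (fun w => z ∘ₗ hf.lin (𝒜.twl (e + 1 + m + 1) v) w ∘ₗ
    𝒜.twz (e + 1 + m)) g p

theorem bvH_apply (hf : MLin R f) (l : List A) (a : A) :
    𝒜.bvH m e e' z f g hf l a = splitSum (fun p v => z (𝒜.circ e' (fun w =>
      f (𝒜.twl (e + 1 + m + 1) v ++ 𝒜.twz (e + 1 + m) a :: w)) g p)) l := by
  simp only [bvH, splitSum_lapply, circ, splitSum₃_lapply, map_splitSum₃]
  rfl

/-- The pairing of the equation `D f = 0` with a trace. -/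
theorem IsTrace.cocycle (hz : 𝒜.IsTrace m z) (hDf : hD 𝒜.selfBimod (e + 1) f = 0) (v : List A) (a : A)
    (w : List A) : sg (e + 1) • 𝒜.circ 1 (fun w => z (f w)) 𝒜.mm (v ++ a :: w)
      - (splitSum (fun x y => sg (m + 1) • z (𝒜.mul (f (y ++ a :: w))
          (𝒜.twz (e + 1 + m + 1) (id1 x)))) v
        + if v = [] then z (𝒜.mul (𝒜.twz (e + 1) a) (f w)) else 0)
      + sg (e + 1) • (splitSum (fun x y =>
          z (𝒜.mul (f (𝒜.twl 1 v ++ 𝒜.tw a :: 𝒜.twl 1 x)) (id1 y))) w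
        + z (𝒜.mul (f (𝒜.twl 1 v)) (const0 a w))) = 0 := by
  have h := congrArg z (congrFun hDf (v ++ a :: w))
  rw [hD, Pi.zero_apply, map_zero, map_add, map_sub, map_add, map_zsmul, map_zsmul,
    ← circ_comp_left] at h
  have e1 : z (𝒜.selfBimod.d (f (v ++ a :: w))) = 0 := hz.d _
  have e2 : z (𝒜.conv 𝒜.mul (e + 1) id1 f (v ++ a :: w)) =
      splitSum (fun x y => sg (m + 1) • z (𝒜.mul (f (y ++ a :: w))
        (𝒜.twz (e + 1 + m + 1) (id1 x)))) v
      + if v = [] then z (𝒜.mul (𝒜.twz (e + 1) a) (f w)) else 0 := by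
    have h2 : splitSum (fun p q => 𝒜.mul (id1 (𝒜.twl (e + 1) (v ++ a :: p))) (f q)) w =
        if v = [] then 𝒜.mul (𝒜.twz (e + 1) a) (f w) else 0 := by
      rw [splitSum_of_left_nil]
      · rcases v with _ | ⟨b, v⟩
        · simp
        · cases v <;> simp
      · intro b x y
        rcases v with _ | ⟨b', v⟩
        · simp
        · cases v <;> simp
    rw [conv, splitSum_append_cons, map_add, map_splitSum, h2]
    congr 1
    · refine splitSum_congr fun x y _ => ?_
      rw [id1_twl, hz.mul, twz_twz, show m + 1 + (e + 1) = e + 1 + m + 1 by ring]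
    · split <;> simp
  have e3 : z (𝒜.conv 𝒜.mul 1 f id1 (v ++ a :: w)) =
      splitSum (fun x y => z (𝒜.mul (f (𝒜.twl 1 v ++ 𝒜.tw a :: 𝒜.twl 1 x)) (id1 y))) w
      + z (𝒜.mul (f (𝒜.twl 1 v)) (const0 a w)) := by
    have h2 : splitSum (fun p q => 𝒜.mul (f (𝒜.twl 1 p)) (id1 (q ++ a :: w))) v =
        𝒜.mul (f (𝒜.twl 1 v)) (const0 a w) := by
      rw [splitSum_of_right_nil]
      · cases w <;> simp
      · intro x b y
        cases y <;> simp
    rw [conv, splitSum_append_cons, h2, map_add, map_splitSum, add_comm]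
    simp
  rw [e1, zero_add] at h
  rw [← e2, ← e3]
  exact h

theorem hD_bvH (hz : 𝒜.IsTrace m z) (hf : MLin R f) (hpf : 𝒜.Par e f)
    (hpg : 𝒜.Par e' g) (hDf : hD 𝒜.selfBimod (e + 1) f = 0)
    (hDg : hD 𝒜.selfBimod (e' + 1) g = 0) (l : List A) (a : A) :
    hD 𝒜.dualBimod (e + e' + m) (𝒜.bvH m e e' z f g hf) l a =
      sg (e + 1 + m) • splitSum₃ (fun u w v => z (𝒜.mul (f (𝒜.twl (e + 1 + m + 1) v ++
        𝒜.twz (e + 1 + m) a :: 𝒜.twl (e' + 1) u)) (g w))) l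
      - sg (e + 1 + m) • splitSum₃ (fun w u v => z (f (𝒜.twl (e + 1 + m + 1) v ++
        𝒜.mul (𝒜.twz (e + 1 + m) a) (g w) :: u))) l
      - sg m • z (𝒜.mul (𝒜.twz (m + 1) a) (𝒜.circ e' f g l)) := by
  set s := e + 1 + m with hs
  set k := e + e' + m with hk
  have hss : s + 1 + 1 = s := by rw [add_assoc, CharTwo.add_self_eq_zero, add_zero]
  set Pf : List A → A → List A → A := fun v a p => 𝒜.circ e' (fun w => f (v ++ a :: w)) g p with hPf
  have hfb : ∀ v a, MLin R fun w => f (v ++ a :: w) := fun v a => by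
    simpa using hf.prepend (v ++ [a])
  have hzf : MLin R fun w => z (f w) := hf.comp z
  have hPz : ∀ v a p, 𝒜.circ e' (fun w => z (f (v ++ a :: w))) g p = z (Pf v a p) :=
    fun v a p => circ_comp_left _ _ _ _ _
  have hH : ∀ l a, 𝒜.bvH m e e' z f g hf l a =
      splitSum (fun p v => z (Pf (𝒜.twl (s + 1) v) (𝒜.twz s a) p)) l := bvH_apply hf
  have hPadd : ∀ v a b p, Pf v (a + b) p = Pf v a p + Pf v b p := fun v a b p => by
    simp only [Pf, circ, hf.add, splitSum₃_add]
  have hPsmul : ∀ v (t : ℤ) a p, Pf v (t • a) p = t • Pf v a p := fun v t a p => by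
    simp only [Pf, circ, hf.zsmul, splitSum₃_zsmul]
  have hPlin : ∀ a p, MLin R fun v => Pf v a p := fun a p => by
    refine MLin.of_lin fun u v => ⟨splitSum₃ (fun x y t => hf.lin u (v ++ a ::
      (𝒜.twl e' x ++ g y :: t))) p, fun b => ?_⟩
    simp [Pf, circ, splitSum₃_lapply, hf.lin_apply]
  -- parity of `Pf`
  have hPp : ∀ v a p, Pf (𝒜.twl 1 v) (𝒜.tw a) (𝒜.twl 1 p) = sg (e + e') • 𝒜.tw (Pf v a p) := by
    intro v a p
    simp only [Pf]
    rw [circ_twl _ (hfb _ _) hpg, _root_.one_mul]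
    simp only [circ, map_splitSum₃, ← splitSum₃_zsmul]
    refine splitSum₃_congr fun x y t _ => ?_
    rw [hpf, sg_smul_smul]
    simp only [twl_append, twl_cons, twz_one]
    congr 2
    rw [add_right_comm, CharTwo.add_self_eq_zero, zero_add]
  have hPpz : ∀ v a p, z (Pf (𝒜.twl 1 v) (𝒜.tw a) (𝒜.twl 1 p)) = sg (k + 1) • z (Pf v a p) := by
    intro v a p
    rw [hPp, map_zsmul, hz.tw, sg_smul_smul]; congr 2; rw [hk]; ring
  have star : ∀ v a p,
      sg (e + 1) • (𝒜.circ 1 (fun w => z (Pf w a p)) 𝒜.mm v + z (Pf (𝒜.twl 1 v) (𝒜.d a) p)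
        - (splitSum (fun x y => z (f (𝒜.twl 1 v ++ 𝒜.mul (𝒜.tw a) (g x) :: y))) p
          + splitSum (fun x y => z (Pf (𝒜.twl 1 v) (𝒜.mul (𝒜.tw a) (𝒜.twz e' (id1 x))) y)) p)
        - splitSum (fun x y => z (Pf (𝒜.twl 1 x) (𝒜.mul (𝒜.tw (id1 y)) a) p)) v
        + sg e' • 𝒜.circ 1 (fun w => z (Pf (𝒜.twl 1 v) (𝒜.tw a) w)) 𝒜.mm p)
      - (splitSum (fun x y => sg (m + 1) • z (𝒜.mul (Pf y a p) (𝒜.twz (s + 1) (id1 x)))) v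
        + if v = [] then z (𝒜.mul (𝒜.twz (e + 1) a) (𝒜.circ e' f g p)) else 0)
      + sg (e + 1) • (sg e' • splitSum (fun x y =>
          z (𝒜.mul (Pf (𝒜.twl 1 v) (𝒜.tw a) (𝒜.twl 1 x)) (id1 y))) p
        + splitSum (fun x y => z (𝒜.mul (f (𝒜.twl 1 v ++ 𝒜.tw a :: 𝒜.twl (e' + 1) x)) (g y))) p
        + 0) = 0 := by
    intro v a p
    let C₁ : List A → R := fun w => 𝒜.circ 1 (fun w' => z (f (w' ++ a :: w))) 𝒜.mm v
    let C₂ : List A → R := fun w => z (f (𝒜.twl 1 v ++ 𝒜.d a :: w))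
    let C₃ : List A → R := fun w => splitSum (fun p q =>
      z (f (𝒜.twl 1 v ++ 𝒜.mul (𝒜.tw a) (id1 p) :: q))) w
    let C₄ : List A → R := fun w => splitSum (fun p q =>
      z (f (𝒜.twl 1 p ++ 𝒜.mul (𝒜.tw (id1 q)) a :: w))) v
    let C₅ : List A → R := 𝒜.circ 1 (fun w' => z (f (𝒜.twl 1 v ++ 𝒜.tw a :: w'))) 𝒜.mm
    let E₁ : List A → R := fun w => splitSum (fun x y =>
      sg (m + 1) • z (𝒜.mul (f (y ++ a :: w)) (𝒜.twz (s + 1) (id1 x)))) v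
    let E₂ : List A → R := fun w => if v = [] then z (𝒜.mul (𝒜.twz (e + 1) a) (f w)) else 0
    let F₁ : List A → R := fun w => splitSum (fun x y =>
      z (𝒜.mul (f (𝒜.twl 1 v ++ 𝒜.tw a :: 𝒜.twl 1 x)) (id1 y))) w
    let F₂ : List A → R := fun w => z (𝒜.mul (f (𝒜.twl 1 v)) (const0 a w))
    have hfun : sg (e + 1) • (C₁ + C₂ - C₃ - C₄ + C₅) - (E₁ + E₂) + sg (e + 1) • (F₁ + F₂) = 0 := by
      funext w
      have h := hz.cocycle hDf v a w
      rw [circ_mm_append_cons hzf] at h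
      exact h
    have h := congrArg (fun Ψ => 𝒜.circ e' Ψ g p) hfun
    have h0 : 𝒜.circ e' (0 : List A → R) g p = 0 := by simp [circ, splitSum₃]
    simp only [h0, circ_add_left, circ_sub_left, circ_zsmul_left, Pi.add_apply, Pi.sub_apply,
      Pi.smul_apply] at h
    have c1 : 𝒜.circ e' C₁ g p = 𝒜.circ 1 (fun w => z (Pf w a p)) 𝒜.mm v := by
      simp only [← hPz, C₁, circ]
      rw [splitSum₃_comm]
    have c2 : 𝒜.circ e' C₂ g p = z (Pf (𝒜.twl 1 v) (𝒜.d a) p) := hPz _ _ _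
    have c3 : 𝒜.circ e' C₃ g p =
        splitSum (fun x y => z (f (𝒜.twl 1 v ++ 𝒜.mul (𝒜.tw a) (g x) :: y))) p
        + splitSum (fun x y => z (Pf (𝒜.twl 1 v) (𝒜.mul (𝒜.tw a) (𝒜.twz e' (id1 x))) y)) p := by
      have h := conv_circ (LinearMap.id.flip : A →ₗ[R] (A →ₗ[R] R) →ₗ[R] R) 0 e' mlin_id1
        (fun w => hzf.lin (𝒜.twl 1 v) w ∘ₗ 𝒜.mul (𝒜.tw a)) hpg
      have h := congrFun h p
      rw [circ_id1, zero_mul, sg_zero, one_smul, zero_add] at h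
      have e1 : 𝒜.conv (LinearMap.id.flip : A →ₗ[R] (A →ₗ[R] R) →ₗ[R] R) 0 id1
          (fun w => hzf.lin (𝒜.twl 1 v) w ∘ₗ 𝒜.mul (𝒜.tw a)) = C₃ := by
        funext w; simp only [conv, C₃, twl_zero]; rfl
      rw [e1] at h
      rw [h]
      simp only [Pi.add_apply, conv, twl_zero, id1_twl]
      congr 1
      refine splitSum_congr fun x y _ => ?_
      rw [← hPz]
      simp only [circ, LinearMap.flip_apply, LinearMap.id_apply, splitSum₃_lapply]
      rfl
    have c4 : 𝒜.circ e' C₄ g p =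
        splitSum (fun x y => z (Pf (𝒜.twl 1 x) (𝒜.mul (𝒜.tw (id1 y)) a) p)) v := by
      simp only [← hPz, C₄, circ]
      rw [splitSum₃_splitSum_comm]
    have c5 : 𝒜.circ e' C₅ g p = sg e' • 𝒜.circ 1 (fun w => z (Pf (𝒜.twl 1 v) (𝒜.tw a) w)) 𝒜.mm p := by
      have hΘ : MLin R (fun w' => z (f (𝒜.twl 1 v ++ 𝒜.tw a :: w'))) := (hfb _ _).comp z
      simp only [← hPz, C₅]
      rw [hD_selfBimod hpg, sub_eq_zero] at hDg
      change 𝒜.circ e' (𝒜.circ 1 _ 𝒜.mm) g p = sg e' • 𝒜.circ 1 (𝒜.circ e' _ g) 𝒜.mm p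
      rw [circ_circ 1 e' hΘ _ hpg, circ_circ e' 1 hΘ _ par_mm, hDg, circ_zsmul_right _ _ hΘ]
      simp only [Pi.add_apply, Pi.smul_apply, smul_add, sg_smul_smul, _root_.one_mul, _root_.mul_one,
        CharTwo.add_self_eq_zero, sg_zero, one_smul, add_comm 1 e']
      abel
    have c6 : 𝒜.circ e' E₁ g p =
        splitSum (fun x y => sg (m + 1) • z (𝒜.mul (Pf y a p) (𝒜.twz (s + 1) (id1 x)))) v := by
      simp only [E₁, circ, Pf]
      rw [splitSum₃_splitSum_comm]
      refine splitSum_congr fun x y _ => ?_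
      rw [splitSum₃_zsmul, map_splitSum₃, splitSum₃_lapply, map_splitSum₃]
    have c7 : 𝒜.circ e' E₂ g p =
        if v = [] then z (𝒜.mul (𝒜.twz (e + 1) a) (𝒜.circ e' f g p)) else 0 := by
      simp only [E₂]
      split
      · exact circ_comp_left e' (z ∘ₗ 𝒜.mul (𝒜.twz (e + 1) a)) f g p
      · simp [circ, splitSum₃]
    have c8 : 𝒜.circ e' F₁ g p = sg e' • splitSum (fun x y =>
          z (𝒜.mul (Pf (𝒜.twl 1 v) (𝒜.tw a) (𝒜.twl 1 x)) (id1 y))) p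
        + splitSum (fun x y => z (𝒜.mul (f (𝒜.twl 1 v ++ 𝒜.tw a :: 𝒜.twl (e' + 1) x)) (g y))) p := by
      have h := congrFun (conv_circ 𝒜.mul 1 e' (hfb (𝒜.twl 1 v) (𝒜.tw a)) id1 hpg) p
      rw [circ_id1, _root_.one_mul] at h
      have h := congrArg z h
      rw [← circ_comp_left] at h
      have e1 : (fun l => z (𝒜.conv 𝒜.mul 1 (fun w => f (𝒜.twl 1 v ++ 𝒜.tw a :: w)) id1 l)) = F₁ := by
        funext w; simp only [conv, F₁, map_splitSum]
      rw [e1] at h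
      rw [h]
      simp only [Pi.add_apply, Pi.smul_apply, map_add, map_zsmul, conv, map_splitSum, Pf,
        add_comm 1 e']
    have c9 : 𝒜.circ e' F₂ g p = 0 := splitSum₃_eq_zero fun u v t _ => by simp [F₂]
    rw [c1, c2, c3, c4, c5, c6, c7, c8, c9] at h
    exact h
  have key : ∀ p v,
      sg (e + 1) • (sg s • 𝒜.circ 1 (fun w => z (Pf (𝒜.twl s w) (𝒜.twz (s + 1) a) p)) 𝒜.mm v
        + sg (s + 1) • z (Pf (𝒜.twl (s + 1) v) (𝒜.twz s (𝒜.tw (𝒜.d a))) p)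
        - (splitSum (fun x y => z (f (𝒜.twl (s + 1) v ++ 𝒜.mul (𝒜.twz s a) (g x) :: y))) p
          + splitSum (fun x y => z (Pf (𝒜.twl (s + 1) v)
              (𝒜.mul (𝒜.twz s a) (𝒜.twz e' (id1 x))) y)) p)
        - splitSum (fun x y => z (Pf (𝒜.twl (s + 1) x)
            (𝒜.mul (𝒜.twz (s + 1) (id1 y)) (𝒜.twz (s + 1) a)) p)) v
        + sg e' • 𝒜.circ 1 (fun w => z (Pf (𝒜.twl (s + 1) v) (𝒜.twz s a) w)) 𝒜.mm p)
      - (sg (m + 1) • splitSum (fun x y =>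
            z (𝒜.mul (Pf (𝒜.twl s y) (𝒜.twz (s + 1) a) p) (𝒜.tw (id1 x)))) v
        + if v = [] then z (𝒜.mul (𝒜.twz (m + 1) a) (𝒜.circ e' f g p)) else 0)
      + sg (e + 1) • (sg e' • sg k • splitSum (fun x y =>
          z (𝒜.mul (Pf (𝒜.twl s v) (𝒜.twz (s + 1) a) x) (𝒜.tw (id1 y)))) p
        + splitSum (fun x y => z (𝒜.mul (f (𝒜.twl (s + 1) v ++
            𝒜.twz s a :: 𝒜.twl (e' + 1) x)) (g y))) p) = 0 := by
    intro p v
    have h := star (𝒜.twl s v) (𝒜.twz (s + 1) a) p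
    have h2 : 𝒜.d (𝒜.twz (s + 1) a) = sg (s + 1) • 𝒜.twz s (𝒜.tw (𝒜.d a)) := by
      rw [𝒜.d_twz, ← 𝒜.twz_one (𝒜.d a), twz_twz]
    have h6 : ∀ x : A, 𝒜.twz (s + 1) (𝒜.twz s x) = 𝒜.tw x := fun x => by
      rw [twz_twz, add_right_comm, CharTwo.add_self_eq_zero, zero_add]; rfl
    have h7 : 𝒜.twz (e + 1) (𝒜.twz (s + 1) a) = 𝒜.twz (m + 1) a := by
      rw [twz_twz]; congr 2; rw [hs]; linear_combination (e + 1) * zmod_two_eq_zero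
    have h8 : ∀ x y, z (𝒜.mul (Pf (𝒜.twl (s + 1) v) (𝒜.twz s a) (𝒜.twl 1 x)) (id1 y)) =
        sg k • z (𝒜.mul (Pf (𝒜.twl s v) (𝒜.twz (s + 1) a) x) (𝒜.tw (id1 y))) := by
      intro x y
      have h := hPp (𝒜.twl s v) (𝒜.twz (s + 1) a) x
      rw [twl_twl, ← 𝒜.twz_one, twz_twz, add_comm 1 s, add_comm 1 (s + 1), hss] at h
      have h' := 𝒜.tw_mul (Pf (𝒜.twl s v) (𝒜.twz (s + 1) a) x) (𝒜.tw (id1 y))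
      rw [𝒜.tw_tw, ← neg_eq_iff_eq_neg] at h'
      rw [h, map_zsmul, LinearMap.smul_apply, map_zsmul, ← h', map_neg, hz.tw, ← neg_smul, smul_smul,
        hk, sg_add m, sg_add (e + e') m]
      simp
    rw [circ_twl _ ((hPlin _ _).comp z) par_mm, h2, h7] at h
    simp only [splitSum_twl, twl_twl, add_comm 1 s, hPsmul, map_zsmul, id1_twl, h6,
      ← 𝒜.twz_one (𝒜.twz (s + 1) a), twz_twz, add_comm 1 (s + 1), hss, splitSum_zsmul, h8] at h
    simp only [← 𝒜.twz_one (𝒜.twz s (id1 _)), twz_twz, add_comm 1 s, _root_.mul_one, add_zero] at h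
    have hv : (𝒜.twl s v = []) = (v = []) := by simp [twl]
    simp only [hv] at h
    exact h
  have hsum : splitSum (fun p v => (0 : R)) l = 0 := splitSum_zero l
  rw [← splitSum_congr fun p v _ => key p v] at hsum
  simp only [splitSum_add, splitSum_sub, splitSum_zsmul] at hsum
  rw [splitSum_of_right_nil (F := fun p v => if v = [] then _ else _) (fun u b v => by simp)] at hsum
  rw [splitSum_assoc (fun x y v => z (f (𝒜.twl (s + 1) v ++ 𝒜.mul (𝒜.twz s a) (g x) :: y))),
    splitSum_assoc (fun x y v => z (𝒜.mul (Pf (𝒜.twl s v) (𝒜.twz (s + 1) a) x) (𝒜.tw (id1 y)))),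
    splitSum_assoc (fun x y v => z (𝒜.mul (f (𝒜.twl (s + 1) v ++
            𝒜.twz s a :: 𝒜.twl (e' + 1) x)) (g y))), if_pos rfl] at hsum
  have t2 : 𝒜.circ 1 (𝒜.bvH m e e' z f g hf) 𝒜.mm l a =
      splitSum (fun p v => 𝒜.circ 1 (fun w => z (Pf (𝒜.twl (s + 1) v) (𝒜.twz s a) w)) 𝒜.mm p) l
      + sg (k + 1) • splitSum (fun p v =>
        𝒜.circ 1 (fun w => z (Pf (𝒜.twl s w) (𝒜.twz (s + 1) a) p)) 𝒜.mm v) l := by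
    have := circ_comp_left (𝒜 := 𝒜) 1 (LinearMap.applyₗ a) (𝒜.bvH m e e' z f g hf) 𝒜.mm l
    rw [LinearMap.applyₗ_apply_apply] at this
    rw [← this]
    simp only [LinearMap.applyₗ_apply_apply, hH]
    refine (circ_splitSum 1 (fun p v => z (Pf (𝒜.twl (s + 1) v) (𝒜.twz s a) p)) 𝒜.mm l).trans ?_
    congr 1
    rw [← splitSum_zsmul]
    refine splitSum_congr fun p v _ => ?_
    have h : ∀ w, z (Pf (𝒜.twl (s + 1) w) (𝒜.twz s a) (𝒜.twl 1 p)) =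
        sg (k + 1) • z (Pf (𝒜.twl s w) (𝒜.twz (s + 1) a) p) := fun w => by
      rw [← hPpz, twl_twl, ← 𝒜.twz_one, twz_twz, add_comm 1 s, add_comm 1 (s + 1), hss]
    simp only [h]
    exact congrFun (circ_zsmul_left 1 (sg (k + 1)) _ _) v
  have t3 : 𝒜.conv 𝒜.dualBimod.lm k id1 (𝒜.bvH m e e' z f g hf) l a =
      -(sg s • splitSum (fun p v => splitSum (fun x y => z (Pf (𝒜.twl (s + 1) v)
        (𝒜.mul (𝒜.twz s a) (𝒜.twz e' (id1 x))) y)) p) l) := by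
    rw [splitSum_assoc (fun x y v => z (Pf (𝒜.twl (s + 1) v)
        (𝒜.mul (𝒜.twz s a) (𝒜.twz e' (id1 x))) y))]
    simp only [conv, splitSum_lapply, dual_lm, hH, id1_twl, splitSum_neg, twz_mul, hPsmul, map_zsmul,
      splitSum_zsmul]
    have h : ∀ x : A, 𝒜.twz s (𝒜.tw (𝒜.twz k x)) = 𝒜.twz e' x := fun x => by
      rw [← 𝒜.twz_one, twz_twz, twz_twz]; congr 2; rw [hs, hk]
      linear_combination (e + 1 + m) * zmod_two_eq_zero
    simp only [h]
  have t4 : 𝒜.conv 𝒜.dualBimod.rm 1 (𝒜.bvH m e e' z f g hf) id1 l a =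
      sg (k + 1) • sg (s + 1) • splitSum (fun p v => splitSum (fun x y => z (Pf (𝒜.twl (s + 1) x)
            (𝒜.mul (𝒜.twz (s + 1) (id1 y)) (𝒜.twz (s + 1) a)) p)) v) l := by
    rw [← splitSum_assoc (fun p x y => z (Pf (𝒜.twl (s + 1) x)
            (𝒜.mul (𝒜.twz (s + 1) (id1 y)) (𝒜.twz (s + 1) a)) p))]
    simp only [conv, splitSum_lapply, dual_rm, hH, splitSum_twl, ← splitSum_zsmul]
    refine splitSum_congr fun x y _ => splitSum_congr fun p v _ => ?_
    have h : 𝒜.twz s (𝒜.mul (id1 y) a) = 𝒜.tw (𝒜.twz (s + 1) (𝒜.mul (id1 y) a)) := by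
      rw [← 𝒜.twz_one, twz_twz, add_comm 1 (s + 1), hss]
    rw [h, twl_twl, add_comm (s + 1) 1, ← twl_twl, hPpz, twz_mul, hPsmul, map_zsmul]
  rw [hD, LinearMap.add_apply, LinearMap.sub_apply, LinearMap.add_apply, LinearMap.smul_apply,
    LinearMap.smul_apply, t2, t3, t4, dual_d, hH]
  simp only [splitSum₃]
  rw [hs, hk] at hsum ⊢
  rcases zmod_two_cases m with rfl | rfl <;> rcases zmod_two_cases e with rfl | rfl <;>
    rcases zmod_two_cases e' with rfl | rfl <;>
    simp only [sg_zero, sg_one, add_zero, zero_add, CharTwo.add_self_eq_zero, one_smul, neg_smul,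
      smul_add, smul_sub, smul_neg, neg_neg] at hsum ⊢ <;>
    first | linear_combination hsum | linear_combination -hsum

end BV

end DGAlg

namespace DGAlg

variable {R : Type v} {A : Type u} [CommRing R] [AddCommGroup A] [Module R A] {𝒜 : DGAlg R A}

variable {m e e' : ZMod 2} {z : A →ₗ[R] R} {f g h : List A → A}

theorem par_circ (hf : MLin R f) (hpf : 𝒜.Par e f) (hpg : 𝒜.Par e' g) :
    𝒜.Par (e + e') (𝒜.circ e' f g) := fun l => by
  have hpf' : (fun l => 𝒜.tw (f l)) = sg e • fun l => f (𝒜.twl 1 l) := funext hpf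
  rw [circ_twl _ hf hpg, ← circ_comp_left, hpf', circ_zsmul_left, Pi.smul_apply, sg_smul_smul,
    _root_.one_mul, add_assoc, CharTwo.add_self_eq_zero, add_zero]

theorem par_conv (k : ZMod 2) (hpf : 𝒜.Par e f) (hpg : 𝒜.Par e' g) :
    𝒜.Par (e + e' + 1) (𝒜.conv 𝒜.mul k f g) := fun l => by
  simp only [conv, splitSum_twl, map_splitSum, ← splitSum_zsmul]
  refine splitSum_congr fun u v _ => ?_
  rw [𝒜.tw_mul, hpf, hpg, twl_twl, twl_twl, add_comm 1 k, map_zsmul, map_zsmul, LinearMap.smul_apply,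
    sg_smul_smul, sg_add _ 1, add_comm e']
  simp

theorem cap_apply (hph : 𝒜.Par e h) (l : List A) (a : A) :
    𝒜.conv 𝒜.dualBimod.lm m h (const0 z) l a =
      sg (e + 1) • z (𝒜.mul a (h (𝒜.twl (m + 1) l))) := by
  rw [conv_const0, dual_lm, hph, twl_twl, map_zsmul, map_zsmul, sg_add, add_comm 1 m]
  simp

theorem mlin_const0 (z : A →ₗ[R] R) : MLin R (const0 z : List A → A →ₗ[R] R) :=
  MLin.of_lin fun u v => ⟨0, fun a => by simp⟩

theorem norm_const0 (z : A →ₗ[R] R) : 𝒜.Norm (const0 z : List A → A →ₗ[R] R) :=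
  fun u v => by simp

theorem connes_cap (hh : MLin R h) (hph : 𝒜.Par e h) (l : List A) (a : A) :
    𝒜.connes (e + 1 + m) (𝒜.conv 𝒜.dualBimod.lm m h (const0 z))
      (mlin_conv _ _ hh (mlin_const0 z)) l a =
      sg (m + 1) • splitSum (fun u v =>
        z (h (𝒜.twl m v ++ 𝒜.twz (m + 1) a :: 𝒜.twl e u))) l := by
  rw [connes_apply]
  have h1 : m + 1 + (e + 1 + m) = e := by
    linear_combination (m + 1) * zmod_two_eq_zero
  have h2 : m + 1 + 1 = m := by linear_combination zmod_two_eq_zero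
  simp only [cap_apply hph, 𝒜.one_mul, twl_append, twl_cons, twl_twl, splitSum_zsmul, h1, h2]
  rw [sg_smul_smul]; congr 2
  linear_combination (e + 1) * zmod_two_eq_zero

theorem IsTrace.mul_twl (hz : 𝒜.IsTrace m z) (hpf : 𝒜.Par e f) (hpg : 𝒜.Par e' g) (k : ZMod 2)
    (u v : List A) : z (𝒜.mul (f (𝒜.twl k u)) (g (𝒜.twl k v))) =
      sg (k * (e + e' + m)) • z (𝒜.mul (f u) (g v)) := by
  have h1 : f (𝒜.twl k u) = sg (k * e) • 𝒜.twz k (f u) := by rw [hpf.twz, sg_smul_sg_smul]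
  have h2 : g (𝒜.twl k v) = sg (k * e') • 𝒜.twz k (g v) := by rw [hpg.twz, sg_smul_sg_smul]
  have h3 := congrArg z (𝒜.twz_mul k (f u) (g v))
  rw [hz.twz, map_zsmul] at h3
  rw [h1, h2]
  simp only [map_zsmul, LinearMap.smul_apply, sg_smul_smul]
  have h4 : z (𝒜.mul (𝒜.twz k (f u)) (𝒜.twz k (g v))) =
      sg k • sg (k * (m + 1)) • z (𝒜.mul (f u) (g v)) := by rw [h3, sg_smul_sg_smul]
  rw [h4, sg_smul_smul, sg_smul_smul]; congr 2
  linear_combination k * zmod_two_eq_zero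

theorem connes_cap_cup (hz : 𝒜.IsTrace m z) (hf : MLin R f) (hg : MLin R g) (hpf : 𝒜.Par e f)
    (hpg : 𝒜.Par e' g) (l : List A) (a : A) :
    𝒜.connes (e + e' + 1 + 1 + m) (𝒜.conv 𝒜.dualBimod.lm m (𝒜.conv 𝒜.mul (e' + 1) f g) (const0 z))
      (mlin_conv _ _ (mlin_conv _ _ hf hg) (mlin_const0 z)) l a =
      sg (m + 1 + (e + e' + 1) * (e + e' + m)) • splitSum₃ (fun u w v =>
        z (𝒜.mul (f (𝒜.twl (e + 1 + m + 1) v ++ 𝒜.twz (e + 1 + m) a :: 𝒜.twl (e' + 1) u)) (g w))) l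
      + sg ((m + 1) * e + e' * (e + e' + m)) • splitSum₃ (fun u w v =>
        z (𝒜.mul (g (𝒜.twl (e' + 1 + m + 1) v ++ 𝒜.twz (e' + 1 + m) a :: 𝒜.twl (e + 1) u)) (f w))) l := by
  rw [connes_cap (mlin_conv _ _ hf hg) (par_conv _ hpf hpg)]
  have h1 : ∀ u v : List A, z (𝒜.conv 𝒜.mul (e' + 1) f g
      (𝒜.twl m v ++ 𝒜.twz (m + 1) a :: 𝒜.twl (e + e' + 1) u)) =
      sg (m + 1 + (m + 1) * e + e' * (e + e' + m)) • splitSum (fun x y =>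
        z (𝒜.mul (g (𝒜.twl (e' + 1 + m + 1) y ++ 𝒜.twz (e' + 1 + m) a :: 𝒜.twl (e + 1) u)) (f x))) v
      + sg ((e + e' + 1) * (e + e' + m)) • splitSum (fun x y =>
        z (𝒜.mul (f (𝒜.twl (e + 1 + m + 1) v ++ 𝒜.twz (e + 1 + m) a :: 𝒜.twl (e' + 1) x)) (g y))) u := by
    intro u v
    rw [conv, splitSum_append_cons, map_add, map_splitSum, map_splitSum, splitSum_twl, splitSum_twl,
      ← splitSum_zsmul, ← splitSum_zsmul]
    congr 1
    · refine splitSum_congr fun x y _ => ?_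
      have h := hz.mul_twl hpg hpf e'
        (𝒜.twl (e' + 1 + m + 1) y ++ 𝒜.twz (e' + 1 + m) a :: 𝒜.twl (e + 1) u) x
      rw [hz.mul, hpf.twz, map_zsmul, map_zsmul, twl_twl, twl_twl]
      simp only [twl_append, twl_cons, twl_twl, twz_twz] at h
      rw [show e' + (e' + 1 + m + 1) = m by
          linear_combination (e' + 1) * zmod_two_eq_zero,
        show e' + (e' + 1 + m) = m + 1 by linear_combination e' * zmod_two_eq_zero,
        show e' + (e + 1) = e + e' + 1 by ring] at h
      rw [show m + 1 + (e' + 1) + m = e' by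
        linear_combination (m + 1) * zmod_two_eq_zero, h]
      simp only [sg_smul_smul]
      congr 2; ring
    · refine splitSum_congr fun x y _ => ?_
      have h := hz.mul_twl hpf hpg (e + e' + 1)
        (𝒜.twl (e + 1 + m + 1) v ++ 𝒜.twz (e + 1 + m) a :: 𝒜.twl (e' + 1) x) y
      simp only [twl_append, twl_cons, twl_twl, twz_twz] at h ⊢
      rw [show e + e' + 1 + (e + 1 + m + 1) = e' + 1 + m by
          linear_combination (e + 1) * zmod_two_eq_zero,
        show e + e' + 1 + (e + 1 + m) = e' + 1 + (m + 1) by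
          linear_combination e * zmod_two_eq_zero,
        show e + e' + 1 + (e' + 1) = e' + 1 + (e + e' + 1) by ring] at h
      exact h
  simp only [h1, splitSum_add, splitSum_zsmul, smul_add, sg_smul_smul]
  rw [splitSum_assoc (fun x y v => z (𝒜.mul (f (𝒜.twl (e + 1 + m + 1) v ++
    𝒜.twz (e + 1 + m) a :: 𝒜.twl (e' + 1) x)) (g y))), add_comm]
  rw [show m + 1 + (m + 1 + (m + 1) * e + e' * (e + e' + m)) = (m + 1) * e + e' * (e + e' + m) by
    linear_combination (m + 1) * zmod_two_eq_zero]
  rfl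

theorem conv_connes_cap (hz : 𝒜.IsTrace m z) (hf : MLin R f) (hpf : 𝒜.Par e f)
    (hpg : 𝒜.Par e' g) (l : List A) (a : A) :
    𝒜.conv 𝒜.dualBimod.lm (e + 1 + m + 1) g (𝒜.connes (e + 1 + m)
      (𝒜.conv 𝒜.dualBimod.lm m f (const0 z)) (mlin_conv _ _ hf (mlin_const0 z))) l a =
      sg (e + 1 + e * m + (e + m) * e') • splitSum₃ (fun w u v =>
        z (f (𝒜.twl (e + 1 + m + 1) v ++ 𝒜.mul (𝒜.twz (e + 1 + m) a) (g w) :: u))) l := by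
  rw [show ∀ F : List A → A →ₗ[R] R, 𝒜.conv 𝒜.dualBimod.lm (e + 1 + m + 1) g F l =
    splitSum (fun w t => 𝒜.dualBimod.lm (g (𝒜.twl (e + 1 + m + 1) w)) (F t)) l from fun _ => rfl]
  simp only [splitSum_lapply, dual_lm, connes_cap hf hpf, splitSum₃, ← splitSum_zsmul,
    ← splitSum_neg]
  refine splitSum_congr fun w t _ => splitSum_congr fun u v _ => ?_
  have h := hz.twl hpf e (𝒜.twl (e + 1 + m + 1) v ++ 𝒜.mul (𝒜.twz (e + 1 + m) a) (g w) :: u)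
  simp only [twl_append, twl_cons, twl_twl, twz_mul, twz_twz] at h ⊢
  have h2 : 𝒜.twz (m + 1) (𝒜.tw (g (𝒜.twl (e + 1 + m + 1) w))) =
      sg ((e + 1 + m + 1) * e') • 𝒜.twz e (g w) := by
    have h1 : g (𝒜.twl (e + 1 + m + 1) w) = sg ((e + 1 + m + 1) * e') • 𝒜.twz (e + 1 + m + 1) (g w) := by
      rw [hpg.twz, sg_smul_sg_smul]
    rw [h1, map_zsmul, map_zsmul, ← 𝒜.twz_one, twz_twz, twz_twz]; congr 3
    linear_combination (m + 2) * zmod_two_eq_zero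
  rw [show e + (e + 1 + m + 1) = m by linear_combination (e + 1) * zmod_two_eq_zero,
    show e + (e + 1 + m) = m + 1 by linear_combination e * zmod_two_eq_zero,
    hf.zsmul, map_zsmul] at h
  rw [h2, map_zsmul, hf.zsmul, hf.zsmul, map_zsmul, map_zsmul]
  have h3 := congrArg (sg e • ·) h
  simp only [sg_smul_sg_smul] at h3
  rw [h3]
  simp only [sg_smul_smul]
  rcases zmod_two_cases m with rfl | rfl <;> rcases zmod_two_cases e with rfl | rfl <;>
    rcases zmod_two_cases e' with rfl | rfl <;>
    simp [CharTwo.add_self_eq_zero]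

theorem cap_apply' (hz : 𝒜.IsTrace m z) (hph : 𝒜.Par e h) (l : List A) (a : A) :
    𝒜.conv 𝒜.dualBimod.lm m h (const0 z) l a =
      sg (e + 1 + (m + 1) * e) • z (𝒜.mul (𝒜.twz (m + 1) a) (h l)) := by
  have h1 : h (𝒜.twl (m + 1) l) = sg ((m + 1) * e) • 𝒜.twz (m + 1) (h l) := by
    rw [hph.twz, sg_smul_sg_smul]
  have h2 := congrArg z (𝒜.twz_mul (m + 1) (𝒜.twz (m + 1) a) (h l))
  rw [hz.twz, twz_twz, CharTwo.add_self_eq_zero, twz_zero, map_zsmul] at h2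
  rw [cap_apply hph, h1, map_zsmul, map_zsmul, sg_smul_smul]
  have h3 := congrArg (sg (m + 1) • ·) h2
  simp only [sg_smul_sg_smul] at h3
  rw [← h3, sg_smul_smul, sg_smul_smul]; congr 2
  rcases zmod_two_cases m with rfl | rfl <;> rcases zmod_two_cases e with rfl | rfl <;>
    simp [CharTwo.add_self_eq_zero]

/-- The Batalin–Vilkovisky identity on cochains. -/
theorem bv_identity (hz : 𝒜.IsTrace m z) (hf : MLin R f) (hg : MLin R g) (hpf : 𝒜.Par e f)
    (hpg : 𝒜.Par e' g) (hDf : hD 𝒜.selfBimod (e + 1) f = 0)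
    (hDg : hD 𝒜.selfBimod (e' + 1) g = 0) :
    𝒜.connes (e + e' + 1 + 1 + m) (𝒜.conv 𝒜.dualBimod.lm m (𝒜.conv 𝒜.mul (e' + 1) f g) (const0 z))
      (mlin_conv _ _ (mlin_conv _ _ hf hg) (mlin_const0 z)) =
      sg (e + 1) • 𝒜.conv 𝒜.dualBimod.lm m (𝒜.br e e' f g) (const0 z)
      + sg (e * (e' + 1)) • 𝒜.conv 𝒜.dualBimod.lm (e + 1 + m + 1) g (𝒜.connes (e + 1 + m)
          (𝒜.conv 𝒜.dualBimod.lm m f (const0 z)) (mlin_conv _ _ hf (mlin_const0 z)))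
      + sg (e + 1) • 𝒜.conv 𝒜.dualBimod.lm (e' + 1 + m + 1) f (𝒜.connes (e' + 1 + m)
          (𝒜.conv 𝒜.dualBimod.lm m g (const0 z)) (mlin_conv _ _ hg (mlin_const0 z)))
      + hD 𝒜.dualBimod (e + e' + m)
        (sg ((e + e' + 1) * (e + e' + m) + e) • 𝒜.bvH m e e' z f g hf
          + sg ((e + 1) * (e' + 1) + (e + e' + 1) * (e + e' + m) + e') •
            𝒜.bvH m e' e z g f hg) := by
  funext l; ext a
  have h1 := hD_bvH hz hf hpf hpg hDf hDg l a
  have h2 := hD_bvH hz hg hpg hpf hDg hDf l a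
  rw [add_comm e' e] at h2
  rw [connes_cap_cup hz hf hg hpf hpg, hD_add, hD_zsmul, hD_zsmul, br, conv_sub_left, conv_zsmul_left]
  simp only [Pi.add_apply, Pi.sub_apply, Pi.smul_apply, LinearMap.add_apply, LinearMap.sub_apply,
    LinearMap.smul_apply, h1, h2, conv_connes_cap hz hf hpf hpg, conv_connes_cap hz hg hpg hpf,
    cap_apply' hz (par_circ hf hpf hpg), cap_apply' hz (par_circ hg hpg hpf)]
  rcases zmod_two_cases m with rfl | rfl <;> rcases zmod_two_cases e with rfl | rfl <;>
    rcases zmod_two_cases e' with rfl | rfl <;>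
    simp only [sg_zero, sg_one, add_zero, zero_add, CharTwo.add_self_eq_zero, one_smul, neg_smul,
      smul_sub, smul_neg, neg_neg, mul_zero, _root_.mul_one] <;>
    abel

end DGAlg

/-! ### Monotone functions and hulls -/

/-- The monoid of monotone functions `{0, …, n} → ℕ`. -/
def monotoneSubmonoid (n : ℕ) : AddSubmonoid (Fin (n + 1) → ℕ) where
  carrier := {x | Monotone x}
  zero_mem' := fun _ _ _ => le_rfl
  add_mem' h h' := h.add h'

/-- Monotone functions `{0, …, n} → ℕ`, for instance sums of perversities. -/
def Per (n : ℕ) : Type := monotoneSubmonoid n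

instance (n : ℕ) : AddCommMonoid (Per n) := inferInstanceAs (AddCommMonoid (monotoneSubmonoid n))

instance (n : ℕ) : PartialOrder (Per n) := inferInstanceAs (PartialOrder (monotoneSubmonoid n))

namespace GMPerversity

variable {n : ℕ}

theorem monotone (p : GMPerversity n) : Monotone p.toFun := by
  rw [Fin.monotone_iff_le_succ]
  intro i
  by_cases hi : 1 ≤ (i : ℕ)
  · exact (p.step i.castSucc i.succ (by simpa using hi) (by simp)).1
  · rw [p.zero_of_le_two i.castSucc (by simp; omega)]
    exact Nat.zero_le _

/-- A perversity as a monotone function. -/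
def per (p : GMPerversity n) : Per n := ⟨p.toFun, p.monotone⟩

theorem per_le_per {p q : GMPerversity n} : p.per ≤ q.per ↔ p ≤ q := Iff.rfl

theorem per_add_le {p q r : GMPerversity n} :
    p.per + q.per ≤ r.per ↔ p.toFun + q.toFun ≤ r.toFun := Iff.rfl

@[simp] theorem per_zero : (zero n).per = 0 := rfl

theorem per_le_top (p : GMPerversity n) : p.per ≤ (top n).per := le_top p

end GMPerversity

namespace Per

variable {n : ℕ}

/-- The smallest perversity which is at least `x`. -/
noncomputable def hull (x : Per n) : GMPerversity n := GMPerversity.hull x.1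

theorem hull_le {x : Per n} {q : GMPerversity n} (h : x ≤ q.per) : x.hull ≤ q :=
  fun _ => Nat.sInf_le ⟨q, h, rfl⟩

theorem le_hull {x : Per n} {q : GMPerversity n} (h : x ≤ q.per) : x ≤ x.hull.per := by
  intro i
  have hne : {m | ∃ q : GMPerversity n, x.1 ≤ q.toFun ∧ q.toFun i = m}.Nonempty := ⟨_, q, h, rfl⟩
  obtain ⟨r, hr, hri⟩ := Nat.sInf_mem hne
  change x.1 i ≤ sInf _
  rw [← hri]; exact hr i

theorem le_add_right' (x y : Per n) : x ≤ x + y := fun _ => Nat.le_add_right _ _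

theorem le_add_left' (x y : Per n) : y ≤ x + y := fun _ => Nat.le_add_left _ _

theorem add_le_add' {x x' y y' : Per n} (h : x ≤ x') (h' : y ≤ y') : x + y ≤ x' + y' :=
  fun i => Nat.add_le_add (h i) (h' i)

/-- The values of `q` decrease by at most one in each step. -/
theorem toFun_sub_le (q : GMPerversity n) (i : Fin (n + 1)) (k : ℕ) (hk : (i : ℕ) + k < n + 1) :
    q.toFun ⟨i + k, hk⟩ - k ≤ q.toFun i := by
  induction k with
  | zero => simp
  | succ k ih =>
    have h1 := ih (by omega)
    by_cases h : 1 ≤ (i : ℕ) + k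
    · have := (q.step ⟨i + k, by omega⟩ ⟨i + (k + 1), hk⟩ h (by simp; omega)).2
      omega
    · have := q.zero_of_le_two ⟨i + (k + 1), hk⟩ (by simp; omega)
      omega

theorem hull_add_le {x s : Per n} {q : GMPerversity n} (h : x + s ≤ q.per) :
    x.hull.per + s ≤ q.per := by
  -- the perversity `i ↦ max over j ≥ i of x j - (j - i)`
  let Y : Fin (n + 1) → ℕ := fun i => Finset.univ.sup fun j : Fin (n + 1) =>
    if i ≤ j then x.1 j - (j - i : ℕ) else 0
  have hY : ∀ i, Y i + s.1 i ≤ q.toFun i := by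
    intro i
    have h0 : s.1 i ≤ q.toFun i := (Nat.le_add_left _ _).trans (h i)
    have : Y i ≤ q.toFun i - s.1 i := by
      refine Finset.sup_le fun j _ => ?_
      split
      · rename_i hij
        have h1 : x.1 j + s.1 j ≤ q.toFun j := h j
        have h2 := s.2 hij
        have h3 := toFun_sub_le q i (j - i) (by have := j.2; have : (i : ℕ) ≤ j := hij; omega)
        have h4 : (⟨(i : ℕ) + ((j : ℕ) - i), by have := j.2; have : (i : ℕ) ≤ j := hij; omega⟩ :
            Fin (n + 1)) = j := Fin.ext (by have : (i : ℕ) ≤ j := hij; simp; omega)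
        rw [h4] at h3
        omega
      · exact Nat.zero_le _
    omega
  let y : GMPerversity n :=
    { toFun := Y
      zero_of_le_two := fun i hi => by
        have := hY i
        rw [q.zero_of_le_two i hi] at this
        omega
      step := fun i j hi hij => by
        constructor
        · refine Finset.sup_le fun k _ => ?_
          split
          · rename_i hik
            by_cases hjk : j ≤ k
            · refine le_trans ?_ (Finset.le_sup (f := fun k : Fin (n + 1) =>
                if j ≤ k then x.1 k - (k - j : ℕ) else 0) (Finset.mem_univ k))
              simp only [hjk, if_true]; omega
            · have hk : k = i := Fin.ext (by
                have : (i : ℕ) ≤ k := hik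
                have : ¬ (j : ℕ) ≤ k := hjk
                omega)
              subst hk
              have hkj : k ≤ j := by have : (k : ℕ) ≤ j := by omega
                                     exact this
              have h1 := x.2 hkj
              refine le_trans ?_ (Finset.le_sup (f := fun k : Fin (n + 1) =>
                if j ≤ k then x.1 k - (k - j : ℕ) else 0) (Finset.mem_univ j))
              simp; omega
          · exact Nat.zero_le _
        · refine Finset.sup_le fun k _ => ?_
          split
          · rename_i hjk
            have hik : i ≤ k := by
              have h1 : (j : ℕ) ≤ k := hjk
              have : (i : ℕ) ≤ k := by omega
              exact this
            have h1 := (Finset.le_sup (f := fun k : Fin (n + 1) =>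
                if i ≤ k then x.1 k - (k - i : ℕ) else 0) (Finset.mem_univ k))
            simp only [hik, if_true] at h1
            change _ ≤ Y i + 1
            change _ ≤ Y i at h1
            have h2 : (j : ℕ) ≤ k := hjk
            omega
          · exact Nat.zero_le _ }
  have hx : x ≤ y.per := fun i => by
    refine le_trans ?_ (Finset.le_sup (f := fun k : Fin (n + 1) =>
                if i ≤ k then x.1 k - (k - i : ℕ) else 0) (Finset.mem_univ i))
    simp
  intro i
  have h1 : x.hull.toFun i ≤ Y i := hull_le hx i
  exact (Nat.add_le_add_right h1 _).trans (hY i)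

@[simp] theorem hull_per (p : GMPerversity n) : p.per.hull = p :=
  le_antisymm (hull_le le_rfl) (le_hull (q := p) le_rfl)

theorem hull_congr {x y : Per n} (h : ∀ q : GMPerversity n, x ≤ q.per ↔ y ≤ q.per) :
    x.hull = y.hull := by
  have : ∀ q : GMPerversity n, x.1 ≤ q.toFun ↔ y.1 ≤ q.toFun := h
  simp only [hull, GMPerversity.hull, this]

theorem hull_add_le_iff {x s : Per n} (hx : x ≤ (GMPerversity.top n).per) {q : GMPerversity n} :
    x.hull.per + s ≤ q.per ↔ x + s ≤ q.per :=
  ⟨fun h => (add_le_add' (le_hull hx) le_rfl).trans h, hull_add_le⟩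

theorem add_hull_le_iff {x s : Per n} (hx : x ≤ (GMPerversity.top n).per) {q : GMPerversity n} :
    s + x.hull.per ≤ q.per ↔ s + x ≤ q.per := by
  rw [add_comm s, add_comm s]; exact hull_add_le_iff hx

theorem hull_add_hull_le_iff {x y : Per n} (hx : x ≤ (GMPerversity.top n).per)
    (hy : y ≤ (GMPerversity.top n).per) {q : GMPerversity n} :
    x.hull.per + y.hull.per ≤ q.per ↔ x + y ≤ q.per := by
  rw [hull_add_le_iff hx, add_hull_le_iff hy]

end Per

/-! ### Sections of perverse complexes -/

namespace PDGA

variable {R : Type u} [CommRing R] {n : ℕ} {A : PDGA R n}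

/-- Families of elements of a perverse bimodule. -/
abbrev Fam (M : PBimod A) : Type u := ∀ (q : GMPerversity n) (j : ℤ), M.X q j

/-- `s` is an element of degree `i` of the limit of the `M_q` for `q ≥ x`. -/
structure Sec {M : PBimod A} (x : Per n) (i : ℤ) (s : Fam M) : Prop where
  supp : ∀ q j, ¬ (x ≤ q.per ∧ j = i) → s q j = 0
  res : ∀ (q q' : GMPerversity n) (h : q ≤ q') (j : ℤ), x ≤ q.per → M.res h (s q j) = s q' j

variable {M : PBimod A} {x y : Per n} {i j : ℤ} {s t : Fam M}

namespace Sec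

theorem zero : Sec x i (0 : Fam M) := ⟨fun _ _ _ => rfl, fun _ _ _ _ _ => map_zero _⟩

theorem add (hs : Sec x i s) (ht : Sec x i t) : Sec x i (s + t) :=
  ⟨fun q j h => by simp [hs.supp q j h, ht.supp q j h],
    fun q q' h j hq => by simp [hs.res q q' h j hq, ht.res q q' h j hq]⟩

theorem smul (a : R) (hs : Sec x i s) : Sec x i (a • s) :=
  ⟨fun q j h => by simp [hs.supp q j h], fun q q' h j hq => by simp [hs.res q q' h j hq]⟩

theorem zsmul (a : ℤ) (hs : Sec x i s) : Sec x i (a • s) :=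
  ⟨fun q j h => by simp [hs.supp q j h], fun q q' h j hq => by simp [hs.res q q' h j hq]⟩

theorem neg (hs : Sec x i s) : Sec x i (-s) := by simpa using hs.zsmul (-1)

theorem sub (hs : Sec x i s) (ht : Sec x i t) : Sec x i (s - t) := by
  rw [sub_eq_add_neg]; exact hs.add ht.neg

theorem sum {ι : Type*} (I : Finset ι) {s : ι → Fam M} (h : ∀ a ∈ I, Sec x i (s a)) :
    Sec x i (∑ a ∈ I, s a) := by
  classical
  induction I using Finset.induction_on with
  | empty => exact zero
  | insert a I ha ih =>
    rw [Finset.sum_insert ha]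
    exact (h a (by simp)).add (ih fun b hb => h b (by simp [hb]))

theorem eq_zero (hs : Sec x i s) (h : ¬ x ≤ (GMPerversity.top n).per) : s = 0 := by
  funext q j
  exact hs.supp q j fun h' => h (h'.1.trans q.per_le_top)

theorem res_hull (hs : Sec x i s) {q : GMPerversity n} (h : x ≤ q.per) (j : ℤ) :
    M.res (Per.hull_le h) (s x.hull j) = s q j := hs.res _ _ _ _ (Per.le_hull h)

theorem ext (hs : Sec x i s) (ht : Sec x i t) (h : s x.hull i = t x.hull i) : s = t := by
  funext q j
  by_cases hq : x ≤ q.per ∧ j = i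
  · obtain ⟨hq, rfl⟩ := hq
    rw [← hs.res_hull hq, h, ht.res_hull hq]
  · rw [hs.supp q j hq, ht.supp q j hq]

/-- Sections over `x` are sections over every `y` with the same upper bounds. -/
theorem congr (hs : Sec x i s) (h : ∀ q : GMPerversity n, x ≤ q.per ↔ y ≤ q.per) : Sec y i s :=
  ⟨fun q j hq => hs.supp q j (by rwa [h]), fun q q' hq j h' => hs.res q q' hq j ((h q).2 h')⟩

end Sec

/-- The family of the images of an element. -/
noncomputable def fam (M : PBimod A) (p : GMPerversity n) (i : ℤ) (a : M.X p i) : Fam M := by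
  classical
  exact fun q j => if h : p ≤ q ∧ i = j then h.2 ▸ M.res h.1 a else 0

theorem fam_apply (p q : GMPerversity n) (h : p ≤ q) (i : ℤ) (a : M.X p i) :
    fam M p i a q i = M.res h a := by
  simp [fam, h]

theorem sec_fam (p : GMPerversity n) (i : ℤ) (a : M.X p i) : Sec p.per i (fam M p i a) where
  supp q j h := by
    simp only [fam]
    rw [dif_neg]
    rintro ⟨h1, rfl⟩
    exact h ⟨h1, rfl⟩
  res q q' h j hq := by
    by_cases hj : i = j
    · subst hj
      have hq' : p ≤ q := GMPerversity.per_le_per.1 hq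
      rw [fam_apply _ _ hq', fam_apply _ _ (le_trans hq' h), M.res_trans]
    · simp [fam, hj]

/-! Products of sections. -/

theorem lact_zero_left {p p' : GMPerversity n} {i i' : ℤ} (m : M.X p' i') (q : GMPerversity n)
    (j : ℤ) : lact M (0 : A.X p i) m q j = 0 := by
  unfold lact; split <;> simp

theorem lact_zero_right {p p' : GMPerversity n} {i i' : ℤ} (a : A.X p i) (q : GMPerversity n)
    (j : ℤ) : lact M a (0 : M.X p' i') q j = 0 := by
  unfold lact; split <;> simp

theorem ract_zero_left {p p' : GMPerversity n} {i i' : ℤ} (a : A.X p' i') (q : GMPerversity n)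
    (j : ℤ) : ract M (0 : M.X p i) a q j = 0 := by
  unfold ract; split <;> simp

theorem ract_zero_right {p p' : GMPerversity n} {i i' : ℤ} (m : M.X p i) (q : GMPerversity n)
    (j : ℤ) : ract M m (0 : A.X p' i') q j = 0 := by
  unfold ract; split <;> simp

theorem lact_pos {p p' q : GMPerversity n} {i i' j : ℤ} (h : p.per + p'.per ≤ q.per)
    (e : i + i' = j) (a : A.X p i) (m : M.X p' i') : lact M a m q j = M.lsmul h e a m :=
  dif_pos ⟨h, e⟩

theorem lact_neg {p p' q : GMPerversity n} {i i' j : ℤ}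
    (h : ¬ (p.per + p'.per ≤ q.per ∧ i + i' = j)) (a : A.X p i) (m : M.X p' i') :
    lact M a m q j = 0 :=
  dif_neg h

theorem ract_pos {p p' q : GMPerversity n} {i i' j : ℤ} (h : p.per + p'.per ≤ q.per)
    (e : i + i' = j) (m : M.X p i) (a : A.X p' i') : ract M m a q j = M.rsmul h e m a :=
  dif_pos ⟨h, e⟩

theorem ract_neg {p p' q : GMPerversity n} {i i' j : ℤ}
    (h : ¬ (p.per + p'.per ≤ q.per ∧ i + i' = j)) (m : M.X p i) (a : A.X p' i') :
    ract M m a q j = 0 :=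
  dif_neg h

theorem sec_lact {a : Fam A.self} (ha : Sec x i a) (hs : Sec y j s) :
    Sec (x + y) (i + j) (lact M (a x.hull i) (s y.hull j)) := by
  by_cases hx : x ≤ (GMPerversity.top n).per
  swap
  · rw [ha.eq_zero hx]
    convert Sec.zero using 1; funext q j; exact lact_zero_left _ _ _
  by_cases hy : y ≤ (GMPerversity.top n).per
  swap
  · rw [hs.eq_zero hy]
    convert Sec.zero using 1; funext q j; exact lact_zero_right _ _ _
  constructor
  · intro q k h
    rw [lact_neg]
    rintro ⟨h1, h2⟩
    exact h ⟨(Per.hull_add_hull_le_iff hx hy).1 h1, h2.symm⟩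
  · intro q q' h k hq
    have hq1 := (Per.hull_add_hull_le_iff hx hy).2 hq
    by_cases hk : i + j = k
    · rw [lact_pos hq1 hk, lact_pos (hq1.trans (GMPerversity.per_le_per.2 h)) hk]
      have hq2 := hq1.trans (GMPerversity.per_le_per.2 h)
      have := M.lsmul_res le_rfl le_rfl h hq1 hq2 hk (a x.hull i) (s y.hull j)
      rw [A.res_refl, M.res_refl] at this
      exact this.symm
    · rw [lact_neg (fun h => hk h.2), lact_neg (fun h => hk h.2), map_zero]

theorem lact_eval {a : Fam A.self} (ha : Sec x i a) (hs : Sec y j s) {p p' q : GMPerversity n}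
    {k : ℤ} (hp : x ≤ p.per) (hp' : y ≤ p'.per) (h : p.toFun + p'.toFun ≤ q.toFun) (e : i + j = k) :
    lact M (a x.hull i) (s y.hull j) q k = M.lsmul h e (a p i) (s p' j) := by
  have hq1 : x.hull.per + y.hull.per ≤ q.per :=
    (Per.add_le_add' (GMPerversity.per_le_per.2 (Per.hull_le hp))
      (GMPerversity.per_le_per.2 (Per.hull_le hp'))).trans (GMPerversity.per_add_le.2 h)
  rw [lact_pos hq1 e, ← ha.res_hull hp, ← hs.res_hull hp']
  exact ((M.lsmul_res _ _ le_rfl hq1 h e _ _).trans (M.res_refl _)).symm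

theorem sec_ract {a : Fam A.self} (hs : Sec x i s) (ha : Sec y j a) :
    Sec (x + y) (i + j) (ract M (s x.hull i) (a y.hull j)) := by
  by_cases hx : x ≤ (GMPerversity.top n).per
  swap
  · rw [hs.eq_zero hx]
    convert Sec.zero using 1; funext q j; exact ract_zero_left _ _ _
  by_cases hy : y ≤ (GMPerversity.top n).per
  swap
  · rw [ha.eq_zero hy]
    convert Sec.zero using 1; funext q j; exact ract_zero_right _ _ _
  constructor
  · intro q k h
    rw [ract_neg]
    rintro ⟨h1, h2⟩
    exact h ⟨(Per.hull_add_hull_le_iff hx hy).1 h1, h2.symm⟩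
  · intro q q' h k hq
    have hq1 := (Per.hull_add_hull_le_iff hx hy).2 hq
    by_cases hk : i + j = k
    · rw [ract_pos hq1 hk, ract_pos (hq1.trans (GMPerversity.per_le_per.2 h)) hk]
      have hq2 := hq1.trans (GMPerversity.per_le_per.2 h)
      have := M.rsmul_res le_rfl le_rfl h hq1 hq2 hk (s x.hull i) (a y.hull j)
      rw [A.res_refl, M.res_refl] at this
      exact this.symm
    · rw [ract_neg (fun h => hk h.2), ract_neg (fun h => hk h.2), map_zero]

theorem ract_eval {a : Fam A.self} (hs : Sec x i s) (ha : Sec y j a) {p p' q : GMPerversity n}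
    {k : ℤ} (hp : x ≤ p.per) (hp' : y ≤ p'.per) (h : p.toFun + p'.toFun ≤ q.toFun) (e : i + j = k) :
    ract M (s x.hull i) (a y.hull j) q k = M.rsmul h e (s p i) (a p' j) := by
  have hq1 : x.hull.per + y.hull.per ≤ q.per :=
    (Per.add_le_add' (GMPerversity.per_le_per.2 (Per.hull_le hp))
      (GMPerversity.per_le_per.2 (Per.hull_le hp'))).trans (GMPerversity.per_add_le.2 h)
  rw [ract_pos hq1 e, ← hs.res_hull hp, ← ha.res_hull hp']
  exact ((M.rsmul_res _ _ le_rfl hq1 h e _ _).trans (M.res_refl _)).symm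

/-- The differential of a family. -/
def dFam (s : Fam M) : Fam M := fun q j => M.d (sub_add_cancel j 1) (s q (j - 1))

theorem dFam_apply (s : Fam M) (q : GMPerversity n) {i j : ℤ} (e : i + 1 = j) :
    dFam s q j = M.d e (s q i) := by
  obtain rfl : i = j - 1 := by omega
  rfl

theorem sec_dFam (hs : Sec x i s) (e : i + 1 = j) : Sec x j (dFam s) where
  supp q k h := by
    rw [dFam, hs.supp, map_zero]
    rintro ⟨h1, h2⟩
    exact h ⟨h1, by omega⟩
  res q q' h k hq := by
    rw [dFam, dFam, ← hs.res q q' h _ hq, M.d_res]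

end PDGA

namespace PDGA

variable {R : Type u} [CommRing R] {n : ℕ} (A : PDGA R n)

/-! ### The total algebra -/

open Classical in
/-- The total module of a perverse differential graded algebra. -/
abbrev Tot : Type u := DirectSum (GMPerversity n × ℤ) fun k => A.X k.1 k.2

open Classical in
/-- The inclusion of the elements of given degrees. -/
noncomputable def inc (p : GMPerversity n) (i : ℤ) : A.X p i →ₗ[R] A.Tot :=
  DirectSum.lof R (GMPerversity n × ℤ) (fun k => A.X k.1 k.2) (p, i)

open Classical in
/-- The projection to the elements of given degrees. -/
noncomputable def proj (p : GMPerversity n) (i : ℤ) : A.Tot →ₗ[R] A.X p i :=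
  DirectSum.component R (GMPerversity n × ℤ) (fun k => A.X k.1 k.2) (p, i)

open Classical in
/-- The linear map on the total module given by its values on homogeneous elements. -/
noncomputable def totLift {N : Type w} [AddCommGroup N] [Module R N]
    (φ : ∀ (p : GMPerversity n) (i : ℤ), A.X p i →ₗ[R] N) : A.Tot →ₗ[R] N :=
  DirectSum.toModule R (GMPerversity n × ℤ) N fun k => φ k.1 k.2

variable {A} {N : Type w} [AddCommGroup N] [Module R N]

@[simp] theorem totLift_inc (φ : ∀ (p : GMPerversity n) (i : ℤ), A.X p i →ₗ[R] N)
    (p : GMPerversity n) (i : ℤ) (a : A.X p i) : A.totLift φ (A.inc p i a) = φ p i a := by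
  classical
  exact DirectSum.toModule_lof (φ := fun k : GMPerversity n × ℤ => φ k.1 k.2) R (p, i) a

theorem proj_inc (p : GMPerversity n) (i : ℤ) (a : A.X p i) : A.proj p i (A.inc p i a) = a := by
  classical
  exact DirectSum.component.lof_self (M := fun k : GMPerversity n × ℤ => A.X k.1 k.2) R (i := (p, i)) a

theorem proj_inc_ne {p : GMPerversity n} {i j : ℤ} (h : i ≠ j) (a : A.X p i) :
    A.proj p j (A.inc p i a) = 0 := by
  classical
  exact DFinsupp.single_eq_of_ne (by simp [h.symm])

theorem tot_induction {P : A.Tot → Prop} (zero : P 0) (add : ∀ a b, P a → P b → P (a + b))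
    (inc : ∀ p i a, P (A.inc p i a)) (a : A.Tot) : P a := by
  classical
  induction a using DirectSum.induction_on with
  | zero => exact zero
  | of k a => exact inc k.1 k.2 a
  | add a b ha hb => exact add a b ha hb

theorem tot_hom_ext {φ ψ : A.Tot →ₗ[R] N} (h : ∀ p i a, φ (A.inc p i a) = ψ (A.inc p i a)) :
    φ = ψ := by
  ext a
  induction a using tot_induction with
  | zero => simp
  | add a b ha hb => simp [ha, hb]
  | inc p i a => exact h p i a

theorem lact_add_left {M : PBimod A} {p p' : GMPerversity n} {i i' : ℤ} (a b : A.X p i)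
    (x : M.X p' i') (q : GMPerversity n) (j : ℤ) :
    lact M (a + b) x q j = lact M a x q j + lact M b x q j := by
  unfold lact; split <;> simp

theorem lact_smul_left {M : PBimod A} {p p' : GMPerversity n} {i i' : ℤ} (s : R) (a : A.X p i)
    (x : M.X p' i') (q : GMPerversity n) (j : ℤ) :
    lact M (s • a) x q j = s • lact M a x q j := by
  unfold lact; split <;> simp

variable (A)

/-- The product of the total algebra. -/
noncomputable def totMul : A.Tot →ₗ[R] A.Tot →ₗ[R] A.Tot :=
  A.totLift fun p i => LinearMap.flip (A.totLift fun q j => LinearMap.flip <|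
    LinearMap.mk₂ R (fun a b => A.inc (p.per + q.per).hull (i + j) (lact A.self a b _ _))
      (fun a a' b => by rw [lact_add_left, map_add]) (fun s a b => by rw [lact_smul_left, map_smul])
      (fun a b b' => by rw [lact_add, map_add]) (fun s a b => by rw [lact_smul, map_smul]))

/-- The differential of the total algebra. -/
noncomputable def totD : A.Tot →ₗ[R] A.Tot := A.totLift fun p i => A.inc p (i + 1) ∘ₗ A.d rfl

/-- The operator `(-1)^(|a| - 1)`. -/
noncomputable def totTw : A.Tot →ₗ[R] A.Tot := A.totLift fun p i => sg (i + 1) • A.inc p i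

variable {A}

theorem totMul_inc {p q : GMPerversity n} {i j : ℤ} (a : A.X p i) (b : A.X q j) :
    A.totMul (A.inc p i a) (A.inc q j b) =
      A.inc (p.per + q.per).hull (i + j) (lact A.self a b _ _) := by
  simp [totMul]

theorem totD_inc {p : GMPerversity n} {i j : ℤ} (e : i + 1 = j) (a : A.X p i) :
    A.totD (A.inc p i a) = A.inc p j (A.d e a) := by
  subst e; simp [totD]

theorem totTw_inc {p : GMPerversity n} {i : ℤ} (a : A.X p i) :
    A.totTw (A.inc p i a) = sg (i + 1) • A.inc p i a := by
  simp [totTw]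

/-! Sections and their products. -/

theorem inn_fam {M : PBimod A} (inn : ∀ (p : GMPerversity n) (i : ℤ), M.X p i →ₗ[R] N)
    (p : GMPerversity n) (i : ℤ) (a : M.X p i) :
    inn p.per.hull i (fam M p i a p.per.hull i) = inn p i a := by
  have : ∀ (q : GMPerversity n), q = p → inn q i (fam M p i a q i) = inn p i a := by
    rintro q rfl
    rw [fam_apply _ _ le_rfl, M.res_refl]
  exact this _ (Per.hull_per p)

theorem inn_lact {M : PBimod A} {β : A.Tot →ₗ[R] N →ₗ[R] N}
    {inn : ∀ (p : GMPerversity n) (i : ℤ), M.X p i →ₗ[R] N}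
    (h : ∀ (p q : GMPerversity n) (i j : ℤ) (a : A.X p i) (m : M.X q j),
      β (A.inc p i a) (inn q j m) = inn (p.per + q.per).hull (i + j) (lact M a m _ _))
    {x y : Per n} {i j : ℤ} {a : Fam A.self} {s : Fam M} (ha : Sec x i a) (hs : Sec y j s) :
    β (A.inc x.hull i (a x.hull i)) (inn y.hull j (s y.hull j)) =
      inn (x + y).hull (i + j) (lact M (a x.hull i) (s y.hull j) _ _) := by
  rw [h]
  by_cases hx : x ≤ (GMPerversity.top n).per
  swap
  · rw [ha.eq_zero hx]
    simp [lact_zero_left]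
  by_cases hy : y ≤ (GMPerversity.top n).per
  swap
  · rw [hs.eq_zero hy]
    simp [lact_zero_right]
  rw [Per.hull_congr (x := x.hull.per + y.hull.per) fun q => Per.hull_add_hull_le_iff hx hy]

theorem inn_ract {M : PBimod A} {β : N →ₗ[R] A.Tot →ₗ[R] N}
    {inn : ∀ (p : GMPerversity n) (i : ℤ), M.X p i →ₗ[R] N}
    (h : ∀ (p q : GMPerversity n) (i j : ℤ) (m : M.X p i) (a : A.X q j),
      β (inn p i m) (A.inc q j a) = inn (p.per + q.per).hull (i + j) (ract M m a _ _))
    {x y : Per n} {i j : ℤ} {s : Fam M} {a : Fam A.self} (hs : Sec x i s) (ha : Sec y j a) :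
    β (inn x.hull i (s x.hull i)) (A.inc y.hull j (a y.hull j)) =
      inn (x + y).hull (i + j) (ract M (s x.hull i) (a y.hull j) _ _) := by
  rw [h]
  by_cases hx : x ≤ (GMPerversity.top n).per
  swap
  · rw [hs.eq_zero hx]
    simp [ract_zero_left]
  by_cases hy : y ≤ (GMPerversity.top n).per
  swap
  · rw [ha.eq_zero hy]
    simp [ract_zero_right]
  rw [Per.hull_congr (x := x.hull.per + y.hull.per) fun q => Per.hull_add_hull_le_iff hx hy]

theorem totMul_sec {x y : Per n} {i j : ℤ} {a b : Fam A.self} (ha : Sec x i a) (hb : Sec y j b) :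
    A.totMul (A.inc x.hull i (a x.hull i)) (A.inc y.hull j (b y.hull j)) =
      A.inc (x + y).hull (i + j) (lact A.self (a x.hull i) (b y.hull j) _ _) :=
  inn_lact (M := A.self) (inn := A.inc) (fun _ _ _ _ a b => totMul_inc a b) ha hb

theorem inc_congr {x y : Per n} {i j : ℤ} {s t : Fam A.self} (hx : x = y) (hi : i = j)
    (h : s = t) : A.inc x.hull i (s x.hull i) = A.inc y.hull j (t y.hull j) := by
  subst hx hi h; rfl

theorem lact_assoc {x y z : Per n} {i j k : ℤ} {a b c : Fam A.self} (ha : Sec x i a)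
    (hb : Sec y j b) (hc : Sec z k c) :
    (lact A.self (lact A.self (a x.hull i) (b y.hull j) (x + y).hull (i + j)) (c z.hull k) :
      Fam A.self) =
    lact A.self (a x.hull i) (lact A.self (b y.hull j) (c z.hull k) (y + z).hull (j + k)) := by
  have hab := sec_lact ha hb
  have hbc := sec_lact hb hc
  have h1 := sec_lact hab hc
  have h2 := sec_lact ha hbc
  funext q l
  by_cases h : x + y + z ≤ q.per ∧ l = i + j + k
  · obtain ⟨h, rfl⟩ := h
    have hxy : x + y ≤ (x + y).hull.per := Per.le_hull ((Per.le_add_right' _ _).trans h)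
    have h' : x + (y + z) ≤ q.per := by rwa [← add_assoc]
    have hyz : y + z ≤ (y + z).hull.per := Per.le_hull ((Per.le_add_left' x _).trans h')
    have hx : x ≤ x.hull.per := Per.le_hull ((Per.le_add_right' _ _).trans h')
    have hy : y ≤ y.hull.per := Per.le_hull ((Per.le_add_right' _ _).trans hyz)
    have hz : z ≤ z.hull.per := Per.le_hull ((Per.le_add_left' _ _).trans hyz)
    have hp : x.hull.per + y.hull.per ≤ (x + y).hull.per := by
      rw [Per.hull_add_hull_le_iff (hx.trans (GMPerversity.per_le_top _))
        (hy.trans (GMPerversity.per_le_top _))]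
      exact hxy
    have hp' : y.hull.per + z.hull.per ≤ (y + z).hull.per := by
      rw [Per.hull_add_hull_le_iff (hy.trans (GMPerversity.per_le_top _))
        (hz.trans (GMPerversity.per_le_top _))]
      exact hyz
    have hq : (x + y).hull.per + z.hull.per ≤ q.per := by
      rw [Per.hull_add_hull_le_iff (hxy.trans (GMPerversity.per_le_top _))
        (hz.trans (GMPerversity.per_le_top _))]
      exact h
    have hq' : x.hull.per + (y + z).hull.per ≤ q.per := by
      rw [Per.hull_add_hull_le_iff (hx.trans (GMPerversity.per_le_top _))
        (hyz.trans (GMPerversity.per_le_top _))]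
      exact h'
    rw [lact_pos hq rfl, lact_pos hp rfl, lact_pos hq' (add_assoc _ _ _).symm, lact_pos hp' rfl]
    exact A.mul_assoc _ _ _ _ _ _ _ _ _ _ _
  · rw [h1.supp _ _ h, h2.supp]
    rwa [← add_assoc, ← add_assoc]

theorem totMul_assoc (a b c : A.Tot) :
    A.totMul (A.totMul a b) c = A.totMul a (A.totMul b c) := by
  induction a using tot_induction with
  | zero => simp
  | add a a' h h' => simp [h, h']
  | inc p i a =>
  induction b using tot_induction with
  | zero => simp
  | add b b' h h' => simp [h, h']
  | inc q j b =>
  induction c using tot_induction with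
  | zero => simp
  | add c c' h h' => simp [h, h']
  | inc r k c =>
    have ha := sec_fam (M := A.self) p i a
    have hb := sec_fam (M := A.self) q j b
    have hc := sec_fam (M := A.self) r k c
    rw [← inn_fam (M := A.self) A.inc p i a, ← inn_fam (M := A.self) A.inc q j b,
      ← inn_fam (M := A.self) A.inc r k c, totMul_sec ha hb, totMul_sec hb hc,
      totMul_sec (sec_lact ha hb) hc, totMul_sec ha (sec_lact hb hc)]
    exact inc_congr (add_assoc _ _ _) (add_assoc _ _ _) (lact_assoc ha hb hc)

theorem inc_eq_of_res {p q : GMPerversity n} {i j : ℤ} (h : p = q) (e : i = j) {a : A.X p i}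
    {b : A.X q j} (hab : A.res h.le a = e ▸ b) : A.inc p i a = A.inc q j b := by
  subst h e
  rw [A.res_refl] at hab
  rw [hab]

/-- The total algebra of a perverse differential graded algebra. -/
noncomputable def totAlg : DGAlg R A.Tot where
  mul := A.totMul
  one := A.inc (GMPerversity.zero n) 0 A.one
  d := A.totD
  tw := A.totTw
  mul_assoc := totMul_assoc
  one_mul a := by
    induction a using tot_induction with
    | zero => simp
    | add a b ha hb => simp [ha, hb]
    | inc p i a =>
      have h : (GMPerversity.zero n).toFun + p.toFun ≤ p.toFun := (zero_add p.toFun).le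
      have hp : ((GMPerversity.zero n).per + p.per).hull = p := by
        rw [GMPerversity.per_zero, zero_add, Per.hull_per]
      rw [totMul_inc]
      have key : ∀ (q : GMPerversity n) (j : ℤ), q = p → j = i →
          A.inc q j (lact A.self A.one a q j) = A.inc p i a := by
        rintro q j rfl rfl
        rw [lact_pos (M := A.self) (GMPerversity.per_add_le.2 h) (zero_add _)]
        exact congrArg _ (A.one_mul h _ a)
      exact key _ _ hp (zero_add i)
  mul_one a := by
    induction a using tot_induction with
    | zero => simp
    | add a b ha hb => simp [ha, hb]
    | inc p i a =>
      have h : p.toFun + (GMPerversity.zero n).toFun ≤ p.toFun := (add_zero p.toFun).le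
      have hp : (p.per + (GMPerversity.zero n).per).hull = p := by
        rw [GMPerversity.per_zero, add_zero, Per.hull_per]
      rw [totMul_inc]
      have key : ∀ (q : GMPerversity n) (j : ℤ), q = p → j = i →
          A.inc q j (lact A.self a A.one q j) = A.inc p i a := by
        rintro q j rfl rfl
        rw [lact_pos (M := A.self) (GMPerversity.per_add_le.2 h) (add_zero _)]
        exact congrArg _ (A.mul_one h _ a)
      exact key _ _ hp (add_zero i)
  tw_tw a := by
    induction a using tot_induction with
    | zero => simp
    | add a b ha hb => simp [ha, hb]
    | inc p i a => simp [totTw_inc, sg_smul_sg_smul]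
  tw_mul a b := by
    induction a using tot_induction with
    | zero => simp
    | add a a' h h' => simp [h, h']; abel
    | inc p i a =>
    induction b using tot_induction with
    | zero => simp
    | add b b' h h' => simp [h, h']; abel
    | inc q j b =>
      simp only [totMul_inc, totTw_inc, map_zsmul, LinearMap.smul_apply, sg_smul_smul]
      rw [← neg_smul]
      congr 1
      push_cast
      rcases zmod_two_cases (i : ZMod 2) with h | h <;>
        rcases zmod_two_cases (j : ZMod 2) with h' | h' <;> rw [h, h'] <;> rfl
  tw_one := by
    rw [totTw_inc]; simp
  d_tw a := by
    induction a using tot_induction with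
    | zero => simp
    | add a b ha hb => simp [ha, hb]; abel
    | inc p i a =>
      simp only [totTw_inc, map_zsmul, totD_inc rfl]
      rw [← neg_smul]
      congr 1
      push_cast
      rcases zmod_two_cases (i : ZMod 2) with h | h <;> rw [h] <;> rfl
  d_mul a b := by
    induction a using tot_induction with
    | zero => simp
    | add a a' h h' => simp [h, h']; abel
    | inc p i a =>
    induction b using tot_induction with
    | zero => simp
    | add b b' h h' => simp [h, h']; abel
    | inc q j b =>
      simp only [totMul_inc, totTw_inc, map_zsmul, LinearMap.smul_apply, totD_inc rfl]
      have e1 : i + 1 + j = i + j + 1 := by ring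
      have e2 : i + (j + 1) = i + j + 1 := by ring
      rw [e1, e2, ← map_zsmul, ← map_sub]
      congr 1
      by_cases h : p.per + q.per ≤ (p.per + q.per).hull.per
      · rw [lact_pos h rfl, lact_pos h e1, lact_pos h e2]
        refine (A.leibniz h rfl rfl rfl rfl e1 e2 a b).trans ?_
        rw [negOnePow_smul, sub_eq_add_neg, ← neg_smul]
        congr 2
        rcases zmod_two_cases (i : ZMod 2) with h | h <;> rw [h] <;> rfl
      · rw [lact_neg fun h' => h h'.1, lact_neg fun h' => h h'.1, lact_neg fun h' => h h'.1]
        simp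

end PDGA

namespace PDGA

variable {R : Type u} [CommRing R] {n : ℕ} {A : PDGA R n}

/-! ### Bimodules over the total algebra with homogeneous components -/

/-- A bimodule over the total algebra containing the homogeneous components of a perverse
bimodule. -/
structure Realization (M : PBimod A) {N : Type w} [AddCommGroup N] [Module R N]
    (ℬ : DGBimod A.totAlg N) where
  inn : ∀ (p : GMPerversity n) (i : ℤ), M.X p i →ₗ[R] N
  out : ∀ (p : GMPerversity n) (i : ℤ), N →ₗ[R] M.X p i
  out_inn : ∀ p i x, out p i (inn p i x) = x
  out_inn_ne : ∀ p i j x, i ≠ j → out p j (inn p i x) = 0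
  lm_inn : ∀ (p q : GMPerversity n) (i j : ℤ) (a : A.X p i) (x : M.X q j),
    ℬ.lm (A.inc p i a) (inn q j x) = inn (p.per + q.per).hull (i + j) (lact M a x _ _)
  rm_inn : ∀ (p q : GMPerversity n) (i j : ℤ) (x : M.X p i) (a : A.X q j),
    ℬ.rm (inn p i x) (A.inc q j a) = inn (p.per + q.per).hull (i + j) (ract M x a _ _)
  d_inn : ∀ (p : GMPerversity n) (i j : ℤ) (e : i + 1 = j) (x : M.X p i),
    ℬ.d (inn p i x) = inn p j (M.d e x)

variable (A) in
/-- The total algebra as a bimodule over itself. -/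
noncomputable def selfReal : Realization A.self A.totAlg.selfBimod where
  inn := A.inc
  out := A.proj
  out_inn := proj_inc
  out_inn_ne _ _ _ x h := proj_inc_ne h x
  lm_inn _ _ _ _ a b := totMul_inc a b
  rm_inn _ _ _ _ a b := totMul_inc a b
  d_inn _ _ _ e a := totD_inc e a

/-- Compatible sections `s` over `x` and `t` over `y ≥ x`. -/
structure FamRel {M : PBimod A} (x y : Per n) (i : ℤ) (s t : Fam M) : Prop where
  le : x ≤ y
  left : Sec x i s
  right : Sec y i t
  eq : ∀ q j, y ≤ GMPerversity.per q → s q j = t q j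

namespace Realization

variable {M : PBimod A} {N : Type w} [AddCommGroup N] [Module R N] {ℬ : DGBimod A.totAlg N}
  (ρ : Realization M ℬ)

/-- The element of the bimodule given by a section. -/
noncomputable def inj (x : Per n) (i : ℤ) (s : Fam M) : N := ρ.inn x.hull i (s x.hull i)

/-- `X` and `Y` are homogeneous of degree `i` and of perverse degree `x` and `y ≥ x`, and `Y` is
the image of `X`. -/
def Rel (x y : Per n) (i : ℤ) (X Y : N) : Prop :=
  ∃ s t, FamRel x y i s t ∧ X = ρ.inj x i s ∧ Y = ρ.inj y i t

variable {ρ}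

theorem inj_add (x : Per n) (i : ℤ) (s t : Fam M) : ρ.inj x i (s + t) = ρ.inj x i s + ρ.inj x i t :=
  map_add _ _ _

theorem inj_sub (x : Per n) (i : ℤ) (s t : Fam M) : ρ.inj x i (s - t) = ρ.inj x i s - ρ.inj x i t :=
  map_sub _ _ _

theorem inj_smul (x : Per n) (i : ℤ) (a : R) (s : Fam M) : ρ.inj x i (a • s) = a • ρ.inj x i s :=
  map_smul _ _ _

theorem inj_zsmul (x : Per n) (i : ℤ) (a : ℤ) (s : Fam M) : ρ.inj x i (a • s) = a • ρ.inj x i s :=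
  map_zsmul _ _ _

@[simp] theorem inj_zero (x : Per n) (i : ℤ) : ρ.inj x i 0 = 0 := map_zero _

theorem inj_sum {ι : Type*} (I : Finset ι) (x : Per n) (i : ℤ) (s : ι → Fam M) :
    ρ.inj x i (∑ a ∈ I, s a) = ∑ a ∈ I, ρ.inj x i (s a) := by
  simp only [inj, Finset.sum_apply, map_sum]

theorem inj_congr {x y : Per n} {i : ℤ} {s : Fam M}
    (h : ∀ q : GMPerversity n, x ≤ q.per ↔ y ≤ q.per) : ρ.inj x i s = ρ.inj y i s := by
  rw [inj, inj, Per.hull_congr h]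

theorem inj_fam (p : GMPerversity n) (i : ℤ) (a : M.X p i) :
    ρ.inj p.per i (fam M p i a) = ρ.inn p i a := inn_fam ρ.inn p i a

variable {x y x' y' : Per n} {i j : ℤ} {X Y X' Y' : N} {s : Fam M} {a : Fam A.self}

theorem inj_lact (ha : Sec x i a) (hs : Sec y j s) :
    ℬ.lm (A.selfReal.inj x i a) (ρ.inj y j s) =
      ρ.inj (x + y) (i + j) (lact M (a x.hull i) (s y.hull j)) :=
  inn_lact ρ.lm_inn ha hs

theorem inj_ract (hs : Sec x i s) (ha : Sec y j a) :
    ℬ.rm (ρ.inj x i s) (A.selfReal.inj y j a) =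
      ρ.inj (x + y) (i + j) (ract M (s x.hull i) (a y.hull j)) :=
  inn_ract ρ.rm_inn hs ha

theorem inj_d (e : i + 1 = j) (s : Fam M) : ℬ.d (ρ.inj x i s) = ρ.inj x j (dFam s) := by
  rw [inj, ρ.d_inn _ _ _ e, inj, dFam_apply s _ e]

namespace Rel

theorem le (h : ρ.Rel x y i X Y) : x ≤ y := by
  obtain ⟨s, t, h, -, -⟩ := h
  exact h.le

theorem zero (h : x ≤ y) : ρ.Rel x y i 0 0 :=
  ⟨0, 0, ⟨h, .zero, .zero, fun _ _ _ => rfl⟩, by simp, by simp⟩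

theorem add (h : ρ.Rel x y i X Y) (h' : ρ.Rel x y i X' Y') : ρ.Rel x y i (X + X') (Y + Y') := by
  obtain ⟨s, t, h, rfl, rfl⟩ := h
  obtain ⟨s', t', h', rfl, rfl⟩ := h'
  exact ⟨s + s', t + t', ⟨h.le, h.left.add h'.left, h.right.add h'.right, fun q j hq => by
    simp [h.eq q j hq, h'.eq q j hq]⟩, (inj_add _ _ _ _).symm, (inj_add _ _ _ _).symm⟩

theorem smul (r : R) (h : ρ.Rel x y i X Y) : ρ.Rel x y i (r • X) (r • Y) := by
  obtain ⟨s, t, h, rfl, rfl⟩ := h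
  exact ⟨r • s, r • t, ⟨h.le, h.left.smul r, h.right.smul r, fun q j hq => by
    simp [h.eq q j hq]⟩, (inj_smul _ _ _ _).symm, (inj_smul _ _ _ _).symm⟩

theorem zsmul (r : ℤ) (h : ρ.Rel x y i X Y) : ρ.Rel x y i (r • X) (r • Y) := by
  obtain ⟨s, t, h, rfl, rfl⟩ := h
  exact ⟨r • s, r • t, ⟨h.le, h.left.zsmul r, h.right.zsmul r, fun q j hq => by
    simp [h.eq q j hq]⟩, (inj_zsmul _ _ _ _).symm, (inj_zsmul _ _ _ _).symm⟩

theorem sub (h : ρ.Rel x y i X Y) (h' : ρ.Rel x y i X' Y') : ρ.Rel x y i (X - X') (Y - Y') := by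
  simpa [sub_eq_add_neg] using h.add (h'.zsmul (-1))

theorem cast (h : ρ.Rel x y i X Y) (hx : x = x') (hy : y = y') (hi : i = j) :
    ρ.Rel x' y' j X Y := by
  subst hx hy hi; exact h

theorem d (h : ρ.Rel x y i X Y) : ρ.Rel x y (i + 1) (ℬ.d X) (ℬ.d Y) := by
  obtain ⟨s, t, h, rfl, rfl⟩ := h
  refine ⟨dFam s, dFam t, ⟨h.le, sec_dFam h.left rfl, sec_dFam h.right rfl, fun q j hq => ?_⟩,
    inj_d rfl s, inj_d rfl t⟩
  rw [dFam, dFam, h.eq q _ hq]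

theorem lm {X Y : A.Tot} {X' Y' : N} (h : A.selfReal.Rel x y i X Y) (h' : ρ.Rel x' y' j X' Y') :
    ρ.Rel (x + x') (y + y') (i + j) (ℬ.lm X X') (ℬ.lm Y Y') := by
  obtain ⟨s, t, h, rfl, rfl⟩ := h
  obtain ⟨s', t', h', rfl, rfl⟩ := h'
  refine ⟨_, _, ⟨Per.add_le_add' h.le h'.le, sec_lact h.left h'.left, sec_lact h.right h'.right,
    fun q k hq => ?_⟩, inj_lact h.left h'.left, inj_lact h.right h'.right⟩
  by_cases hk : i + j = k
  · have hy : y ≤ y.hull.per := Per.le_hull ((Per.le_add_right' _ _).trans hq)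
    have hy' : y' ≤ y'.hull.per := Per.le_hull ((Per.le_add_left' _ _).trans hq)
    have hq' : y.hull.per + y'.hull.per ≤ q.per :=
      (Per.hull_add_hull_le_iff (hy.trans (GMPerversity.per_le_top _))
        (hy'.trans (GMPerversity.per_le_top _))).2 hq
    rw [lact_eval h.left h'.left (h.le.trans hy) (h'.le.trans hy') hq' hk,
      lact_eval h.right h'.right hy hy' hq' hk, h.eq _ _ hy, h'.eq _ _ hy']
  · rw [lact_neg fun h => hk h.2, lact_neg fun h => hk h.2]

theorem rm {X Y : N} {X' Y' : A.Tot} (h : ρ.Rel x y i X Y) (h' : A.selfReal.Rel x' y' j X' Y') :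
    ρ.Rel (x + x') (y + y') (i + j) (ℬ.rm X X') (ℬ.rm Y Y') := by
  obtain ⟨s, t, h, rfl, rfl⟩ := h
  obtain ⟨s', t', h', rfl, rfl⟩ := h'
  refine ⟨_, _, ⟨Per.add_le_add' h.le h'.le, sec_ract h.left h'.left, sec_ract h.right h'.right,
    fun q k hq => ?_⟩, inj_ract h.left h'.left, inj_ract h.right h'.right⟩
  by_cases hk : i + j = k
  · have hy : y ≤ y.hull.per := Per.le_hull ((Per.le_add_right' _ _).trans hq)
    have hy' : y' ≤ y'.hull.per := Per.le_hull ((Per.le_add_left' _ _).trans hq)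
    have hq' : y.hull.per + y'.hull.per ≤ q.per :=
      (Per.hull_add_hull_le_iff (hy.trans (GMPerversity.per_le_top _))
        (hy'.trans (GMPerversity.per_le_top _))).2 hq
    rw [ract_eval h.left h'.left (h.le.trans hy) (h'.le.trans hy') hq' hk,
      ract_eval h.right h'.right hy hy' hq' hk, h.eq _ _ hy, h'.eq _ _ hy']
  · rw [ract_neg fun h => hk h.2, ract_neg fun h => hk h.2]

theorem tw_left {X Y : A.Tot} (h : A.selfReal.Rel x y i X Y) :
    A.totAlg.tw X = sg (i + 1) • X ∧ A.totAlg.tw Y = sg (i + 1) • Y := by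
  obtain ⟨s, t, h, rfl, rfl⟩ := h
  exact ⟨totTw_inc _, totTw_inc _⟩

theorem twz {X Y : A.Tot} (h : A.selfReal.Rel x y i X Y) (k : ZMod 2) :
    A.selfReal.Rel x y i (A.totAlg.twz k X) (A.totAlg.twz k Y) := by
  rcases zmod_two_cases k with rfl | rfl
  · simpa using h
  · rw [DGAlg.twz_one, DGAlg.twz_one, h.tw_left.1, h.tw_left.2]
    exact h.zsmul _

end Rel

end Realization

/-! ### Related words -/

/-- Letterwise related words. -/
inductive WRel : Per n → Per n → ℤ → List A.Tot → List A.Tot → Prop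
  | nil : WRel 0 0 0 [] []
  | cons {x y u v : Per n} {i k : ℤ} {X Y : A.Tot} {l l' : List A.Tot} :
    A.selfReal.Rel x y i X Y → WRel u v k l l' →
      WRel (x + u) (y + v) (i - 1 + k) (X :: l) (Y :: l')

namespace WRel

variable {u v u' v' x y : Per n} {k k' i : ℤ} {l l' m m' : List A.Tot}

theorem le (h : WRel u v k l l') : u ≤ v := by
  induction h with
  | nil => exact le_rfl
  | cons h _ ih => exact Per.add_le_add' h.le ih

theorem cast (h : WRel u v k l l') (hu : u = u') (hv : v = v') (hk : k = k') :
    WRel u' v' k' l l' := by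
  subst hu hv hk; exact h

theorem append (h : WRel u v k l l') (h' : WRel u' v' k' m m') :
    WRel (u + u') (v + v') (k + k') (l ++ m) (l' ++ m') := by
  induction h with
  | nil => simpa using h'
  | cons h _ ih => exact (cons h ih).cast (by abel) (by abel) (by ring)

theorem twl (h : WRel u v k l l') (e : ZMod 2) :
    WRel u v k (A.totAlg.twl e l) (A.totAlg.twl e l') := by
  induction h with
  | nil => exact nil
  | cons h _ ih => exact cons (h.twz e) ih

theorem splitSum {N : Type w} [AddCommMonoid N] {S : N → N → Prop}
    (hS : ∀ a b a' b', S a b → S a' b' → S (a + a') (b + b')) {F F' : List A.Tot → List A.Tot → N}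
    (hw : WRel u v k l l')
    (h : ∀ u₁ v₁ k₁ p p' u₂ v₂ k₂ q q', WRel u₁ v₁ k₁ p p' → WRel u₂ v₂ k₂ q q' → u₁ + u₂ = u →
      v₁ + v₂ = v → k₁ + k₂ = k → S (F p q) (F' p' q')) :
    S (_root_.splitSum F l) (_root_.splitSum F' l') := by
  induction hw generalizing F F' with
  | nil => exact h _ _ _ _ _ _ _ _ _ _ nil nil (by simp) (by simp) (by simp)
  | cons h₀ hw ih =>
    refine hS _ _ _ _ (h _ _ _ _ _ _ _ _ _ _ nil (cons h₀ hw) (by simp) (by simp) (by simp))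
      (ih fun u₁ v₁ k₁ p p' u₂ v₂ k₂ q q' h₁ h₂ hu hv hk => ?_)
    exact h _ _ _ _ _ _ _ _ _ _ (cons h₀ h₁) h₂ (by rw [← hu]; abel) (by rw [← hv]; abel)
      (by rw [← hk]; abel)

theorem splitSum₃ {N : Type w} [AddCommMonoid N] {S : N → N → Prop}
    (hS : ∀ a b a' b', S a b → S a' b' → S (a + a') (b + b'))
    {F F' : List A.Tot → List A.Tot → List A.Tot → N} (hw : WRel u v k l l')
    (h : ∀ u₁ v₁ k₁ p p' u₂ v₂ k₂ q q' u₃ v₃ k₃ r r', WRel u₁ v₁ k₁ p p' → WRel u₂ v₂ k₂ q q' →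
      WRel u₃ v₃ k₃ r r' → u₁ + u₂ + u₃ = u → v₁ + v₂ + v₃ = v → k₁ + k₂ + k₃ = k →
      S (F p q r) (F' p' q' r')) :
    S (_root_.splitSum₃ F l) (_root_.splitSum₃ F' l') := by
  refine hw.splitSum hS fun u₁ v₁ k₁ p p' u₂ v₂ k₂ q q' h₁ h₂ hu hv hk => ?_
  refine h₂.splitSum hS fun u₂' v₂' k₂' q q' u₃ v₃ k₃ r r' h₂ h₃ hu' hv' hk' => ?_
  exact h _ _ _ _ _ _ _ _ _ _ _ _ _ _ _ h₁ h₂ h₃ (by rw [← hu, ← hu', add_assoc])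
    (by rw [← hv, ← hv', add_assoc]) (by rw [← hk, ← hk', add_assoc])

end WRel

/-! ### Related cochains -/

/-- Functions on words preserving relations, of perverse degree `x` and `y` and of degree `c`. -/
def GoodRel {N : Type w} (S : Per n → Per n → ℤ → N → N → Prop) (x y : Per n) (c : ℤ)
    (F F' : List A.Tot → N) : Prop :=
  ∀ ⦃u v k l l'⦄, WRel u v k l l' → S (x + u) (y + v) (c + k) (F l) (F' l')

section GoodRel

variable {M : PBimod A} {N : Type w} [AddCommGroup N] [Module R N] {ℬ : DGBimod A.totAlg N}
  {ρ : Realization M ℬ} {N₁ N₂ : Type*} [AddCommGroup N₁] [Module R N₁] [AddCommGroup N₂]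
  [Module R N₂] {S₁ : Per n → Per n → ℤ → N₁ → N₁ → Prop} {S₂ : Per n → Per n → ℤ → N₂ → N₂ → Prop}
  {S : Per n → Per n → ℤ → N → N → Prop}
  {x y x' y' x'' y'' : Per n} {c c' c'' : ℤ} {F F' : List A.Tot → N}
  {G G' H H' : List A.Tot → A.Tot}

theorem GoodRel.cast (h : GoodRel S x y c F F') (hx : x = x') (hy : y = y') (hc : c = c') :
    GoodRel S x' y' c' F F' := by
  subst hx hy hc; exact h

theorem good_conv (hS : ∀ x y i a b a' b', S x y i a b → S x y i a' b' → S x y i (a + a') (b + b'))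
    {β : N₁ →ₗ[R] N₂ →ₗ[R] N}
    (hβ : ∀ x y x' y' i j X Y X' Y', S₁ x y i X Y → S₂ x' y' j X' Y' →
      S (x + x') (y + y') (i + j) (β X X') (β Y Y'))
    (e : ZMod 2) {F F' : List A.Tot → N₁} {G G' : List A.Tot → N₂} (hF : GoodRel S₁ x y c F F')
    (hG : GoodRel S₂ x' y' c' G G') :
    GoodRel S (x + x') (y + y') (c + c') (A.totAlg.conv β e F G) (A.totAlg.conv β e F' G') := by
  intro u v k l l' hw
  refine hw.splitSum (hS _ _ _) fun u₁ v₁ k₁ p p' u₂ v₂ k₂ q q' h₁ h₂ hu hv hk => ?_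
  have := hβ _ _ _ _ _ _ _ _ _ _ (hF (h₁.twl e)) (hG h₂)
  rw [← hu, ← hv, ← hk]
  convert this using 1 <;> abel

theorem good_circ (hS : ∀ x y i a b a' b', S x y i a b → S x y i a' b' → S x y i (a + a') (b + b'))
    (e : ZMod 2) (hF : GoodRel S x y c F F') (hG : GoodRel A.selfReal.Rel x' y' c' G G') :
    GoodRel S (x + x') (y + y') (c + c' - 1) (A.totAlg.circ e F G) (A.totAlg.circ e F' G') := by
  intro u v k l l' hw
  refine hw.splitSum₃ (hS _ _ _)
    fun u₁ v₁ k₁ p p' u₂ v₂ k₂ q q' u₃ v₃ k₃ r r' h₁ h₂ h₃ hu hv hk => ?_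
  have := hF ((h₁.twl e).append (.cons (hG h₂) h₃))
  rw [← hu, ← hv, ← hk]
  convert this using 1
  · abel
  · abel
  · ring

theorem good_lm (e : ZMod 2) (hG : GoodRel A.selfReal.Rel x y c G G')
    (hF : GoodRel ρ.Rel x' y' c' F F') :
    GoodRel ρ.Rel (x + x') (y + y') (c + c') (A.totAlg.conv ℬ.lm e G F)
      (A.totAlg.conv ℬ.lm e G' F') :=
  good_conv (fun _ _ _ _ _ _ _ h h' => h.add h') (fun _ _ _ _ _ _ _ _ _ _ h h' => h.lm h') e hG hF

theorem good_rm (e : ZMod 2) (hF : GoodRel ρ.Rel x y c F F')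
    (hG : GoodRel A.selfReal.Rel x' y' c' G G') :
    GoodRel ρ.Rel (x + x') (y + y') (c + c') (A.totAlg.conv ℬ.rm e F G)
      (A.totAlg.conv ℬ.rm e F' G') :=
  good_conv (fun _ _ _ _ _ _ _ h h' => h.add h') (fun _ _ _ _ _ _ _ _ _ _ h h' => h.rm h') e hF hG

theorem good_mul (e : ZMod 2) (hG : GoodRel A.selfReal.Rel x y c G G')
    (hH : GoodRel A.selfReal.Rel x' y' c' H H') :
    GoodRel A.selfReal.Rel (x + x') (y + y') (c + c') (A.totAlg.conv A.totAlg.mul e G H)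
      (A.totAlg.conv A.totAlg.mul e G' H') :=
  good_lm e hG hH

theorem good_circ' (e : ZMod 2) (hF : GoodRel ρ.Rel x y c F F')
    (hG : GoodRel A.selfReal.Rel x' y' c' G G') :
    GoodRel ρ.Rel (x + x') (y + y') (c + c' - 1) (A.totAlg.circ e F G) (A.totAlg.circ e F' G') :=
  good_circ (fun _ _ _ _ _ _ _ h h' => h.add h') e hF hG

theorem GoodRel.add {F₂ F₂' : List A.Tot → N} (hF : GoodRel ρ.Rel x y c F F')
    (hF' : GoodRel ρ.Rel x y c F₂ F₂') : GoodRel ρ.Rel x y c (F + F₂) (F' + F₂') :=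
  fun _ _ _ _ _ h => (hF h).add (hF' h)

theorem GoodRel.sub {F₂ F₂' : List A.Tot → N} (hF : GoodRel ρ.Rel x y c F F')
    (hF' : GoodRel ρ.Rel x y c F₂ F₂') : GoodRel ρ.Rel x y c (F - F₂) (F' - F₂') :=
  fun _ _ _ _ _ h => (hF h).sub (hF' h)

theorem GoodRel.zsmul (r : ℤ) (hF : GoodRel ρ.Rel x y c F F') :
    GoodRel ρ.Rel x y c (r • F) (r • F') := fun _ _ _ _ _ h => (hF h).zsmul r

theorem GoodRel.smul (r : R) (hF : GoodRel ρ.Rel x y c F F') :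
    GoodRel ρ.Rel x y c (r • F) (r • F') := fun _ _ _ _ _ h => (hF h).smul r

theorem good_id1 : GoodRel A.selfReal.Rel 0 0 1 (DGAlg.id1 : List A.Tot → A.Tot) DGAlg.id1 := by
  intro u v k l l' hw
  have hle := hw.le
  cases hw with
  | nil => exact .zero (by simpa using hle)
  | cons h hw =>
    cases hw with
    | nil => exact h.cast (by simp) (by simp) (by ring)
    | cons h' hw => exact .zero (by simpa using hle)

theorem good_mm : GoodRel A.selfReal.Rel 0 0 2 A.totAlg.mm A.totAlg.mm := by
  have h1 := (good_mul 1 good_id1 good_id1).cast (A := A) (x' := 0) (y' := 0) (c' := 2) (by simp)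
    (by simp) (by norm_num)
  intro u v k l l' hw
  exact (((good_id1 hw).d (ℬ := A.totAlg.selfBimod)).cast rfl rfl (by ring)).sub (h1 hw)

theorem good_hD (e : ZMod 2) (hF : GoodRel ρ.Rel x y c F F') :
    GoodRel ρ.Rel x y (c + 1) (DGAlg.hD ℬ e F) (DGAlg.hD ℬ e F') := by
  intro u v k l l' hw
  have h1 : ρ.Rel _ _ _ _ _ := (hF hw).d
  have h2 := good_circ' 1 hF good_mm hw
  have h3 := good_lm e good_id1 hF hw
  have h4 := good_rm 1 hF good_id1 hw
  refine (((h1.cast rfl rfl (by ring)).add ((h2.cast (by simp) (by simp) (by ring)).zsmul _)).sub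
    (h3.cast (by simp) (by simp) (by ring))).add ((h4.cast (by simp) (by simp) (by ring)).zsmul _)

theorem good_brace (e e' : ZMod 2) (hF : GoodRel ρ.Rel x y c F F')
    (hG : GoodRel A.selfReal.Rel x' y' c' G G') (hH : GoodRel A.selfReal.Rel x'' y'' c'' H H') :
    GoodRel ρ.Rel (x + x' + x'') (y + y' + y'') (c + c' + c'' - 2) (A.totAlg.brace e e' F G H)
      (A.totAlg.brace e e' F' G' H') := by
  intro u v k l l' hw
  refine hw.splitSum₃ (fun _ _ _ _ h h' => h.add h')
    fun u₁ v₁ k₁ p p' u₂ v₂ k₂ q q' u₃ v₃ k₃ r r' h₁ h₂ h₃ hu hv hk => ?_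
  refine h₃.splitSum₃ (fun _ _ _ _ h h' => h.add h')
    fun u₄ v₄ k₄ p₂ p₂' u₅ v₅ k₅ q₂ q₂' u₆ v₆ k₆ r₂ r₂' h₄ h₅ h₆ hu' hv' hk' => ?_
  have := hF ((h₁.twl (e + e')).append (.cons (hG (h₂.twl e')) ((h₄.twl e').append
    (.cons (hH h₅) h₆))))
  rw [← hu, ← hv, ← hk, ← hu', ← hv', ← hk']
  exact this.cast (by abel) (by abel) (by ring)

end GoodRel

/-! ### Words of homogeneous elements -/

/-- The element of the total algebra given by a letter. -/
noncomputable def el (a : A.Letter) : A.Tot := A.inc a.per a.deg a.val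

theorem perSum_cons (a : A.Letter) (l : List A.Letter) :
    perSum (a :: l) = a.per.toFun + perSum l := by simp [perSum]

theorem perSum_append (l l' : List A.Letter) : perSum (l ++ l') = perSum l + perSum l' := by
  simp [perSum]

@[simp] theorem wordDeg_nil : wordDeg ([] : List A.Letter) = 0 := rfl

@[simp] theorem wordDeg_cons (a : A.Letter) (l : List A.Letter) :
    wordDeg (a :: l) = a.deg - 1 + wordDeg l := by simp [wordDeg]

@[simp] theorem wordDeg_append (l l' : List A.Letter) :
    wordDeg (l ++ l') = wordDeg l + wordDeg l' := by simp [wordDeg]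

/-- The sum of the perverse degrees of the letters of a word. -/
def psum (l : List A.Letter) : Per n := ⟨perSum l, by
  induction l with
  | nil => exact (0 : Per n).2
  | cons a l ih => rw [perSum_cons]; exact a.per.monotone.add ih⟩

@[simp] theorem psum_nil : psum ([] : List A.Letter) = 0 := rfl

@[simp] theorem psum_cons (a : A.Letter) (l : List A.Letter) :
    psum (a :: l) = a.per.per + psum l := Subtype.ext (perSum_cons a l)

@[simp] theorem psum_append (l l' : List A.Letter) : psum (l ++ l') = psum l + psum l' :=
  Subtype.ext (perSum_append l l')

theorem per_add_psum_le {r q : GMPerversity n} {l : List A.Letter} :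
    r.per + psum l ≤ q.per ↔ r.toFun + perSum l ≤ q.toFun := Iff.rfl

theorem wrel_letters (l : List A.Letter) : WRel (psum l) (psum l) (wordDeg l) (l.map el) (l.map el) := by
  induction l with
  | nil => exact .nil
  | cons a l ih =>
    rw [psum_cons, wordDeg_cons]
    refine .cons ⟨fam A.self _ _ a.val, fam A.self _ _ a.val, ⟨le_rfl, sec_fam _ _ _, sec_fam _ _ _,
      fun _ _ _ => rfl⟩, ?_, ?_⟩ ih <;> exact (Realization.inj_fam (ρ := A.selfReal) _ _ _).symm

theorem rel_res {p q : GMPerversity n} {i : ℤ} (h : p ≤ q) (a : A.X p i) :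
    A.selfReal.Rel p.per q.per i (el ⟨p, i, a⟩) (el ⟨q, i, A.res h a⟩) := by
  refine ⟨fam A.self p i a, fam A.self q i (A.res h a), ⟨h, sec_fam _ _ _, sec_fam _ _ _, ?_⟩,
    (Realization.inj_fam (ρ := A.selfReal) _ _ _).symm,
    (Realization.inj_fam (ρ := A.selfReal) _ _ _).symm⟩
  intro r j hr
  have hqr : q ≤ r := GMPerversity.per_le_per.1 hr
  by_cases hj : i = j
  · subst hj
    rw [fam_apply _ _ (h.trans hqr), fam_apply _ _ hqr]
    exact (A.res_trans _ _ _).symm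
  · rw [(sec_fam (M := A.self) p i a).supp _ _ fun h => hj h.2.symm,
      (sec_fam (M := A.self) q i _).supp _ _ fun h => hj h.2.symm]

/-- The second letter is the image of the first one. -/
inductive LRel : A.Letter → A.Letter → Prop
  | mk (p q : GMPerversity n) (i : ℤ) (h : p ≤ q) (a : A.X p i) : LRel ⟨p, i, a⟩ ⟨q, i, A.res h a⟩

theorem IsCochain.forall₂ {M : PBimod A} {r : GMPerversity n} {c : ℤ} {f : A.RawCochain M}
    (hf : IsCochain M r c f) {l l' : List A.Letter} (h : List.Forall₂ LRel l l')
    (m : List A.Letter) (q : GMPerversity n) (j : ℤ) (hq : r.per + psum (m ++ l') ≤ q.per) :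
    f (m ++ l') q j = f (m ++ l) q j := by
  induction h generalizing m with
  | nil => rfl
  | @cons a b l l' h hl ih =>
    cases h with
    | mk p p' i h a =>
      rw [hf.map_res m l' p p' i h a q j hq]
      have := ih (m ++ [⟨p, i, a⟩])
      simp only [List.append_assoc, List.cons_append, List.nil_append] at this
      refine this (le_trans ?_ hq)
      refine Per.add_le_add' le_rfl ?_
      simp only [psum_append, psum_cons]
      exact Per.add_le_add' le_rfl (Per.add_le_add' h le_rfl)

/-- The upper bounds of `u` and of the perverse degrees of `l` agree, up to degenerate cases. -/
def Near (u : Per n) (l : List A.Letter) : Prop :=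
  (∀ (s : Per n) (q : GMPerversity n), psum l + s ≤ q.per ↔ u + s ≤ q.per) ∨
    (0 ∈ l.map el ∧ ¬ u ≤ (GMPerversity.top n).per)

theorem near_cons {x u : Per n} {i : ℤ} {s : Fam A.self} (hs : Sec x i s) {l : List A.Letter}
    (h : Near u l) : Near (x + u) (⟨x.hull, i, s x.hull i⟩ :: l) := by
  by_cases hx : x ≤ (GMPerversity.top n).per
  · rcases h with h | ⟨h, h'⟩
    · left
      intro t q
      rw [psum_cons, add_assoc, Per.hull_add_le_iff hx, add_left_comm, h, add_left_comm, add_assoc]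
    · right
      refine ⟨by rw [List.map_cons]; exact List.mem_cons_of_mem _ h, fun h'' => h' ?_⟩
      exact (Per.le_add_left' _ _).trans h''
  · right
    refine ⟨?_, fun h'' => hx ((Per.le_add_right' _ _).trans h'')⟩
    rw [hs.eq_zero hx]
    simp [el]

theorem WRel.exists_letters {u v : Per n} {k : ℤ} {L L' : List A.Tot} (h : WRel u v k L L') :
    ∃ l l' : List A.Letter, L = l.map el ∧ L' = l'.map el ∧ wordDeg l = k ∧ wordDeg l' = k ∧
      Near u l ∧ Near v l' ∧ (v ≤ (GMPerversity.top n).per → List.Forall₂ LRel l l') := by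
  induction h with
  | nil => exact ⟨[], [], rfl, rfl, rfl, rfl, .inl fun _ _ => Iff.rfl, .inl fun _ _ => Iff.rfl,
      fun _ => .nil⟩
  | @cons x y u v i k X Y L L' h _ ih =>
    obtain ⟨l, l', rfl, rfl, rfl, h4, h5, h6, h7⟩ := ih
    obtain ⟨s, t, hst, rfl, rfl⟩ := h
    refine ⟨⟨x.hull, i, s x.hull i⟩ :: l, ⟨y.hull, i, t y.hull i⟩ :: l', rfl, rfl, by simp,
      by simp [h4], near_cons hst.left h5, near_cons hst.right h6, fun hy => ?_⟩
    refine .cons ?_ (h7 ((Per.le_add_left' _ _).trans hy))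
    have hy' : y ≤ y.hull.per := Per.le_hull ((Per.le_add_right' _ _).trans hy)
    have hx := hst.le.trans hy'
    rw [← hst.eq _ _ hy', ← hst.left.res_hull hx]
    exact .mk _ _ _ _ _

/-! ### Multilinear extension -/

section Extension

variable {N : Type w} [AddCommGroup N] [Module R N]

theorem mlin_ext {F F' : List A.Tot → N} (hF : MLin R F) (hF' : MLin R F')
    (h : ∀ l : List A.Letter, F (l.map el) = F' (l.map el)) : F = F' := by
  suffices H : ∀ (L : List A.Tot) (l : List A.Letter), F (l.map el ++ L) = F' (l.map el ++ L) by
    funext L; exact H L []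
  intro L
  induction L with
  | nil => intro l; simpa using h l
  | cons X L ih =>
    intro l
    have : hF.lin (l.map el) L = hF'.lin (l.map el) L := tot_hom_ext fun p i a => by
      have := ih (l ++ [⟨p, i, a⟩])
      simpa [MLin.lin_apply, el] using this
    exact LinearMap.congr_fun this X

variable (A N) in
/-- Multilinear functions on words of letters. -/
def letterMult : Submodule R (List A.Letter → N) where
  carrier := {g | (∀ (l₁ l₂ : List A.Letter) (p : GMPerversity n) (i : ℤ) (a b : A.X p i),
      g (l₁ ++ ⟨p, i, a + b⟩ :: l₂) = g (l₁ ++ ⟨p, i, a⟩ :: l₂) + g (l₁ ++ ⟨p, i, b⟩ :: l₂)) ∧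
    ∀ (l₁ l₂ : List A.Letter) (p : GMPerversity n) (i : ℤ) (s : R) (a : A.X p i),
      g (l₁ ++ ⟨p, i, s • a⟩ :: l₂) = s • g (l₁ ++ ⟨p, i, a⟩ :: l₂)}
  zero_mem' := ⟨by simp, by simp⟩
  add_mem' h h' := ⟨fun l₁ l₂ p i a b => by simp [h.1, h'.1]; abel,
    fun l₁ l₂ p i s a => by simp [h.2, h'.2]⟩
  smul_mem' t g h := ⟨fun l₁ l₂ p i a b => by simp [h.1],
    fun l₁ l₂ p i s a => by simp [h.2, smul_comm t]⟩

/-- The insertion of a first letter. -/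
noncomputable def consL : A.Tot →ₗ[R] letterMult A N →ₗ[R] letterMult A N :=
  A.totLift (N := letterMult A N →ₗ[R] letterMult A N) fun p i => LinearMap.mk₂ R
    (fun (a : A.X p i) (g : letterMult A N) => (⟨fun l => g.1 (⟨p, i, a⟩ :: l),
      fun l₁ l₂ => g.2.1 (_ :: l₁) l₂, fun l₁ l₂ => g.2.2 (_ :: l₁) l₂⟩ : letterMult A N))
    (fun a b g => Subtype.ext (funext fun l => g.2.1 [] l p i a b))
    (fun s a g => Subtype.ext (funext fun l => g.2.2 [] l p i s a))
    (fun a g g' => rfl) (fun s a g => rfl)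

theorem consL_el (a : A.Letter) (g : letterMult A N) (l : List A.Letter) :
    (consL (el a) g).1 l = g.1 (a :: l) := by
  simp [consL, el]

/-- The multilinear extension of a function on words of letters. -/
noncomputable def extend (g : letterMult A N) (L : List A.Tot) : N :=
  (L.foldl (fun g X => consL X g) g).1 []

theorem extend_letters (g : letterMult A N) (l : List A.Letter) : extend g (l.map el) = g.1 l := by
  induction l generalizing g with
  | nil => rfl
  | cons a l ih =>
    have := ih (consL (el a) g)
    rw [consL_el] at this
    exact this

/-- The extension on a given word, as a linear map. -/
noncomputable def extendL (L : List A.Tot) : letterMult A N →ₗ[R] N where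
  toFun g := extend g L
  map_add' g g' := by
    induction L generalizing g g' with
    | nil => rfl
    | cons X L ih => simpa [extend] using ih (consL X g) (consL X g')
  map_smul' s g := by
    induction L generalizing g with
    | nil => rfl
    | cons X L ih => simpa [extend] using ih (consL X g)

theorem mlin_extend (g : letterMult A N) : MLin R (extend g) := by
  refine MLin.of_lin fun u v => ?_
  refine ⟨extendL v ∘ₗ consL.flip (u.foldl (fun g X => consL X g) g), fun a => ?_⟩
  simp [extend, extendL]

end Extension

/-! ### Cochains on the total algebra -/

variable {M : PBimod A} {N : Type w} [AddCommGroup N] [Module R N] {ℬ : DGBimod A.totAlg N}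

namespace Realization

variable (ρ : Realization M ℬ)

/-- Normalized natural multilinear cochains of perverse degree `x` and degree `c`. -/
structure IsHoch (x : Per n) (c : ℤ) (F : List A.Tot → N) : Prop where
  mlin : MLin R F
  norm : A.totAlg.Norm F
  good : GoodRel ρ.Rel x x c F F

/-- The cochain `F` represents the family `f`. -/
structure IsRep (x : Per n) (c : ℤ) (f : A.RawCochain M) (F : List A.Tot → N) : Prop where
  sec : ∀ l, Sec (x + psum l) (c + wordDeg l) (f l)
  eq : ∀ l : List A.Letter, F (l.map el) = ρ.inj (x + psum l) (c + wordDeg l) (f l)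

open Classical in
/-- The section corresponding to an element. -/
noncomputable def ext (x : Per n) (X : N) : Fam M := fun q j =>
  if h : x ≤ q.per then M.res (Per.hull_le h) (ρ.out x.hull j X) else 0

open Classical in
/-- The family given by a cochain of perverse degree `x`, in perverse degrees at least `r`. -/
noncomputable def raw (r : GMPerversity n) (x : Per n) (F : List A.Tot → N) : A.RawCochain M :=
  fun l q j => if r.per + psum l ≤ q.per then ρ.ext (x + psum l) (F (l.map el)) q j else 0

variable {ρ}

theorem ext_inj {x : Per n} {i : ℤ} {s : Fam M} (hs : Sec x i s) : ρ.ext x (ρ.inj x i s) = s := by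
  funext q j
  rw [ext]
  split
  · rename_i h
    by_cases hj : i = j
    · subst hj
      rw [inj, ρ.out_inn, hs.res_hull h]
    · rw [inj, ρ.out_inn_ne _ _ _ _ hj, map_zero, hs.supp _ _ fun h => hj h.2.symm]
  · rename_i h
    rw [hs.supp _ _ fun h' => h h'.1]

theorem ext_add (x : Per n) (X Y : N) : ρ.ext x (X + Y) = ρ.ext x X + ρ.ext x Y := by
  funext q j
  simp only [ext, Pi.add_apply]
  split <;> simp

theorem ext_smul (x : Per n) (a : R) (X : N) : ρ.ext x (a • X) = a • ρ.ext x X := by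
  funext q j
  simp only [ext, Pi.smul_apply]
  split <;> simp

theorem ext_zero (x : Per n) : ρ.ext x (0 : N) = 0 := by
  simpa using ρ.ext_smul x 0 0

theorem raw_add (r : GMPerversity n) (x : Per n) (F G : List A.Tot → N) :
    ρ.raw r x (F + G) = ρ.raw r x F + ρ.raw r x G := by
  funext l q j
  simp only [raw, Pi.add_apply, ext_add]
  split <;> simp

theorem raw_smul (r : GMPerversity n) (x : Per n) (a : R) (F : List A.Tot → N) :
    ρ.raw r x (a • F) = a • ρ.raw r x F := by
  funext l q j
  simp only [raw, Pi.smul_apply, ext_smul]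
  split <;> simp

theorem raw_zero (r : GMPerversity n) (x : Per n) : ρ.raw r x (0 : List A.Tot → N) = 0 := by
  simpa using ρ.raw_smul r x 0 0

theorem IsRep.raw_eq {r : GMPerversity n} {x : Per n} {c : ℤ} {f : A.RawCochain M}
    {F : List A.Tot → N} (h : ρ.IsRep x c f F) : ρ.raw r x F = trunc r f := by
  funext l q j
  rw [raw, trunc, h.eq, ext_inj (h.sec l)]
  rfl

theorem sec_of_mem {r : GMPerversity n} {c : ℤ} {f : A.RawCochain M} (hf : f ∈ HC M r c)
    (l : List A.Letter) : Sec (r.per + psum l) (c + wordDeg l) (f l) :=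
  ⟨fun q j h => hf.support l q j h, fun q q' h j hq => hf.res_map l q q' h j hq⟩

theorem IsHoch.exists_sec {x : Per n} {c : ℤ} {F : List A.Tot → N} (h : ρ.IsHoch x c F)
    (l : List A.Letter) : ∃ s, Sec (x + psum l) (c + wordDeg l) s ∧
      F (l.map el) = ρ.inj (x + psum l) (c + wordDeg l) s := by
  obtain ⟨s, t, hst, h1, -⟩ := h.good (wrel_letters l)
  exact ⟨s, hst.left, h1⟩

theorem raw_apply {r : GMPerversity n} {x : Per n} {F : List A.Tot → N} {l : List A.Letter}
    {q : GMPerversity n} (h : r.per + psum l ≤ q.per) (j : ℤ) :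
    ρ.raw r x F l q j = ρ.ext (x + psum l) (F (l.map el)) q j := if_pos h

theorem raw_apply_neg {r : GMPerversity n} {x : Per n} {F : List A.Tot → N} {l : List A.Letter}
    {q : GMPerversity n} (h : ¬ r.per + psum l ≤ q.per) (j : ℤ) :
    ρ.raw r x F l q j = 0 := if_neg h

theorem _root_.PDGA.letters_insert (l₁ l₂ : List A.Letter) (a : A.Letter) :
    (l₁ ++ a :: l₂).map el = l₁.map el ++ el a :: l₂.map el := by simp

theorem IsHoch.raw_mem {r : GMPerversity n} {x : Per n} {c : ℤ} {F : List A.Tot → N}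
    (h : ρ.IsHoch x c F) (hx : x ≤ r.per) : ρ.raw r x F ∈ HC M r c where
  support l q j hl := by
    by_cases hq : r.per + psum l ≤ q.per
    · obtain ⟨s, hs, h1⟩ := h.exists_sec l
      rw [raw_apply hq, h1, ext_inj hs, hs.supp]
      exact fun h' => hl ⟨hq, h'.2⟩
    · exact raw_apply_neg hq j
  map_add l₁ l₂ p i a b q j := by
    by_cases hq : r.per + psum (l₁ ++ ⟨p, i, a⟩ :: l₂) ≤ q.per
    · have e : ∀ c, psum (l₁ ++ (⟨p, i, c⟩ : A.Letter) :: l₂) = psum (l₁ ++ ⟨p, i, a⟩ :: l₂) := by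
        intro c; simp
      have e' : el (⟨p, i, a + b⟩ : A.Letter) = el ⟨p, i, a⟩ + el ⟨p, i, b⟩ := map_add _ _ _
      rw [raw_apply (by rwa [e]), raw_apply hq, raw_apply (by rwa [e]), e (a + b), e b]
      simp only [letters_insert, e', h.mlin.add, ext_add, Pi.add_apply]
    · rw [raw_apply_neg, raw_apply_neg, raw_apply_neg, add_zero] <;> simpa using hq
  map_smul l₁ l₂ p i s a q j := by
    by_cases hq : r.per + psum (l₁ ++ ⟨p, i, a⟩ :: l₂) ≤ q.per
    · have e : ∀ c, psum (l₁ ++ (⟨p, i, c⟩ : A.Letter) :: l₂) = psum (l₁ ++ ⟨p, i, a⟩ :: l₂) := by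
        intro c; simp
      have e' : el (⟨p, i, s • a⟩ : A.Letter) = s • el ⟨p, i, a⟩ := map_smul _ _ _
      rw [raw_apply (by rwa [e]), raw_apply hq, e (s • a)]
      simp only [letters_insert, e', h.mlin.smul, ext_smul, Pi.smul_apply]
    · rw [raw_apply_neg, raw_apply_neg, smul_zero] <;> simpa using hq
  map_res l₁ l₂ p p' i hp a q j hq := by
    rw [← per_add_psum_le] at hq
    have hq' : r.per + psum (l₁ ++ ⟨p, i, a⟩ :: l₂) ≤ q.per := by
      refine le_trans (Per.add_le_add' le_rfl ?_) hq
      simp only [psum_append, psum_cons]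
      exact Per.add_le_add' le_rfl (Per.add_le_add' hp le_rfl)
    rw [raw_apply hq, raw_apply hq']
    have hw := (wrel_letters l₁).append (.cons (rel_res hp a) (wrel_letters l₂))
    obtain ⟨s, t, hst, h1, h2⟩ := h.good hw
    rw [letters_insert, letters_insert, h1, h2, psum_append, psum_append, psum_cons, psum_cons,
      ext_inj hst.left, ext_inj hst.right]
    refine (hst.eq q j ?_).symm
    refine le_trans (Per.add_le_add' hx ?_) hq
    simp
  res_map l q q' hq j h' := by
    have hq' : r.per + psum l ≤ q.per := h'
    rw [raw_apply hq', raw_apply (hq'.trans hq)]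
    obtain ⟨s, hs, h1⟩ := h.exists_sec l
    rw [h1, ext_inj hs, hs.res]
    exact (Per.add_le_add' hx le_rfl).trans hq'
  normalized l₁ l₂ q j := by
    by_cases hq : r.per + psum (l₁ ++ ⟨GMPerversity.zero n, 0, A.one⟩ :: l₂) ≤ q.per
    · rw [raw_apply hq, letters_insert]
      rw [show F (l₁.map el ++ el ⟨GMPerversity.zero n, 0, A.one⟩ :: l₂.map el) = 0 from h.norm _ _,
        ext_zero]
      rfl
    · exact raw_apply_neg hq j

theorem IsHoch.isRep {r : GMPerversity n} {c : ℤ} {F : List A.Tot → N}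
    (h : ρ.IsHoch r.per c F) : ρ.IsRep r.per c (ρ.raw r r.per F) F := by
  have hm := h.raw_mem le_rfl
  refine ⟨sec_of_mem hm, fun l => ?_⟩
  obtain ⟨s, hs, h1⟩ := h.exists_sec l
  have : ρ.raw r r.per F l = s := by
    funext q j
    by_cases hq : r.per + psum l ≤ q.per
    · rw [raw_apply hq, h1, ext_inj hs]
    · rw [raw_apply_neg hq, hs.supp _ _ fun h' => hq h'.1]
  rw [this, h1]

theorem IsHoch.eq_of_raw_eq {r : GMPerversity n} {c : ℤ} {F G : List A.Tot → N}
    (hF : ρ.IsHoch r.per c F) (hG : ρ.IsHoch r.per c G)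
    (h : ρ.raw r r.per F = ρ.raw r r.per G) : F = G :=
  mlin_ext hF.mlin hG.mlin fun l => by rw [hF.isRep.eq, hG.isRep.eq, h]

theorem inj_near {x u : Per n} {l : List A.Letter}
    (hu : ∀ (s : Per n) (q : GMPerversity n), psum l + s ≤ q.per ↔ u + s ≤ q.per)
    (q : GMPerversity n) : x + psum l ≤ q.per ↔ x + u ≤ q.per := by
  rw [add_comm x, add_comm x, hu]

theorem _root_.MLin.eq_zero_of_mem {A : Type*} [AddCommGroup A] [Module R A] {F : List A → N}
    (hF : MLin R F) {L : List A} (h : (0 : A) ∈ L) : F L = 0 := by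
  obtain ⟨u, v, rfl⟩ := List.append_of_mem h
  exact hF.zero u v

theorem norm_of_letters {F : List A.Tot → N} (hF : MLin R F) (h : ∀ l₁ l₂ : List A.Letter,
    F (l₁.map el ++ A.totAlg.one :: l₂.map el) = 0) : A.totAlg.Norm F := by
  have h1 : ∀ (u : List A.Tot) (l₂ : List A.Letter), F (u ++ A.totAlg.one :: l₂.map el) = 0 := by
    intro u l₂
    exact congrFun (mlin_ext (F := fun u => F (u ++ A.totAlg.one :: l₂.map el)) (F' := fun _ => 0)
      (hF.append _) .fzero fun l₁ => h l₁ l₂) u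
  intro u v
  have h2 : MLin R fun v => F (u ++ A.totAlg.one :: v) := by
    simpa using hF.prepend (u ++ [A.totAlg.one])
  exact congrFun (mlin_ext h2 .fzero fun l₂ => h1 u l₂) v

theorem exists_rep {r : GMPerversity n} {c : ℤ} {f : A.RawCochain M} (hf : f ∈ HC M r c) :
    ∃ F, ρ.IsHoch r.per c F ∧ ρ.IsRep r.per c f F := by
  let g : letterMult A N := ⟨fun l => ρ.inj (r.per + psum l) (c + wordDeg l) (f l), by
    constructor
    · intro l₁ l₂ p i a b
      have e : f (l₁ ++ ⟨p, i, a + b⟩ :: l₂) = f (l₁ ++ ⟨p, i, a⟩ :: l₂) + f (l₁ ++ ⟨p, i, b⟩ :: l₂) := by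
        funext q j; exact hf.map_add _ _ _ _ _ _ _ _
      simp [e, inj_add]
    · intro l₁ l₂ p i s a
      have e : f (l₁ ++ ⟨p, i, s • a⟩ :: l₂) = s • f (l₁ ++ ⟨p, i, a⟩ :: l₂) := by
        funext q j; exact hf.map_smul _ _ _ _ _ _ _ _
      simp [e, inj_smul]⟩
  have hg : ∀ l : List A.Letter, extend g (l.map el) = ρ.inj (r.per + psum l) (c + wordDeg l) (f l) :=
    extend_letters g
  have hm := mlin_extend g
  refine ⟨extend g, ⟨hm, norm_of_letters hm fun l₁ l₂ => ?_, fun u v k L L' hw => ?_⟩,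
    sec_of_mem hf, hg⟩
  · have := hg (l₁ ++ ⟨GMPerversity.zero n, 0, A.one⟩ :: l₂)
    rw [letters_insert] at this
    refine this.trans ?_
    rw [show f (l₁ ++ ⟨GMPerversity.zero n, 0, A.one⟩ :: l₂) = 0 from
      funext fun q => funext fun j => hf.normalized _ _ _ _, inj_zero]
  · have hle := hw.le
    obtain ⟨l, l', rfl, rfl, rfl, hk, h1, h2, h3⟩ := hw.exists_letters
    have hle' : r.per + u ≤ r.per + v := Per.add_le_add' le_rfl hle
    by_cases hv : r.per + v ≤ (GMPerversity.top n).per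
    · have hv' : v ≤ (GMPerversity.top n).per := (Per.le_add_left' _ _).trans hv
      replace h1 := h1.resolve_right fun h => h.2 (hle.trans hv')
      replace h2 := h2.resolve_right fun h => h.2 hv'
      refine ⟨f l, f l', ⟨hle', (sec_of_mem hf l).congr (inj_near h1),
        hk ▸ (sec_of_mem hf l').congr (inj_near h2), fun q j hq => ?_⟩, ?_, ?_⟩
      · exact (hf.forall₂ (h3 hv') [] q j ((inj_near h2 q).2 hq)).symm
      · rw [hg, inj_congr (inj_near h1)]
      · rw [hg, inj_congr (inj_near h2), hk]
    · have hz : extend g (l'.map el) = 0 := by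
        rcases h2 with h2 | h2
        · rw [hg, (sec_of_mem hf l').eq_zero, inj_zero]
          rwa [inj_near h2]
        · exact hm.eq_zero_of_mem h2.1
      rw [hz]
      rcases h1 with h1 | h1
      · refine ⟨f l, 0, ⟨hle', (sec_of_mem hf l).congr (inj_near h1), .zero, fun q j hq => ?_⟩, ?_,
          by simp⟩
        · exact absurd (hq.trans q.per_le_top) hv
        · rw [hg, inj_congr (inj_near h1)]
      · rw [hm.eq_zero_of_mem h1.1]
        exact .zero hle'

theorem IsHoch.good_raw {r : GMPerversity n} {x : Per n} {c : ℤ} {F F₀ : List A.Tot → N}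
    (hF : ρ.IsHoch x c F) (hx : x ≤ r.per) (hF₀ : ρ.IsHoch r.per c F₀)
    (h : ρ.raw r r.per F₀ = ρ.raw r x F) : GoodRel ρ.Rel x r.per c F F₀ := by
  intro u v k L L' hw
  have hle := hw.le
  obtain ⟨s, t, hst, h1, h2⟩ := hF.good hw
  have hle' : x + u ≤ r.per + v := Per.add_le_add' hx hle
  obtain ⟨s₀, t₀, hst₀, h3, h4⟩ := hF₀.good hw
  refine ⟨s, t₀, ⟨hle', hst.left, hst₀.right, fun q j hq => ?_⟩, h1, h4⟩
  have hv' : v ≤ (GMPerversity.top n).per := (Per.le_add_left' _ _).trans (hq.trans q.per_le_top)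
  obtain ⟨l, l', rfl, rfl, rfl, hk, h1', h2', h3'⟩ := hw.exists_letters
  replace h2' := h2'.resolve_right fun h => h.2 hv'
  rw [hst.eq q j ((Per.add_le_add' hx le_rfl).trans hq)]
  have h5 := congrFun (congrFun (congrFun h l') q) j
  have hq' := (inj_near h2' q).2 hq
  rw [raw_apply hq', raw_apply hq', h2, h4, inj_congr (fun q => (inj_near h2' q).symm),
    inj_congr (x := x + v) (fun q => (inj_near h2' q).symm),
    ext_inj (hst₀.right.congr (fun q => (inj_near h2' q).symm)),
    ext_inj (hst.right.congr (fun q => (inj_near h2' q).symm))] at h5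
  exact h5.symm

theorem _root_.PDGA.GoodRel.raw_eq {r : GMPerversity n} {x y : Per n} {c : ℤ}
    {F F₀ : List A.Tot → N} (hF : GoodRel ρ.Rel x y c F F₀) (hy : y ≤ r.per) :
    ρ.raw r y F₀ = ρ.raw r x F := by
  funext l q j
  by_cases hq : r.per + psum l ≤ q.per
  · obtain ⟨s, t, hst, h1, h2⟩ := hF (wrel_letters l)
    rw [raw_apply hq, raw_apply hq, h1, h2, ext_inj hst.left, ext_inj hst.right, hst.eq]
    exact (Per.add_le_add' hy le_rfl).trans hq
  · rw [raw_apply_neg hq, raw_apply_neg hq]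

end Realization

end PDGA

theorem splitSum₃_short {α : Type u} {N : Type v} [AddCommMonoid N]
    (Φ : List α → List α → List α → N) (h0 : ∀ u t, Φ u [] t = 0)
    (h3 : ∀ u a b c v t, Φ u (a :: b :: c :: v) t = 0) (l : List α) :
    splitSum₃ Φ l =
      ∑ i ∈ Finset.range l.length, (match l.drop i with
        | a :: t => Φ (l.take i) [a] t
        | [] => 0)
      + ∑ i ∈ Finset.range l.length, (match l.drop i with
        | a :: b :: t => Φ (l.take i) [a, b] t
        | _ => 0) := by
  induction l generalizing Φ with
  | nil => simp [splitSum₃, h0]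
  | cons a l ih =>
    have h1 : splitSum (Φ []) (a :: l) = Φ [] [a] l + (match a :: l with
        | a :: b :: t => Φ [] [a, b] t
        | _ => 0) := by
      rw [splitSum_cons, h0, zero_add]
      cases l with
      | nil => simp
      | cons b l =>
        rw [splitSum_cons]
        congr 1
        rw [splitSum_of_left_nil]
        exact fun c u v => h3 _ _ _ _ _ _
    have h2 := ih (fun u => Φ (a :: u)) (fun u => h0 _) (fun u => h3 _)
    rw [List.length_cons, Finset.sum_range_succ', Finset.sum_range_succ']
    rw [splitSum₃, splitSum_cons]
    change splitSum (Φ []) (a :: l) + splitSum₃ (fun u => Φ (a :: u)) l = _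
    rw [h1, h2]
    simp only [List.drop_succ_cons, List.take_succ_cons, List.drop_zero, List.take_zero]
    abel

namespace DGAlg

variable {R : Type v} {A : Type u} [CommRing R] [AddCommGroup A] [Module R A] {𝒜 : DGAlg R A}

theorem mm_nil : 𝒜.mm [] = 0 := by simp [mm, conv]

theorem mm_single (a : A) : 𝒜.mm [a] = 𝒜.d a := by
  have := 𝒜.mm_append_cons [] [] a
  simpa using this

theorem mm_pair (a b : A) : 𝒜.mm [a, b] = -𝒜.mul (𝒜.tw a) b := by
  have := 𝒜.mm_append_cons [] [b] a
  simpa using this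

theorem mm_long (a b c : A) (l : List A) : 𝒜.mm (a :: b :: c :: l) = 0 := by
  have := 𝒜.mm_append_cons [] (b :: c :: l) a
  simpa using this

end DGAlg

namespace PDGA

variable {R : Type u} [CommRing R] {n : ℕ} {A : PDGA R n}

theorem totAlg_tw_el (a : A.Letter) : A.totAlg.tw (el a) = sg (a.deg + 1) • el a := totTw_inc _

theorem twz_el (k : ZMod 2) (a : A.Letter) :
    A.totAlg.twz k (el a) = sg (k * (a.deg + 1)) • el a := by
  rcases zmod_two_cases k with rfl | rfl
  · simp
  · rw [DGAlg.twz_one, totAlg_tw_el, _root_.one_mul]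

theorem _root_.MLin.twl_letters {N : Type w} [AddCommGroup N] [Module R N] {F : List A.Tot → N}
    (hF : MLin R F) (k : ZMod 2) (l : List A.Letter) :
    F (A.totAlg.twl k (l.map el)) = sg (k * (wordDeg l : ℤ)) • F (l.map el) := by
  induction l generalizing F with
  | nil => simp
  | cons a l ih =>
    have h1 := ih (hF.prepend [el a])
    simp only [List.cons_append, List.nil_append] at h1
    rw [List.map_cons, DGAlg.twl_cons, twz_el]
    have h2 := hF.zsmul [] (A.totAlg.twl k (l.map el)) (sg (k * (a.deg + 1))) (el a)
    simp only [List.nil_append] at h2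
    rw [h2, h1, sg_smul_smul]
    congr 2
    push_cast [wordDeg_cons]
    linear_combination k * zmod_two_eq_zero

theorem _root_.MLin.twl_letters_append {N : Type w} [AddCommGroup N] [Module R N]
    {F : List A.Tot → N} (hF : MLin R F) (k : ZMod 2) (l : List A.Letter) (m : List A.Tot) :
    F (A.totAlg.twl k (l.map el) ++ m) = sg (k * (wordDeg l : ℤ)) • F (l.map el ++ m) :=
  (hF.append m).twl_letters k l

variable {M : PBimod A} {N : Type w} [AddCommGroup N] [Module R N] {ℬ : DGBimod A.totAlg N}

namespace Realization

/-- The section `s` represents the element `X`. -/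
structure HRep (ρ : Realization M ℬ) (x : Per n) (i : ℤ) (X : N) (s : Fam M) : Prop where
  sec : Sec x i s
  eq : X = ρ.inj x i s

variable {ρ : Realization M ℬ}

section HRep

variable {x y : Per n} {i j : ℤ} {X Y : N} {s t : Fam M}

theorem HRep.zero : ρ.HRep x i 0 0 := ⟨.zero, by simp⟩

theorem HRep.add (h : ρ.HRep x i X s) (h' : ρ.HRep x i Y t) : ρ.HRep x i (X + Y) (s + t) :=
  ⟨h.sec.add h'.sec, by rw [h.eq, h'.eq, inj_add]⟩

theorem HRep.sub (h : ρ.HRep x i X s) (h' : ρ.HRep x i Y t) : ρ.HRep x i (X - Y) (s - t) :=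
  ⟨h.sec.sub h'.sec, by rw [h.eq, h'.eq, inj_sub]⟩

theorem HRep.zsmul (a : ℤ) (h : ρ.HRep x i X s) : ρ.HRep x i (a • X) (a • s) :=
  ⟨h.sec.zsmul a, by rw [h.eq, inj_zsmul]⟩

theorem HRep.sum {ι : Type*} (I : Finset ι) {X : ι → N} {s : ι → Fam M}
    (h : ∀ a ∈ I, ρ.HRep x i (X a) (s a)) : ρ.HRep x i (∑ a ∈ I, X a) (∑ a ∈ I, s a) :=
  ⟨Sec.sum I fun a ha => (h a ha).sec, by rw [inj_sum, Finset.sum_congr rfl fun a ha => (h a ha).eq]⟩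

theorem HRep.cast (h : ρ.HRep x i X s) (hx : x = y) (hi : i = j) : ρ.HRep y j X s := by
  subst hx hi; exact h

theorem HRep.congr (h : ρ.HRep x i X s) (hX : Y = X) (hs : t = s) : ρ.HRep x i Y t := by
  subst hX hs; exact h

theorem HRep.d (h : ρ.HRep x i X s) (e : i + 1 = j) : ρ.HRep x j (ℬ.d X) (dFam s) :=
  ⟨sec_dFam h.sec e, by rw [h.eq, inj_d e]⟩

theorem HRep.lact {X : A.Tot} {Y : N} {a : Fam A.self} (h : A.selfReal.HRep x i X a)
    (h' : ρ.HRep y j Y s) :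
    ρ.HRep (x + y) (i + j) (ℬ.lm X Y) (lact M (a x.hull i) (s y.hull j)) :=
  ⟨sec_lact h.sec h'.sec, by rw [h.eq, h'.eq, inj_lact h.sec h'.sec]⟩

theorem HRep.ract {X : N} {Y : A.Tot} {a : Fam A.self} (h : ρ.HRep x i X s)
    (h' : A.selfReal.HRep y j Y a) :
    ρ.HRep (x + y) (i + j) (ℬ.rm X Y) (ract M (s x.hull i) (a y.hull j)) :=
  ⟨sec_ract h.sec h'.sec, by rw [h.eq, h'.eq, inj_ract h.sec h'.sec]⟩

theorem hrep_el (a : A.Letter) :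
    A.selfReal.HRep a.per.per a.deg (el a) (fam A.self a.per a.deg a.val) :=
  ⟨sec_fam _ _ _, (inj_fam (ρ := A.selfReal) _ _ _).symm⟩

theorem _root_.PDGA.lact_fam {p p' : GMPerversity n} {i i' : ℤ} (a : A.X p i) (m : M.X p' i') :
    PDGA.lact M (fam A.self p i a p.per.hull i) m = PDGA.lact M a m := by
  have : ∀ q, q = p → PDGA.lact M (fam A.self p i a q i) m = PDGA.lact M a m := by
    rintro q rfl
    rw [fam_apply _ _ le_rfl]
    exact congrArg (fun b => PDGA.lact M b m) (A.res_refl a)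
  exact this _ (Per.hull_per p)

theorem _root_.PDGA.ract_fam {p p' : GMPerversity n} {i i' : ℤ} (a : A.X p i) (m : M.X p' i') :
    PDGA.ract M m (fam A.self p i a p.per.hull i) = PDGA.ract M m a := by
  have : ∀ q, q = p → PDGA.ract M m (fam A.self p i a q i) = PDGA.ract M m a := by
    rintro q rfl
    rw [fam_apply _ _ le_rfl]
    exact congrArg (fun b => PDGA.ract M m b) (A.res_refl a)
  exact this _ (Per.hull_per p)

theorem _root_.PDGA.lact_fam_right {p p' : GMPerversity n} {i i' : ℤ} (a : A.X p i) (m : M.X p' i') :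
    PDGA.lact M a (fam M p' i' m p'.per.hull i') = PDGA.lact M a m := by
  have : ∀ q, q = p' → PDGA.lact M a (fam M p' i' m q i') = PDGA.lact M a m := by
    rintro q rfl
    rw [fam_apply _ _ le_rfl]
    exact congrArg (fun b => PDGA.lact M a b) (M.res_refl m)
  exact this _ (Per.hull_per p')

theorem _root_.PDGA.letter_mul (a b : A.Letter) :
    a.mul b = ⟨(a.per.per + b.per.per).hull, a.deg + b.deg, PDGA.lact A.self a.val b.val _ _⟩ := by
  have : ∀ (x y : A.X (a.per.per + b.per.per).hull (a.deg + b.deg)), x = y →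
    (⟨(a.per.per + b.per.per).hull, a.deg + b.deg, x⟩ : A.Letter) = ⟨_, _, y⟩ := by rintro x y rfl; rfl
  refine this _ _ ?_
  by_cases h : a.per.per + b.per.per ≤ (a.per.per + b.per.per).hull.per
  · rw [lact_pos (M := A.self) h rfl]
    exact dif_pos (by exact h)
  · rw [lact_neg (M := A.self) fun h' => h h'.1]
    exact dif_neg (by exact h)

theorem HRep.lact_el (a : A.Letter) (h' : ρ.HRep y j Y s) :
    ρ.HRep (a.per.per + y) (a.deg + j) (ℬ.lm (el a) Y) (PDGA.lact M a.val (s y.hull j)) := by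
  have := (hrep_el a).lact h'
  rwa [lact_fam] at this

theorem HRep.ract_el (a : A.Letter) (h' : ρ.HRep y j Y s) :
    ρ.HRep (y + a.per.per) (j + a.deg) (ℬ.rm Y (el a)) (PDGA.ract M (s y.hull j) a.val) := by
  have := h'.ract (hrep_el a)
  rwa [ract_fam] at this

end HRep

section Translation

variable {r r' : GMPerversity n} {c c' : ℤ} {f : A.RawCochain M} {F : List A.Tot → N}
  {g : A.RawCochain A.self} {G : List A.Tot → A.Tot}

theorem IsRep.hrep {x : Per n} (h : ρ.IsRep x c f F) (l : List A.Letter) :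
    ρ.HRep (x + psum l) (c + wordDeg l) (F (l.map el)) (f l) := ⟨h.sec l, h.eq l⟩

theorem hrep_insert (hf : f ∈ HC M r c) (hF : ρ.IsRep r.per c f F) (hm : MLin R F)
    (u t : List A.Letter) {X : Per n} {k : ℤ} {s : Fam A.self} (hs : Sec X k s) :
    ρ.HRep (r.per + psum u + X + psum t) (c + wordDeg u + (k - 1) + wordDeg t)
      (F (u.map el ++ A.selfReal.inj X k s :: t.map el)) (f (u ++ ⟨X.hull, k, s X.hull k⟩ :: t)) := by
  have h1 : A.selfReal.inj X k s = el ⟨X.hull, k, s X.hull k⟩ := rfl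
  by_cases hX : X ≤ (GMPerversity.top n).per
  · have h2 := hF.hrep (u ++ ⟨X.hull, k, s X.hull k⟩ :: t)
    rw [letters_insert, ← h1] at h2
    have h3 : ∀ q : GMPerversity n, r.per + psum (u ++ (⟨X.hull, k, s X.hull k⟩ : A.Letter) :: t) ≤ q.per ↔
        r.per + psum u + X + psum t ≤ q.per := by
      intro q
      have e1 : r.per + psum (u ++ (⟨X.hull, k, s X.hull k⟩ : A.Letter) :: t) =
          X.hull.per + (r.per + psum u + psum t) := by simp; abel
      have e2 : r.per + psum u + X + psum t = X + (r.per + psum u + psum t) := by abel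
      rw [e1, e2, Per.hull_add_le_iff hX]
    refine HRep.cast (i := c + wordDeg (u ++ (⟨X.hull, k, s X.hull k⟩ : A.Letter) :: t))
      ⟨h2.sec.congr h3, h2.eq.trans (inj_congr h3)⟩ rfl ?_
    simp; ring
  · rw [hs.eq_zero hX, inj_zero, hm.zero]
    have : f (u ++ ⟨X.hull, k, (0 : Fam A.self) X.hull k⟩ :: t) = 0 := by
      funext q j
      have := hf.map_smul u t X.hull k 0 0 q j
      rw [zero_smul, zero_smul] at this
      exact this
    rw [this]
    exact .zero

theorem IsRep.act (hg : A.selfReal.IsRep r.per c g G) (hmg : MLin R G)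
    (hF : ρ.IsRep r'.per c' f F) :
    ρ.IsRep (r.per + r'.per) (c + c') (PDGA.act M r r' c c' g f)
      (A.totAlg.conv ℬ.lm (c' : ℤ) G F) := by
  suffices H : ∀ l, ρ.HRep (r.per + r'.per + psum l) (c + c' + wordDeg l)
      (A.totAlg.conv ℬ.lm (c' : ℤ) G F (l.map el)) (PDGA.act M r r' c c' g f l) from
    ⟨fun l => (H l).sec, fun l => (H l).eq⟩
  intro l
  rw [DGAlg.conv, splitSum_map, splitSum_eq_range]
  refine (HRep.sum _ fun i _ => ?_).congr rfl (t := PDGA.act M r r' c c' g f l)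
    (s := ∑ i ∈ Finset.range (l.length + 1), sg (c' * wordDeg (l.take i) : ℤ) •
      PDGA.lact M (val (M := A.self) r c g (l.take i)) (val r' c' f (l.drop i))) ?_
  · have hl : l = l.take i ++ l.drop i := (List.take_append_drop i l).symm
    have h1 := ((hg.hrep (l.take i)).lact (hF.hrep (l.drop i))).zsmul (sg (c' * wordDeg (l.take i) : ℤ))
    refine (h1.cast ?_ ?_).congr ?_ rfl
    · conv_rhs => rw [hl, psum_append]
      abel
    · conv_rhs => rw [hl, wordDeg_append]
      ring
    · rw [hmg.twl_letters, map_zsmul, LinearMap.smul_apply]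
      push_cast; rfl
  · funext q j
    simp only [PDGA.act, Finset.sum_apply, Pi.smul_apply, negOnePow_smul]

theorem IsRep.circ (hf : f ∈ HC M r c) (hF : ρ.IsRep r.per c f F) (hm : MLin R F)
    (hG : A.selfReal.IsRep r'.per c' g G) (l : List A.Letter) :
    ρ.HRep (r.per + r'.per + psum l) (c + c' - 1 + wordDeg l)
      (A.totAlg.circ (c' + 1 : ℤ) F G (l.map el))
      (∑ i ∈ Finset.range (l.length + 1), ∑ i' ∈ Finset.Icc i l.length,
        sg ((c' - 1) * wordDeg (l.take i) : ℤ) •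
          f (l.take i ++ cochainLetter r' c' g ((l.take i').drop i) :: l.drop i')) := by
  have key : ∀ u v t : List A.Letter, u ++ (v ++ t) = l →
      ρ.HRep (r.per + r'.per + psum l) (c + c' - 1 + wordDeg l)
        (F (A.totAlg.twl (c' + 1 : ℤ) (u.map el) ++ G (v.map el) :: t.map el))
        (sg ((c' - 1) * wordDeg u : ℤ) • f (u ++ cochainLetter r' c' g v :: t)) := by
    rintro u v t rfl
    rw [hm.twl_letters_append, hG.eq]
    refine (((hrep_insert hf hF hm u t (hG.sec v)).zsmul _).cast ?_ ?_).congr ?_ rfl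
    · simp only [psum_append]; abel
    · simp only [wordDeg_append]; ring
    · congr 2
      push_cast
      rw [show (c' : ZMod 2) - 1 = c' + 1 by
        linear_combination -zmod_two_eq_zero]
  rw [DGAlg.circ, splitSum₃, splitSum_map, splitSum_eq_range]
  refine HRep.sum _ fun i hi => ?_
  rw [splitSum_map, splitSum_eq_range, List.length_drop]
  have e : Finset.Icc i l.length = (Finset.range (l.length - i + 1)).image (i + ·) := by
    ext k
    simp only [Finset.mem_range] at hi
    simp only [Finset.mem_Icc, Finset.mem_image, Finset.mem_range]
    constructor
    · rintro ⟨h1, h2⟩; exact ⟨k - i, by omega, by omega⟩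
    · rintro ⟨a, h1, rfl⟩; omega
  rw [e, Finset.sum_image (by intro a _ b _ h; simpa using h)]
  refine HRep.sum _ fun k _ => ?_
  have h1 : (l.take (i + k)).drop i = (l.drop i).take k := by
    rw [List.drop_take]; simp
  have h2 : l.drop (i + k) = (l.drop i).drop k := by rw [List.drop_drop]
  rw [h1, h2]
  exact key _ _ _ (by simp)

theorem hrep_termDiff (hF : ρ.IsRep r.per c f F) (hm : MLin R F)
    (u t : List A.Letter) (a : A.Letter) :
    ρ.HRep (r.per + psum (u ++ a :: t)) (c + 1 + wordDeg (u ++ a :: t))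
      (F (A.totAlg.twl 1 (u.map el) ++ A.totAlg.mm [el a] :: t.map el))
      (sg (wordDeg u : ℤ) • f (u ++ a.diff :: t)) := by
  have h1 : A.totAlg.d (el a) = el a.diff := totD_inc rfl _
  rw [hm.twl_letters_append, DGAlg.mm_single, h1, _root_.one_mul, ← letters_insert]
  refine ((hF.hrep (u ++ a.diff :: t)).zsmul _).cast ?_ ?_
  · simp [Letter.diff]
  · simp [Letter.diff]; ring

theorem hrep_termMul (hf : f ∈ HC M r c) (hF : ρ.IsRep r.per c f F) (hm : MLin R F)
    (u t : List A.Letter) (a b : A.Letter) :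
    ρ.HRep (r.per + psum (u ++ a :: b :: t)) (c + 1 + wordDeg (u ++ a :: b :: t))
      (F (A.totAlg.twl 1 (u.map el) ++ A.totAlg.mm [el a, el b] :: t.map el))
      (-sg (wordDeg (u ++ [a]) : ℤ) • f (u ++ a.mul b :: t)) := by
  have hab := (hrep_el b).lact_el (ρ := A.selfReal) a
  rw [lact_fam_right] at hab
  have h2 := hrep_insert hf hF hm u t hab.sec
  rw [← letter_mul] at h2
  have h3 : A.totAlg.mul (A.totAlg.tw (el a)) (el b) =
      sg (a.deg + 1) • A.selfReal.inj (a.per.per + b.per.per) (a.deg + b.deg)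
        (PDGA.lact A.self a.val b.val) := by
    rw [totAlg_tw_el, map_zsmul, LinearMap.smul_apply, ← hab.eq]
    rfl
  rw [hm.twl_letters_append, DGAlg.mm_pair, h3, hm.neg, hm.zsmul, smul_neg, sg_smul_smul, ← neg_smul]
  refine ((h2.zsmul _).cast ?_ ?_).congr ?_ rfl
  · simp only [psum_append, psum_cons]; abel
  · simp only [wordDeg_append, wordDeg_cons]; ring
  · congr 2
    simp only [wordDeg_append, wordDeg_cons, wordDeg_nil]
    push_cast
    congr 1
    linear_combination zmod_two_eq_zero

theorem hrep_circ_mm (hf : f ∈ HC M r c) (hF : ρ.IsRep r.per c f F) (hm : MLin R F)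
    (l : List A.Letter) :
    ρ.HRep (r.per + psum l) (c + 1 + wordDeg l) (sg c • A.totAlg.circ 1 F A.totAlg.mm (l.map el))
      ((fun q j => ∑ i ∈ Finset.range l.length, termDiff c f l q j i)
        - fun q j => ∑ i ∈ Finset.range l.length, termMul c f l q j i) := by
  rw [DGAlg.circ, splitSum₃_map, splitSum₃_short, smul_add, Finset.smul_sum, Finset.smul_sum,
    sub_eq_add_neg]
  · refine .add ((HRep.sum _ (s := fun i q j => termDiff c f l q j i) fun i hi => ?_).congr rfl ?_)
      ((HRep.sum _ (s := fun i => -fun q j => termMul c f l q j i) fun i hi => ?_).congr rfl ?_)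
    · rcases h : l.drop i with _ | ⟨a, t⟩
      · rw [List.drop_eq_nil_iff] at h
        simp only [Finset.mem_range] at hi
        omega
      · have hl : l.take i ++ a :: t = l := by rw [← h, List.take_append_drop]
        refine ((hrep_termDiff hF hm (l.take i) t a).zsmul (sg c)).congr ?_ ?_ |>.cast
          (by rw [hl]) (by rw [hl])
        · rfl
        · funext q j
          simp only [termDiff, h, Pi.smul_apply, negOnePow_smul, sg_smul_smul]
          push_cast
          rw [add_comm (c : ZMod 2)]
    · funext q j; simp only [Finset.sum_apply]
    · rcases h : l.drop i with _ | ⟨a, _ | ⟨b, t⟩⟩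
      · refine HRep.zero.congr (by simp) ?_
        funext q j; simp [termMul, h]
      · refine HRep.zero.congr (by simp) ?_
        funext q j; simp [termMul, h]
      · have hl : l.take i ++ a :: b :: t = l := by rw [← h, List.take_append_drop]
        refine ((hrep_termMul hf hF hm (l.take i) t a b).zsmul (sg c)).congr ?_ ?_ |>.cast
          (by rw [hl]) (by rw [hl])
        · rfl
        · funext q j
          simp only [termMul, h, Pi.smul_apply, Pi.neg_apply, negOnePow_smul, sg_smul_smul, neg_smul,
            smul_neg]
          push_cast
          rw [add_comm (c : ZMod 2)]
    · funext q j; simp only [Finset.sum_apply, Pi.neg_apply, Finset.sum_neg_distrib]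
  · intro u t
    simp [DGAlg.mm_nil, hm.zero]
  · intro u a b c v t
    simp [DGAlg.mm_long, hm.zero]

theorem hrep_termLeft (hF : ρ.IsRep r.per c f F) (l : List A.Letter) :
    ρ.HRep (r.per + psum l) (c + 1 + wordDeg l) (A.totAlg.conv ℬ.lm c DGAlg.id1 F (l.map el))
      (termLeft r c f l) := by
  rcases l with _ | ⟨a, t⟩
  · refine HRep.zero.congr (by simp [DGAlg.conv]) ?_
    rfl
  · have h1 : A.totAlg.conv ℬ.lm c DGAlg.id1 F ((a :: t).map el) =
        sg (c * (a.deg + 1)) • ℬ.lm (el a) (F (t.map el)) := by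
      rw [DGAlg.conv, List.map_cons, splitSum_cons, splitSum_of_left_nil]
      · simp [twz_el]
      · intro b u v; simp
    refine ((((hF.hrep t).lact_el a).zsmul (sg (c * (a.deg + 1)))).cast ?_ ?_).congr h1 ?_
    · simp; abel
    · simp; ring
    · funext q j
      simp only [termLeft, negOnePow_smul, Pi.smul_apply]
      push_cast
      rw [mul_comm]
      rfl

theorem hrep_termRight (hF : ρ.IsRep r.per c f F) (hm : MLin R F) (l : List A.Letter) :
    ρ.HRep (r.per + psum l) (c + 1 + wordDeg l)
      (sg c • A.totAlg.conv ℬ.rm 1 F DGAlg.id1 (l.map el)) (termRight r c f l) := by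
  rcases List.eq_nil_or_concat' l with rfl | ⟨t, a, rfl⟩
  · refine HRep.zero.congr (by simp [DGAlg.conv]) ?_
    rfl
  · have h1 : A.totAlg.conv ℬ.rm 1 F DGAlg.id1 ((t ++ [a]).map el) =
        sg (wordDeg t : ℤ) • ℬ.rm (F (t.map el)) (el a) := by
      rw [DGAlg.conv, List.map_append, List.map_cons, List.map_nil, splitSum_concat,
        splitSum_of_right_nil]
      · simp [hm.twl_letters]
      · intro u b v; cases v <;> simp
    rw [h1, sg_smul_smul]
    refine (((hF.hrep t).ract_el a).zsmul (sg (c + (wordDeg t : ℤ)))).cast ?_ ?_ |>.congr rfl ?_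
    · simp; abel
    · simp; ring
    · funext q j
      have key : ∀ t', t' = t → PDGA.ract M (val r c f t') a.val q j =
          PDGA.ract M (val r c f t) a.val q j := by rintro _ rfl; rfl
      simp only [termRight, List.getLast?_concat, negOnePow_smul, Pi.smul_apply]
      rw [key _ List.dropLast_concat, List.dropLast_concat]
      push_cast
      rw [add_comm (c : ZMod 2)]
      rfl

theorem IsRep.hochD (hf : f ∈ HC M r c) (hF : ρ.IsRep r.per c f F) (hm : MLin R F) :
    ρ.IsRep r.per (c + 1) (PDGA.hochD M r c f) (DGAlg.hD ℬ c F) := by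
  suffices H : ∀ l, ρ.HRep (r.per + psum l) (c + 1 + wordDeg l)
      (DGAlg.hD ℬ c F (l.map el)) (PDGA.hochD M r c f l) from
    ⟨fun l => (H l).sec, fun l => (H l).eq⟩
  intro l
  have h1 := (hF.hrep l).d (j := c + 1 + wordDeg l) (by ring)
  refine (((h1.add (hrep_circ_mm hf hF hm l)).sub (hrep_termLeft hF l)).add
    (hrep_termRight hF hm l)).congr rfl ?_
  funext q j
  simp only [PDGA.hochD, LinearMap.coe_mk, AddHom.coe_mk, Pi.add_apply, Pi.sub_apply, dFam]
  abel

end Translation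

end Realization

end PDGA

theorem MLin.splitSum₃_const {R : Type v} {A : Type*} {N α : Type*} [CommRing R] [AddCommGroup A]
    [Module R A] [AddCommGroup N] [Module R N] {F : List A → List α → List α → List α → N}
    (h : ∀ p q r, MLin R fun u => F u p q r) (l : List α) :
    MLin R fun u => _root_.splitSum₃ (F u) l where
  add u v a b := by
    rw [← splitSum₃_add]
    exact splitSum₃_congr fun p q r _ => (h p q r).add u v a b
  smul u v s a := by
    rw [← splitSum₃_smul]
    exact splitSum₃_congr fun p q r _ => (h p q r).smul u v s a

theorem DGAlg.mlin_brace {R : Type v} {A : Type*} [CommRing R] [AddCommGroup A] [Module R A]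
    {𝒜 : DGAlg R A} {N : Type*} [AddCommGroup N] [Module R N] (e e' : ZMod 2) {f : List A → N}
    {g h : List A → A} (hf : MLin R f) (hg : MLin R g) (hh : MLin R h) :
    MLin R (𝒜.brace e e' f g h) := by
  refine MLin.splitSum₃ (fun v t => MLin.splitSum₃_const (fun p q r => mlin_twl (hf.append _) _) t)
    (fun u t => MLin.splitSum₃_const (fun p q r => (mlin_twl hg e').comp (hf.lin (𝒜.twl _ u) _)) t)
    fun u v => MLin.splitSum₃ (fun q r => ?_) (fun p r => ?_) fun p q => ?_
  · have := mlin_twl (𝒜 := 𝒜) ((hf.prepend (𝒜.twl (e + e') u ++ [g (𝒜.twl e' v)])).append (h q :: r)) e'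
    simpa using this
  · have := hh.comp (hf.lin (𝒜.twl (e + e') u ++ g (𝒜.twl e' v) :: 𝒜.twl e' p) r)
    simpa [MLin.lin_apply] using this
  · simpa using hf.prepend (𝒜.twl (e + e') u ++ g (𝒜.twl e' v) :: (𝒜.twl e' p ++ [h q]))

namespace PDGA

variable {R : Type u} [CommRing R] {n : ℕ} {A : PDGA R n}

namespace Realization

variable {M : PBimod A} {N : Type w} [AddCommGroup N] [Module R N] {ℬ : DGBimod A.totAlg N}
  {ρ : Realization M ℬ}

/-! ### Closure properties of representable cochains -/

section Closure

variable {x y z : Per n} {c c' c'' : ℤ} {F F' : List A.Tot → N} {G H : List A.Tot → A.Tot}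

theorem IsHoch.cast (h : ρ.IsHoch x c F) (hx : x = y) (hc : c = c') : ρ.IsHoch y c' F := by
  subst hx hc; exact h

theorem IsHoch.zero : ρ.IsHoch x c 0 :=
  ⟨MLin.fzero, fun _ _ => rfl, fun _ _ _ _ _ h => .zero (Per.add_le_add' le_rfl h.le)⟩

theorem IsHoch.add (h : ρ.IsHoch x c F) (h' : ρ.IsHoch x c F') : ρ.IsHoch x c (F + F') :=
  ⟨h.mlin.fadd h'.mlin, h.norm.add h'.norm, h.good.add h'.good⟩

theorem IsHoch.sub (h : ρ.IsHoch x c F) (h' : ρ.IsHoch x c F') : ρ.IsHoch x c (F - F') :=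
  ⟨h.mlin.fsub h'.mlin, h.norm.sub h'.norm, h.good.sub h'.good⟩

theorem IsHoch.zsmul (a : ℤ) (h : ρ.IsHoch x c F) : ρ.IsHoch x c (a • F) :=
  ⟨h.mlin.fzsmul a, h.norm.zsmul a, h.good.zsmul a⟩

theorem IsHoch.smul (a : R) (h : ρ.IsHoch x c F) : ρ.IsHoch x c (a • F) :=
  ⟨h.mlin.fsmul a, fun u v => by simp [h.norm u v], h.good.smul a⟩

theorem IsHoch.conv (k : ZMod 2) (hG : A.selfReal.IsHoch x c G) (hF : ρ.IsHoch y c' F) :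
    ρ.IsHoch (x + y) (c + c') (A.totAlg.conv ℬ.lm k G F) :=
  ⟨DGAlg.mlin_conv _ _ hG.mlin hF.mlin, DGAlg.norm_conv _ _ hG.mlin hG.norm hF.norm,
    good_lm k hG.good hF.good⟩

theorem IsHoch.circ (k : ZMod 2) (hF : ρ.IsHoch x c F) (hG : A.selfReal.IsHoch y c' G) :
    ρ.IsHoch (x + y) (c + c' - 1) (A.totAlg.circ k F G) :=
  ⟨DGAlg.mlin_circ _ hF.mlin hG.mlin, DGAlg.norm_circ _ hF.mlin hF.norm hG.norm,
    good_circ' k hF.good hG.good⟩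

theorem IsHoch.brace (k k' : ZMod 2) (hF : ρ.IsHoch x c F) (hG : A.selfReal.IsHoch y c' G)
    (hH : A.selfReal.IsHoch z c'' H) :
    ρ.IsHoch (x + y + z) (c + c' + c'' - 2) (A.totAlg.brace k k' F G H) :=
  ⟨DGAlg.mlin_brace _ _ hF.mlin hG.mlin hH.mlin,
    DGAlg.norm_brace _ _ hF.mlin hF.norm hG.norm hG.mlin hH.norm, good_brace k k' hF.good hG.good hH.good⟩

theorem IsHoch.hD (k : ZMod 2) (hF : ρ.IsHoch x c F) : ρ.IsHoch x (c + 1) (DGAlg.hD ℬ k F) :=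
  ⟨DGAlg.mlin_hD _ _ hF.mlin, DGAlg.norm_hD _ _ hF.mlin hF.norm, good_hD k hF.good⟩

theorem IsHoch.br (k k' : ZMod 2) (hG : A.selfReal.IsHoch x c G) (hH : A.selfReal.IsHoch y c' H) :
    A.selfReal.IsHoch (x + y) (c + c' - 1) (A.totAlg.br k k' G H) :=
  (hG.circ k' hH).sub (((hH.circ k hG).cast (add_comm _ _) (by ring)).zsmul _)

theorem IsHoch.par (hG : A.selfReal.IsHoch x c G) : A.totAlg.Par (c + 1 : ℤ) G := by
  suffices H : (fun l => A.totAlg.tw (G l)) = sg (c + 1 : ℤ) • fun l => G (A.totAlg.twl 1 l) from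
    congrFun H
  refine mlin_ext (hG.mlin.comp _) ((DGAlg.mlin_twl hG.mlin 1).fzsmul _) fun l => ?_
  obtain ⟨s, hs, h⟩ := hG.exists_sec l
  simp only [Pi.smul_apply, hG.mlin.twl_letters, h, sg_smul_smul]
  refine (totTw_inc _).trans ?_
  push_cast
  rw [_root_.one_mul, add_right_comm]
  rfl

theorem rel_one : A.selfReal.Rel 0 0 0 A.totAlg.one A.totAlg.one := by
  have h := rel_res (A := A) le_rfl A.one
  rwa [A.res_refl] at h

theorem isHoch_one : A.selfReal.IsHoch 0 0 (DGAlg.const0 A.totAlg.one) := by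
  refine ⟨MLin.of_lin fun u v => ⟨0, fun a => by simp⟩, fun u v => by simp, fun u v k l l' hw => ?_⟩
  cases hw with
  | nil => exact rel_one.cast (by simp) (by simp) (by simp)
  | cons h hw => exact .zero (by simpa using Per.add_le_add' h.le hw.le)

end Closure

/-! ### Representatives -/

section Reps

variable {r r' : GMPerversity n} {x y : Per n} {c c' : ℤ} {f f' : A.RawCochain M} {F F' : List A.Tot → N}

theorem IsRep.cast (h : ρ.IsRep x c f F) (hx : x = y) (hc : c = c') : ρ.IsRep y c' f F := by
  subst hx hc; exact h

theorem IsRep.sub (h : ρ.IsRep x c f F) (h' : ρ.IsRep x c f' F') : ρ.IsRep x c (f - f') (F - F') :=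
  ⟨fun l => (h.sec l).sub (h'.sec l), fun l => by simp [h.eq, h'.eq, inj_sub]⟩

theorem IsRep.zsmul (a : ℤ) (h : ρ.IsRep x c f F) : ρ.IsRep x c (a • f) (a • F) :=
  ⟨fun l => (h.sec l).zsmul a, fun l => by simp [h.eq, inj_zsmul]⟩

theorem IsRep.trunc_eq (h : ρ.IsRep r.per c f F) : trunc r f = f := by
  funext l q j
  rw [trunc]
  split
  · rfl
  · rename_i hq
    rw [(h.sec l).supp q j fun h' => hq h'.1]

theorem IsRep.raw_eq_self (h : ρ.IsRep r.per c f F) : ρ.raw r r.per F = f :=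
  h.raw_eq.trans h.trunc_eq

theorem hochD_raw (hF : ρ.IsHoch x c F) (hx : x ≤ r.per) :
    PDGA.hochD M r c (ρ.raw r x F) = ρ.raw r x (DGAlg.hD ℬ c F) := by
  obtain ⟨F₀, h₀, hr⟩ := exists_rep (ρ := ρ) (hF.raw_mem hx)
  have h1 := hr.raw_eq_self
  rw [← (IsRep.hochD (hF.raw_mem hx) hr h₀.mlin).raw_eq_self,
    (good_hD c (hF.good_raw hx h₀ h1)).raw_eq le_rfl]

theorem IsRep.circ' {f g : A.RawCochain A.self} {F G : List A.Tot → A.Tot} (hf : f ∈ HC A.self r c)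
    (hF : A.selfReal.IsRep r.per c f F) (hm : MLin R F) (hG : A.selfReal.IsRep r'.per c' g G) :
    A.selfReal.IsRep (r.per + r'.per) (c + c' - 1) (PDGA.circ r' c' f g)
      (A.totAlg.circ (c' + 1 : ℤ) F G) := by
  have key : ∀ l, PDGA.circ r' c' f g l = ∑ i ∈ Finset.range (l.length + 1),
      ∑ i' ∈ Finset.Icc i l.length, sg ((c' - 1) * wordDeg (l.take i) : ℤ) •
          f (l.take i ++ cochainLetter r' c' g ((l.take i').drop i) :: l.drop i') := by
    intro l
    funext q j
    simp only [PDGA.circ, Finset.sum_apply, Pi.smul_apply, negOnePow_smul]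
  refine ⟨fun l => ?_, fun l => ?_⟩
  · rw [key]; exact (hF.circ hf hm hG l).sec
  · rw [key]; exact (hF.circ hf hm hG l).eq

theorem IsRep.bracket {f g : A.RawCochain A.self} {F G : List A.Tot → A.Tot} (hf : f ∈ HC A.self r c)
    (hg : g ∈ HC A.self r' c') (hF : A.selfReal.IsRep r.per c f F) (hm : MLin R F)
    (hG : A.selfReal.IsRep r'.per c' g G) (hm' : MLin R G) :
    A.selfReal.IsRep (r.per + r'.per) (c + c' - 1) (PDGA.bracket r r' c c' f g)
      (A.totAlg.br (c + 1 : ℤ) (c' + 1 : ℤ) F G) := by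
  have h := (hF.circ' hf hm hG).sub
    (((IsRep.circ' hg hG hm' hF).cast (add_comm _ _) (by ring)).zsmul (sg ((c - 1) * (c' - 1) : ℤ)))
  rw [PDGA.bracket, negOnePow_smul, DGAlg.br]
  convert h using 4
  push_cast
  linear_combination (c + c' : ZMod 2) * zmod_two_eq_zero

end Reps

end Realization

/-! ### The dual of the total algebra -/

theorem _root_.GMPerversity.le_compl_iff {p q : GMPerversity n} :
    p ≤ q.compl ↔ p.per + q.per ≤ (GMPerversity.top n).per := by
  refine ⟨fun h i => ?_, fun h i => ?_⟩
  · have h1 : p.toFun i ≤ (GMPerversity.top n).toFun i - q.toFun i := h i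
    have h2 : q.toFun i ≤ (GMPerversity.top n).toFun i := q.le_top i
    change p.toFun i + q.toFun i ≤ (GMPerversity.top n).toFun i
    omega
  · have h1 : p.toFun i + q.toFun i ≤ (GMPerversity.top n).toFun i := h i
    change p.toFun i ≤ (GMPerversity.top n).toFun i - q.toFun i
    omega

theorem per_le_compl_iff {x : Per n} {q : GMPerversity n} :
    x ≤ q.compl.per ↔ x + q.per ≤ (GMPerversity.top n).per := by
  constructor
  · intro h
    exact (Per.add_le_add' h le_rfl).trans (GMPerversity.le_compl_iff.1 le_rfl)
  · intro h
    have hx : x ≤ (GMPerversity.top n).per := (Per.le_add_right' _ _).trans h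
    exact (Per.le_hull hx).trans (GMPerversity.le_compl_iff.2 (Per.hull_add_le h))

section Fam

variable {M : PBimod A}

theorem fam_neg {p q : GMPerversity n} {i j : ℤ} (h : ¬ (p ≤ q ∧ i = j)) (a : M.X p i) :
    fam M p i a q j = 0 := by
  rw [fam, dif_neg h]

/-- The components of the family of images, as linear maps. -/
noncomputable def famL (M : PBimod A) (p : GMPerversity n) (i : ℤ) (q : GMPerversity n) (j : ℤ) :
    M.X p i →ₗ[R] M.X q j where
  toFun a := fam M p i a q j
  map_add' a b := by
    by_cases h : p ≤ q ∧ i = j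
    · obtain ⟨h, rfl⟩ := h
      simp only [fam_apply _ _ h, map_add]
    · simp [fam_neg h]
  map_smul' s a := by
    by_cases h : p ≤ q ∧ i = j
    · obtain ⟨h, rfl⟩ := h
      simp [fam_apply _ _ h]
    · simp [fam_neg h]

theorem fam_sec {x : Per n} {i : ℤ} {s : Fam M} (hs : Sec x i s) : fam M x.hull i (s x.hull i) = s := by
  by_cases hx : x ≤ (GMPerversity.top n).per
  · funext q j
    by_cases h : x.hull ≤ q ∧ i = j
    · obtain ⟨h, rfl⟩ := h
      rw [fam_apply _ _ h, hs.res_hull ((Per.le_hull hx).trans h)]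
    · rw [fam_neg h, hs.supp]
      rintro ⟨h1, rfl⟩
      exact h ⟨Per.hull_le h1, rfl⟩
  · have h0 : s x.hull i = 0 := hs.supp _ _ fun h => hx (h.1.trans (GMPerversity.per_le_top _))
    rw [h0, hs.eq_zero hx]
    funext q j
    exact map_zero (famL M x.hull i q j)

theorem d_fam {p : GMPerversity n} {i i' : ℤ} (e : i + 1 = i') (a : M.X p i) (q : GMPerversity n)
    {j j' : ℤ} (e' : j + 1 = j') : fam M p i' (M.d e a) q j' = M.d e' (fam M p i a q j) := by
  by_cases h : p ≤ q ∧ i = j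
  · obtain ⟨h, rfl⟩ := h
    subst e'
    subst e
    rw [fam_apply _ _ h, fam_apply _ _ h, M.d_res]
  · rw [fam_neg h, map_zero, fam_neg]
    rintro ⟨h1, h2⟩
    exact h ⟨h1, by omega⟩

end Fam

/-- The elements of the dual bimodule as linear forms. -/
def ev {q : GMPerversity n} {j : ℤ} : A.dual.X q j →ₗ[R] A.X q.compl (-j) →ₗ[R] R where
  toFun ψ := ψ
  map_add' _ _ := rfl
  map_smul' _ _ := rfl

theorem ev_ext {q : GMPerversity n} {j : ℤ} {φ ψ : A.dual.X q j} (h : ∀ x, ev φ x = ev ψ x) : φ = ψ :=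
  LinearMap.ext (f := (show A.X q.compl (-j) →ₗ[R] R from φ)) h

/-- The linear form on the total algebra given by an element of the dual bimodule. -/
noncomputable def form (q : GMPerversity n) (j : ℤ) : A.dual.X q j →ₗ[R] (A.Tot →ₗ[R] R) where
  toFun ψ := A.totLift fun p i => ev ψ ∘ₗ famL A.self p i q.compl (-j)
  map_add' ψ ψ' := tot_hom_ext fun p i a => by simp
  map_smul' s ψ := tot_hom_ext fun p i a => by simp

theorem form_inc (q : GMPerversity n) (j : ℤ) (ψ : A.dual.X q j) (p : GMPerversity n)
    (i : ℤ) (a : A.X p i) : form (A := A) q j ψ (A.inc p i a) = ev ψ (fam A.self p i a q.compl (-j)) :=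
  A.totLift_inc _ _ _ _

theorem form_sec (q : GMPerversity n) (j : ℤ) (ψ : A.dual.X q j) {x : Per n} {i : ℤ}
    {s : Fam A.self} (hs : Sec x i s) :
    form (A := A) q j ψ (A.inc x.hull i (s x.hull i)) = ev ψ (s q.compl (-j)) := by
  rw [form_inc, fam_sec hs]

theorem sec_lact' {M : PBimod A} {p q : GMPerversity n} {i j : ℤ} (a : A.X p i) (m : M.X q j) :
    Sec (p.per + q.per) (i + j) (PDGA.lact M a m) := by
  have h := sec_lact (sec_fam (M := A.self) p i a) (sec_fam q j m)
  rwa [lact_fam, lact_fam_right] at h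

theorem res_dual {p q : GMPerversity n} {i : ℤ} (h : p ≤ q) (ψ : A.dual.X p i) (x : A.X q.compl (-i)) :
    ev (A.dual.res h ψ) x =
      ev ψ (A.res (GMPerversity.compl_le h) x) := rfl

theorem d_dual {p : GMPerversity n} {i j : ℤ} (e : i + 1 = j) (ψ : A.dual.X p i) (x : A.X p.compl (-j)) :
    ev (A.dual.d e ψ) x =
      -(sg (i : ZMod 2) • ev ψ (A.d (by omega) x)) := by
  rw [← negOnePow_smul]; rfl

theorem lsmul_dual {p q r : GMPerversity n} {i j k : ℤ} (h : p.toFun + q.toFun ≤ r.toFun)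
    (e : i + j = k) (a : A.X p i) (ψ : A.dual.X q j) (x : A.X r.compl (-k)) :
    ev (A.dual.lsmul h e a ψ) x = sg (i : ZMod 2) •
      ev ψ (A.mul (GMPerversity.compl_add_le h) (by omega) x a) := by
  rw [← negOnePow_smul]; rfl

theorem rsmul_dual {p q r : GMPerversity n} {i j k : ℤ} (h : p.toFun + q.toFun ≤ r.toFun)
    (e : i + j = k) (ψ : A.dual.X p i) (a : A.X q j) (x : A.X r.compl (-k)) :
    ev (A.dual.rsmul h e ψ a) x =
      ev ψ (A.mul (GMPerversity.add_compl_le h) (by omega) a x) := rfl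

theorem lact_dual_apply {p q s : GMPerversity n} {i j k : ℤ} (a : A.X p i) (ψ : A.dual.X q j)
    (x : A.X s k) :
    ev (PDGA.lact A.dual a ψ (p.per + q.per).hull (i + j))
      (fam A.self s k x (p.per + q.per).hull.compl (-(i + j))) =
    sg (i : ZMod 2) • ev ψ (PDGA.lact A.self x a q.compl (-j)) := by
  by_cases hpq : p.per + q.per ≤ (GMPerversity.top n).per
  · rw [lact_pos (Per.le_hull hpq) rfl]
    refine (lsmul_dual (Per.le_hull hpq) rfl a ψ _).trans ?_
    by_cases h : s ≤ (p.per + q.per).hull.compl ∧ k = -(i + j)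
    · obtain ⟨h, rfl⟩ := h
      have h1 : s.per + p.per ≤ q.compl.per := GMPerversity.add_le_of_le_left h
        (GMPerversity.compl_add_le (Per.le_hull hpq))
      rw [fam_apply _ _ h, lact_pos h1 (by omega)]
      congr 2
      exact A.mul_res_left h (show s.toFun + p.toFun ≤ q.compl.toFun from h1) _ _ _ _
    · rw [fam_neg h, map_zero, LinearMap.zero_apply, map_zero, lact_neg, map_zero]
      rintro ⟨h1, h2⟩
      refine h ⟨?_, by omega⟩
      rw [per_le_compl_iff] at h1
      rw [GMPerversity.le_compl_iff, add_comm]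
      apply Per.hull_add_le
      rwa [add_comm, ← add_assoc]
  · rw [lact_neg, lact_neg, map_zero]
    · simp
    · rintro ⟨h1, -⟩
      rw [per_le_compl_iff] at h1
      exact hpq ((Per.le_add_left' s.per _).trans (by rwa [← add_assoc]))
    · rintro ⟨h1, -⟩
      exact hpq (h1.trans (GMPerversity.per_le_top _))

theorem ract_dual_apply {p q s : GMPerversity n} {i j k : ℤ} (ψ : A.dual.X p i) (a : A.X q j)
    (x : A.X s k) :
    ev (PDGA.ract A.dual ψ a (p.per + q.per).hull (i + j))
      (fam A.self s k x (p.per + q.per).hull.compl (-(i + j))) =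
    ev ψ (PDGA.lact A.self a x p.compl (-i)) := by
  by_cases hpq : p.per + q.per ≤ (GMPerversity.top n).per
  · rw [ract_pos (Per.le_hull hpq) rfl]
    refine (rsmul_dual (Per.le_hull hpq) rfl ψ a _).trans ?_
    by_cases h : s ≤ (p.per + q.per).hull.compl ∧ k = -(i + j)
    · obtain ⟨h, rfl⟩ := h
      have h1 : q.per + s.per ≤ p.compl.per := GMPerversity.add_le_of_le_right h
        (GMPerversity.add_compl_le (Per.le_hull hpq))
      rw [fam_apply _ _ h, lact_pos h1 (by omega)]
      congr 1
      exact A.mul_res_right h (show q.toFun + s.toFun ≤ p.compl.toFun from h1) _ _ _ _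
    · rw [fam_neg h, map_zero, map_zero, lact_neg, map_zero]
      rintro ⟨h1, h2⟩
      refine h ⟨?_, by omega⟩
      rw [per_le_compl_iff] at h1
      rw [GMPerversity.le_compl_iff, add_comm]
      apply Per.hull_add_le
      rwa [add_comm, ← add_assoc, add_right_comm, add_comm (_ + _) p.per, ← add_assoc, add_comm p.per,
        add_right_comm] at *
  · rw [ract_neg, lact_neg, map_zero]
    · simp
    · rintro ⟨h1, -⟩
      rw [per_le_compl_iff] at h1
      exact hpq (le_trans (by rw [add_right_comm, add_comm p.per]; exact Per.le_add_right' _ _) h1)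
    · rintro ⟨h1, -⟩
      exact hpq (h1.trans (GMPerversity.per_le_top _))

variable (A) in
/-- The linear dual of the total algebra as a realization of the dual bimodule. -/
noncomputable def dualReal : Realization A.dual A.totAlg.dualBimod where
  inn := form
  out q j := (LinearMap.lcomp R R (A.inc q.compl (-j)) : _ →ₗ[R] A.X q.compl (-j) →ₗ[R] R)
  out_inn q j ψ := by
    refine ev_ext fun x => ?_
    refine (form_inc q j ψ _ _ x).trans ?_
    rw [fam_apply _ _ le_rfl]
    exact congrArg _ (A.res_refl x)
  out_inn_ne q j j' ψ h := by
    refine ev_ext fun x => ?_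
    refine (form_inc q j ψ _ _ x).trans ?_
    rw [fam_neg (by rintro ⟨-, h'⟩; omega)]
    exact map_zero _
  lm_inn p q i j a ψ := tot_hom_ext fun s k x => by
    rw [form_inc, lact_dual_apply, DGAlg.dual_lm]
    rw [show A.totAlg.tw (A.inc p i a) = _ from totTw_inc a, map_zsmul, map_zsmul,
      show A.totAlg.mul (A.inc s k x) (A.inc p i a) = _ from totMul_inc x a,
      form_sec _ _ _ (sec_lact' (M := A.self) x a), sg_add]
    simp
  rm_inn p q i j ψ a := tot_hom_ext fun s k x => by
    rw [form_inc, ract_dual_apply, DGAlg.dual_rm,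
      show A.totAlg.mul (A.inc q j a) (A.inc s k x) = _ from totMul_inc a x,
      form_sec _ _ _ (sec_lact' (M := A.self) a x)]
  d_inn p i j e ψ := tot_hom_ext fun s k x => by
    rw [form_inc, d_dual, DGAlg.dual_d, show A.totAlg.d (A.inc s k x) = _ from totD_inc rfl x,
      show A.totAlg.tw (A.inc s (k + 1) _) = _ from totTw_inc _, map_zsmul, form_inc]
    rw [show fam A.self s (k + 1) (A.d rfl x) p.compl (-i) = _ from
      d_fam (M := A.self) rfl x p.compl (j := -j) (by omega)]
    by_cases h : k = -j
    · subst h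
      obtain rfl : j = i + 1 := e.symm
      rw [show (((-(i + 1) + 1 : ℤ) : ZMod 2) + 1) = i + 1 by
        push_cast; linear_combination -(i : ZMod 2) * zmod_two_eq_zero, sg_add]
      simp
    · rw [fam_neg (by rintro ⟨-, h'⟩; exact h h')]
      simp

end PDGA

section

variable {R : Type v} {A : Type u} {N : Type w} [CommRing R] [AddCommGroup A] [Module R A]
  [AddCommGroup N] [Module R N] {f g : List A → A}

theorem MLin.lin_left {f : List A → N} (hf : MLin R f) (v : List A) : MLin R fun u => hf.lin u v where
  add p q a b := LinearMap.ext fun c => by simpa [lin_apply] using hf.add p (q ++ c :: v) a b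
  smul p q s a := LinearMap.ext fun c => by simpa [lin_apply] using hf.smul p (q ++ c :: v) s a

theorem MLin.lin_right {f : List A → N} (hf : MLin R f) (u : List A) : MLin R fun v => hf.lin u v where
  add p q a b := LinearMap.ext fun c => by simpa [lin_apply] using hf.add (u ++ c :: p) q a b
  smul p q s a := LinearMap.ext fun c => by simpa [lin_apply] using hf.smul (u ++ c :: p) q s a

variable {𝒜 : DGAlg R A} {m e e' : ZMod 2} {z : A →ₗ[R] R}

theorem DGAlg.mlin_bvH (hf : MLin R f) (hg : MLin R g) : MLin R (𝒜.bvH m e e' z f g hf) :=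
  MLin.splitSum
    (fun v => mlin_circ e' ((hf.lin_right _).comp
      ((LinearMap.compRight R z) ∘ₗ LinearMap.lcomp R A (𝒜.twz (e + 1 + m)))) hg)
    fun p => MLin.splitSum₃_const (fun x y w => (mlin_twl (hf.lin_left _) _).comp
      ((LinearMap.compRight R z) ∘ₗ LinearMap.lcomp R A (𝒜.twz (e + 1 + m)))) p

theorem DGAlg.norm_bvH (hf : MLin R f) (hnf : 𝒜.Norm f) (hng : 𝒜.Norm g) :
    𝒜.Norm (𝒜.bvH m e e' z f g hf) := fun u v => by
  rw [bvH, splitSum_append_cons, splitSum_eq_zero, splitSum_eq_zero, add_zero]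
  · intro p q _
    refine norm_circ e' ((hf.lin_right _).comp
      ((LinearMap.compRight R z) ∘ₗ LinearMap.lcomp R A (𝒜.twz (e + 1 + m)))) (fun x y => ?_) hng _ _
    ext a
    have := hnf (𝒜.twl (e + 1 + m + 1) q ++ 𝒜.twz (e + 1 + m) a :: x) y
    simp only [List.append_assoc, List.cons_append] at this
    simp [MLin.lin_apply, this]
  · intro p q _
    refine splitSum₃_eq_zero fun x y w _ => ?_
    ext a
    have := hnf.twz hf (e + 1 + m + 1) (𝒜.twl (e + 1 + m + 1) q)
      (𝒜.twl (e + 1 + m + 1) v ++ 𝒜.twz (e + 1 + m) a :: (𝒜.twl e' x ++ g y :: w))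
    simp [MLin.lin_apply, this]

end

namespace PDGA

variable {R : Type u} [CommRing R] {n : ℕ} {A : PDGA R n}

/-! ### Relations on scalars -/

/-- Related scalars: homogeneous of degree `0`, and of perverse degree at most the top one. -/
structure RelR (x y : Per n) (i : ℤ) (a b : R) : Prop where
  left : ¬ (x ≤ (GMPerversity.top n).per ∧ i = 0) → a = 0
  right : ¬ (y ≤ (GMPerversity.top n).per ∧ i = 0) → b = 0
  eq : y ≤ (GMPerversity.top n).per → a = b

namespace RelR

variable {x y x' y' : Per n} {i j : ℤ} {a b a' b' : R}

theorem add (h : RelR x y i a b) (h' : RelR x y i a' b') : RelR x y i (a + a') (b + b') :=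
  ⟨fun hx => by rw [h.left hx, h'.left hx, add_zero], fun hy => by rw [h.right hy, h'.right hy, add_zero],
    fun hy => by rw [h.eq hy, h'.eq hy]⟩

theorem zsmul (k : ℤ) (h : RelR x y i a b) : RelR x y i (k • a) (k • b) :=
  ⟨fun hx => by rw [h.left hx, smul_zero], fun hy => by rw [h.right hy, smul_zero],
    fun hy => by rw [h.eq hy]⟩

theorem cast (h : RelR x y i a b) (hx : x = x') (hy : y = y') (hi : i = j) : RelR x' y' j a b := by
  subst hx hy hi; exact h

end RelR

namespace Realization

variable {M : PBimod A} {N : Type w} [AddCommGroup N] [Module R N] {ℬ : DGBimod A.totAlg N}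
  {ρ : Realization M ℬ} {x y u v : Per n} {i k : ℤ}

theorem Rel.self_left {X Y : N} (h : ρ.Rel x y i X Y) : ρ.Rel x x i X X := by
  obtain ⟨s, t, hst, h1, h2⟩ := h
  exact ⟨s, s, ⟨le_rfl, hst.left, hst.left, fun _ _ _ => rfl⟩, h1, h1⟩

theorem Rel.self_right {X Y : N} (h : ρ.Rel x y i X Y) : ρ.Rel y y i Y Y := by
  obtain ⟨s, t, hst, h1, h2⟩ := h
  exact ⟨t, t, ⟨le_rfl, hst.right, hst.right, fun _ _ _ => rfl⟩, h2, h2⟩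

theorem _root_.PDGA.WRel.self_left {l l' : List A.Tot} (h : WRel u v k l l') : WRel u u k l l := by
  induction h with
  | nil => exact .nil
  | cons h _ ih => exact .cons h.self_left ih

theorem _root_.PDGA.WRel.self_right {l l' : List A.Tot} (h : WRel u v k l l') : WRel v v k l' l' := by
  induction h with
  | nil => exact .nil
  | cons h _ ih => exact .cons h.self_right ih

theorem inj_dual (x : Per n) (i : ℤ) (s : Fam A.dual) {b : Fam A.self} (hb : Sec u k b) :
    A.dualReal.inj x i s (A.selfReal.inj u k b) = ev (s x.hull i) (b x.hull.compl (-i)) :=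
  form_sec _ _ _ hb

/-- Related forms have related values. -/
theorem Rel.apply {φ ψ : A.Tot →ₗ[R] R} (h : A.dualReal.Rel x y i φ ψ) {a b : A.Tot}
    (h' : A.selfReal.Rel u v k a b) : RelR (x + u) (y + v) (i + k) (φ a) (ψ b) := by
  obtain ⟨s, t, hst, rfl, rfl⟩ := h
  obtain ⟨b, b', hb, rfl, rfl⟩ := h'
  have key : ∀ {x u : Per n} {s : Fam A.dual} {b : Fam A.self}, Sec x i s → Sec u k b →
      ¬ (x + u ≤ (GMPerversity.top n).per ∧ i + k = 0) → ev (s x.hull i) (b x.hull.compl (-i)) = 0 := by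
    intro x u s b hs hb h
    by_cases hx : x ≤ (GMPerversity.top n).per
    · rw [hb.supp, map_zero]
      rintro ⟨h1, h2⟩
      refine h ⟨?_, by omega⟩
      rw [per_le_compl_iff, add_comm, Per.hull_add_le_iff hx] at h1
      exact h1
    · rw [hs.eq_zero hx]
      exact LinearMap.congr_fun (map_zero ev) _
  rw [inj_dual _ _ _ hb.left, inj_dual _ _ _ hb.right]
  refine ⟨key hst.left hb.left, key hst.right hb.right, fun hy => ?_⟩
  by_cases hi : i + k = 0
  · have hy1 : y ≤ (GMPerversity.top n).per := (Per.le_add_right' _ _).trans hy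
    have hle : x.hull ≤ y.hull := Per.hull_le (hst.le.trans (Per.le_hull hy1))
    have hv : v ≤ y.hull.compl.per := by
      rw [per_le_compl_iff, add_comm]
      exact Per.hull_add_le hy
    rw [← hst.eq _ _ (Per.le_hull hy1), ← hb.eq _ _ hv,
      ← hst.left.res _ _ hle _ (Per.le_hull (hst.le.trans hy1)),
      ← hb.left.res _ _ (GMPerversity.compl_le hle) _ (hb.le.trans hv)]
    exact (res_dual hle _ _).symm
  · rw [key hst.left hb.left fun h => hi h.2, key hst.right hb.right fun h => hi h.2]

/-- Forms with related values are related. -/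
theorem Rel.of_apply {φ ψ : A.Tot →ₗ[R] R} (hle : x ≤ y)
    (hx : ∀ ⦃u v k a b⦄, A.selfReal.Rel u v k a b → RelR (x + u) (x + v) (i + k) (φ a) (φ b))
    (hy : ∀ ⦃u v k a b⦄, A.selfReal.Rel u v k a b → RelR (y + u) (y + v) (i + k) (ψ a) (ψ b))
    (hxy : ∀ ⦃u v k a b⦄, A.selfReal.Rel u v k a b → RelR (x + u) (y + v) (i + k) (φ a) (ψ b)) :
    A.dualReal.Rel x y i φ ψ := by
  classical
  let S : Per n → (A.Tot →ₗ[R] R) → Fam A.dual := fun x φ q j =>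
    if x ≤ q.per ∧ j = i then A.dualReal.out q j φ else 0
  have S_pos : ∀ {x : Per n} (φ : A.Tot →ₗ[R] R) {q : GMPerversity n}, x ≤ q.per →
      S x φ q i = A.dualReal.out q i φ := fun φ _ h => if_pos ⟨h, rfl⟩
  have key : ∀ (x : Per n) (φ : A.Tot →ₗ[R] R),
      (∀ ⦃u v k a b⦄, A.selfReal.Rel u v k a b → RelR (x + u) (x + v) (i + k) (φ a) (φ b)) →
      Sec x i (S x φ) ∧ φ = A.dualReal.inj x i (S x φ) := by
    intro x φ h
    refine ⟨⟨fun q j hq => if_neg hq, fun q q' hq j hxq => ?_⟩, ?_⟩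
    · by_cases hj : j = i
      · subst hj
        rw [S_pos φ hxq, S_pos φ (hxq.trans hq)]
        refine ev_ext fun a => (res_dual hq _ a).trans ?_
        refine ((h (rel_res (GMPerversity.compl_le hq) a)).eq ?_).symm
        refine (Per.add_le_add' hxq le_rfl).trans ?_
        rw [add_comm, ← per_le_compl_iff]
      · simp only [S]
        rw [if_neg fun h => hj h.2, if_neg fun h => hj h.2, map_zero]
    · refine tot_hom_ext fun p k a => ?_
      have h1 := form_inc x.hull i (S x φ x.hull i) p k a
      refine Eq.trans ?_ h1.symm
      have h0 := h (rel_res le_rfl a)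
      by_cases hx : x ≤ (GMPerversity.top n).per
      · by_cases hk : p ≤ x.hull.compl ∧ k = -i
        · obtain ⟨hp, rfl⟩ := hk
          rw [fam_apply _ _ hp]
          rw [S_pos φ (Per.le_hull hx)]
          refine (h (rel_res hp a)).eq ?_
          rw [add_comm, ← Per.add_hull_le_iff hx, ← per_le_compl_iff]
        · rw [fam_neg hk, map_zero]
          refine h0.left ?_
          rintro ⟨h1, h2⟩
          refine hk ⟨?_, by omega⟩
          rw [GMPerversity.le_compl_iff, Per.add_hull_le_iff hx, add_comm]
          exact h1
      · simp only [S]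
        rw [if_neg fun h => hx (h.1.trans (GMPerversity.per_le_top _))]
        refine (h0.left fun h => hx ((Per.le_add_right' _ _).trans h.1)).trans ?_
        exact (LinearMap.congr_fun (map_zero ev) _).symm
  refine ⟨S x φ, S y ψ, ⟨hle, (key x φ hx).1, (key y ψ hy).1, fun q j hq => ?_⟩, (key x φ hx).2,
    (key y ψ hy).2⟩
  by_cases hj : j = i
  · subst hj
    rw [S_pos ψ hq, S_pos φ (hle.trans hq)]
    refine ev_ext fun a => ?_
    have h0 := hxy (rel_res (le_refl q.compl) a)
    rw [A.res_refl] at h0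
    refine h0.eq ((Per.add_le_add' hq le_rfl).trans ?_)
    rw [add_comm, ← per_le_compl_iff]
  · simp only [S]
    rw [if_neg fun h => hj h.2, if_neg fun h => hj h.2]

theorem good_of_apply {c : ℤ} {F F' : List A.Tot → A.Tot →ₗ[R] R} (hle : x ≤ y)
    (hx : ∀ ⦃u v k l l'⦄, WRel u v k l l' → ∀ ⦃u' v' k' a b⦄, A.selfReal.Rel u' v' k' a b →
      RelR (x + u + u') (x + v + v') (c + k + k') (F l a) (F l' b))
    (hy : ∀ ⦃u v k l l'⦄, WRel u v k l l' → ∀ ⦃u' v' k' a b⦄, A.selfReal.Rel u' v' k' a b →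
      RelR (y + u + u') (y + v + v') (c + k + k') (F' l a) (F' l' b))
    (hxy : ∀ ⦃u v k l l'⦄, WRel u v k l l' → ∀ ⦃u' v' k' a b⦄, A.selfReal.Rel u' v' k' a b →
      RelR (x + u + u') (y + v + v') (c + k + k') (F l a) (F' l' b)) :
    GoodRel A.dualReal.Rel x y c F F' := fun _ _ _ _ _ hw =>
  .of_apply (Per.add_le_add' hle hw.le) (hx hw.self_left) (hy hw.self_right) (hxy hw)

/-! ### The Connes operator and the homotopy for the Batalin–Vilkovisky identity -/

variable {z : Per n} {c c' m : ℤ} {F : List A.Tot → A.Tot →ₗ[R] R} {G H : List A.Tot → A.Tot}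

theorem IsHoch.parD (hF : A.dualReal.IsHoch x c F) : A.totAlg.ParD c F := by
  intro l
  suffices h : (fun l => F (A.totAlg.twl 1 l) ∘ₗ A.totAlg.tw) = sg ((c : ZMod 2) + 1) • F from
    fun a => LinearMap.congr_fun (congrFun h l) a
  refine mlin_ext ((DGAlg.mlin_twl hF.mlin 1).comp (LinearMap.lcomp R R A.totAlg.tw))
    (hF.mlin.fzsmul _) fun l => ?_
  refine tot_hom_ext fun p i a => ?_
  obtain ⟨s, hs, h⟩ := hF.exists_sec l
  rw [Pi.smul_apply, LinearMap.comp_apply, show A.totAlg.tw (A.inc p i a) = _ from totTw_inc a,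
    map_zsmul, hF.mlin.twl_letters, LinearMap.smul_apply, LinearMap.smul_apply, sg_smul_smul, h]
  by_cases hi : i = -(c + wordDeg l)
  · congr 2
    subst hi
    push_cast
    linear_combination -(c : ZMod 2) * zmod_two_eq_zero
  · have : A.dualReal.inj (x + psum l) (c + wordDeg l) s (A.inc p i a) = 0 := by
      refine (form_inc _ _ _ _ _ _).trans ?_
      rw [fam_neg (fun h => hi h.2), map_zero]
    rw [this, smul_zero, smul_zero]

theorem connes_rel {F F' : List A.Tot → A.Tot →ₗ[R] R} (hF : GoodRel A.dualReal.Rel x y c F F')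
    (hm : MLin R F) (hm' : MLin R F') (e : ZMod 2) ⦃u v : Per n⦄ ⦃k : ℤ⦄ ⦃l l' : List A.Tot⦄
    (hw : WRel u v k l l') ⦃u' v' : Per n⦄ ⦃k' : ℤ⦄ ⦃a b : A.Tot⦄ (hab : A.selfReal.Rel u' v' k' a b) :
    RelR (x + u + u') (y + v + v') (c - 1 + k + k') (A.totAlg.connes e F hm l a)
      (A.totAlg.connes e F' hm' l' b) := by
  rw [DGAlg.connes_apply, DGAlg.connes_apply]
  refine RelR.zsmul _ (hw.splitSum (fun _ _ _ _ h h' => h.add h')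
    fun u₁ v₁ k₁ p p' u₂ v₂ k₂ q q' h₁ h₂ hu hv hk => ?_)
  have h := (hF ((h₂.twl 1).append (.cons hab (h₁.twl e)))).apply rel_one
  refine h.cast ?_ ?_ ?_
  · rw [← hu]; abel
  · rw [← hv]; abel
  · rw [← hk]; ring

theorem good_connes {F F' : List A.Tot → A.Tot →ₗ[R] R} (hF : A.dualReal.IsHoch x c F)
    (hF' : A.dualReal.IsHoch y c F') (h : GoodRel A.dualReal.Rel x y c F F') (e : ZMod 2) :
    GoodRel A.dualReal.Rel x y (c - 1) (A.totAlg.connes e F hF.mlin) (A.totAlg.connes e F' hF'.mlin) :=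
  good_of_apply (by simpa using (h .nil).le) (connes_rel hF.good hF.mlin hF.mlin e)
    (connes_rel hF'.good hF'.mlin hF'.mlin e) (connes_rel h hF.mlin hF'.mlin e)

theorem IsHoch.connes (hF : A.dualReal.IsHoch x c F) (e : ZMod 2) :
    A.dualReal.IsHoch x (c - 1) (A.totAlg.connes e F hF.mlin) :=
  ⟨DGAlg.mlin_connes _, DGAlg.norm_connes _ hF.norm, good_connes hF hF hF.good e⟩

theorem isHoch_const0 {φ : A.Tot →ₗ[R] R} (h : A.dualReal.Rel 0 0 m φ φ) :
    A.dualReal.IsHoch 0 m (DGAlg.const0 φ) := by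
  refine ⟨DGAlg.mlin_const0 φ, DGAlg.norm_const0 φ, fun u v k l l' hw => ?_⟩
  cases hw with
  | nil => exact h.cast (by simp) (by simp) (by simp)
  | cons h hw => exact .zero (by simpa using Per.add_le_add' h.le hw.le)

theorem IsHoch.bvH {φ : A.Tot →ₗ[R] R} (hφ : A.dualReal.Rel 0 0 m φ φ) (hG : A.selfReal.IsHoch x c G)
    (hH : A.selfReal.IsHoch y c' H) (j e e' : ZMod 2) :
    A.dualReal.IsHoch (x + y) (c + c' + m - 2) (A.totAlg.bvH j e e' φ G H hG.mlin) := by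
  have key : ∀ ⦃u v k l l'⦄, WRel u v k l l' → ∀ ⦃u' v' k' a b⦄, A.selfReal.Rel u' v' k' a b →
      RelR (x + y + u + u') (x + y + v + v') (c + c' + m - 2 + k + k')
        (A.totAlg.bvH j e e' φ G H hG.mlin l a) (A.totAlg.bvH j e e' φ G H hG.mlin l' b) := by
    intro u v k l l' hw u' v' k' a b hab
    rw [DGAlg.bvH_apply, DGAlg.bvH_apply]
    refine hw.splitSum (fun _ _ _ _ h h' => h.add h')
      fun u₁ v₁ k₁ p p' u₂ v₂ k₂ q q' h₁ h₂ hu hv hk => ?_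
    have h3 : GoodRel A.selfReal.Rel (x + u₂ + u') (x + v₂ + v') (c + k₂ + (k' - 1))
        (fun w => G (A.totAlg.twl (e + 1 + j + 1) q ++ A.totAlg.twz (e + 1 + j) a :: w))
        (fun w => G (A.totAlg.twl (e + 1 + j + 1) q' ++ A.totAlg.twz (e + 1 + j) b :: w)) := by
      intro u₃ v₃ k₃ w w' hw'
      refine (hG.good ((h₂.twl _).append (.cons (hab.twz _) hw'))).cast ?_ ?_ ?_
      · abel
      · abel
      · ring
    have h := hφ.apply (good_circ' (ρ := A.selfReal) e' h3 hH.good h₁)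
    refine h.cast ?_ ?_ ?_
    · rw [← hu]; abel
    · rw [← hv]; abel
    · rw [← hk]; ring
  exact ⟨DGAlg.mlin_bvH _ hH.mlin, DGAlg.norm_bvH hG.mlin hG.norm hH.norm, good_of_apply le_rfl key key key⟩

end Realization

end PDGA

namespace DGAlg

variable {R : Type v} {A : Type u} [CommRing R] [AddCommGroup A] [Module R A] {𝒜 : DGAlg R A}
  {N : Type w} [AddCommGroup N] [Module R N]

theorem circ_zero_left (e : ZMod 2) (g : List A → A) : 𝒜.circ e (0 : List A → N) g = 0 := by
  funext l; simp [circ, splitSum₃]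

theorem circ_zero_right (e : ZMod 2) {f : List A → N} (hf : MLin R f) : 𝒜.circ e f 0 = 0 := by
  funext l; simp [circ, splitSum₃, hf.zero]

theorem br_leibniz {e e₁ e₂ : ZMod 2} {f g h : List A → A} (hf : MLin R f) (hg : MLin R g)
    (hpf : 𝒜.Par e f) (hpg : 𝒜.Par e₁ g) (hph : 𝒜.Par e₂ h)
    (hpb : 𝒜.Par (e + e₁ + e₂) (𝒜.brace e₁ e₂ f g h))
    (hDf : hD 𝒜.selfBimod (e + 1) f = 0) (hDg : hD 𝒜.selfBimod (e₁ + 1) g = 0)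
    (hDh : hD 𝒜.selfBimod (e₂ + 1) h = 0) :
    𝒜.br e (e₁ + e₂ + 1) f (𝒜.conv 𝒜.mul (e₂ + 1) g h) =
      𝒜.conv 𝒜.mul (e₂ + 1) (𝒜.br e e₁ f g) h
      + sg (e * (e₁ + 1)) • 𝒜.conv 𝒜.mul (e + e₂ + 1) g (𝒜.br e e₂ f h)
      + hD 𝒜.selfBimod (e + e₁ + e₂ + 1) (-sg (e + e₁) • 𝒜.brace e₁ e₂ f g h) := by
  rw [hD_zsmul, hD_brace hf hg hpf hpg hph hpb hDf hDg hDh, br, br, br,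
    conv_circ _ _ _ hg _ hpf, conv_sub_left, conv_sub_right, conv_zsmul_left, conv_zsmul_right]
  simp only [smul_add, smul_sub, neg_smul, sg_smul_smul]
  rcases zmod_two_cases e with rfl | rfl <;> rcases zmod_two_cases e₁ with rfl | rfl <;>
    rcases zmod_two_cases e₂ with rfl | rfl <;>
    simp only [sg_zero, sg_one, add_zero, zero_add, CharTwo.add_self_eq_zero, one_smul, neg_smul,
      mul_zero, _root_.mul_one, neg_neg] <;>
    abel

theorem conv_const0_left (β : A →ₗ[R] N →ₗ[R] N) (k : ZMod 2) (a : A) (g : List A → N) :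
    𝒜.conv β k (const0 a) g = fun l => β a (g l) := by
  funext l
  rw [conv, splitSum_of_left_nil]
  · rfl
  · intro b u v; simp

theorem hD_const0_one : hD 𝒜.selfBimod 0 (const0 𝒜.one) = 0 := by
  funext l
  have h1 : 𝒜.circ 1 (const0 𝒜.one) 𝒜.mm l = 0 := splitSum₃_eq_zero fun u v t _ => by simp
  have h2 : 𝒜.selfBimod.d (const0 𝒜.one l) = 0 := by
    cases l with
    | nil => exact d_one
    | cons a l => exact map_zero _
  have h3 : 𝒜.conv 𝒜.selfBimod.lm 0 id1 (const0 𝒜.one) l = id1 l := by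
    rw [conv_const0, twl_zero]; exact 𝒜.mul_one _
  have h4 : 𝒜.conv 𝒜.selfBimod.rm 1 (const0 𝒜.one) id1 l = id1 l := by
    rw [conv_const0_left]; exact 𝒜.one_mul _
  rw [hD, h1, h2, h3, h4]
  simp

end DGAlg

namespace PDGA

variable {R : Type u} [CommRing R] {n : ℕ} {A : PDGA R n}

/-! ### Hochschild cohomology classes -/

theorem cls_eq_cls {M : PBimod A} {r : GMPerversity n} {c : ℤ} {f g : A.RawCochain M}
    {hf : f ∈ cocycles M r c} {hg : g ∈ cocycles M r c} :
    cls f hf = cls g hg ↔ f - g ∈ coboundaries M r c :=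
  Submodule.Quotient.eq _

theorem exists_cls {M : PBimod A} {r : GMPerversity n} {c : ℤ} (ξ : HH M r c) :
    ∃ f, ∃ hf : f ∈ cocycles M r c, ξ = cls f hf := by
  obtain ⟨⟨f, hf⟩, rfl⟩ := Submodule.Quotient.mk_surjective _ ξ
  exact ⟨f, hf, rfl⟩

namespace Realization

variable {M : PBimod A} {N : Type w} [AddCommGroup N] [Module R N] {ℬ : DGBimod A.totAlg N}
  {ρ : Realization M ℬ}

theorem IsHoch.raw_mem_cocycles {r : GMPerversity n} {x : Per n} {c : ℤ} {F : List A.Tot → N}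
    (hF : ρ.IsHoch x c F) (hx : x ≤ r.per) (hD : DGAlg.hD ℬ c F = 0) :
    ρ.raw r x F ∈ cocycles M r c :=
  ⟨hF.raw_mem hx, LinearMap.mem_ker.2 (by rw [hochD_raw hF hx, hD, raw_zero])⟩

/-- The cocycle `F` of perverse degree `x` represents the class `ξ`. -/
structure Reps (ρ : Realization M ℬ) (r : GMPerversity n) (x : Per n) (c : ℤ) (F : List A.Tot → N)
    (ξ : HH M r c) : Prop where
  le : x ≤ r.per
  hoch : ρ.IsHoch x c F
  cocycle : DGAlg.hD ℬ c F = 0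
  cls : ∃ h, ξ = cls (ρ.raw r x F) h

section Reps

variable {r r' : GMPerversity n} {x y : Per n} {c c' : ℤ} {F F' : List A.Tot → N} {ξ ξ' : HH M r c}

theorem IsHoch.reps (hF : ρ.IsHoch x c F) (hx : x ≤ r.per) (hD : DGAlg.hD ℬ c F = 0) :
    ρ.Reps r x c F (PDGA.cls (ρ.raw r x F) (hF.raw_mem_cocycles hx hD)) :=
  ⟨hx, hF, hD, _, rfl⟩

theorem Reps.add (h : ρ.Reps r x c F ξ) (h' : ρ.Reps r x c F' ξ') :
    ρ.Reps r x c (F + F') (ξ + ξ') := by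
  obtain ⟨hx, hF, hD, m, rfl⟩ := h
  obtain ⟨-, hF', hD', m', rfl⟩ := h'
  have hDD : DGAlg.hD ℬ c (F + F') = 0 := by rw [DGAlg.hD_add, hD, hD', add_zero]
  refine ⟨hx, hF.add hF', hDD, (hF.add hF').raw_mem_cocycles hx hDD, ?_⟩
  simp only [raw_add]; rfl

theorem Reps.smul (a : R) (h : ρ.Reps r x c F ξ) : ρ.Reps r x c (a • F) (a • ξ) := by
  obtain ⟨hx, hF, hD, m, rfl⟩ := h
  have hDD : DGAlg.hD ℬ c (a • F) = 0 := by rw [DGAlg.hD_smul, hD, smul_zero]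
  refine ⟨hx, hF.smul a, hDD, (hF.smul a).raw_mem_cocycles hx hDD, ?_⟩
  simp only [raw_smul]; rfl

theorem Reps.zsmul (a : ℤ) (h : ρ.Reps r x c F ξ) : ρ.Reps r x c (a • F) (a • ξ) := by
  have := h.smul (a : R)
  simpa only [Int.cast_smul_eq_zsmul] using this

theorem Reps.neg (h : ρ.Reps r x c F ξ) : ρ.Reps r x c (-F) (-ξ) := by
  simpa using h.zsmul (-1)

theorem Reps.sub (h : ρ.Reps r x c F ξ) (h' : ρ.Reps r x c F' ξ') :
    ρ.Reps r x c (F - F') (ξ - ξ') := by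
  rw [sub_eq_add_neg, sub_eq_add_neg]; exact h.add h'.neg

theorem Reps.zero (hx : x ≤ r.per) : ρ.Reps r x c 0 0 := by
  have h0 : DGAlg.hD ℬ c (0 : List A.Tot → N) = 0 := by
    simpa using DGAlg.hD_smul ℬ c (0 : R) (0 : List A.Tot → N)
  refine ⟨hx, .zero, h0, IsHoch.zero.raw_mem_cocycles hx h0, ?_⟩
  simp only [raw_zero]; rfl

theorem Reps.cast (h : ρ.Reps r x c F ξ) (hx : x = y) (hF : F = F') : ρ.Reps r y c F' ξ := by
  subst hx hF; exact h

theorem Reps.eq_of_exact (h : ρ.Reps r x c F ξ) (h' : ρ.Reps r y c F' ξ') (e : x = y)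
    {K : List A.Tot → N} (hK : ρ.IsHoch x (c - 1) K)
    (hFK : F = F' + DGAlg.hD ℬ (c - 1 : ℤ) K) : ξ = ξ' := by
  subst e
  obtain ⟨hx, hF, hD, m, rfl⟩ := h
  obtain ⟨-, hF', hD', m', rfl⟩ := h'
  rw [cls_eq_cls]
  refine ⟨ρ.raw r x K, hK.raw_mem hx, ?_⟩
  rw [hochD_raw hK hx, eq_sub_iff_add_eq, ← raw_add, add_comm, ← hFK]

theorem Reps.eq (h : ρ.Reps r x c F ξ) (h' : ρ.Reps r y c F' ξ') (e : x = y) (hF : F = F') :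
    ξ = ξ' :=
  h.eq_of_exact h' e .zero (by
    rw [hF, left_eq_add]
    simpa using DGAlg.hD_smul ℬ (c - 1 : ℤ) (0 : R) (0 : List A.Tot → N))

theorem exists_rep_cls {f : A.RawCochain M} (hf : f ∈ cocycles M r c) :
    ∃ F, ρ.IsRep r.per c f F ∧ ρ.Reps r r.per c F (PDGA.cls f hf) := by
  obtain ⟨F, hF, hr⟩ := exists_rep (ρ := ρ) hf.1
  have h1 := IsRep.hochD hf.1 hr hF.mlin
  rw [show PDGA.hochD M r c f = 0 from hf.2] at h1
  have h2 : DGAlg.hD ℬ c F = 0 := mlin_ext (DGAlg.mlin_hD _ _ hF.mlin) MLin.fzero fun l => by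
    rw [h1.eq, Pi.zero_apply]
    exact map_zero _
  refine ⟨F, hr, le_rfl, hF, h2, hF.raw_mem_cocycles le_rfl h2, ?_⟩
  simp only [hr.raw_eq_self]

theorem exists_reps (ξ : HH M r c) : ∃ F, ρ.Reps r r.per c F ξ := by
  obtain ⟨f, hf, rfl⟩ := exists_cls ξ
  obtain ⟨F, -, h⟩ := exists_rep_cls (ρ := ρ) hf
  exact ⟨F, h⟩

theorem Reps.exact (h : ρ.Reps r r.per c F ξ) (h' : ρ.Reps r r.per c F' ξ) :
    ∃ K, ρ.IsHoch r.per (c - 1) K ∧ F = F' + DGAlg.hD ℬ (c - 1 : ℤ) K := by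
  obtain ⟨hx, hF, hD, m, rfl⟩ := h
  obtain ⟨-, hF', hD', m', e⟩ := h'
  rw [cls_eq_cls] at e
  obtain ⟨k, hk, e⟩ := e
  obtain ⟨K, hK, hr⟩ := exists_rep (ρ := ρ) hk
  refine ⟨K, hK, (hF.eq_of_raw_eq (hF'.add ((hK.hD _).cast rfl (by ring))) ?_)⟩
  rw [raw_add, ← hochD_raw hK le_rfl, hr.raw_eq_self, e]
  abel

/-- Every class of perverse degree `x` is represented in the perverse degree of its module. -/
theorem Reps.good (h : ρ.Reps r x c F ξ) : ∃ F₀, ρ.Reps r r.per c F₀ ξ ∧ GoodRel ρ.Rel x r.per c F F₀ := by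
  obtain ⟨hx, hF, hD, m, rfl⟩ := h
  obtain ⟨F₀, hr, h₀⟩ := exists_rep_cls (ρ := ρ) m
  exact ⟨F₀, h₀, hF.good_raw hx h₀.hoch hr.raw_eq_self⟩

theorem Reps.of_good (h : ρ.Reps r y c F' ξ) (hF : ρ.IsHoch x c F) (hD : DGAlg.hD ℬ c F = 0)
    (hG : GoodRel ρ.Rel x y c F F') : ρ.Reps r x c F ξ := by
  obtain ⟨hy, hF', hD', m, rfl⟩ := h
  have hx : x ≤ y := by simpa using (hG .nil).le
  refine ⟨hx.trans hy, hF, hD, hF.raw_mem_cocycles (hx.trans hy) hD, ?_⟩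
  simp only [hG.raw_eq hy]

end Reps

/-! ### Operations on cohomology -/

section Operations

variable {M' M'' : PBimod A} {N' N'' : Type*} [AddCommGroup N'] [Module R N'] [AddCommGroup N'']
  [Module R N''] {ℬ' : DGBimod A.totAlg N'} {ℬ'' : DGBimod A.totAlg N''}

/-- A natural linear operation on cochains, compatible with the differentials. -/
structure Op (ρ : Realization M ℬ) (ρ' : Realization M' ℬ') (c c' : ℤ)
    (O : (List A.Tot → N) → List A.Tot → N') : Prop where
  good : ∀ ⦃x y F F'⦄, ρ.IsHoch x c F → ρ.IsHoch y c F' → GoodRel ρ.Rel x y c F F' →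
    GoodRel ρ'.Rel x y c' (O F) (O F')
  hoch : ∀ ⦃x F⦄, ρ.IsHoch x c F → ρ'.IsHoch x c' (O F)
  add : ∀ ⦃F F'⦄, MLin R F → MLin R F' → O (F + F') = O F + O F'
  smul : ∀ ⦃F⦄ (a : R), MLin R F → O (a • F) = a • O F
  cocycle : ∀ ⦃x F⦄, ρ.IsHoch x c F → DGAlg.hD ℬ c F = 0 → DGAlg.hD ℬ' c' (O F) = 0
  exact : ∀ ⦃x K⦄, ρ.IsHoch x (c - 1) K → ∃ L, ρ'.IsHoch x (c' - 1) L ∧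
    O (DGAlg.hD ℬ (c - 1 : ℤ) K) = DGAlg.hD ℬ' (c' - 1 : ℤ) L

/-- A natural bilinear operation on cochains, compatible with the differentials. -/
structure Op₂ (ρ : Realization M ℬ) (ρ' : Realization M' ℬ') (ρ'' : Realization M'' ℬ'')
    (c c' c'' : ℤ) (O : (List A.Tot → N) → (List A.Tot → N') → List A.Tot → N'') : Prop where
  good : ∀ ⦃x y F F' x' y' G G'⦄, GoodRel ρ.Rel x y c F F' → GoodRel ρ'.Rel x' y' c' G G' →
    GoodRel ρ''.Rel (x + x') (y + y') c'' (O F G) (O F' G')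
  hoch : ∀ ⦃x F y G⦄, ρ.IsHoch x c F → ρ'.IsHoch y c' G → ρ''.IsHoch (x + y) c'' (O F G)
  add_left : ∀ ⦃F F' G⦄, MLin R F → MLin R F' → MLin R G → O (F + F') G = O F G + O F' G
  add_right : ∀ ⦃F G G'⦄, MLin R F → MLin R G → MLin R G' → O F (G + G') = O F G + O F G'
  smul_left : ∀ ⦃F G⦄ (a : R), MLin R F → MLin R G → O (a • F) G = a • O F G
  smul_right : ∀ ⦃F G⦄ (a : R), MLin R F → MLin R G → O F (a • G) = a • O F G
  cocycle : ∀ ⦃x F y G⦄, ρ.IsHoch x c F → ρ'.IsHoch y c' G → DGAlg.hD ℬ c F = 0 →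
    DGAlg.hD ℬ' c' G = 0 → DGAlg.hD ℬ'' c'' (O F G) = 0
  exact_left : ∀ ⦃x K y G⦄, ρ.IsHoch x (c - 1) K → ρ'.IsHoch y c' G → DGAlg.hD ℬ' c' G = 0 →
    ∃ L, ρ''.IsHoch (x + y) (c'' - 1) L ∧
      O (DGAlg.hD ℬ (c - 1 : ℤ) K) G = DGAlg.hD ℬ'' (c'' - 1 : ℤ) L
  exact_right : ∀ ⦃x F y K⦄, ρ.IsHoch x c F → ρ'.IsHoch y (c' - 1) K → DGAlg.hD ℬ c F = 0 →
    ∃ L, ρ''.IsHoch (x + y) (c'' - 1) L ∧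
      O F (DGAlg.hD ℬ' (c' - 1 : ℤ) K) = DGAlg.hD ℬ'' (c'' - 1 : ℤ) L

variable {ρ' : Realization M' ℬ'} {ρ'' : Realization M'' ℬ''} {c c' c'' : ℤ}

/-- The linear map induced by an operation. -/
theorem Op.exists_linear {O : (List A.Tot → N) → List A.Tot → N'} (hO : Op ρ ρ' c c' O)
    {p r : GMPerversity n} (h : p ≤ r) : ∃ β : HH M p c →ₗ[R] HH M' r c',
      ∀ ⦃x F ξ⦄, ρ.Reps p x c F ξ → ρ'.Reps r x c' (O F) (β ξ) := by
  choose S hS using fun ξ : HH M p c => exists_reps (ρ := ρ) ξ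
  have key : ∀ ξ, ∃ χ, ∀ ⦃x F⦄, ρ.Reps p x c F ξ → ρ'.Reps r x c' (O F) χ := by
    intro ξ
    obtain ⟨χ, hr⟩ : ∃ χ, ρ'.Reps r p.per c' (O (S ξ)) χ :=
      ⟨_, (hO.hoch (hS ξ).hoch).reps h (hO.cocycle (hS ξ).hoch (hS ξ).cocycle)⟩
    refine ⟨χ, fun x F hF => ?_⟩
    obtain ⟨F₀, h₀, hg⟩ := hF.good
    refine Reps.of_good (F' := O F₀) ?_ (hO.hoch hF.hoch) (hO.cocycle hF.hoch hF.cocycle)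
      (hO.good hF.hoch h₀.hoch hg)
    obtain ⟨K, hK, e⟩ := h₀.exact (hS ξ)
    obtain ⟨L, hL, e'⟩ := hO.exact hK
    have h1 := (hO.hoch h₀.hoch).reps (r := r) h (hO.cocycle h₀.hoch h₀.cocycle)
    rwa [h1.eq_of_exact hr rfl hL (by
      conv_lhs => rw [e]
      rw [hO.add (hS ξ).hoch.mlin (DGAlg.mlin_hD _ _ hK.mlin), e'])] at h1
  choose β hβ using key
  refine ⟨{ toFun := β, map_add' := fun ξ η => ?_, map_smul' := fun a ξ => ?_ }, fun x F ξ hF => hβ ξ hF⟩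
  · refine (hβ _ ((hS ξ).add (hS η))).eq ((hβ _ (hS ξ)).add (hβ _ (hS η))) rfl ?_
    rw [hO.add (hS ξ).hoch.mlin (hS η).hoch.mlin]
  · refine (hβ _ ((hS ξ).smul a)).eq ((hβ _ (hS ξ)).smul a) rfl ?_
    rw [hO.smul a (hS ξ).hoch.mlin]

/-- The bilinear map induced by an operation. -/
theorem Op₂.exists_bilinear {O : (List A.Tot → N) → (List A.Tot → N') → List A.Tot → N''}
    (hO : Op₂ ρ ρ' ρ'' c c' c'' O) {p q r : GMPerversity n} (h : p.toFun + q.toFun ≤ r.toFun) :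
    ∃ β : HH M p c →ₗ[R] HH M' q c' →ₗ[R] HH M'' r c'',
      ∀ ⦃x F ξ y G η⦄, ρ.Reps p x c F ξ → ρ'.Reps q y c' G η →
        ρ''.Reps r (x + y) c'' (O F G) (β ξ η) := by
  choose S hS using fun ξ : HH M p c => exists_reps (ρ := ρ) ξ
  choose T hT using fun ξ : HH M' q c' => exists_reps (ρ := ρ') ξ
  have h' : p.per + q.per ≤ r.per := h
  have key : ∀ ξ η, ∃ χ, ∀ ⦃x F y G⦄, ρ.Reps p x c F ξ → ρ'.Reps q y c' G η →
      ρ''.Reps r (x + y) c'' (O F G) χ := by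
    intro ξ η
    obtain ⟨χ, hr⟩ : ∃ χ, ρ''.Reps r (p.per + q.per) c'' (O (S ξ) (T η)) χ :=
      ⟨_, (hO.hoch (hS ξ).hoch (hT η).hoch).reps (r := r) h'
        (hO.cocycle (hS ξ).hoch (hT η).hoch (hS ξ).cocycle (hT η).cocycle)⟩
    refine ⟨χ, fun x F y G hF hG => ?_⟩
    obtain ⟨F₀, hF₀, hFF⟩ := hF.good
    obtain ⟨G₀, hG₀, hGG⟩ := hG.good
    refine Reps.of_good ?_ (hO.hoch hF.hoch hG.hoch)
      (hO.cocycle hF.hoch hG.hoch hF.cocycle hG.cocycle) (hO.good hFF hGG)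
    obtain ⟨K, hK, e₁⟩ := hF₀.exact (hS ξ)
    obtain ⟨L, hL, e₂⟩ := hG₀.exact (hT η)
    obtain ⟨K', hK', e₁'⟩ := hO.exact_left hK hG₀.hoch hG₀.cocycle
    obtain ⟨L', hL', e₂'⟩ := hO.exact_right (hS ξ).hoch hL (hS ξ).cocycle
    have h1 := (hO.hoch hF₀.hoch hG₀.hoch).reps (r := r) h'
      (hO.cocycle hF₀.hoch hG₀.hoch hF₀.cocycle hG₀.cocycle)
    rwa [h1.eq_of_exact hr rfl (hL'.add hK') (by
      rw [DGAlg.hD_add, ← e₁', ← e₂', ← add_assoc, ← hO.add_right (hS ξ).hoch.mlin (hT η).hoch.mlin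
        (DGAlg.mlin_hD _ _ hL.mlin), ← e₂, ← hO.add_left (hS ξ).hoch.mlin
        (DGAlg.mlin_hD _ _ hK.mlin) hG₀.hoch.mlin, ← e₁])] at h1
  choose β hβ using key
  refine ⟨LinearMap.mk₂ R β (fun ξ ξ' η => ?_) (fun a ξ η => ?_) (fun ξ η η' => ?_)
    fun a ξ η => ?_, fun x F ξ y G η hF hG => hβ ξ η hF hG⟩
  · refine (hβ _ _ ((hS ξ).add (hS ξ')) (hT η)).eq ((hβ _ _ (hS ξ) (hT η)).add
      (hβ _ _ (hS ξ') (hT η))) rfl ?_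
    rw [hO.add_left (hS ξ).hoch.mlin (hS ξ').hoch.mlin (hT η).hoch.mlin]
  · refine (hβ _ _ ((hS ξ).smul a) (hT η)).eq ((hβ _ _ (hS ξ) (hT η)).smul a) rfl ?_
    rw [hO.smul_left a (hS ξ).hoch.mlin (hT η).hoch.mlin]
  · refine (hβ _ _ (hS ξ) ((hT η).add (hT η'))).eq ((hβ _ _ (hS ξ) (hT η)).add
      (hβ _ _ (hS ξ) (hT η'))) rfl ?_
    rw [hO.add_right (hS ξ).hoch.mlin (hT η).hoch.mlin (hT η').hoch.mlin]
  · refine (hβ _ _ (hS ξ) ((hT η).smul a)).eq ((hβ _ _ (hS ξ) (hT η)).smul a) rfl ?_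
    rw [hO.smul_right a (hS ξ).hoch.mlin (hT η).hoch.mlin]

end Operations

end Realization

end PDGA

namespace DGAlg

variable {R : Type v} {A : Type u} [CommRing R] [AddCommGroup A] [Module R A] {𝒜 : DGAlg R A}

theorem br_zero_left (e e' : ZMod 2) {g : List A → A} (hg : MLin R g) : 𝒜.br e e' 0 g = 0 := by
  rw [br, circ_zero_left, circ_zero_right _ hg, smul_zero, sub_zero]

theorem br_zero_right (e e' : ZMod 2) {f : List A → A} (hf : MLin R f) : 𝒜.br e e' f 0 = 0 := by
  rw [br, circ_zero_left, circ_zero_right _ hf, smul_zero, sub_zero]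

end DGAlg

namespace PDGA

variable {R : Type u} [CommRing R] {n : ℕ} {A : PDGA R n}

theorem cast_sub_one (c : ℤ) : ((c - 1 : ℤ) : ZMod 2) = c + 1 := by
  push_cast
  linear_combination -zmod_two_eq_zero

theorem cast_eq_of_add_eq_succ {i j k : ℤ} (e : i + j = k + 1) : (k : ZMod 2) = i + j + 1 := by
  have h : ((i + j : ℤ) : ZMod 2) = ((k + 1 : ℤ) : ZMod 2) := by rw [e]
  push_cast at h
  linear_combination -h - zmod_two_eq_zero

theorem cast_eq_of_add_eq {i j k : ℤ} (e : i + j = k) : (k : ZMod 2) = i + j := by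
  subst e; push_cast; rfl

theorem cast_succ_succ (c : ZMod 2) : c + 1 + 1 = c := by
  linear_combination zmod_two_eq_zero

namespace Realization

variable {M : PBimod A} {N : Type w} [AddCommGroup N] [Module R N] {ℬ : DGBimod A.totAlg N}
  {ρ : Realization M ℬ}

theorem IsHoch.par' {x : Per n} {c : ℤ} {G : List A.Tot → A.Tot} (hG : A.selfReal.IsHoch x c G) :
    A.totAlg.Par ((c : ZMod 2) + 1) G := by
  have := hG.par
  push_cast at this
  exact this

theorem op_id (c : ℤ) : Op ρ ρ c c id where
  good _ _ _ _ _ _ h := h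
  hoch _ _ h := h
  add _ _ _ _ := rfl
  smul _ _ _ := rfl
  cocycle _ _ _ h := h
  exact _ K hK := ⟨K, hK, rfl⟩

theorem op₂_conv {c c' k : ℤ} (e : c + c' = k) :
    Op₂ A.selfReal ρ ρ c c' k (A.totAlg.conv ℬ.lm (c' : ZMod 2)) where
  good _ _ _ _ _ _ _ _ h h' := (good_lm _ h h').cast rfl rfl e
  hoch _ _ _ _ h h' := (h.conv _ h').cast rfl e
  add_left _ _ _ _ _ _ := DGAlg.conv_add_left _ _ _ _ _
  add_right _ _ _ _ _ _ := DGAlg.conv_add_right _ _ _ _ _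
  smul_left _ _ _ _ _ := DGAlg.conv_smul_left _ _ _ _ _
  smul_right _ _ _ _ _ := DGAlg.conv_smul_right _ _ _ _ _
  cocycle _ _ _ _ hF hG h h' := by
    rw [cast_eq_of_add_eq e, DGAlg.hD_conv _ _ hF.mlin hF.par', h, h', DGAlg.conv_zero_left,
      DGAlg.conv_zero_right, smul_zero, add_zero]
  exact_left _ K _ G hK hG h := by
    refine ⟨_, (hK.conv (c' : ZMod 2) hG).cast rfl (by omega), ?_⟩
    rw [cast_eq_of_add_eq (show c - 1 + c' = k - 1 by omega), DGAlg.hD_conv _ _ hK.mlin hK.par', h,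
      DGAlg.conv_zero_right, smul_zero, add_zero]
  exact_right _ F _ K hF hK h := by
    refine ⟨_, ((hF.conv ((c' - 1 : ℤ) : ZMod 2) hK).zsmul (sg c)).cast rfl (by omega), ?_⟩
    rw [DGAlg.hD_zsmul, cast_eq_of_add_eq (show c + (c' - 1) = k - 1 by omega),
      DGAlg.hD_conv _ _ hF.mlin hF.par', h, DGAlg.conv_zero_left, zero_add, sg_smul_sg_smul,
      cast_sub_one, cast_succ_succ]

theorem op₂_br {c c' k : ℤ} (e : c + c' = k + 1) :
    Op₂ A.selfReal A.selfReal A.selfReal c c' k (A.totAlg.br ((c : ZMod 2) + 1) ((c' : ZMod 2) + 1)) where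
  good _ _ _ _ _ _ _ _ h h' := ((good_circ' _ h h').cast rfl rfl (by omega)).sub
    (((good_circ' _ h' h).cast (add_comm _ _) (add_comm _ _) (by omega)).zsmul _)
  hoch _ _ _ _ h h' := (h.br _ _ h').cast rfl (by omega)
  add_left _ _ _ hF hF' hG := by
    rw [DGAlg.br, DGAlg.br, DGAlg.br, DGAlg.circ_add_left, DGAlg.circ_add_right _ hG, smul_add]; abel
  add_right _ _ _ hF hG hG' := by
    rw [DGAlg.br, DGAlg.br, DGAlg.br, DGAlg.circ_add_left, DGAlg.circ_add_right _ hF, smul_add]; abel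
  smul_left _ _ a hF hG := by
    rw [DGAlg.br, DGAlg.br, DGAlg.circ_smul_left, DGAlg.circ_smul_right _ _ hG, smul_comm, smul_sub]
  smul_right _ _ a hF hG := by
    rw [DGAlg.br, DGAlg.br, DGAlg.circ_smul_left, DGAlg.circ_smul_right _ _ hF, smul_comm, smul_sub]
  cocycle _ F _ G hF hG h h' := by
    have h1 := DGAlg.hD_br hF.mlin hG.mlin hF.par' hG.par' (DGAlg.par_circ hF.mlin hF.par' hG.par')
      (DGAlg.par_circ hG.mlin hG.par' hF.par')
    rw [cast_succ_succ, cast_succ_succ, h, h', DGAlg.br_zero_left _ _ hG.mlin,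
      DGAlg.br_zero_right _ _ hF.mlin, smul_zero, add_zero] at h1
    rw [cast_eq_of_add_eq_succ e, show (c : ZMod 2) + c' + 1 = c + 1 + (c' + 1) + 1 by
      linear_combination -zmod_two_eq_zero, h1]
  exact_left _ K _ G hK hG h := by
    refine ⟨_, (hK.br ((c - 1 : ℤ) + 1 : ZMod 2) ((c' : ZMod 2) + 1) hG).cast rfl (by omega), ?_⟩
    have h1 := DGAlg.hD_br hK.mlin hG.mlin hK.par' hG.par' (DGAlg.par_circ hK.mlin hK.par' hG.par')
      (DGAlg.par_circ hG.mlin hG.par' hK.par')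
    rw [cast_succ_succ, cast_succ_succ, h, DGAlg.br_zero_right _ _ hK.mlin, smul_zero, add_zero] at h1
    rw [cast_eq_of_add_eq_succ (show c - 1 + c' = k - 1 + 1 by omega),
      show ((c - 1 : ℤ) : ZMod 2) + c' + 1 = (c - 1 : ℤ) + 1 + (c' + 1) + 1 by
      linear_combination -zmod_two_eq_zero, h1, cast_sub_one]
  exact_right _ F _ K hF hK h := by
    refine ⟨_, ((hF.br ((c : ZMod 2) + 1) ((c' - 1 : ℤ) + 1 : ZMod 2) hK).zsmul (sg (c + 1))).cast rfl
      (by omega), ?_⟩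
    have h1 := DGAlg.hD_br hF.mlin hK.mlin hF.par' hK.par' (DGAlg.par_circ hF.mlin hF.par' hK.par')
      (DGAlg.par_circ hK.mlin hK.par' hF.par')
    rw [cast_succ_succ, cast_succ_succ, h, DGAlg.br_zero_left _ _ hK.mlin, zero_add] at h1
    rw [DGAlg.hD_zsmul, cast_eq_of_add_eq_succ (show c + (c' - 1) = k - 1 + 1 by omega),
      show (c : ZMod 2) + ((c' - 1 : ℤ) : ZMod 2) + 1 = c + 1 + ((c' - 1 : ℤ) + 1) + 1 by
      linear_combination -zmod_two_eq_zero, h1, sg_smul_sg_smul, cast_sub_one]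

/-- The structure morphisms of Hochschild cohomology. -/
noncomputable def resHH (ρ : Realization M ℬ) {p q : GMPerversity n} {i : ℤ} (h : p ≤ q) :
    HH M p i →ₗ[R] HH M q i :=
  ((op_id (ρ := ρ) i).exists_linear h).choose

/-- The action of Hochschild cohomology on Hochschild cohomology with coefficients. -/
noncomputable def actHH (ρ : Realization M ℬ) {p q r : GMPerversity n} {i j k : ℤ}
    (h : p.toFun + q.toFun ≤ r.toFun) (e : i + j = k) :
    HH A.self p i →ₗ[R] HH M q j →ₗ[R] HH M r k :=
  ((op₂_conv (ρ := ρ) e).exists_bilinear h).choose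

variable (A) in
/-- The bracket of Hochschild cohomology. -/
noncomputable def bracketHH {p q r : GMPerversity n} {i j k : ℤ} (h : p.toFun + q.toFun ≤ r.toFun)
    (e : i + j = k + 1) : HH A.self p i →ₗ[R] HH A.self q j →ₗ[R] HH A.self r k :=
  ((op₂_br (A := A) e).exists_bilinear h).choose

section

variable {p q r : GMPerversity n} {x y : Per n} {i j k : ℤ} {F : List A.Tot → N}
  {G H : List A.Tot → A.Tot} {ξ : HH M p i} {η : HH A.self q j} {χ : HH A.self p i}

theorem Reps.res (hF : ρ.Reps p x i F ξ) (h : p ≤ q) : ρ.Reps q x i F (ρ.resHH h ξ) :=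
  ((op_id (ρ := ρ) i).exists_linear h).choose_spec hF

theorem Reps.act (hG : A.selfReal.Reps q y j G η) (hF : ρ.Reps p x i F ξ)
    (h : q.toFun + p.toFun ≤ r.toFun) (e : j + i = k) :
    ρ.Reps r (y + x) k (A.totAlg.conv ℬ.lm (i : ZMod 2) G F) (ρ.actHH h e η ξ) :=
  ((op₂_conv (ρ := ρ) e).exists_bilinear h).choose_spec hG hF

theorem Reps.cup (hG : A.selfReal.Reps q y j G η) (hH : A.selfReal.Reps p x i H χ)
    (h : q.toFun + p.toFun ≤ r.toFun) (e : j + i = k) :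
    A.selfReal.Reps r (y + x) k (A.totAlg.conv A.totAlg.mul (i : ZMod 2) G H)
      (A.selfReal.actHH h e η χ) :=
  hG.act hH h e

theorem Reps.bracket (hG : A.selfReal.Reps q y j G η) (hH : A.selfReal.Reps p x i H χ)
    (h : q.toFun + p.toFun ≤ r.toFun) (e : j + i = k + 1) :
    A.selfReal.Reps r (y + x) k (A.totAlg.br ((j : ZMod 2) + 1) ((i : ZMod 2) + 1) G H)
      (bracketHH A h e η χ) :=
  ((op₂_br (A := A) e).exists_bilinear h).choose_spec hG hH

end

end Realization

end PDGA

namespace PDGA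

variable {R : Type u} [CommRing R] {n : ℕ} {A : PDGA R n}

namespace Realization

variable {M : PBimod A} {N : Type w} [AddCommGroup N] [Module R N] {ℬ : DGBimod A.totAlg N}
  {ρ : Realization M ℬ} {r : GMPerversity n} {x : Per n} {c : ℤ} {f : A.RawCochain M}
  {F : List A.Tot → N} {ξ : HH M r c}

theorem Reps.exists_cls_eq (h : ρ.Reps r x c F ξ) (hf : ρ.IsRep x c f F) :
    ∃ hf' : trunc r f ∈ cocycles M r c, ξ = PDGA.cls (trunc r f) hf' := by
  obtain ⟨-, -, -, hm, e⟩ := h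
  have h1 := hf.raw_eq (r := r)
  exact ⟨h1 ▸ hm, by rw [e]; simp only [h1]⟩

end Realization

open Realization

theorem cast_succ_of_add_eq {i j x : ℤ} (e : i + j = x + 1) : (x : ZMod 2) + 1 = i + 1 + (j + 1) := by
  rw [cast_eq_of_add_eq_succ e]; ring

theorem cast_succ_of_cast {j k x : ℤ} (e : j + k = x) : (x : ZMod 2) + 1 = j + 1 + (k + 1) + 1 := by
  rw [cast_eq_of_add_eq e]
  linear_combination -zmod_two_eq_zero

theorem cast_succ_of_cast' {i k z : ℤ} (e : i + k = z + 1) : (z : ZMod 2) = i + 1 + (k + 1) + 1 := by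
  rw [cast_eq_of_add_eq_succ e]
  linear_combination -zmod_two_eq_zero

theorem isRep_augmentation : A.selfReal.IsRep 0 0 A.augmentation (DGAlg.const0 A.totAlg.one) := by
  have h0 : A.augmentation [] = fam A.self (GMPerversity.zero n) 0 A.one := by
    funext q j
    by_cases h : j = 0
    · subst h
      rw [fam_apply _ _ (GMPerversity.zero_le q)]
      simp [augmentation, unit]
    · rw [fam_neg (fun h' => h h'.2.symm)]
      simp [augmentation, h]
  refine ⟨fun l => ?_, fun l => ?_⟩
  · cases l with
    | nil =>
      rw [h0]
      simpa using sec_fam (M := A.self) (GMPerversity.zero n) 0 A.one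
    | cons a l => exact .zero
  · cases l with
    | nil =>
      rw [h0]
      have h1 : A.totAlg.one = _ := (inj_fam (ρ := A.selfReal) (GMPerversity.zero n) 0 A.one).symm
      simpa using h1
    | cons a l => exact (inj_zero _ _).symm

variable (A) in
theorem augmentation_mem : A.augmentation ∈ cocycles A.self (GMPerversity.zero n) 0 := by
  have h1 := isHoch_one.raw_mem_cocycles (A := A) (r := GMPerversity.zero n) le_rfl
    (by simpa using DGAlg.hD_const0_one)
  rwa [show A.selfReal.raw (GMPerversity.zero n) 0 _ = _ from isRep_augmentation.raw_eq_self] at h1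

theorem reps_one : A.selfReal.Reps (GMPerversity.zero n) 0 0 (DGAlg.const0 A.totAlg.one)
    (cls A.augmentation A.augmentation_mem) := by
  have h : A.selfReal.raw (GMPerversity.zero n) 0 (DGAlg.const0 A.totAlg.one) = A.augmentation :=
    isRep_augmentation.raw_eq_self
  refine ⟨le_rfl, isHoch_one, by simpa using DGAlg.hD_const0_one, ?_⟩
  simp only [h]
  exact ⟨A.augmentation_mem, trivial⟩

theorem hoch_cup_comm {i j : ℤ} {x y : Per n} {F G : List A.Tot → A.Tot}
    (hF : A.selfReal.IsHoch x i F) (hG : A.selfReal.IsHoch y j G)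
    (hDF : DGAlg.hD A.totAlg.selfBimod i F = 0) (hDG : DGAlg.hD A.totAlg.selfBimod j G = 0) :
    A.totAlg.conv A.totAlg.mul (j : ZMod 2) F G =
      sg ((i * j : ℤ) : ZMod 2) • A.totAlg.conv A.totAlg.mul (i : ZMod 2) G F
      + DGAlg.hD A.totAlg.selfBimod (i + j + 1 : ZMod 2)
        (sg (i + 1 : ZMod 2) • A.totAlg.circ (j + 1 : ZMod 2) F G) := by
  have h := DGAlg.hD_circ hF.mlin hF.par' hG.par' (DGAlg.par_circ hF.mlin hF.par' hG.par')
  rw [cast_succ_succ, cast_succ_succ, hDF, hDG, DGAlg.circ_zero_left, DGAlg.circ_zero_right _ hF.mlin,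
    smul_zero, zero_add, zero_add, show (1 + (j + 1) : ZMod 2) = j by rw [add_comm, cast_succ_succ],
    show (1 + (i + 1) : ZMod 2) = i by rw [add_comm, cast_succ_succ],
    show (i + 1 + (j + 1) + 1 : ZMod 2) = i + j + 1 by
      linear_combination zmod_two_eq_zero] at h
  rw [DGAlg.hD_zsmul, h, smul_add, sg_smul_sg_smul, sg_smul_smul, show
    (i + 1 + ((i + 1) * (j + 1) + (j + 1)) : ZMod 2) = i * j + 1 by
      linear_combination (i + j + 1 : ZMod 2) * zmod_two_eq_zero, sg_add]
  push_cast
  simp only [sg_one, mul_neg, _root_.mul_one, neg_smul]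
  abel

variable (A)

/-- Hochschild cohomology as a perverse Gerstenhaber algebra. -/
noncomputable def hochschildGerstenhaber : PerverseGerstenhaber R n (HH A.self) where
  res h := A.selfReal.resHH h
  res_refl ξ := by
    obtain ⟨F, h⟩ := exists_reps (ρ := A.selfReal) ξ
    exact (h.res _).eq h rfl rfl
  res_trans h h' ξ := by
    obtain ⟨F, hF⟩ := exists_reps (ρ := A.selfReal) ξ
    exact ((hF.res h).res h').eq (hF.res _) rfl rfl
  one := cls A.augmentation A.augmentation_mem
  cup h e := A.selfReal.actHH h e
  cup_res hp hq hr h h' e ξ η := by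
    obtain ⟨F, hF⟩ := exists_reps (ρ := A.selfReal) ξ
    obtain ⟨G, hG⟩ := exists_reps (ρ := A.selfReal) η
    exact ((hF.res hp).cup (hG.res hq) h' e).eq ((hF.cup hG h e).res hr) rfl rfl
  one_cup h e ξ := by
    obtain ⟨F, hF⟩ := exists_reps (ρ := A.selfReal) ξ
    refine (reps_one.cup hF h e).eq hF (zero_add _) ?_
    rw [DGAlg.conv_const0_left]
    exact funext fun l => A.totAlg.one_mul _
  cup_one h e ξ := by
    obtain ⟨F, hF⟩ := exists_reps (ρ := A.selfReal) ξ
    refine (hF.cup reps_one h e).eq hF (add_zero _) ?_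
    funext l
    rw [DGAlg.conv_const0, Int.cast_zero, DGAlg.twl_zero]
    exact A.totAlg.mul_one _
  cup_assoc h₁ h₂ h₃ h₄ e₁ e₂ e₃ e₄ ξ η χ := by
    obtain ⟨F, hF⟩ := exists_reps (ρ := A.selfReal) ξ
    obtain ⟨G, hG⟩ := exists_reps (ρ := A.selfReal) η
    obtain ⟨H, hH⟩ := exists_reps (ρ := A.selfReal) χ
    refine ((hF.cup hG h₁ e₁).cup hH h₂ e₂).eq (hF.cup (hG.cup hH h₃ e₃) h₄ e₄) (add_assoc _ _ _) ?_
    rw [cast_eq_of_add_eq e₃]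
    exact DGAlg.conv_assoc _ _ _ _ (fun a b c => A.totAlg.mul_assoc a b c) _ _ _ _ _
  cup_comm {_ _ _ i j k} h h' e e' ξ η := by
    obtain ⟨F, hF⟩ := exists_reps (ρ := A.selfReal) ξ
    obtain ⟨G, hG⟩ := exists_reps (ρ := A.selfReal) η
    rw [negOnePow_smul]
    refine (hF.cup hG h e).eq_of_exact ((hG.cup hF h' e').zsmul _) (add_comm _ _)
      (K := sg (i + 1 : ZMod 2) • A.totAlg.circ (j + 1 : ZMod 2) F G)
      (((hF.hoch.circ _ hG.hoch).zsmul _).cast rfl (by omega)) ?_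
    rw [hoch_cup_comm hF.hoch hG.hoch hF.cocycle hG.cocycle, cast_sub_one, cast_eq_of_add_eq e]
  bracket h e := bracketHH A h e
  bracket_res hp hq hr h h' e ξ η := by
    obtain ⟨F, hF⟩ := exists_reps (ρ := A.selfReal) ξ
    obtain ⟨G, hG⟩ := exists_reps (ρ := A.selfReal) η
    exact ((hF.res hp).bracket (hG.res hq) h' e).eq ((hF.bracket hG h e).res hr) rfl rfl
  bracket_skew {_ _ _ i j k} h h' e e' ξ η := by
    obtain ⟨F, hF⟩ := exists_reps (ρ := A.selfReal) ξ
    obtain ⟨G, hG⟩ := exists_reps (ρ := A.selfReal) η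
    rw [negOnePow_smul]
    refine (hF.bracket hG h e).eq ((hG.bracket hF h' e').zsmul _).neg (add_comm _ _) ?_
    rw [DGAlg.br_skew, Int.cast_mul, cast_sub_one, cast_sub_one]
  jacobi {_ _ _ _ _ _ _ i j k x y z w} h₁ h₁' h₂ h₂' h₃ h₃' e₁ e₁' e₂ e₂' e₃ e₃' ξ η χ := by
    obtain ⟨F, hF⟩ := exists_reps (ρ := A.selfReal) ξ
    obtain ⟨G, hG⟩ := exists_reps (ρ := A.selfReal) η
    obtain ⟨H, hH⟩ := exists_reps (ρ := A.selfReal) χ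
    rw [negOnePow_smul]
    refine ((hF.bracket hG h₁ e₁).bracket hH h₁' e₁').eq
      ((hF.bracket (hG.bracket hH h₂ e₂) h₂' e₂').sub
        (((hG.bracket (hF.bracket hH h₃ e₃) h₃' e₃').cast (by abel) rfl).zsmul _)) (add_assoc _ _ _) ?_
    have := DGAlg.br_jacobi hF.hoch.mlin hG.hoch.mlin hH.hoch.mlin hF.hoch.par' hG.hoch.par' hH.hoch.par'
    rw [Int.cast_mul, cast_sub_one, cast_sub_one, cast_succ_of_add_eq e₁, cast_succ_of_add_eq e₂,
      cast_succ_of_add_eq e₃, this]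
  leibniz {_ _ _ _ _ _ _ i j k x y z w} h₁ h₁' h₂ h₂' h₃ h₃' e₁ e₁' e₂ e₂' e₃ e₃' ξ η χ := by
    obtain ⟨F, hF⟩ := exists_reps (ρ := A.selfReal) ξ
    obtain ⟨G, hG⟩ := exists_reps (ρ := A.selfReal) η
    obtain ⟨H, hH⟩ := exists_reps (ρ := A.selfReal) χ
    rw [negOnePow_smul]
    have hb := hF.hoch.brace (j + 1 : ZMod 2) (k + 1 : ZMod 2) hG.hoch hH.hoch
    have hpb := hb.par'
    have := DGAlg.br_leibniz hF.hoch.mlin hG.hoch.mlin hF.hoch.par' hG.hoch.par' hH.hoch.par' (by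
        convert hpb using 1
        push_cast
        linear_combination 2 * zmod_two_eq_zero)
      (by rw [cast_succ_succ]; exact hF.cocycle) (by rw [cast_succ_succ]; exact hG.cocycle)
      (by rw [cast_succ_succ]; exact hH.cocycle)
    refine (hF.bracket (hG.cup hH h₁ e₁) h₁' e₁').eq_of_exact
      (((hF.bracket hG h₂ e₂).cup hH h₂' e₂').add
        (((hG.cup (hF.bracket hH h₃ e₃) h₃' e₃').cast (by abel) rfl).zsmul _)) (add_assoc _ _ _).symm
        ((hb.zsmul (-sg (i + 1 + (j + 1) : ZMod 2))).cast (add_assoc _ _ _) (by omega)) ?_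
    rw [cast_succ_succ] at this
    rw [Int.cast_mul, cast_sub_one, cast_succ_of_cast e₁, this, cast_succ_of_cast' e₃, cast_succ_succ]
    congr 2
    rw [cast_sub_one, show (w : ZMod 2) = i + (j + k) + 1 by
      rw [← cast_eq_of_add_eq e₁, cast_eq_of_add_eq_succ e₁']]
    linear_combination zmod_two_eq_zero

theorem isHochschildGerstenhaber : A.IsHochschildGerstenhaber A.hochschildGerstenhaber where
  res p q i h f hf := by
    obtain ⟨F, hr, hF⟩ := exists_rep_cls (ρ := A.selfReal) hf
    exact (hF.res h).exists_cls_eq hr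
  one := ⟨A.augmentation_mem, rfl⟩
  cup p q r i j k h e f g hf hg := by
    obtain ⟨F, hr, hF⟩ := exists_rep_cls (ρ := A.selfReal) hf
    obtain ⟨G, hr', hG⟩ := exists_rep_cls (ρ := A.selfReal) hg
    exact (hF.cup hG h e).exists_cls_eq ((hr.act hF.hoch.mlin hr').cast rfl e)
  bracket p q r i j k h e f g hf hg := by
    obtain ⟨F, hr, hF⟩ := exists_rep_cls (ρ := A.selfReal) hf
    obtain ⟨G, hr', hG⟩ := exists_rep_cls (ρ := A.selfReal) hg
    have h1 := (hr.bracket hf.1 hg.1 hF.hoch.mlin hr' hG.hoch.mlin).cast rfl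
      (show i + j - 1 = k by omega)
    push_cast at h1
    exact (hF.bracket hG h e).exists_cls_eq h1

end PDGA

namespace PDGA

variable {R : Type u} [CommRing R] {n : ℕ} {A : PDGA R n}

open Realization

/-! ### The Connes operator on cohomology -/

open Classical in
variable (A) in
/-- The dual of the Connes boundary as an operation on all functions on words. -/
noncomputable def connesOp (c : ZMod 2) (F : List A.Tot → A.Tot →ₗ[R] R) :
    List A.Tot → A.Tot →ₗ[R] R :=
  if h : MLin R F then A.totAlg.connes c F h else 0

theorem connesOp_eq (c : ZMod 2) {F : List A.Tot → A.Tot →ₗ[R] R} (h : MLin R F) :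
    A.connesOp c F = A.totAlg.connes c F h := dif_pos h

theorem connesOp_zero (c : ZMod 2) : A.connesOp c 0 = 0 := by
  rw [connesOp_eq c (F := 0) MLin.fzero]
  funext l
  refine LinearMap.ext fun a => ?_
  simp [DGAlg.connes_apply]

theorem op_connes {i k : ℤ} (e : i = k + 1) : Op A.dualReal A.dualReal i k (A.connesOp i) where
  good _ _ _ _ h h' hg := by
    rw [connesOp_eq _ h.mlin, connesOp_eq _ h'.mlin]
    exact (good_connes h h' hg i).cast rfl rfl (by omega)
  hoch _ _ h := by
    rw [connesOp_eq _ h.mlin]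
    exact (h.connes i).cast rfl (by omega)
  add F F' h h' := by
    rw [connesOp_eq _ h, connesOp_eq _ h', connesOp_eq _ (h.fadd h')]
    funext l
    refine LinearMap.ext fun a => ?_
    simp only [DGAlg.connes_apply, Pi.add_apply, LinearMap.add_apply, splitSum_add, smul_add]
  smul F a h := by
    rw [connesOp_eq _ h, connesOp_eq _ (h.fsmul a)]
    funext l
    refine LinearMap.ext fun b => ?_
    simp only [DGAlg.connes_apply, Pi.smul_apply, LinearMap.smul_apply, splitSum_smul,
      smul_comm _ a]
  cocycle x F h hD := by
    have h1 := DGAlg.hD_connes h.mlin h.parD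
    rw [connesOp_eq _ h.mlin, show (k : ZMod 2) = i + 1 by
      rw [e]; push_cast; rw [cast_succ_succ], h1, ← connesOp_eq, hD, connesOp_zero, neg_zero]
  exact x K h := by
    have h1 := DGAlg.hD_connes h.mlin h.parD
    refine ⟨-A.totAlg.connes (i - 1 : ℤ) K h.mlin, ?_, ?_⟩
    · have := ((h.connes (i - 1 : ℤ)).zsmul (-1)).cast (c' := k - 1) rfl (by omega)
      simpa using this
    · have h2 := DGAlg.hD_zsmul A.totAlg.dualBimod (k - 1 : ℤ) (-1)
        (A.totAlg.connes (i - 1 : ℤ) K h.mlin)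
      rw [neg_one_smul, neg_one_smul] at h2
      rw [h2, show ((k - 1 : ℤ) : ZMod 2) = (i - 1 : ℤ) + 1 by
        rw [show k = i - 1 by omega]; push_cast
        linear_combination -zmod_two_eq_zero, h1, neg_neg,
        ← connesOp_eq, show ((i - 1 : ℤ) : ZMod 2) + 1 = i by push_cast; ring]

variable (A) in
/-- The operator on Hochschild cohomology induced by the dual of the Connes boundary. -/
noncomputable def connesHH {p : GMPerversity n} {i k : ℤ} (e : i = k + 1) :
    HH A.dual p i →ₗ[R] HH A.dual p k :=
  ((op_connes (A := A) e).exists_linear (le_refl p)).choose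

theorem Realization.Reps.connes {p : GMPerversity n} {x : Per n} {i k : ℤ}
    {F : List A.Tot → A.Tot →ₗ[R] R} {ξ : HH A.dual p i} (hF : A.dualReal.Reps p x i F ξ)
    (e : i = k + 1) : A.dualReal.Reps p x k (A.connesOp i F) (A.connesHH e ξ) :=
  ((op_connes (A := A) e).exists_linear (le_refl p)).choose_spec hF

/-! ### Comparison with the operator on families -/

theorem inj_dual_inc {x : Per n} {i j : ℤ} {s : Fam A.dual} (hs : Sec x i s) {q : GMPerversity n}
    (hq : x ≤ q.per) (a : A.X q.compl (-j)) :
    A.dualReal.inj x i s (A.inc q.compl (-j) a) = ev (s q j) a := by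
  refine (form_inc _ _ _ _ _ _).trans ?_
  by_cases h : j = i
  · subst h
    rw [fam_apply _ _ (GMPerversity.compl_le (Per.hull_le hq)), ← hs.res_hull hq]
    rfl
  · rw [fam_neg fun h' => h (by omega), map_zero, hs.supp _ _ fun h' => h h'.2, map_zero]
    rfl

theorem compl_top : (GMPerversity.top n).compl = GMPerversity.zero n :=
  GMPerversity.ext (funext fun _ => Nat.sub_self _)

theorem inj_dual_one {x : Per n} {i : ℤ} {s : Fam A.dual} (hs : Sec x i s) :
    A.dualReal.inj x i s A.totAlg.one = A.evalOne (s (GMPerversity.top n) 0) := by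
  by_cases hx : x ≤ (GMPerversity.top n).per
  · have h1 : A.totAlg.one = A.inc (GMPerversity.top n).compl (-0) (A.unit _) :=
      inc_eq_of_res compl_top.symm rfl rfl
    rw [h1, inj_dual_inc hs hx]
    rfl
  · rw [hs.eq_zero hx, inj_zero]
    exact (map_zero A.evalOne).symm

theorem bdual_eq {r : GMPerversity n} {c : ℤ} {f : A.RawCochain A.dual} (hf : IsCochain A.dual r c f)
    {F : List A.Tot → A.Tot →ₗ[R] R} (hF : A.dualReal.IsHoch r.per c F)
    (hr : A.dualReal.IsRep r.per c f F) :
    Bdual r c f hf = A.dualReal.raw r r.per (A.totAlg.connes c F hF.mlin) := by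
  have key : ∀ (u v : List A.Letter) (q : GMPerversity n) (j : ℤ) (a : A.X q.compl (-j)),
      F (v.map el ++ el ⟨q.compl, -j, a⟩ :: u.map el) A.totAlg.one =
        A.evalOne (f (v ++ ⟨q.compl, -j, a⟩ :: u) (GMPerversity.top n) 0) := by
    intro u v q j a
    rw [← letters_insert, hr.eq, inj_dual_one (hr.sec _)]
  funext l q j
  refine ev_ext fun a => ?_
  have hB : ev (Bdual r c f hf l q j) a = (c + 1 + -j * wordDeg l).negOnePow •
      ∑ i ∈ Finset.range (l.length + 1), ((-j - 1 + wordDeg (l.take i)) * wordDeg (l.drop i)).negOnePow •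
        A.evalOne (f (l.drop i ++ ⟨q.compl, -j, a⟩ :: l.take i) (GMPerversity.top n) 0) := by
    change ((_ : ℤˣ) • (∑ i ∈ _, (_ : ℤˣ) • _ : A.X q.compl (-j) →ₗ[R] R)) a = _
    rw [LinearMap.smul_apply, LinearMap.sum_apply]
    rfl
  have hps : ∀ i, psum (l.drop i ++ (⟨q.compl, -j, a⟩ : A.Letter) :: l.take i) =
      psum l + q.compl.per := by
    intro i
    conv_rhs => rw [← List.take_append_drop i l]
    simp only [psum_append, psum_cons]
    abel
  have hwd : ∀ i, wordDeg (l.drop i ++ (⟨q.compl, -j, a⟩ : A.Letter) :: l.take i) =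
      wordDeg l - j - 1 := by
    intro i
    conv_rhs => rw [← List.take_append_drop i l]
    simp only [wordDeg_append, wordDeg_cons]
    ring
  rw [hB]
  by_cases hq : r.per + psum l ≤ q.per
  · obtain ⟨s, hs, h1⟩ := (hF.connes c).exists_sec l
    rw [raw_apply hq, h1, ext_inj hs, ← inj_dual_inc hs hq, ← h1, DGAlg.connes_apply, splitSum_map,
      splitSum_eq_range]
    rw [negOnePow_smul, Finset.smul_sum, Finset.smul_sum]
    refine Finset.sum_congr rfl fun i _ => ?_
    have h2 := (hF.mlin.comp (LinearMap.applyₗ A.totAlg.one)).twl_letters_append 1 (l.drop i)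
      (el ⟨q.compl, -j, a⟩ :: A.totAlg.twl c ((l.take i).map el))
    have h3 := ((hF.mlin.comp (LinearMap.applyₗ A.totAlg.one)).prepend
      ((l.drop i).map el ++ [el ⟨q.compl, -j, a⟩])).twl_letters c (l.take i)
    simp only [List.append_assoc, List.cons_append, List.nil_append, LinearMap.applyₗ_apply_apply] at h2 h3
    refine Eq.trans ?_ (congrArg (sg ((c : ZMod 2) + 1) • ·) h2.symm)
    rw [h3, key, negOnePow_smul, sg_smul_smul, sg_smul_smul, sg_smul_smul]
    by_cases hd : 0 = c + (wordDeg l - j - 1)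
    · congr 2
      have hl : wordDeg l = wordDeg (l.take i) + wordDeg (l.drop i) := by
        rw [← wordDeg_append, List.take_append_drop]
      obtain rfl : j = c + wordDeg l - 1 := by omega
      rw [hl]
      push_cast
      generalize (wordDeg (l.take i) : ZMod 2) = U
      generalize (wordDeg (l.drop i) : ZMod 2) = V
      generalize (c : ZMod 2) = C
      revert U V C
      decide
    · rw [hf.support _ _ _ fun h => hd (by rw [← hwd i]; exact h.2), map_zero, smul_zero, smul_zero]
  · rw [raw_apply_neg hq, map_zero, Finset.sum_eq_zero, smul_zero]
    · rfl
    · intro i _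
      rw [hf.support _ _ _ fun h => hq ?_, map_zero, smul_zero]
      have h1 : r.per + psum (l.drop i ++ (⟨q.compl, -j, a⟩ : A.Letter) :: l.take i) ≤
        (GMPerversity.top n).per := h.1
      rw [hps, ← add_assoc, ← per_le_compl_iff] at h1
      intro k
      have h2 : (r.per + psum l).1 k ≤ (GMPerversity.top n).toFun k - ((GMPerversity.top n).toFun k - q.toFun k) := h1 k
      have h3 : q.toFun k ≤ (GMPerversity.top n).toFun k := q.le_top k
      exact h2.trans (by change _ ≤ q.toFun k; omega)

theorem isInducedByBdual_connesHH : A.IsInducedByBdual fun e => A.connesHH e := by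
  intro p i k e f hf
  obtain ⟨F, hr, hF⟩ := exists_rep_cls (ρ := A.dualReal) hf
  obtain ⟨-, -, -, hm, h⟩ := hF.connes e
  have h1 : A.dualReal.raw p p.per (A.connesOp i F) = Bdual p i f hf.1 := by
    rw [bdual_eq hf.1 hF.hoch hr, connesOp_eq]
  exact ⟨h1 ▸ hm, by rw [h]; simp only [h1]⟩

/-! ### The trace given by a cocycle of the dual bimodule -/

variable {m : ℤ} (ζ : A.dual.X (.zero n) m)

/-- The linear form on the total algebra given by an element of perverse degree `0`. -/
noncomputable def trace : A.Tot →ₗ[R] R := form (GMPerversity.zero n) m ζ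

theorem rel_trace : A.dualReal.Rel 0 0 m (trace ζ) (trace ζ) := by
  have h : trace ζ = _ := (inj_fam (ρ := A.dualReal) (GMPerversity.zero n) m ζ).symm
  have hs := sec_fam (GMPerversity.zero n) m ζ
  rw [GMPerversity.per_zero] at hs
  exact ⟨_, _, ⟨le_rfl, hs, hs, fun _ _ _ => rfl⟩, h, h⟩

theorem isRep_lift : A.dualReal.IsRep 0 m (A.lift ζ) (DGAlg.const0 (trace ζ)) := by
  have h0 : A.lift ζ [] = fam A.dual (.zero n) m ζ := by
    funext q j
    rw [lift]
    by_cases h : j = m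
    · subst h
      rw [fam_apply _ _ (GMPerversity.zero_le q)]
      have h1 : A.augmentation [] q (j - j) = (sub_self j).symm ▸ A.unit q := by
        simp [augmentation]
      have h2 : ∀ {i : ℤ} (hi : 0 = i) (e : i + j = j),
          A.gMap ζ q e (hi ▸ A.unit q) = A.dual.res (GMPerversity.zero_le q) ζ := by
        rintro i rfl e
        have h3 := A.dual.lsmul_res (GMPerversity.zero_le q) (le_refl (GMPerversity.zero n))
          (GMPerversity.zero_le q)
          (show (GMPerversity.zero n).toFun + (GMPerversity.zero n).toFun ≤ (GMPerversity.zero n).toFun from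
            (add_zero (GMPerversity.zero n).toFun).le)
          (show q.toFun + (GMPerversity.zero n).toFun ≤ q.toFun from (add_zero q.toFun).le) e A.one ζ
        rw [A.dual.res_refl, A.dual.one_lsmul] at h3
        exact h3
      rw [h1]
      exact h2 _ _
    · rw [fam_neg fun h' => h h'.2.symm]
      have : A.augmentation [] q (j - m) = 0 := by
        simp only [augmentation]
        rw [dif_neg (by omega)]
      rw [this, map_zero]
  have h1 : ∀ a l, A.lift ζ (a :: l) = 0 := fun a l => by
    funext q j
    exact map_zero _
  refine ⟨fun l => ?_, fun l => ?_⟩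
  · cases l with
    | nil =>
      rw [h0]
      simpa using sec_fam (M := A.dual) (GMPerversity.zero n) m ζ
    | cons a l => rw [h1]; exact .zero
  · cases l with
    | nil =>
      rw [h0]
      have h1 : trace ζ = _ := (inj_fam (ρ := A.dualReal) (GMPerversity.zero n) m ζ).symm
      simpa using h1
    | cons a l => rw [h1]; exact (inj_zero _ _).symm

theorem totMul_comm (hA : A.IsCommutative) {p q : GMPerversity n} {i j : ℤ} (a : A.X p i) (b : A.X q j) :
    A.totAlg.mul (A.inc p i a) (A.inc q j b) =
      sg ((i : ZMod 2) * j) • A.totAlg.mul (A.inc q j b) (A.inc p i a) := by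
  rw [show A.totAlg.mul (A.inc p i a) (A.inc q j b) = _ from totMul_inc a b,
    show A.totAlg.mul (A.inc q j b) (A.inc p i a) = _ from totMul_inc b a, ← map_zsmul]
  have key : ∀ {s s' : GMPerversity n} {k k' : ℤ}, s = s' → k = k' →
      A.inc s k (lact A.self a b s k) = A.inc s' k' (sg ((i : ZMod 2) * j) • lact A.self b a s' k') := by
    rintro s _ k _ rfl rfl
    congr 1
    by_cases h : p.per + q.per ≤ s.per ∧ i + j = k
    · rw [lact_pos h.1 h.2, lact_pos (by rw [add_comm]; exact h.1) (by omega), ← Int.cast_mul,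
        ← negOnePow_smul]
      exact hA h.1 _ h.2 _ a b
    · rw [lact_neg h, lact_neg, smul_zero]
      rwa [add_comm, add_comm j]
  exact key (by rw [add_comm]) (add_comm _ _)

theorem trace_inc_ne {p : GMPerversity n} {i : ℤ} (h : i ≠ -m) (a : A.X p i) :
    trace ζ (A.inc p i a) = 0 := by
  refine (form_inc _ _ _ _ _ _).trans ?_
  rw [fam_neg fun h' => h h'.2, map_zero]

theorem isTrace (hA : A.IsCommutative) (hζ : A.dual.d rfl ζ = 0) :
    A.totAlg.IsTrace m (trace ζ) where
  d a := by
    have h1 : A.totAlg.dualBimod.d (trace ζ) = 0 := by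
      refine (A.dualReal.d_inn _ _ _ rfl ζ).trans ?_
      rw [hζ, map_zero]
    have h2 := LinearMap.congr_fun h1 (A.totAlg.tw a)
    rw [DGAlg.dual_d, A.totAlg.d_tw] at h2
    simpa [A.totAlg.tw_tw] using h2
  tw a := by
    refine LinearMap.congr_fun (f := trace ζ ∘ₗ A.totAlg.tw) (g := sg ((m : ZMod 2) + 1) • trace ζ)
      (tot_hom_ext fun p i a => ?_) a
    rw [LinearMap.comp_apply, show A.totAlg.tw (A.inc p i a) = _ from totTw_inc a, map_zsmul,
      LinearMap.smul_apply]
    by_cases h : i = -m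
    · subst h
      push_cast
      rw [CharTwo.neg_eq]
    · rw [trace_inc_ne ζ h, smul_zero, smul_zero]
  mul a b := by
    have h1 : ∀ (p : GMPerversity n) (i : ℤ) (a : A.X p i) (q : GMPerversity n) (j : ℤ) (b : A.X q j),
        trace ζ (A.totAlg.mul (A.inc p i a) (A.inc q j b)) = sg ((m : ZMod 2) + 1) •
          trace ζ (A.totAlg.mul (A.inc q j b) (A.totAlg.twz (m + 1) (A.inc p i a))) := by
      intro p i a q j b
      have h2 := twz_el (m + 1 : ZMod 2) (⟨p, i, a⟩ : A.Letter)
      rw [show A.totAlg.twz (m + 1 : ZMod 2) (A.inc p i a) = _ from h2, map_zsmul, map_zsmul,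
        sg_smul_smul, totMul_comm hA, map_zsmul]
      change _ • trace ζ (A.totAlg.mul (A.inc q j b) (A.inc p i a)) =
        _ • trace ζ (A.totAlg.mul (A.inc q j b) (A.inc p i a))
      by_cases h : j + i = -m
      · congr 2
        obtain rfl : j = -m - i := by omega
        push_cast
        generalize (i : ZMod 2) = I
        generalize (m : ZMod 2) = M
        revert I M
        decide
      · rw [show A.totAlg.mul (A.inc q j b) (A.inc p i a) = _ from totMul_inc b a,
          trace_inc_ne ζ h, smul_zero, smul_zero]
    refine LinearMap.congr_fun₂ (f := (A.totAlg.mul).compr₂ (trace ζ))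
      (g := sg ((m : ZMod 2) + 1) • ((A.totAlg.mul.flip ∘ₗ A.totAlg.twz (m + 1)).compr₂ (trace ζ)))
      (tot_hom_ext fun p i a => tot_hom_ext fun q j b => ?_) a b
    exact h1 p i a q j b

theorem reps_lift (hA : A.IsCommutative) (hζ : A.dual.d rfl ζ = 0) :
    ∃ h : A.lift ζ ∈ cocycles A.dual (.zero n) m,
      A.dualReal.Reps (GMPerversity.zero n) 0 m (DGAlg.const0 (trace ζ)) (cls (A.lift ζ) h) := by
  have h1 : A.dualReal.raw (GMPerversity.zero n) 0 (DGAlg.const0 (trace ζ)) = A.lift ζ :=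
    (isRep_lift ζ).raw_eq_self
  have h2 := (isHoch_const0 (rel_trace ζ)).reps (r := GMPerversity.zero n) le_rfl
    (DGAlg.hD_const0 (isTrace ζ hA hζ))
  obtain ⟨-, -, -, hm, -⟩ := id h2
  refine ⟨h1 ▸ hm, ⟨h2.le, h2.hoch, h2.cocycle, hm, ?_⟩⟩
  simp only [h1]

theorem bdual_lift (h : IsCochain A.dual (.zero n) m (A.lift ζ)) :
    Bdual (GMPerversity.zero n) m (A.lift ζ) h = 0 := by
  have h1 : A.totAlg.connes m (DGAlg.const0 (trace ζ)) (DGAlg.mlin_const0 _) = 0 := by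
    funext l
    refine LinearMap.ext fun a => ?_
    rw [DGAlg.connes_apply]
    simp
  rw [bdual_eq h (isHoch_const0 (rel_trace ζ)) (isRep_lift ζ), h1, raw_zero]

end PDGA

namespace DGBimod

variable {R : Type v} {A : Type u} [CommRing R] [AddCommGroup A] [Module R A] {𝒜 : DGAlg R A}
  {N N' : Type*} [AddCommGroup N] [Module R N] [AddCommGroup N'] [Module R N']

/-- Linear maps of degree `m` compatible with the structure of bimodules. -/
structure IsHom (ℬ : DGBimod 𝒜 N) (ℬ' : DGBimod 𝒜 N') (m : ZMod 2) (W : N →ₗ[R] N') : Prop where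
  d : ∀ x, ℬ'.d (W x) = sg m • W (ℬ.d x)
  sgn : ∀ x, ℬ'.sgn (W x) = sg m • W (ℬ.sgn x)
  lm : ∀ a x, W (ℬ.lm a x) = sg m • ℬ'.lm (𝒜.twz m a) (W x)
  rm : ∀ x a, W (ℬ.rm x a) = ℬ'.rm (W x) a

variable {ℬ : DGBimod 𝒜 N} {ℬ' : DGBimod 𝒜 N'} {m : ZMod 2} {W : N →ₗ[R] N'}

/-- The homotopy fiber of a morphism of degree `m`. -/
def fiber (h : IsHom ℬ ℬ' m W) : DGBimod 𝒜 (N × N') where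
  lm := LinearMap.mk₂ R (fun a x => (ℬ.lm a x.1, sg (m + 1) • ℬ'.lm (𝒜.twz (m + 1) a) x.2))
    (fun a b x => by simp) (fun s a x => by simp [smul_comm _ s])
    (fun a x y => by simp) (fun s a x => by simp [smul_comm _ s])
  rm := LinearMap.mk₂ R (fun x a => (ℬ.rm x.1 a, ℬ'.rm x.2 a))
    (fun a b x => by simp) (fun s a x => by simp) (fun a x y => by simp) (fun s a x => by simp)
  d := LinearMap.prod (ℬ.d ∘ₗ LinearMap.fst R N N')
    (W ∘ₗ LinearMap.fst R N N' + sg (m + 1) • ℬ'.d ∘ₗ LinearMap.snd R N N')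
  sgn := LinearMap.prod (ℬ.sgn ∘ₗ LinearMap.fst R N N')
    (sg (m + 1) • ℬ'.sgn ∘ₗ LinearMap.snd R N N')
  mul_lm a b x := by
    simp only [LinearMap.mk₂_apply, ℬ.mul_lm, DGAlg.twz_mul, map_zsmul, LinearMap.smul_apply, ℬ'.mul_lm,
      sg_smul_smul, CharTwo.add_self_eq_zero]
  lm_rm a x b := by simp [ℬ.lm_rm, ℬ'.lm_rm]
  rm_mul x a b := by simp [ℬ.rm_mul, ℬ'.rm_mul]
  one_lm x := by simp [ℬ.one_lm, DGAlg.twz_oneA, ℬ'.one_lm, sg_smul_sg_smul]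
  rm_one x := by simp [ℬ.rm_one, ℬ'.rm_one]
  d_lm a x := by
    have h1 : sg m • ℬ'.lm (𝒜.twz m a) (W x.1) =
        -(sg (m + 1) • ℬ'.lm (𝒜.twz (m + 1) (𝒜.tw a)) (W x.1)) := by
      rw [← DGAlg.twz_one, DGAlg.twz_twz, sg_add, add_assoc, CharTwo.add_self_eq_zero]
      simp
    have h2 : ∀ y, ℬ'.lm (𝒜.tw (𝒜.twz (m + 1) a)) y = ℬ'.lm (𝒜.twz (m + 1) (𝒜.tw a)) y := by
      intro y
      rw [← DGAlg.twz_one, DGAlg.twz_twz, ← DGAlg.twz_one, DGAlg.twz_twz, add_comm]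
    refine Prod.ext ?_ ?_
    · simp [ℬ.d_lm]
    · simp only [LinearMap.prod_apply, LinearMap.mk₂_apply, Function.prod, LinearMap.add_apply,
        LinearMap.comp_apply, LinearMap.fst_apply, LinearMap.smul_apply, LinearMap.snd_apply, h.lm,
        map_zsmul, ℬ'.d_lm, sg_smul_sg_smul, Prod.snd_sub, map_add, smul_add, DGAlg.d_twz, h1, h2]
      abel
  d_rm x a := by
    refine Prod.ext ?_ ?_
    · simp [ℬ.d_rm]
    · simp only [LinearMap.prod_apply, LinearMap.mk₂_apply, Function.prod, LinearMap.add_apply,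
        LinearMap.comp_apply, LinearMap.fst_apply, LinearMap.smul_apply, LinearMap.snd_apply, h.rm,
        map_zsmul, ℬ'.d_rm, Prod.snd_add, map_add, smul_add]
      abel

variable (h : IsHom ℬ ℬ' m W)

theorem fiber_lm (a : A) (x : N × N') :
    (fiber h).lm a x = (ℬ.lm a x.1, sg (m + 1) • ℬ'.lm (𝒜.twz (m + 1) a) x.2) := rfl

theorem fiber_d (x : N × N') :
    (fiber h).d x = (ℬ.d x.1, W x.1 + sg (m + 1) • ℬ'.d x.2) := rfl

theorem hD_fiber (c : ZMod 2) (F : List A → N) (G : List A → N') :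
    DGAlg.hD (fiber h) c (fun l => (F l, G l)) = fun l => (DGAlg.hD ℬ c F l,
      W (F l) + sg (m + 1) • DGAlg.hD ℬ' (c + m + 1) G l) := by
  funext l
  have h1 := DGAlg.circ_comp_left (𝒜 := 𝒜) 1 (LinearMap.fst R N N') (fun l => (F l, G l)) 𝒜.mm l
  have h2 := DGAlg.circ_comp_left (𝒜 := 𝒜) 1 (LinearMap.snd R N N') (fun l => (F l, G l)) 𝒜.mm l
  simp only [LinearMap.fst_apply, LinearMap.snd_apply] at h1 h2
  have h3 : 𝒜.conv (fiber h).rm 1 (fun l => (F l, G l)) DGAlg.id1 l =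
      (𝒜.conv ℬ.rm 1 F DGAlg.id1 l, 𝒜.conv ℬ'.rm 1 G DGAlg.id1 l) := by
    refine Prod.ext ?_ ?_
    · exact map_splitSum (LinearMap.fst R N N') _ l
    · exact map_splitSum (LinearMap.snd R N N') _ l
  have h4 : 𝒜.conv (fiber h).lm c DGAlg.id1 (fun l => (F l, G l)) l =
      (𝒜.conv ℬ.lm c DGAlg.id1 F l, sg (m + 1) • 𝒜.conv ℬ'.lm (c + m + 1) DGAlg.id1 G l) := by
    refine Prod.ext ?_ ?_
    · exact map_splitSum (LinearMap.fst R N N') _ l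
    · refine (map_splitSum (LinearMap.snd R N N') _ l).trans ?_
      refine Eq.trans ?_ (splitSum_zsmul (sg (m + 1)) _ l)
      refine splitSum_congr fun u v _ => ?_
      rw [fiber_lm, LinearMap.snd_apply, DGAlg.id1_twl, DGAlg.id1_twl, DGAlg.twz_twz,
        show m + 1 + c = c + m + 1 by ring]
  rw [DGAlg.hD, h3, h4, fiber_d]
  refine Prod.ext ?_ ?_
  · simp [DGAlg.hD, h1]
  · simp only [DGAlg.hD, Prod.snd_add, Prod.snd_sub, Prod.smul_snd, ← h2, smul_add, smul_sub,
      sg_smul_smul, show m + 1 + (c + m + 1) = c by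
        linear_combination (m + 1) * zmod_two_eq_zero]
    abel

end DGBimod

namespace PDGA

variable {R : Type u} [CommRing R] {n : ℕ} {A : PDGA R n}

/-! ### Homotopy fibers -/

section Fiber

variable {M M' : PBimod A} {m : ℤ}

/-- The homotopy fiber of a morphism of bimodules of degree `m`. -/
def fiber (w : BimodHom M M' m) : PBimod A where
  X p i := M.X p i × M'.X p (i + m - 1)
  res h := (M.res h).prodMap (M'.res h)
  d {p i j} e := LinearMap.prod (M.d e ∘ₗ LinearMap.fst _ _ _)
    (w.map p (show i + m = j + m - 1 by omega) ∘ₗ LinearMap.fst _ _ _ + sg (m + 1 : ZMod 2) •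
      M'.d (show i + m - 1 + 1 = j + m - 1 by omega) ∘ₗ LinearMap.snd _ _ _)
  res_refl x := by simp [M.res_refl, M'.res_refl]
  res_trans h h' x := by simp [M.res_trans, M'.res_trans]
  d_d {p i j k} h h' x := by
    refine Prod.ext (M.d_d h h' x.1) ?_
    have h1 := w.map_d (show i + m = j + m - 1 by omega) (show j + m = k + m - 1 by omega) h
      (show j + m - 1 + 1 = k + m - 1 by omega) x.1
    simp only [LinearMap.prod_apply, Function.prod, LinearMap.comp_apply, LinearMap.fst_apply,
      LinearMap.add_apply, LinearMap.smul_apply, LinearMap.snd_apply, map_add, map_zsmul, M'.d_d,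
      smul_zero, add_zero, h1, negOnePow_smul, sg_smul_smul]
    rw [show (m + 1 + m : ZMod 2) = 1 by linear_combination m * zmod_two_eq_zero]
    simp
  d_res h e x := by
    refine Prod.ext (M.d_res h e x.1) ?_
    simp [w.map_res, M'.d_res]
  lsmul {p q r i j k} h e := LinearMap.mk₂ R (fun a x => (M.lsmul h e a x.1,
      sg ((m + 1) * i : ZMod 2) • M'.lsmul h (show i + (j + m - 1) = k + m - 1 by omega) a x.2))
    (fun a b x => by simp) (fun s a x => by simp [smul_comm _ s])
    (fun a x y => by simp) (fun s a x => by simp [smul_comm _ s])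
  rsmul {p q r i j k} h e := LinearMap.mk₂ R (fun x a => (M.rsmul h e x.1 a,
      M'.rsmul h (show i + m - 1 + j = k + m - 1 by omega) x.2 a))
    (fun a b x => by simp) (fun s a x => by simp) (fun a x y => by simp) (fun s a x => by simp)
  lsmul_res hp hq hr h h' e a x :=
    Prod.ext (M.lsmul_res hp hq hr h h' e a x.1) (by
      simp [M'.lsmul_res hp hq hr h h' _ a x.2])
  rsmul_res hp hq hr h h' e x a :=
    Prod.ext (M.rsmul_res hp hq hr h h' e x.1 a) (M'.rsmul_res hp hq hr h h' _ x.2 a)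
  one_lsmul h e x := Prod.ext (M.one_lsmul h e x.1) (by simp [M'.one_lsmul])
  rsmul_one h e x := Prod.ext (M.rsmul_one h e x.1) (M'.rsmul_one h _ x.2)
  mul_lsmul {p q r s s' t i j k x y z} h₁ h₂ h₃ h₄ e₁ e₂ e₃ e₄ a b c :=
    Prod.ext (M.mul_lsmul h₁ h₂ h₃ h₄ e₁ e₂ e₃ e₄ a b c.1) (by
      have h1 := M'.mul_lsmul (z := z + m - 1) h₁ h₂ h₃ h₄ e₁ (by omega)
        (show j + (k + m - 1) = y + m - 1 by omega) (by omega) a b c.2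
      have h2 : (x : ZMod 2) = i + j := cast_eq_of_add_eq e₁
      simp [h1, sg_smul_smul, h2, mul_add])
  lsmul_rsmul {p q r s s' t i j k x y z} h₁ h₂ h₃ h₄ e₁ e₂ e₃ e₄ a b c :=
    Prod.ext (M.lsmul_rsmul h₁ h₂ h₃ h₄ e₁ e₂ e₃ e₄ a b.1 c) (by
      have h1 := M'.lsmul_rsmul (z := z + m - 1) h₁ h₂ h₃ h₄
        (show i + (j + m - 1) = x + m - 1 by omega) (by omega)
        (show j + m - 1 + k = y + m - 1 by omega) (by omega) a b.2 c
      simp [h1])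
  rsmul_mul {p q r s s' t i j k x y z} h₁ h₂ h₃ h₄ e₁ e₂ e₃ e₄ a b c :=
    Prod.ext (M.rsmul_mul h₁ h₂ h₃ h₄ e₁ e₂ e₃ e₄ a.1 b c) (M'.rsmul_mul h₁ h₂ h₃ h₄ _ _ e₃ _ a.2 b c)
  d_lsmul {p q r i i' j j' k k'} h e ei ej ek e₁ e₂ a x := by
    refine Prod.ext (M.d_lsmul h e ei ej ek e₁ e₂ a x.1) ?_
    have h1 := M'.d_lsmul h (show i + (j + m - 1) = k + m - 1 by omega) ei
      (show j + m - 1 + 1 = j' + m - 1 by omega) (show k + m - 1 + 1 = k' + m - 1 by omega)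
      (by omega) (by omega) a x.2
    have h2 := w.map_lsmul h e (show j + m = j' + m - 1 by omega) (show k + m = k' + m - 1 by omega)
      (by omega) a x.1
    have h3 : (i' : ZMod 2) = i + 1 := by rw [← ei]; push_cast; rfl
    simp only [LinearMap.prod_apply, Function.prod, LinearMap.comp_apply, LinearMap.fst_apply,
      LinearMap.mk₂_apply, Prod.snd_add, Prod.smul_snd,
      LinearMap.add_apply, LinearMap.smul_apply, LinearMap.snd_apply, map_add, map_zsmul, h1, h2,
      negOnePow_smul, sg_smul_smul, smul_add, h3]
    push_cast
    rw [show (i + (m + 1) * i : ZMod 2) = m * i by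
      linear_combination (i : ZMod 2) * zmod_two_eq_zero,
      show (m + 1 + (m + 1) * i : ZMod 2) = (m + 1) * (i + 1) by ring,
      show (i + ((m + 1) * i + (m + 1)) : ZMod 2) = m + 1 + ((m + 1) * i + i) by ring]
    abel
  d_rsmul {p q r i i' j j' k k'} h e ei ej ek e₁ e₂ x a := by
    refine Prod.ext (M.d_rsmul h e ei ej ek e₁ e₂ x.1 a) ?_
    have h1 := M'.d_rsmul h (show i + m - 1 + j = k + m - 1 by omega)
      (show i + m - 1 + 1 = i' + m - 1 by omega) ej (show k + m - 1 + 1 = k' + m - 1 by omega)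
      (by omega) (by omega) x.2 a
    have h2 := w.map_rsmul h e (show i + m = i' + m - 1 by omega) (show k + m = k' + m - 1 by omega)
      (by omega) x.1 a
    simp only [LinearMap.prod_apply, Function.prod, LinearMap.comp_apply, LinearMap.fst_apply,
      LinearMap.mk₂_apply, Prod.snd_add, Prod.smul_snd, map_zsmul,
      LinearMap.add_apply, LinearMap.smul_apply, LinearMap.snd_apply, map_add, map_zsmul, h1, h2,
      negOnePow_smul, sg_smul_smul, smul_add]
    push_cast
    rw [show (m + 1 + (i + m - 1) : ZMod 2) = i by
      linear_combination m * zmod_two_eq_zero]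
    abel

end Fiber

end PDGA

namespace Per

variable {n : ℕ} {x y : Per n}

theorem hull_mono (h : x ≤ y) (hy : y ≤ (GMPerversity.top n).per) : x.hull ≤ y.hull :=
  hull_le (h.trans (le_hull hy))

theorem hull_le_iff (hx : x ≤ (GMPerversity.top n).per) {q : GMPerversity n} :
    x.hull.per ≤ q.per ↔ x ≤ q.per :=
  ⟨(le_hull hx).trans, hull_le⟩

end Per

namespace PDGA

variable {R : Type u} [CommRing R] {n : ℕ} {A : PDGA R n}

namespace Realization

variable {M : PBimod A} {N : Type w} [AddCommGroup N] [Module R N] {ℬ : DGBimod A.totAlg N}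
  (ρ : Realization M ℬ) {x y : Per n} {i : ℤ} {X Y : N}

theorem inn_eq {p q : GMPerversity n} (h : p = q) (i : ℤ) (a : M.X p i) :
    ρ.inn p i a = ρ.inn q i (M.res h.le a) := by
  subst h
  rw [M.res_refl]

theorem inn_congr {p : GMPerversity n} {i j : ℤ} (h : i = j) (s : Fam M) :
    ρ.inn p i (s p i) = ρ.inn p j (s p j) := by
  subst h; rfl

theorem rel_iff : ρ.Rel x y i X Y ↔ x ≤ y ∧
    (¬ x ≤ (GMPerversity.top n).per → X = 0) ∧ (¬ y ≤ (GMPerversity.top n).per → Y = 0) ∧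
    (x ≤ (GMPerversity.top n).per → ∃ a, X = ρ.inn x.hull i a ∧
      ∀ (h : x.hull ≤ y.hull), y ≤ (GMPerversity.top n).per →
        Y = ρ.inn y.hull i (M.res h a)) := by
  constructor
  · rintro ⟨s, t, h, rfl, rfl⟩
    refine ⟨h.le, fun hx => by rw [h.left.eq_zero hx, inj_zero],
      fun hy => by rw [h.right.eq_zero hy, inj_zero], fun hx => ⟨s x.hull i, rfl, fun h' hy => ?_⟩⟩
    rw [inj, ← h.eq _ _ (Per.le_hull hy), h.left.res _ _ _ _ (Per.le_hull hx)]
  · rintro ⟨hle, h1, h2, h3⟩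
    by_cases hx : x ≤ (GMPerversity.top n).per
    · obtain ⟨a, rfl, h4⟩ := h3 hx
      have hs : Sec x i (fam M x.hull i a) := (sec_fam _ _ _).congr fun q => Per.hull_le_iff hx
      have e : ∀ (z : Per n) (b : M.X z.hull i), ρ.inn z.hull i b = ρ.inj z i (fam M z.hull i b) := by
        intro z b
        rw [inj, fam_apply _ _ le_rfl, M.res_refl]
      by_cases hy : y ≤ (GMPerversity.top n).per
      · have hxy := Per.hull_mono hle hy
        have ht : Sec y i (fam M y.hull i (M.res hxy a)) :=
          (sec_fam _ _ _).congr fun q => Per.hull_le_iff hy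
        refine ⟨_, _, ⟨hle, hs, ht, fun q j hq => ?_⟩, e _ _, (h4 hxy hy).trans (e _ _)⟩
        by_cases hj : j = i
        · subst hj
          rw [fam_apply _ _ (hxy.trans (Per.hull_le hq)), fam_apply _ _ (Per.hull_le hq), M.res_trans]
        · rw [hs.supp q j fun h => hj h.2, ht.supp q j fun h => hj h.2]
      · exact ⟨_, 0, ⟨hle, hs, .zero, fun q j hq => absurd (hq.trans q.per_le_top) hy⟩, e _ _,
          (h2 hy).trans (inj_zero _ _).symm⟩
    · have hy : ¬ y ≤ (GMPerversity.top n).per := fun h => hx (hle.trans h)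
      rw [h1 hx, h2 hy]
      exact .zero hle

end Realization

/-! ### Realizations of homotopy fibers -/

section Fiber

variable {M M' : PBimod A} {m : ℤ} {w : BimodHom M M' m}

theorem lact_fiber {p q r : GMPerversity n} {i j k : ℤ} (a : A.X p i) (x : (fiber w).X q j) :
    lact (fiber w) a x r k = (lact M a x.1 r k,
      sg ((m + 1) * i : ZMod 2) • lact M' a x.2 r (k + m - 1)) := by
  by_cases h : p.per + q.per ≤ r.per ∧ i + j = k
  · rw [lact_pos h.1 h.2, lact_pos h.1 h.2, lact_pos h.1 (by omega)]
    rfl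
  · rw [lact_neg h, lact_neg h, lact_neg fun h' => h ⟨h'.1, by omega⟩, smul_zero]
    rfl

theorem ract_fiber {p q r : GMPerversity n} {i j k : ℤ} (x : (fiber w).X p i) (a : A.X q j) :
    ract (fiber w) x a r k = (ract M x.1 a r k, ract M' x.2 a r (k + m - 1)) := by
  by_cases h : p.per + q.per ≤ r.per ∧ i + j = k
  · rw [ract_pos h.1 h.2, ract_pos h.1 h.2, ract_pos h.1 (by omega)]
    rfl
  · rw [ract_neg h, ract_neg h, ract_neg fun h' => h ⟨h'.1, by omega⟩]
    rfl

variable {N N' : Type*} [AddCommGroup N] [Module R N] [AddCommGroup N'] [Module R N']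
  {ℬ : DGBimod A.totAlg N} {ℬ' : DGBimod A.totAlg N'} {W : N →ₗ[R] N'}

/-- The realization of a homotopy fiber. -/
def fiberReal (ρ : Realization M ℬ) (ρ' : Realization M' ℬ') (h : ℬ.IsHom ℬ' (m : ZMod 2) W)
    (hW : ∀ (p : GMPerversity n) (i j : ℤ) (e : i + m = j) (x : M.X p i),
      W (ρ.inn p i x) = ρ'.inn p j (w.map p e x)) :
    Realization (fiber w) (DGBimod.fiber h) where
  inn p i := (ρ.inn p i).prodMap (ρ'.inn p (i + m - 1))
  out p i := (ρ.out p i).prodMap (ρ'.out p (i + m - 1))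
  out_inn p i x := Prod.ext (ρ.out_inn _ _ _) (ρ'.out_inn _ _ _)
  out_inn_ne p i j x h := Prod.ext (ρ.out_inn_ne _ _ _ _ h) (ρ'.out_inn_ne _ _ _ _ (by omega))
  lm_inn p q i j a x := by
    have h1 := twz_el ((m : ZMod 2) + 1) (⟨p, i, a⟩ : A.Letter)
    rw [lact_fiber]
    refine Prod.ext (ρ.lm_inn p q i j a x.1) ?_
    change sg ((m : ZMod 2) + 1) • ℬ'.lm (A.totAlg.twz _ (el ⟨p, i, a⟩)) (ρ'.inn q _ x.2) =
      ρ'.inn _ (i + j + m - 1) (sg ((m + 1) * i : ZMod 2) • lact M' a x.2 _ _)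
    have h2 : ℬ'.lm (el ⟨p, i, a⟩) (ρ'.inn q _ x.2) = _ := ρ'.lm_inn p q i (j + m - 1) a x.2
    rw [h1, map_zsmul, map_zsmul, LinearMap.smul_apply, h2, sg_smul_smul,
      ρ'.inn_congr (show i + j + m - 1 = i + (j + m - 1) by ring)]
    congr 2
    linear_combination ((m : ZMod 2) + 1) * zmod_two_eq_zero
  rm_inn p q i j x a := by
    rw [ract_fiber]
    refine Prod.ext (ρ.rm_inn p q i j x.1 a) ?_
    refine (ρ'.rm_inn p q (i + m - 1) j x.2 a).trans ?_
    exact ρ'.inn_congr (by ring) _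
  d_inn p i j e x := by
    refine Prod.ext (ρ.d_inn p i j e x.1) ?_
    change W (ρ.inn p i x.1) + sg ((m : ZMod 2) + 1) • ℬ'.d (ρ'.inn _ _ x.2) = ρ'.inn p _ (_ + _)
    rw [hW p i (j + m - 1) (by omega), ρ'.d_inn p _ (j + m - 1) (by omega), map_add]
    congr 1
    exact (map_zsmul _ _ _).symm

variable {ρ : Realization M ℬ} {ρ' : Realization M' ℬ'} {h : ℬ.IsHom ℬ' (m : ZMod 2) W}
  {hW : ∀ (p : GMPerversity n) (i j : ℤ) (e : i + m = j) (x : M.X p i),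
    W (ρ.inn p i x) = ρ'.inn p j (w.map p e x)}

theorem rel_fiber {x y : Per n} {i : ℤ} {X Y : N × N'} :
    (fiberReal ρ ρ' h hW).Rel x y i X Y ↔
      ρ.Rel x y i X.1 Y.1 ∧ ρ'.Rel x y (i + m - 1) X.2 Y.2 := by
  simp only [Realization.rel_iff]
  constructor
  · rintro ⟨hle, h1, h2, h3⟩
    refine ⟨⟨hle, fun hx => by rw [h1 hx]; rfl, fun hy => by rw [h2 hy]; rfl, fun hx => ?_⟩,
      ⟨hle, fun hx => by rw [h1 hx]; rfl, fun hy => by rw [h2 hy]; rfl, fun hx => ?_⟩⟩ <;>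
    obtain ⟨a, rfl, h4⟩ := h3 hx
    · exact ⟨a.1, rfl, fun h hy => by rw [h4 h hy]; rfl⟩
    · exact ⟨a.2, rfl, fun h hy => by rw [h4 h hy]; rfl⟩
  · rintro ⟨⟨hle, h1, h2, h3⟩, ⟨-, h1', h2', h3'⟩⟩
    refine ⟨hle, fun hx => Prod.ext (h1 hx) (h1' hx), fun hy => Prod.ext (h2 hy) (h2' hy),
      fun hx => ?_⟩
    obtain ⟨a, ha, h4⟩ := h3 hx
    obtain ⟨a', ha', h4'⟩ := h3' hx
    exact ⟨(a, a'), Prod.ext ha ha', fun h hy => Prod.ext (h4 h hy) (h4' h hy)⟩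

theorem isHoch_fiber {x : Per n} {c : ℤ} {F : List A.Tot → N} {G : List A.Tot → N'} :
    (fiberReal ρ ρ' h hW).IsHoch x c (fun l => (F l, G l)) ↔
      ρ.IsHoch x c F ∧ ρ'.IsHoch x (c + m - 1) G := by
  constructor
  · intro hF
    have h1 : ∀ u v k l l', WRel u v k l l' → _ := fun u v k l l' hw => rel_fiber.1 (hF.good hw)
    refine ⟨⟨hF.mlin.comp (LinearMap.fst R N N'), fun u v => congrArg Prod.fst (hF.norm u v),
      fun u v k l l' hw => (h1 u v k l l' hw).1⟩, hF.mlin.comp (LinearMap.snd R N N'),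
      fun u v => congrArg Prod.snd (hF.norm u v),
      fun u v k l l' hw => ((h1 u v k l l' hw).2).cast rfl rfl (by ring)⟩
  · rintro ⟨hF, hG⟩
    exact ⟨MLin.of_lin fun u v => ⟨(hF.mlin.lin u v).prod (hG.mlin.lin u v), fun a => rfl⟩,
      fun u v => Prod.ext (hF.norm u v) (hG.norm u v), fun u v k l l' hw =>
      rel_fiber.2 ⟨hF.good hw, (hG.good hw).cast rfl rfl (by ring)⟩⟩

end Fiber

end PDGA

/-! ### Acyclic complexes -/

/-- The cohomology vanishes. -/
def PerverseComplex.Acyclic {R : Type u} [CommRing R] {n : ℕ} (C : PerverseComplex R n) : Prop :=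
  ∀ (p : GMPerversity n) (i : ℤ) (x : C.X p i), C.d rfl x = 0 →
    ∃ z : C.X p (i - 1), x = C.d (sub_add_cancel i 1) z

/-- The identification of components of equal degrees. -/
def PerverseComplex.shift {R : Type u} [CommRing R] {n : ℕ} (C : PerverseComplex R n)
    (p : GMPerversity n) {i j : ℤ} (h : i = j) : C.X p i →ₗ[R] C.X p j :=
  h ▸ LinearMap.id

namespace PDGA

variable {R : Type u} [CommRing R] {n : ℕ} {A : PDGA R n} {M M' : PBimod A} {m : ℤ}

theorem isQuasiIso_of_acyclic (w : BimodHom M M' m) (h : M.Acyclic) (h' : M'.Acyclic) :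
    w.IsQuasiIso := by
  refine fun p i j e => ⟨fun x hx _ => h p i x hx, fun y hy => ⟨0, map_zero _, ?_⟩⟩
  obtain ⟨z, hz⟩ := h' p j y hy
  exact ⟨z, by rw [map_zero, zero_add, hz]⟩

theorem acyclic_fiber {w : BimodHom M M' m} (hw : w.IsQuasiIso) : (fiber w).Acyclic := by
  rintro p i ⟨x, y⟩ hxy
  have hx : M.d rfl x = 0 := congrArg Prod.fst hxy
  have hy : ∀ (j : ℤ) (e : i + m = j) (e' : i + m - 1 + 1 = j),
      w.map p e x + sg (m + 1 : ZMod 2) • M'.d e' y = 0 := by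
    have : ∀ (j : ℤ), j = i + 1 + m - 1 → ∀ (e : i + m = j) (e' : i + m - 1 + 1 = j),
        w.map p e x + sg (m + 1 : ZMod 2) • M'.d e' y = 0 := by
      rintro _ rfl e e'; exact congrArg Prod.snd hxy
    exact fun j e e' => this j (by omega) e e'
  obtain ⟨z, rfl⟩ := (hw p i _ rfl).1 x hx ⟨-(sg (m + 1 : ZMod 2) • y), by
    rw [map_neg, map_zsmul, eq_neg_iff_add_eq_zero]; exact hy _ _ _⟩
  have h1 := w.map_d (show i - 1 + m = i + m - 1 by omega) rfl (sub_add_cancel i 1)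
    (sub_add_cancel (i + m) 1) z
  have hcyc : M'.d rfl (y - w.map p (show i - 1 + m = i + m - 1 by omega) z) = 0 := by
    have h2 := hy (i + m) rfl (sub_add_cancel _ _)
    have h3 : M'.d (sub_add_cancel (i + m) 1) (y - w.map p (show i - 1 + m = i + m - 1 by omega) z)
        = 0 := by
      rw [map_sub, h1, sub_eq_zero, ← sg_smul_sg_smul (m + 1 : ZMod 2) (M'.d _ y),
        eq_neg_of_add_eq_zero_right h2, negOnePow_smul, smul_neg, sg_add, sg_one]
      simp
    have : ∀ (j : ℤ) (e : j = i + m) (e' : i + m - 1 + 1 = j),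
        M'.d e' (y - w.map p (show i - 1 + m = i + m - 1 by omega) z) = 0 := by
      rintro _ rfl e'; exact h3
    exact this _ (by omega) _
  obtain ⟨x', hx', u', hu'⟩ := (hw p (i - 1) (i + m - 1) (by omega)).2 _ hcyc
  have hcast : ∀ (k : ℤ), k = i - 1 + m - 1 → ∀ (u' : M'.X p k) (e : k + 1 = i + m - 1),
      ∃ u : M'.X p (i - 1 + m - 1), M'.d (by omega) u = M'.d e u' := by
    rintro _ rfl u' e; exact ⟨u', rfl⟩
  obtain ⟨u, hu⟩ := hcast _ (by omega) u' (by omega)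
  have hx'' : M.d (sub_add_cancel i 1) x' = 0 := by
    have : ∀ (j : ℤ), i - 1 + 1 = j → ∀ e : i - 1 + 1 = j, M.d e x' = 0 := by
      rintro _ rfl e; exact hx'
    exact this _ (by omega) _
  refine ⟨(z + x', sg (m + 1 : ZMod 2) • u), Prod.ext ?_ ?_⟩
  · exact (by rw [map_add, hx'', add_zero] : M.d (sub_add_cancel i 1) z =
      M.d (sub_add_cancel i 1) (z + x'))
  · change y = w.map p _ (z + x') + sg (m + 1 : ZMod 2) • M'.d _ (sg (m + 1 : ZMod 2) • u)
    rw [map_zsmul, sg_smul_sg_smul, hu, map_add, add_assoc, ← hu']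
    abel

/-! ### Some morphisms -/

@[simp] theorem shift_rfl (p : GMPerversity n) (i : ℤ) (x : M.X p i) : M.shift p rfl x = x := rfl

/-- The zero morphism. -/
def zeroHom (M M' : PBimod A) (m : ℤ) : BimodHom M M' m where
  map p i j e := 0
  map_res h e x := by simp
  map_d e e' ei ej x := by simp
  map_lsmul h e ej ek e' a x := by simp
  map_rsmul h e ei ek e' x a := by simp

/-- The identity. -/
def idHom (M : PBimod A) : BimodHom M M 0 where
  map p i j e := M.shift p (by omega)
  map_res {p q i j} h e x := by
    obtain rfl : i = j := by omega
    rfl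
  map_d {p i i' j j'} e e' ei ej x := by
    obtain rfl : i = j := by omega
    obtain rfl : i' = j' := by omega
    simp
  map_lsmul {p q r i j j' k k'} h e ej ek e' a x := by
    obtain rfl : j = j' := by omega
    obtain rfl : k = k' := by omega
    simp
  map_rsmul {p q r i i' j k k'} h e ei ek e' x a := by
    obtain rfl : i = i' := by omega
    obtain rfl : k = k' := by omega
    rfl

/-- The projection of the homotopy fiber. -/
def fiberFst (w : BimodHom M M' m) : BimodHom (fiber w) M 0 where
  map p i j e := M.shift p (by omega) ∘ₗ LinearMap.fst R (M.X p i) _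
  map_res {p q i j} h e x := by
    obtain rfl : i = j := by omega
    rfl
  map_d {p i i' j j'} e e' ei ej x := by
    obtain rfl : i = j := by omega
    obtain rfl : i' = j' := by omega
    simp; rfl
  map_lsmul {p q r i j j' k k'} h e ej ek e' a x := by
    obtain rfl : j = j' := by omega
    obtain rfl : k = k' := by omega
    simp; rfl
  map_rsmul {p q r i i' j k k'} h e ei ek e' x a := by
    obtain rfl : i = i' := by omega
    obtain rfl : k = k' := by omega
    rfl

theorem _root_.DGBimod.isHom_id {N : Type w} [AddCommGroup N] [Module R N]
    (ℬ : DGBimod A.totAlg N) : ℬ.IsHom ℬ ((0 : ℤ) : ZMod 2) LinearMap.id :=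
  ⟨by simp, by simp, by simp, by simp⟩

theorem _root_.DGBimod.isHom_zero {N N' : Type*} [AddCommGroup N] [Module R N] [AddCommGroup N']
    [Module R N'] (ℬ : DGBimod A.totAlg N) (ℬ' : DGBimod A.totAlg N') (m : ZMod 2) :
    ℬ.IsHom ℬ' m 0 :=
  ⟨by simp, by simp, by simp, by simp⟩

/-! ### Shifts of perversities -/

section

variable {r p q q' : GMPerversity n}

theorem perShift_le_left (h : p.toFun + q.toFun ≤ q'.toFun)
    (h' : r.per + q'.per ≤ (GMPerversity.top n).per) : r.per + q.per ≤ (GMPerversity.top n).per :=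
  (Per.add_le_add' le_rfl ((Per.le_add_left' p.per q.per).trans (GMPerversity.per_add_le.2 h))).trans
    h'

theorem perShift_le_right (h : q.toFun + p.toFun ≤ q'.toFun)
    (h' : r.per + q'.per ≤ (GMPerversity.top n).per) : r.per + q.per ≤ (GMPerversity.top n).per :=
  perShift_le_left ((add_comm _ _).trans_le h) h'

theorem perShift_left (h : p.toFun + q.toFun ≤ q'.toFun)
    (h' : r.per + q'.per ≤ (GMPerversity.top n).per) :
    p.toFun + (r.per + q.per).hull.toFun ≤ (r.per + q'.per).hull.toFun := by
  rw [← GMPerversity.per_add_le, Per.add_hull_le_iff (perShift_le_left h h'), add_left_comm]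
  exact (Per.add_le_add' le_rfl (GMPerversity.per_add_le.2 h)).trans (Per.le_hull h')

theorem perShift_right (h : q.toFun + p.toFun ≤ q'.toFun)
    (h' : r.per + q'.per ≤ (GMPerversity.top n).per) :
    (r.per + q.per).hull.toFun + p.toFun ≤ (r.per + q'.per).hull.toFun :=
  (add_comm _ _).trans_le (perShift_left ((add_comm _ _).trans_le h) h')

end

variable (M) in
/-- The bimodule with component `M_(r ⊕ q)` in perversity `q`, or `0` if `r + q` exceeds the top
perversity. -/
noncomputable def perShift (r : GMPerversity n) : PBimod A where
  X q i := PLift (r.per + q.per ≤ (GMPerversity.top n).per) → M.X (r.per + q.per).hull i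
  res h := LinearMap.pi fun h' => M.res (Per.hull_mono (Per.add_le_add' le_rfl h) h'.down) ∘ₗ
    LinearMap.proj (PLift.up ((Per.add_le_add' le_rfl h).trans h'.down))
  d e := LinearMap.pi fun h' => M.d e ∘ₗ LinearMap.proj h'
  res_refl x := funext fun h' => M.res_refl _
  res_trans h h' x := funext fun _ => M.res_trans _ _ _
  d_d h h' x := funext fun _ => M.d_d _ _ _
  d_res h e x := funext fun _ => M.d_res _ _ _
  lsmul {p q q' i j k} h e := LinearMap.mk₂ R
    (fun a s h' => M.lsmul (perShift_left h h'.down) e a (s ⟨perShift_le_left h h'.down⟩))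
    (fun _ _ _ => by ext; simp) (fun _ _ _ => by ext; simp)
    (fun _ _ _ => by ext; simp) (fun _ _ _ => by ext; simp)
  rsmul {p q q' i j k} h e := LinearMap.mk₂ R
    (fun s a h' => M.rsmul (perShift_right h h'.down) e (s ⟨perShift_le_right h h'.down⟩) a)
    (fun _ _ _ => by ext; simp) (fun _ _ _ => by ext; simp)
    (fun _ _ _ => by ext; simp) (fun _ _ _ => by ext; simp)
  lsmul_res hp hq hr h h' e a x := funext fun _ => M.lsmul_res _ _ _ _ _ _ _ _
  rsmul_res hp hq hr h h' e x a := funext fun _ => M.rsmul_res _ _ _ _ _ _ _ _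
  one_lsmul h e x := funext fun _ => M.one_lsmul _ _ _
  rsmul_one h e x := funext fun _ => M.rsmul_one _ _ _
  mul_lsmul h₁ h₂ h₃ h₄ e₁ e₂ e₃ e₄ a b c := funext fun h' =>
    M.mul_lsmul h₁ _ (perShift_left h₃ (perShift_le_left h₄ h'.down)) _ _ _ _ _ _ _ _
  lsmul_rsmul h₁ h₂ h₃ h₄ e₁ e₂ e₃ e₄ a b c := funext fun h' =>
    M.lsmul_rsmul (perShift_left h₁ (perShift_le_right h₂ h'.down)) _ _ _ _ _ _ _ _ _ _
  rsmul_mul h₁ h₂ h₃ h₄ e₁ e₂ e₃ e₄ a b c := funext fun h' =>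
    M.rsmul_mul (perShift_right h₁ (perShift_le_right h₂ h'.down)) _ _ _ _ _ _ _ _ _ _
  d_lsmul h e ei ej ek e₁ e₂ a x := funext fun _ => M.d_lsmul _ _ _ _ _ _ _ _ _
  d_rsmul h e ei ej ek e₁ e₂ x a := funext fun _ => M.d_rsmul _ _ _ _ _ _ _ _ _

theorem acyclic_perShift (h : M.Acyclic) (r : GMPerversity n) : (perShift M r).Acyclic := by
  intro p i x hx
  have h1 : ∀ h', ∃ z, x h' = M.d (sub_add_cancel i 1) z := fun h' => h _ _ _ (congrFun hx h')
  choose z hz using h1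
  exact ⟨z, funext hz⟩

end PDGA

namespace PDGA

variable {R : Type u} [CommRing R] {n : ℕ} {A : PDGA R n} {M : PBimod A}
  {N : Type w} [AddCommGroup N] [Module R N] {ℬ : DGBimod A.totAlg N}

theorem hull_add_hull {r : GMPerversity n} {x : Per n} (hx : x ≤ (GMPerversity.top n).per) :
    (r.per + x.hull.per).hull = (r.per + x).hull :=
  Per.hull_congr fun _ => Per.add_hull_le_iff hx

namespace Realization

open Classical in
/-- The inclusions of the components of a shift of perversities. -/
noncomputable def innShift (ρ : Realization M ℬ) (r q : GMPerversity n) (i : ℤ) :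
    (perShift M r).X q i →ₗ[R] N :=
  if h : r.per + q.per ≤ (GMPerversity.top n).per then
    ρ.inn (r.per + q.per).hull i ∘ₗ LinearMap.proj (PLift.up h) else 0

variable (ρ : Realization M ℬ) (r : GMPerversity n)

theorem innShift_pos {q : GMPerversity n} (h : r.per + q.per ≤ (GMPerversity.top n).per) {i : ℤ}
    (s : (perShift M r).X q i) : ρ.innShift r q i s = ρ.inn (r.per + q.per).hull i (s ⟨h⟩) := by
  rw [innShift, dif_pos h]; rfl

theorem innShift_neg {q : GMPerversity n} (h : ¬ r.per + q.per ≤ (GMPerversity.top n).per) {i : ℤ}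
    (s : (perShift M r).X q i) : ρ.innShift r q i s = 0 := by
  rw [innShift, dif_neg h]; rfl

theorem lm_innShift (p q : GMPerversity n) (i j : ℤ) (a : A.X p i) (s : (perShift M r).X q j) :
    ℬ.lm (A.inc p i a) (ρ.innShift r q j s) =
      ρ.innShift r (p.per + q.per).hull (i + j) (lact (perShift M r) a s _ _) := by
  have hz : ∀ h : r.per + q.per ≤ (GMPerversity.top n).per,
      ¬ p.per + (r.per + q.per) ≤ (GMPerversity.top n).per →
      ρ.inn (p.per + (r.per + q.per).hull.per).hull (i + j) (lact M a (s ⟨h⟩) _ _) = 0 := by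
    intro h h'
    rw [lact_neg fun h'' => h' ((Per.add_hull_le_iff h).1 (h''.1.trans (Per.hull _).per_le_top)),
      map_zero]
  by_cases hpq : p.per + q.per ≤ (GMPerversity.top n).per
  · rw [lact_pos (Per.le_hull hpq) rfl]
    have h1 := hull_add_hull (r := r) hpq
    by_cases h : r.per + q.per ≤ (GMPerversity.top n).per
    · rw [ρ.innShift_pos r h, ρ.lm_inn]
      by_cases h' : p.per + (r.per + q.per) ≤ (GMPerversity.top n).per
      · have h2 : r.per + (p.per + q.per).hull.per ≤ (GMPerversity.top n).per := by
          rwa [Per.add_hull_le_iff hpq, add_left_comm]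
        have h3 : (p.per + (r.per + q.per).hull.per).hull = (r.per + (p.per + q.per).hull.per).hull := by
          rw [h1, hull_add_hull h, add_left_comm]
        have h4 := Per.le_hull (x := p.per + (r.per + q.per).hull.per) (by rwa [Per.add_hull_le_iff h])
        have h5 := M.lsmul_res le_rfl le_rfl h3.le h4 (h3 ▸ h4) rfl a (s ⟨h⟩)
        rw [A.res_refl, M.res_refl] at h5
        rw [ρ.innShift_pos r h2, ρ.inn_eq h3, lact_pos h4 rfl]
        exact congrArg _ h5.symm
      · rw [hz h h', ρ.innShift_neg]
        rwa [Per.add_hull_le_iff hpq, add_left_comm]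
    · rw [ρ.innShift_neg r h, map_zero, ρ.innShift_neg]
      rw [Per.add_hull_le_iff hpq]
      exact fun h' => h ((Per.add_le_add' le_rfl (Per.le_add_left' _ _)).trans h')
  · rw [lact_neg fun h => hpq (h.1.trans (Per.hull _).per_le_top), map_zero]
    by_cases h : r.per + q.per ≤ (GMPerversity.top n).per
    · rw [ρ.innShift_pos r h, ρ.lm_inn, hz]
      exact fun h' => hpq ((Per.add_le_add' le_rfl (Per.le_add_left' _ _)).trans h')
    · rw [ρ.innShift_neg r h, map_zero]

theorem rm_innShift (p q : GMPerversity n) (i j : ℤ) (s : (perShift M r).X p i) (a : A.X q j) :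
    ℬ.rm (ρ.innShift r p i s) (A.inc q j a) =
      ρ.innShift r (p.per + q.per).hull (i + j) (ract (perShift M r) s a _ _) := by
  have hz : ∀ h : r.per + p.per ≤ (GMPerversity.top n).per,
      ¬ r.per + p.per + q.per ≤ (GMPerversity.top n).per →
      ρ.inn ((r.per + p.per).hull.per + q.per).hull (i + j) (ract M (s ⟨h⟩) a _ _) = 0 := by
    intro h h'
    rw [ract_neg fun h'' => h' ((Per.hull_add_le_iff h).1 (h''.1.trans (Per.hull _).per_le_top)),
      map_zero]
  by_cases hpq : p.per + q.per ≤ (GMPerversity.top n).per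
  · rw [ract_pos (Per.le_hull hpq) rfl]
    have h1 := hull_add_hull (r := r) hpq
    by_cases h : r.per + p.per ≤ (GMPerversity.top n).per
    · rw [ρ.innShift_pos r h, ρ.rm_inn]
      by_cases h' : r.per + p.per + q.per ≤ (GMPerversity.top n).per
      · have h2 : r.per + (p.per + q.per).hull.per ≤ (GMPerversity.top n).per := by
          rwa [Per.add_hull_le_iff hpq, ← add_assoc]
        have h3 : ((r.per + p.per).hull.per + q.per).hull = (r.per + (p.per + q.per).hull.per).hull := by
          rw [h1, Per.hull_congr fun _ => Per.hull_add_le_iff h, add_assoc]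
        have h4 := Per.le_hull (x := (r.per + p.per).hull.per + q.per) (by rwa [Per.hull_add_le_iff h])
        have h5 := M.rsmul_res le_rfl le_rfl h3.le h4 (h3 ▸ h4) rfl (s ⟨h⟩) a
        rw [A.res_refl, M.res_refl] at h5
        rw [ρ.innShift_pos r h2, ρ.inn_eq h3, ract_pos h4 rfl]
        exact congrArg _ h5.symm
      · rw [hz h h', ρ.innShift_neg]
        rwa [Per.add_hull_le_iff hpq, ← add_assoc]
    · rw [ρ.innShift_neg r h, map_zero, LinearMap.zero_apply, ρ.innShift_neg]
      rw [Per.add_hull_le_iff hpq]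
      exact fun h' => h ((Per.add_le_add' le_rfl (Per.le_add_right' _ _)).trans h')
  · rw [ract_neg fun h => hpq (h.1.trans (Per.hull _).per_le_top), map_zero]
    by_cases h : r.per + p.per ≤ (GMPerversity.top n).per
    · rw [ρ.innShift_pos r h, ρ.rm_inn, hz]
      rw [add_assoc]
      exact fun h' => hpq ((Per.le_add_left' _ _).trans h')
    · rw [ρ.innShift_neg r h, map_zero, LinearMap.zero_apply]

/-- The realization of a shift of perversities. -/
noncomputable def perShift : Realization (perShift M r) ℬ where
  inn := ρ.innShift r
  out q i := LinearMap.pi fun _ => ρ.out (r.per + q.per).hull i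
  out_inn p i x := funext fun h => by
    rw [ρ.innShift_pos r h.down]; exact ρ.out_inn _ _ _
  out_inn_ne p i j x hij := funext fun h => by
    rw [ρ.innShift_pos r h.down]; exact ρ.out_inn_ne _ _ _ _ hij
  lm_inn := ρ.lm_innShift r
  rm_inn := ρ.rm_innShift r
  d_inn p i j e x := by
    by_cases h : r.per + p.per ≤ (GMPerversity.top n).per
    · rw [ρ.innShift_pos r h, ρ.innShift_pos r h]; exact ρ.d_inn _ _ _ _ _
    · rw [ρ.innShift_neg r h, ρ.innShift_neg r h, map_zero]

variable {ρ r}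

theorem rel_perShift {x y : Per n} {i : ℤ} {X Y : N} :
    (ρ.perShift r).Rel x y i X Y ↔ x ≤ y ∧ ρ.Rel (r.per + x) (r.per + y) i X Y := by
  have hle : ∀ z : Per n, r.per + z ≤ (GMPerversity.top n).per → z ≤ (GMPerversity.top n).per :=
    fun z h => (Per.le_add_left' _ _).trans h
  simp only [rel_iff]
  constructor
  · rintro ⟨h, h1, h2, h3⟩
    have h0 : ∀ {z : Per n} (s : (PDGA.perShift M r).X z.hull i), z ≤ (GMPerversity.top n).per →
        ¬ r.per + z ≤ (GMPerversity.top n).per → (ρ.perShift r).inn z.hull i s = 0 := by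
      intro z s hz h
      exact ρ.innShift_neg r (by rwa [Per.add_hull_le_iff hz]) s
    refine ⟨h, Per.add_le_add' le_rfl h, fun hx => ?_, fun hy => ?_, fun hx => ?_⟩
    · by_cases hx' : x ≤ (GMPerversity.top n).per
      · obtain ⟨a, rfl, -⟩ := h3 hx'
        exact h0 a hx' hx
      · exact h1 hx'
    · by_cases hy' : y ≤ (GMPerversity.top n).per
      · obtain ⟨a, rfl, h4⟩ := h3 (h.trans hy')
        rw [h4 (Per.hull_mono h hy') hy']
        exact h0 _ hy' hy
      · exact h2 hy'
    · have hx' := hle x hx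
      obtain ⟨a, rfl, h4⟩ := h3 hx'
      have hx2 : r.per + x.hull.per ≤ (GMPerversity.top n).per := by rwa [Per.add_hull_le_iff hx']
      refine ⟨M.res (hull_add_hull hx').le (a ⟨hx2⟩), ?_, fun h' hy => ?_⟩
      · rw [← ρ.inn_eq (hull_add_hull hx')]
        exact ρ.innShift_pos r hx2 a
      · have hy' := hle y hy
        have hy2 : r.per + y.hull.per ≤ (GMPerversity.top n).per := by
          rwa [Per.add_hull_le_iff hy']
        rw [h4 (Per.hull_mono h hy') hy', M.res_trans]
        refine (ρ.innShift_pos r hy2 _).trans ?_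
        rw [ρ.inn_eq (hull_add_hull hy')]
        exact congrArg _ (M.res_trans _ _ _)
  · rintro ⟨h, -, h1, h2, h3⟩
    refine ⟨h, fun hx => h1 fun h' => hx (hle x h'), fun hy => h2 fun h' => hy (hle y h'),
      fun hx => ?_⟩
    by_cases hx' : r.per + x ≤ (GMPerversity.top n).per
    · obtain ⟨a, rfl, h4⟩ := h3 hx'
      have hx2 : r.per + x.hull.per ≤ (GMPerversity.top n).per := by rwa [Per.add_hull_le_iff hx]
      refine ⟨fun _ => M.res (hull_add_hull hx).ge a, ?_, fun h' hy => ?_⟩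
      · exact (ρ.inn_eq (hull_add_hull hx).symm _ _).trans
          (ρ.innShift_pos r hx2 fun _ => M.res (hull_add_hull hx).ge a).symm
      · by_cases hy' : r.per + y ≤ (GMPerversity.top n).per
        · have hy2 : r.per + y.hull.per ≤ (GMPerversity.top n).per := by rwa [Per.add_hull_le_iff hy]
          rw [h4 (Per.hull_mono (Per.add_le_add' le_rfl h) hy') hy',
            ρ.inn_eq (hull_add_hull hy).symm, M.res_trans]
          refine Eq.trans ?_ (ρ.innShift_pos r hy2 _).symm
          exact congrArg _ (M.res_trans _ _ _).symm
        · rw [h2 hy']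
          exact (ρ.innShift_neg r (by rwa [Per.add_hull_le_iff hy]) _).symm
    · have hy' : ¬ r.per + y ≤ (GMPerversity.top n).per :=
        fun h' => hx' ((Per.add_le_add' le_rfl h).trans h')
      rw [h1 hx', h2 hy']
      exact ⟨0, (map_zero _).symm, fun _ _ => by rw [map_zero, map_zero]⟩

theorem isHoch_perShift {c : ℤ} {F : List A.Tot → N} :
    (ρ.perShift r).IsHoch 0 c F ↔ ρ.IsHoch r.per c F := by
  constructor
  · exact fun h => ⟨h.mlin, h.norm, fun u v k l l' hw =>
      (rel_perShift.1 (h.good hw)).2.cast (by simp) (by simp) rfl⟩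
  · exact fun h => ⟨h.mlin, h.norm, fun u v k l l' hw =>
      rel_perShift.2 ⟨Per.add_le_add' le_rfl hw.le, (h.good hw).cast (by simp) (by simp) rfl⟩⟩

end Realization

/-! ### Vanishing of the cohomology with acyclic coefficients -/

/-- If the bar construction is cofibrant, cocycles with acyclic coefficients are coboundaries. -/
theorem BarCofibrant.exists_primitive (hA : A.BarCofibrant) (hM : M.Acyclic) (ρ : Realization M ℬ)
    {r : GMPerversity n} {c : ℤ} {F : List A.Tot → N} (hF : ρ.IsHoch r.per c F)
    (hD : DGAlg.hD ℬ c F = 0) :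
    ∃ K, ρ.IsHoch r.per (c - 1) K ∧ F = DGAlg.hD ℬ (c - 1 : ℤ) K := by
  have hS := acyclic_perShift hM r
  let z := zeroHom (perShift M r) (perShift M r) (c + 1)
  have hB : (fiber z).Acyclic := acyclic_fiber (isQuasiIso_of_acyclic z hS hS)
  have hE : (fiber (idHom (fiber z))).Acyclic :=
    acyclic_fiber (isQuasiIso_of_acyclic (idHom (fiber z)) hB hB)
  let ρB := fiberReal (w := z) (ρ.perShift r) (ρ.perShift r) (ℬ.isHom_zero ℬ ((c + 1 : ℤ) : ZMod 2))
    fun p i j e x => (map_zero ((ρ.perShift r).inn p j)).symm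
  let ρE := fiberReal (w := idHom (fiber z)) ρB ρB (DGBimod.isHom_id _) fun p i j e x => by
    obtain rfl : i = j := by omega
    rfl
  have hc : ((c + 1 : ℤ) : ZMod 2) + 1 = c := by push_cast; exact cast_succ_succ _
  have hFB : ρB.IsHoch 0 0 fun l => (0, F l) :=
    isHoch_fiber.2 ⟨.zero, (Realization.isHoch_perShift.2 hF).cast rfl (by ring)⟩
  have hDB : DGAlg.hD (DGBimod.fiber (ℬ.isHom_zero ℬ ((c + 1 : ℤ) : ZMod 2))) ((0 : ℤ) : ZMod 2)
      (fun l => (0, F l)) = 0 := by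
    have h0 : DGAlg.hD ℬ ((0 : ℤ) : ZMod 2) (fun _ => (0 : N)) = 0 :=
      (congrArg _ (zero_smul R (0 : List A.Tot → N)).symm).trans
        ((DGAlg.hD_smul ℬ _ (0 : R) (0 : List A.Tot → N)).trans (zero_smul R _))
    rw [DGBimod.hD_fiber, h0, add_assoc, hc, Int.cast_zero, zero_add, hD]
    funext l
    simp
  obtain ⟨g, hg, hgf⟩ := hA _ _ (fiberFst (idHom (fiber z)))
    (fun p i j e => by
      obtain rfl : i = j := by omega
      exact fun x => ⟨(x, 0), rfl⟩) (isQuasiIso_of_acyclic _ hE hB) _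
    (hFB.raw_mem_cocycles (r := GMPerversity.zero n) le_rfl hDB)
  obtain ⟨G, hr, hG⟩ := Realization.exists_rep_cls (ρ := ρE) hg
  obtain ⟨hG₁, hG₂⟩ := (isHoch_fiber (F := fun l => (G l).1) (G := fun l => (G l).2)).1 hG.hoch
  obtain ⟨-, hG₃⟩ := (isHoch_fiber (F := fun l => (G l).2.1) (G := fun l => (G l).2.2)).1 hG₂
  have h1 : (fun l => (G l).1) = fun l => (0, F l) := mlin_ext hG₁.mlin hFB.mlin fun l => by
    have h2 := (hFB.isRep (r := GMPerversity.zero n)).eq l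
    refine Eq.trans ?_ h2.symm
    have h3 : (fun q j => (g l q j).1) = _ := funext fun q => funext fun j => hgf l q j
    rw [hr.eq l]
    exact congrArg (ρB.inj _ _) h3
  have h2 := DGBimod.hD_fiber (DGBimod.isHom_id (DGBimod.fiber (ℬ.isHom_zero ℬ ((c + 1 : ℤ) : ZMod 2))))
    ((0 : ℤ) : ZMod 2) (fun l => (G l).1) (fun l => (G l).2)
  rw [hG.cocycle] at h2
  refine ⟨sg (c : ZMod 2) • fun l => (G l).2.2,
    ((Realization.isHoch_perShift.1 hG₃).cast rfl (by ring)).zsmul _, funext fun l => ?_⟩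
  have h3 := congrArg Prod.snd (congrFun h2 l)
  have h4 := congrFun (DGBimod.hD_fiber (ℬ.isHom_zero ℬ ((c + 1 : ℤ) : ZMod 2)) 1
    (fun l => (G l).2.1) (fun l => (G l).2.2)) l
  have h5 : (G l).1 = (0, F l) := congrFun h1 l
  simp only [h5, Int.cast_zero, add_zero, zero_add, sg_one, neg_smul, one_smul, LinearMap.id_apply,
    h4, LinearMap.zero_apply, add_assoc, hc] at h3
  rw [DGAlg.hD_zsmul, cast_sub_one, add_comm (c : ZMod 2)]
  have h6 := congrArg Prod.snd h3
  rw [Prod.snd_add, Prod.snd_neg, ← sub_eq_add_neg] at h6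
  exact sub_eq_zero.1 h6.symm

end PDGA

/-- Quasi-isomorphisms are stable under changes of signs. -/
theorem PerverseComplex.IsQuasiIso.of_sign {R : Type u} [CommRing R] {n : ℕ}
    {C C' : PerverseComplex R n} {m : ℤ}
    {w w' : ∀ (p : GMPerversity n) {i j : ℤ}, i + m = j → C.X p i →ₗ[R] C'.X p j}
    (h : C.IsQuasiIso C' m w) (s : ℤ → ZMod 2)
    (hw : ∀ (p : GMPerversity n) (i j : ℤ) (e : i + m = j) (x : C.X p i),
      w' p e x = sg (s i) • w p e x) :
    C.IsQuasiIso C' m w' := by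
  refine fun p i j e => ⟨fun x hx hy => ?_, fun y hy => ?_⟩
  · obtain ⟨y, hy⟩ := hy
    exact (h p i j e).1 x hx ⟨sg (s i) • y, by rw [map_zsmul, ← hy, hw, sg_smul_sg_smul]⟩
  · obtain ⟨x, hx, z, hz⟩ := (h p i j e).2 y hy
    exact ⟨sg (s i) • x, by rw [map_zsmul, hx, smul_zero], z, by
      rw [hw, map_zsmul, sg_smul_sg_smul, hz]⟩

namespace DGAlg

variable {R : Type v} {A : Type u} [CommRing R] [AddCommGroup A] [Module R A] {𝒜 : DGAlg R A}

/-- The right multiplication of a trace is a morphism of bimodules. -/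
theorem IsTrace.isHom {m : ZMod 2} {z : A →ₗ[R] R} (hz : 𝒜.IsTrace m z) :
    𝒜.selfBimod.IsHom 𝒜.dualBimod m (𝒜.dualBimod.rm z) where
  d a := by
    refine LinearMap.ext fun x => ?_
    have h1 := hz.d (𝒜.mul a x)
    have h2 := hz.tw (𝒜.mul (𝒜.tw a) (𝒜.d x))
    rw [𝒜.d_mul, map_sub, sub_eq_zero] at h1
    rw [𝒜.tw_mul, 𝒜.tw_tw, map_neg, neg_eq_iff_eq_neg, ← h1, sg_add] at h2
    change z (𝒜.mul a (𝒜.tw (𝒜.d x))) = sg m • z (𝒜.mul (𝒜.d a) x)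
    rw [h2]
    simp
  sgn a := by
    refine LinearMap.ext fun x => ?_
    have h1 := hz.tw (𝒜.mul (𝒜.tw a) x)
    rw [𝒜.tw_mul, 𝒜.tw_tw, map_neg] at h1
    change -z (𝒜.mul a (𝒜.tw x)) = sg m • z (𝒜.mul (-𝒜.tw a) x)
    rw [h1, sg_add]
    simp
  lm a b := by
    refine LinearMap.ext fun x => ?_
    change z (𝒜.mul (𝒜.mul a b) x) = sg m • -z (𝒜.mul b (𝒜.mul x (𝒜.tw (𝒜.twz m a))))
    rw [𝒜.mul_assoc, hz.mul, ← twz_one, twz_twz, add_comm 1 m, 𝒜.mul_assoc, sg_add]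
    simp
  rm a b := LinearMap.ext fun x => congrArg z (𝒜.mul_assoc a b x)

end DGAlg

namespace PDGA

variable {R : Type u} [CommRing R] {n : ℕ} {A : PDGA R n}

/-! ### Duality morphisms -/

theorem zero_add_le (p : GMPerversity n) : (GMPerversity.zero n).toFun + p.toFun ≤ p.toFun :=
  (zero_add p.toFun).le

theorem add_zero_le (p : GMPerversity n) : p.toFun + (GMPerversity.zero n).toFun ≤ p.toFun :=
  (add_zero p.toFun).le

section

variable {m : ℤ} (ζ : A.dual.X (.zero n) m)

theorem lsmul_comm (hA : A.IsCommutative) {p q : GMPerversity n} {i k : ℤ}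
    (h : p.toFun + (GMPerversity.zero n).toFun ≤ q.toFun)
    (h' : (GMPerversity.zero n).toFun + p.toFun ≤ q.toFun) (e : i + m = k) (e' : m + i = k)
    (a : A.X p i) :
    A.dual.lsmul h e a ζ = sg ((m : ZMod 2) * i) • A.dual.rsmul h' e' ζ a := by
  refine ev_ext fun x => ?_
  rw [map_zsmul, LinearMap.smul_apply, lsmul_dual, rsmul_dual,
    hA (GMPerversity.compl_add_le h) (GMPerversity.add_compl_le h') _ (by omega) x a,
    negOnePow_smul, map_zsmul, sg_smul_smul]
  congr 2
  rw [← e]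
  push_cast
  generalize (i : ZMod 2) = I
  generalize (m : ZMod 2) = M
  revert I M
  decide

/-- The morphism `a ↦ ζ a` from the algebra to its dual. -/
noncomputable def capHom (hA : A.IsCommutative) (hζ : A.dual.d rfl ζ = 0) : BimodHom A.self A.dual m where
  map p i j e := A.dual.rsmul (p := GMPerversity.zero n) (q := p) (r := p) (zero_add_le p)
    (by omega) ζ
  map_res h e x := by
    have := A.dual.rsmul_res le_rfl h h (zero_add_le _) (zero_add_le _)
      (show m + _ = _ from (add_comm _ _).trans e) ζ x
    rw [A.dual.res_refl] at this
    exact this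
  map_d {p i i' j j'} e e' ei ej x := by
    have hz : ∀ {m' : ℤ} (h : m + 1 = m'), A.dual.d h ζ = 0 := by
      rintro _ rfl; exact hζ
    have := A.dual.d_rsmul (zero_add_le p) (show m + i = j by omega) rfl ei ej (by omega)
      (by omega) ζ x
    rw [hz, map_zero, LinearMap.zero_apply] at this
    exact this.trans (zero_add _)
  map_lsmul {p q r i j j' k k'} h e ej ek e' a x := by
    have h1 := A.dual.rsmul_mul (zero_add_le p) h h (zero_add_le r) rfl
      (show m + i + j = k' by omega) e (by omega) ζ a x
    have h2 := A.dual.lsmul_rsmul (add_zero_le p) h (zero_add_le q) h (add_comm i m)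
      (show m + i + j = k' by omega) (show m + j = j' by omega) e' a ζ x
    rw [lsmul_comm ζ hA (add_zero_le p) (zero_add_le p) (add_comm i m) rfl, map_zsmul, LinearMap.smul_apply, h1] at h2
    rw [← h2, negOnePow_smul]
    push_cast
    exact (sg_smul_sg_smul _ _).symm
  map_rsmul {p q r i i' j k k'} h e ei ek e' x a :=
    (A.dual.rsmul_mul (zero_add_le p) h h (zero_add_le r) (by omega) (by omega) e (by omega) ζ x a).symm

theorem d_one : A.d (zero_add 1) A.one = 0 := by
  have h := DGAlg.d_one (𝒜 := A.totAlg)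
  rw [show A.totAlg.d A.totAlg.one = _ from totD_inc (zero_add 1) A.one] at h
  rw [← proj_inc (GMPerversity.zero n) 1 (A.d _ A.one), h, map_zero]

theorem IsPDPDA.exists_represents (h : A.IsPDPDA) :
    ∃ (m : ℤ) (θ : A.DerivedDuality m) (ζ : A.dual.X (.zero n) m), θ.Represents ζ := by
  obtain ⟨m, ⟨θ⟩⟩ := h
  obtain ⟨z, hz, t, ht⟩ := (θ.q_quasiIso (GMPerversity.zero n) 0 0 (add_zero 0)).2 A.one d_one
  refine ⟨m, θ, θ.w.map _ (zero_add m) z, z, -t, 0, hz, ?_, by rw [map_zero, add_zero]⟩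
  rw [map_neg, show A.one = _ from ht]
  exact (add_neg_cancel_right _ _).symm

variable {ζ}

namespace DerivedDuality

variable {θ : A.DerivedDuality m}

theorem Represents.d_eq_zero (h : θ.Represents ζ) : A.dual.d rfl ζ = 0 := by
  obtain ⟨z, y, x, hz, hq, hw⟩ := h
  have h1 := θ.w.map_d (zero_add m) (add_comm 1 m) (zero_add 1) rfl z
  rwa [hz, map_zero, smul_zero, hw, map_add, A.dual.d_d, add_zero] at h1

theorem Represents.isQuasiIso_capHom (h : θ.Represents ζ) (hA : A.IsCommutative) :
    (capHom ζ hA h.d_eq_zero).IsQuasiIso := by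
  obtain ⟨z, y, x, hz, hq, hw⟩ := id h
  have hz' : ∀ {m' : ℤ} (h : 0 + 1 = m'), θ.P.d h z = 0 := by
    rintro _ rfl; exact hz
  -- multiples of the representing cocycles
  have h1 : ∀ (p : GMPerversity n) (i : ℤ) (b : A.X p i), A.d rfl b = 0 →
      θ.P.d rfl (θ.P.rsmul (zero_add_le p) (zero_add i) z b) = 0 := by
    intro p i b hb
    rw [θ.P.d_rsmul (zero_add_le p) (zero_add i) rfl rfl rfl (by omega) (by omega), hz', hb]
    simp
  have h2 : ∀ (p : GMPerversity n) (i : ℤ) (b : A.X p i), A.d rfl b = 0 →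
      θ.q.map p (add_zero i) (θ.P.rsmul (zero_add_le p) (zero_add i) z b) =
        b + A.d (sub_add_cancel i 1) (A.mul (zero_add_le p) (by omega) y b) := by
    intro p i b hb
    rw [θ.q.map_rsmul (zero_add_le p) (zero_add i) (add_zero 0) (add_zero i) (zero_add i), hq,
      A.leibniz (zero_add_le p) _ (neg_add_cancel 1) rfl (sub_add_cancel i 1) (zero_add i)
        (by omega), hb, map_add, LinearMap.add_apply]
    rw [map_zero, smul_zero, add_zero]
    exact congrArg (· + _) (A.one_mul _ _ b)
  have h3 : ∀ (p : GMPerversity n) (i j : ℤ) (e : i + m = j) (b : A.X p i), A.d rfl b = 0 →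
      θ.w.map p e (θ.P.rsmul (zero_add_le p) (zero_add i) z b) =
        (capHom ζ hA h.d_eq_zero).map p e b + A.dual.d (sub_add_cancel j 1)
          (A.dual.rsmul (zero_add_le p) (by omega) x b) := by
    intro p i j e b hb
    rw [θ.w.map_rsmul (zero_add_le p) (zero_add i) (zero_add m) e (by omega), hw,
      A.dual.d_rsmul (zero_add_le p) _ (sub_add_cancel m 1) rfl (sub_add_cancel j 1) (by omega)
        (by omega), hb, map_add, LinearMap.add_apply]
    simp
    rfl
  refine fun p i j e => ⟨fun b hb hv => ?_, fun c hc => ?_⟩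
  · obtain ⟨v, hv⟩ := hv
    obtain ⟨t, ht⟩ := (θ.w_quasiIso p i j e).1 _ (h1 p i b hb)
      ⟨v + A.dual.rsmul (zero_add_le p) (by omega) x b, by rw [h3 p i j e b hb, hv, map_add]⟩
    have h4 := h2 p i b hb
    have h5 := θ.q.map_d (add_zero (i - 1)) (add_zero i) (sub_add_cancel i 1) (sub_add_cancel i 1) t
    rw [← ht, h4] at h5
    refine ⟨θ.q.map p (add_zero (i - 1)) t - A.mul (zero_add_le p) (by omega) y b, ?_⟩
    rw [map_sub, h5]
    simp
  · obtain ⟨t, ht, v, rfl⟩ := (θ.w_quasiIso p i j e).2 c hc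
    have hb : A.d rfl (θ.q.map p (add_zero i) t) = 0 := by
      have := θ.q.map_d (add_zero i) (add_zero (i + 1)) rfl rfl t
      rw [ht, map_zero, smul_zero] at this
      exact this
    set b := θ.q.map p (add_zero i) t with hbdef
    obtain ⟨s, hs⟩ := (θ.q_quasiIso p i i (add_zero i)).1
      (θ.P.rsmul (zero_add_le p) (zero_add i) z b - t) (by rw [map_sub, h1 p i b hb, ht, sub_zero])
      ⟨A.mul (zero_add_le p) (by omega) y b, by
        rw [map_sub, h2 p i b hb, ← hbdef]; exact add_sub_cancel_left _ _⟩
    refine ⟨b, hb, v + A.dual.rsmul (zero_add_le p) (by omega) x b -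
      m.negOnePow • θ.w.map p (by omega) s, ?_⟩
    have h4 := h3 p i j e b hb
    have h5 := θ.w.map_d (show i - 1 + m = j - 1 by omega) e (sub_add_cancel i 1) (sub_add_cancel j 1) s
    rw [← hs, map_sub, h4] at h5
    rw [map_sub, map_add, negOnePow_smul, map_zsmul, h5, negOnePow_smul, sg_smul_sg_smul]
    abel

theorem Represents.isQuasiIso_gMap (h : θ.Represents ζ) (hA : A.IsCommutative) :
    PerverseComplex.IsQuasiIso A.self.toPerverseComplex A.dual.toPerverseComplex m
      (fun p _ _ e => A.gMap ζ p e) :=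
  (h.isQuasiIso_capHom hA).of_sign (fun i => (m : ZMod 2) * i) fun p i j e x =>
    lsmul_comm ζ hA _ (zero_add_le p) e (by omega) x

end DerivedDuality

end

end PDGA

namespace DGAlg

variable {R : Type v} {A : Type u} [CommRing R] [AddCommGroup A] [Module R A] {𝒜 : DGAlg R A}

theorem cap_eq {e m : ZMod 2} {z : A →ₗ[R] R} {f : List A → A} (hz : 𝒜.IsTrace m z)
    (hpf : 𝒜.Par e f) (l : List A) : 𝒜.conv 𝒜.dualBimod.lm m f (const0 z) l =
      sg (m * (e + 1)) • 𝒜.dualBimod.rm z (f l) := by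
  refine LinearMap.ext fun a => ?_
  have h : f (𝒜.twl (m + 1) l) = sg ((m + 1) * e) • 𝒜.twz (m + 1) (f l) := by
    rw [hpf.twz, sg_smul_sg_smul]
  rw [cap_apply hpf, LinearMap.smul_apply, dual_rm, hz.mul (f l), h, map_zsmul, map_zsmul,
    sg_smul_smul, sg_smul_smul]
  congr 2
  clear h hpf hz
  revert e m
  decide

end DGAlg

namespace PDGA

variable {R : Type u} [CommRing R] {n : ℕ} {A : PDGA R n}

open Realization

/-! ### The duality isomorphism on Hochschild cohomology -/

section

variable {m : ℤ} {ζ : A.dual.X (.zero n) m}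

theorem rm_trace (hA : A.IsCommutative) (hζ : A.dual.d rfl ζ = 0) (p : GMPerversity n) (i j : ℤ)
    (e : i + m = j) (x : A.self.X p i) : A.totAlg.dualBimod.rm (trace ζ) (A.selfReal.inn p i x) =
      A.dualReal.inn p j ((capHom ζ hA hζ).map p e x) := by
  refine (A.dualReal.rm_inn (GMPerversity.zero n) p m i ζ x).trans ?_
  have key : ∀ (q : GMPerversity n) (k : ℤ), q = p → k = j →
      A.dualReal.inn q k (ract A.dual ζ x q k) =
        A.dualReal.inn p j ((capHom ζ hA hζ).map p e x) := by
    rintro _ _ rfl rfl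
    rw [ract_pos (GMPerversity.per_add_le.2 (zero_add_le _)) (by omega)]
    rfl
  exact key _ _ (by rw [GMPerversity.per_zero, zero_add, Per.hull_per]) (by omega)

variable (ζ)

/-- The action of Hochschild cohomology on the class of the lift of `ζ`. -/
noncomputable def capHH (h : A.lift ζ ∈ cocycles A.dual (.zero n) m)
    {p : GMPerversity n} {i j : ℤ} (e : i + m = j) : HH A.self p i →ₗ[R] HH A.dual p j :=
  (A.dualReal.actHH (add_zero_le p) e).flip (cls (A.lift ζ) h)

variable {ζ}

theorem _root_.PDGA.Realization.Reps.cap (hA : A.IsCommutative) (hζ : A.dual.d rfl ζ = 0)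
    {p : GMPerversity n} {x : Per n} {i j : ℤ} (e : i + m = j) {F : List A.Tot → A.Tot}
    {ξ : HH A.self p i} (hF : A.selfReal.Reps p x i F ξ)
    (h : A.lift ζ ∈ cocycles A.dual (.zero n) m) :
    A.dualReal.Reps p x j (A.totAlg.conv A.totAlg.dualBimod.lm (m : ZMod 2) F
      (DGAlg.const0 (trace ζ))) (capHH ζ h e ξ) := by
  obtain ⟨h', hr⟩ := reps_lift ζ hA hζ
  exact (hF.act hr (add_zero_le p) e).cast (add_zero x) rfl

theorem bijective_capHH (hcof : A.BarCofibrant) (hA : A.IsCommutative) (hζ : A.dual.d rfl ζ = 0)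
    (hcap : (capHom ζ hA hζ).IsQuasiIso) (h : A.lift ζ ∈ cocycles A.dual (.zero n) m)
    (p : GMPerversity n) {i j : ℤ} (e : i + m = j) :
    Function.Bijective (capHH ζ h e : HH A.self p i →ₗ[R] HH A.dual p j) := by
  have hC : (fiber (capHom ζ hA hζ)).Acyclic := acyclic_fiber hcap
  have hz := isTrace ζ hA hζ
  let ρ := fiberReal A.selfReal A.dualReal hz.isHom (rm_trace hA hζ)
  have hj : (j : ZMod 2) = i + m := cast_eq_of_add_eq e
  constructor
  · refine (injective_iff_map_eq_zero _).2 fun ξ hξ => ?_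
    obtain ⟨F, hF⟩ := exists_reps (ρ := A.selfReal) ξ
    have h1 := hF.cap hA hζ e h
    rw [hξ] at h1
    obtain ⟨H, hH, h2⟩ := h1.exact (.zero le_rfl)
    let H' := sg ((m : ZMod 2) * i + m) • H
    have hFH : ρ.IsHoch p.per i (fun l => (F l, H' l)) :=
      isHoch_fiber.2 ⟨hF.hoch, (hH.zsmul _).cast rfl (by omega)⟩
    have hD : DGAlg.hD (DGBimod.fiber hz.isHom) i (fun l => (F l, H' l)) = 0 := by
      rw [DGBimod.hD_fiber, hF.cocycle, DGAlg.hD_zsmul]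
      funext l
      refine Prod.ext rfl ?_
      have h3 := congrFun h2 l
      rw [DGAlg.cap_eq hz hF.hoch.par', cast_succ_succ, Pi.add_apply, Pi.zero_apply, zero_add,
        cast_sub_one, hj] at h3
      change A.totAlg.dualBimod.rm (trace ζ) (F l) + sg _ • sg _ • _ = 0
      rw [← h3, sg_smul_smul, sg_smul_smul, show ((m : ZMod 2) + 1 + (m * i + m) + m * i) = 1 by
        linear_combination (m + m * i : ZMod 2) * zmod_two_eq_zero]
      simp
    obtain ⟨K, hK, h3⟩ := hcof.exists_primitive hC ρ hFH hD
    obtain ⟨hK₁, -⟩ := (isHoch_fiber (F := fun l => (K l).1) (G := fun l => (K l).2)).1 hK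
    refine hF.eq_of_exact (.zero (x := p.per) le_rfl) rfl hK₁ ?_
    rw [zero_add]
    rw [show K = fun l => ((K l).1, (K l).2) from rfl, DGBimod.hD_fiber] at h3
    exact funext fun l => congrArg Prod.fst (congrFun h3 l)
  · intro η
    obtain ⟨G, hG⟩ := exists_reps (ρ := A.dualReal) η
    have hFG : ρ.IsHoch p.per (i + 1) (fun l => (0, G l)) :=
      isHoch_fiber.2 ⟨.zero, hG.hoch.cast rfl (by omega)⟩
    have hD : DGAlg.hD (DGBimod.fiber hz.isHom) (i + 1 : ℤ) (fun l => (0, G l)) = 0 := by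
      have h0 : DGAlg.hD A.totAlg.selfBimod ((i + 1 : ℤ) : ZMod 2) (fun _ => (0 : A.Tot)) = 0 :=
        (congrArg _ (zero_smul R (0 : List A.Tot → A.Tot)).symm).trans
          ((DGAlg.hD_smul A.totAlg.selfBimod _ (0 : R) (0 : List A.Tot → A.Tot)).trans (zero_smul R _))
      rw [DGBimod.hD_fiber, h0, show ((i + 1 : ℤ) : ZMod 2) + m + 1 = j by
        rw [hj]; push_cast; linear_combination zmod_two_eq_zero, hG.cocycle]
      funext l
      simp
    obtain ⟨K, hK, h3⟩ := hcof.exists_primitive hC ρ hFG hD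
    obtain ⟨hK₁, hK₂⟩ := (isHoch_fiber (F := fun l => (K l).1) (G := fun l => (K l).2)).1 hK
    have hi : i + 1 - 1 = i := by omega
    rw [show K = fun l => ((K l).1, (K l).2) from rfl, DGBimod.hD_fiber, hi] at h3
    have hD₁ : DGAlg.hD A.totAlg.selfBimod i (fun l => (K l).1) = 0 :=
      funext fun l => (congrArg Prod.fst (congrFun h3 l)).symm
    have h4 := (hK₁.cast rfl hi).reps le_rfl hD₁
    refine ⟨sg ((m : ZMod 2) * i) • cls _ (h4.hoch.raw_mem_cocycles le_rfl hD₁), ?_⟩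
    refine ((h4.zsmul _).cap hA hζ e h |>.eq_of_exact hG rfl
      (K := -(sg (m + 1 : ZMod 2) • fun l => (K l).2)) ?_ ?_)
    · have := ((hK₂.zsmul (sg (m + 1 : ZMod 2))).zsmul (-1)).cast (c' := j - 1) rfl (by omega)
      simpa using this
    · funext l
      have h5 := congrArg Prod.snd (congrFun h3 l)
      rw [← neg_one_smul ℤ (_ • _), DGAlg.hD_zsmul, DGAlg.hD_zsmul,
        DGAlg.cap_eq hz (h4.zsmul _).hoch.par', cast_succ_succ]
      change G l = A.totAlg.dualBimod.rm (trace ζ) (K l).1 + sg _ • DGAlg.hD _ _ _ l at h5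
      change _ • A.totAlg.dualBimod.rm (trace ζ) (sg _ • (K l).1) = G l + (-1 : ℤ) • sg _ •
        DGAlg.hD _ _ _ l
      rw [h5, map_zsmul, sg_smul_sg_smul, cast_sub_one, hj]
      simp

/-- The duality isomorphism. -/
noncomputable def capEquiv (hcof : A.BarCofibrant) (hA : A.IsCommutative) (hζ : A.dual.d rfl ζ = 0)
    (hcap : (capHom ζ hA hζ).IsQuasiIso) (h : A.lift ζ ∈ cocycles A.dual (.zero n) m)
    {p : GMPerversity n} {i j : ℤ} (e : i + m = j) : HH A.self p i ≃ₗ[R] HH A.dual p j :=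
  LinearEquiv.ofBijective (capHH ζ h e) (bijective_capHH hcof hA hζ hcap h p e)

theorem isActionOn_capHH (hA : A.IsCommutative) (hζ : A.dual.d rfl ζ = 0)
    (h : A.lift ζ ∈ cocycles A.dual (.zero n) m) (p : GMPerversity n) (i j : ℤ)
    (e : i + m = j) (f : A.RawCochain A.self) (hf : f ∈ cocycles A.self p i) :
    ∃ hfc : act A.dual p (GMPerversity.zero n) i m f (A.lift ζ) ∈ cocycles A.dual p j,
      capHH ζ h e (cls f hf) = cls (act A.dual p (GMPerversity.zero n) i m f (A.lift ζ)) hfc := by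
  obtain ⟨F, hr, hF⟩ := exists_rep_cls (ρ := A.selfReal) hf
  have h1 := ((hr.act hF.hoch.mlin (r' := GMPerversity.zero n) (isRep_lift ζ)).cast
    (y := p.per) (add_zero _) e)
  have h2 := (hF.cap hA hζ e h).exists_cls_eq h1
  simpa only [h1.trunc_eq] using h2

theorem capHH_res (hA : A.IsCommutative) (hζ : A.dual.d rfl ζ = 0)
    (h : A.lift ζ ∈ cocycles A.dual (.zero n) m) {p q : GMPerversity n} (hp : p ≤ q) {i j : ℤ} (e : i + m = j) (ξ : HH A.self p i) :
    capHH ζ h e (A.selfReal.resHH hp ξ) = A.dualReal.resHH hp (capHH ζ h e ξ) := by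
  obtain ⟨F, hF⟩ := exists_reps (ρ := A.selfReal) ξ
  exact ((hF.res hp).cap hA hζ e h).eq ((hF.cap hA hζ e h).res hp) rfl rfl

theorem capHH_cup (hA : A.IsCommutative) (hζ : A.dual.d rfl ζ = 0)
    (h : A.lift ζ ∈ cocycles A.dual (.zero n) m) {p q r : GMPerversity n} {i j k j' k' : ℤ} (hpq : p.toFun + q.toFun ≤ r.toFun)
    (e : i + j = k) (ej : j + m = j') (ek : k + m = k') (e' : i + j' = k') (ξ : HH A.self p i)
    (η : HH A.self q j) : capHH ζ h ek (A.selfReal.actHH hpq e ξ η) =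
      A.dualReal.actHH hpq e' ξ (capHH ζ h ej η) := by
  obtain ⟨F, hF⟩ := exists_reps (ρ := A.selfReal) ξ
  obtain ⟨G, hG⟩ := exists_reps (ρ := A.selfReal) η
  refine ((hF.cup hG hpq e).cap hA hζ ek h).eq (hF.act (hG.cap hA hζ ej h) hpq e') rfl ?_
  rw [DGAlg.conv_assoc _ _ _ _ A.totAlg.dualBimod.mul_lm, cast_eq_of_add_eq ej]

theorem connesHH_cap_cup (hA : A.IsCommutative) (hζ : A.dual.d rfl ζ = 0)
    (h : A.lift ζ ∈ cocycles A.dual (.zero n) m) {p q r : GMPerversity n} {i j k i' j' k' t : ℤ}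
    (hpq : p.toFun + q.toFun ≤ r.toFun) (hqp : q.toFun + p.toFun ≤ r.toFun)
    (e : i + j = k) (e' : i + j = k' + 1) (ei : i + m = i' + 1) (ej : j + m = j' + 1)
    (ek : k + m = t + 1) (ek' : k' + m = t) (e₁ : j + i' = t) (e₂ : i + j' = t)
    (ξ : HH A.self p i) (η : HH A.self q j) :
    A.connesHH ek (capHH ζ h rfl (A.selfReal.actHH hpq e ξ η)) =
      sg (i : ZMod 2) • capHH ζ h ek' (bracketHH A hpq e' ξ η)
      + sg ((i + 1 : ZMod 2) * j) • A.dualReal.actHH hqp e₁ η (A.connesHH ei (capHH ζ h rfl ξ))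
      + sg (i : ZMod 2) • A.dualReal.actHH hpq e₂ ξ (A.connesHH ej (capHH ζ h rfl η)) := by
  obtain ⟨F, hF⟩ := exists_reps (ρ := A.selfReal) ξ
  obtain ⟨G, hG⟩ := exists_reps (ρ := A.selfReal) η
  have hz := isTrace ζ hA hζ
  have hk : (k : ZMod 2) = i + j := cast_eq_of_add_eq e
  have hi' : (i' : ZMod 2) = i + m + 1 := cast_eq_of_add_eq_succ ei
  have hj' : (j' : ZMod 2) = j + m + 1 := cast_eq_of_add_eq_succ ej
  have key := DGAlg.bv_identity hz hF.hoch.mlin hG.hoch.mlin hF.hoch.par' hG.hoch.par'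
    (by rw [cast_succ_succ]; exact hF.cocycle) (by rw [cast_succ_succ]; exact hG.cocycle)
  have h1 := ((hF.cup hG hpq e).cap hA hζ rfl h).connes ek
  have h2 := ((hF.bracket hG hpq e').cap hA hζ ek' h).zsmul (sg (i : ZMod 2))
  have h3 := (((hG.act ((hF.cap hA hζ rfl h).connes ei) hqp e₁).cast (add_comm _ _) rfl).zsmul
    (sg ((i + 1 : ZMod 2) * j)))
  have h4 := ((hF.act ((hG.cap hA hζ rfl h).connes ej) hpq e₂).zsmul (sg (i : ZMod 2)))
  have hb := (((hF.hoch.bvH (rel_trace ζ) hG.hoch m (i + 1) (j + 1)).zsmul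
      (sg ((i + 1 + (j + 1) + 1) * (i + 1 + (j + 1) + m) + (i + 1) : ZMod 2))).add
    (((hG.hoch.bvH (rel_trace ζ) hF.hoch m (j + 1) (i + 1)).cast (add_comm _ _) (by ring)).zsmul
      (sg ((i + 1 + 1) * (j + 1 + 1) + (i + 1 + (j + 1) + 1) * (i + 1 + (j + 1) + m) + (j + 1) : ZMod 2)))).cast
        (c' := t - 1) rfl (by omega)
  refine h1.eq_of_exact ((h2.add h3).add h4) rfl hb ?_
  rw [connesOp_eq _ (DGAlg.mlin_conv _ _ (DGAlg.mlin_conv _ _ hF.hoch.mlin hG.hoch.mlin)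
      (DGAlg.mlin_const0 _)),
    connesOp_eq _ (DGAlg.mlin_conv _ _ hF.hoch.mlin (DGAlg.mlin_const0 _)),
    connesOp_eq _ (DGAlg.mlin_conv _ _ hG.hoch.mlin (DGAlg.mlin_const0 _))]
  have ht : ((t - 1 : ℤ) : ZMod 2) = i + 1 + (j + 1) + m := by
    rw [cast_sub_one, cast_eq_of_add_eq e₁, hi']
    ring
  have hij : (i + 1 + (j + 1) + 1 + 1 + m : ZMod 2) = i + j + m := by
    linear_combination 2 * zmod_two_eq_zero
  rw [ht]
  rw [cast_succ_succ (j : ZMod 2), hij] at key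
  push_cast
  rw [hk, hi', hj']
  simp only [cast_succ_succ] at key ⊢
  exact key

end

theorem connesHH_res {p q : GMPerversity n} (h : p ≤ q) {i k : ℤ} (e : i = k + 1)
    (ξ : HH A.dual p i) :
    A.connesHH e (A.dualReal.resHH h ξ) = A.dualReal.resHH h (A.connesHH e ξ) := by
  obtain ⟨F, hF⟩ := exists_reps (ρ := A.dualReal) ξ
  exact ((hF.res h).connes e).eq ((hF.connes e).res h) rfl rfl

theorem connesHH_connesHH {p : GMPerversity n} {i j k : ℤ} (e : i = j + 1) (e' : j = k + 1)
    (ξ : HH A.dual p i) : A.connesHH e' (A.connesHH e ξ) = 0 := by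
  obtain ⟨F, hF⟩ := exists_reps (ρ := A.dualReal) ξ
  refine ((hF.connes e).connes e').eq (Reps.zero le_rfl) rfl ?_
  rw [connesOp_eq _ hF.hoch.mlin, connesOp_eq _ (DGAlg.mlin_connes hF.hoch.mlin)]
  have h := DGAlg.connes_connes (c := (i : ZMod 2)) hF.hoch.mlin hF.hoch.norm
  rwa [show (i : ZMod 2) + 1 = j by rw [e]; push_cast; exact cast_succ_succ _] at h

/-- The Batalin–Vilkovisky operator on Hochschild cohomology obtained from the dual of the Connes
boundary by transport along the isomorphism given by a cocycle of the dual bimodule. -/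
noncomputable def bvOperator {m : ℤ} {ζ : A.dual.X (.zero n) m}
    (hcof : A.BarCofibrant) (hA : A.IsCommutative) (hζ : A.dual.d rfl ζ = 0)
    (hcap : (capHom ζ hA hζ).IsQuasiIso) (h : A.lift ζ ∈ cocycles A.dual (.zero n) m) :
    A.hochschildGerstenhaber.BVOperator where
  Δ {p i k} e := (capEquiv hcof hA hζ hcap h (p := p) (rfl : k + m = _)).symm.toLinearMap ∘ₗ
    A.connesHH (by omega : i + m = (k + m) + 1) ∘ₗ capHH ζ h rfl
  Δ_res {p q i k} hp e ξ := by
    refine (LinearEquiv.symm_apply_eq _).2 ?_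
    refine Eq.trans ?_ (capHH_res hA hζ h hp rfl _).symm
    refine Eq.trans ?_ (congrArg _ (LinearEquiv.apply_symm_apply (capEquiv hcof hA hζ hcap h rfl) _).symm)
    exact (congrArg _ (capHH_res hA hζ h hp rfl ξ)).trans (connesHH_res hp _ _)
  Δ_Δ {p i j k} e e' ξ := by
    refine (LinearEquiv.symm_apply_eq _).2 ?_
    refine (congrArg _ (LinearEquiv.apply_symm_apply (capEquiv hcof hA hζ hcap h rfl) _)).trans ?_
    exact (connesHH_connesHH _ _ _).trans (map_zero _).symm
  bv {p q r i i' j j' k k'} hpq ei ej ek e e₁ e₂ e' ξ η := by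
    have hqp : q.toFun + p.toFun ≤ r.toFun := (add_comm _ _).trans_le hpq
    have hji : j + i' = k' := by omega
    have key := connesHH_cap_cup hA hζ h hpq hqp e e' (by omega : i + m = (i' + m) + 1)
      (by omega : j + m = (j' + m) + 1) (by omega : k + m = (k' + m) + 1) rfl (by omega) (by omega)
      ξ η
    set δξ := (capEquiv hcof hA hζ hcap h (p := p) (rfl : i' + m = _)).symm
      (A.connesHH (by omega : i + m = (i' + m) + 1) (capHH ζ h rfl ξ))
    set δη := (capEquiv hcof hA hζ hcap h (p := q) (rfl : j' + m = _)).symm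
      (A.connesHH (by omega : j + m = (j' + m) + 1) (capHH ζ h rfl η))
    have h1 : A.connesHH (by omega : i + m = (i' + m) + 1) (capHH ζ h rfl ξ) = capHH ζ h rfl δξ :=
      (LinearEquiv.apply_symm_apply (capEquiv hcof hA hζ hcap h rfl) _).symm
    have h2 : A.connesHH (by omega : j + m = (j' + m) + 1) (capHH ζ h rfl η) = capHH ζ h rfl δη :=
      (LinearEquiv.apply_symm_apply (capEquiv hcof hA hζ hcap h rfl) _).symm
    rw [h1, h2, ← capHH_cup hA hζ h hqp hji rfl rfl,
      ← capHH_cup hA hζ h hpq e₂ rfl rfl] at key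
    have hc : A.selfReal.actHH hqp hji η δξ =
        (j * i').negOnePow • A.selfReal.actHH hpq e₁ δξ η :=
      A.hochschildGerstenhaber.cup_comm hqp hpq hji e₁ η δξ
    rw [negOnePow_smul, show ((j * i' : ℤ) : ZMod 2) = (i + 1) * j by
      rw [ei]; push_cast; rw [cast_succ_succ, mul_comm]] at hc
    rw [hc, map_zsmul, sg_smul_sg_smul, ← map_zsmul (capHH ζ h _), ← map_zsmul (capHH ζ h _), ← map_add,
      ← map_add] at key
    have hδ := (LinearEquiv.symm_apply_eq (capEquiv hcof hA hζ hcap h (rfl : k' + m = _))).2 key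
    rw [negOnePow_smul, negOnePow_smul]
    refine eq_sub_of_add_eq (eq_sub_of_add_eq (Eq.trans ?_ hδ.symm))
    exact add_right_comm _ _ _

end PDGA

theorem theoremD {R : Type u} [CommRing R] {n : ℕ} (A : PDGA R n) (hcomm : A.IsCommutative)
    (hcof : A.BarCofibrant) (hdual : A.IsPDPDA) :
    ∃ G : PerverseGerstenhaber R n (PDGA.HH A.self), A.IsHochschildGerstenhaber G ∧
      (∃ (m : ℤ) (θ : A.DerivedDuality m) (ζ : A.dual.X (GMPerversity.zero n) m),
        θ.Represents ζ) ∧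
      ∀ (m : ℤ) (θ : A.DerivedDuality m) (ζ : A.dual.X (GMPerversity.zero n) m),
        θ.Represents ζ →
        PerverseComplex.IsQuasiIso A.self.toPerverseComplex A.dual.toPerverseComplex m
          (fun p _ _ e => A.gMap ζ p e) ∧
        ∃ hc : A.lift ζ ∈ PDGA.cocycles A.dual (GMPerversity.zero n) m,
          PDGA.Bdual (GMPerversity.zero n) m (A.lift ζ) hc.1 = 0 ∧
          ∃ (Φ : ∀ {p : GMPerversity n} {i j : ℤ}, i + m = j →
              PDGA.HH A.self p i ≃ₗ[R] PDGA.HH A.dual p j)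
            (b : ∀ {p : GMPerversity n} {i k : ℤ}, i = k + 1 →
              PDGA.HH A.dual p i →ₗ[R] PDGA.HH A.dual p k)
            (D : G.BVOperator),
            A.IsActionOn (A.lift ζ) Φ ∧ A.IsInducedByBdual b ∧
            ∀ {p : GMPerversity n} {i k j l : ℤ} (e : i = k + 1) (e₁ : i + m = j)
              (e₂ : k + m = l) (e₃ : j = l + 1) (x : PDGA.HH A.self p i),
              Φ e₂ (D.Δ e x) = b e₃ (Φ e₁ x) := by
  refine ⟨A.hochschildGerstenhaber, A.isHochschildGerstenhaber, hdual.exists_represents,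
    fun m θ ζ hr => ⟨hr.isQuasiIso_gMap hcomm, ?_⟩⟩
  have hζ := hr.d_eq_zero
  have hcap := hr.isQuasiIso_capHom hcomm
  have hc : A.lift ζ ∈ PDGA.cocycles A.dual (GMPerversity.zero n) m := by
    obtain ⟨hc, -⟩ := PDGA.reps_lift ζ hcomm hζ
    exact hc
  refine ⟨hc, PDGA.bdual_lift ζ hc.1, fun e => PDGA.capEquiv hcof hcomm hζ hcap hc e,
    fun e => A.connesHH e, PDGA.bvOperator hcof hcomm hζ hcap hc,
    fun p i j e f hf => PDGA.isActionOn_capHH hcomm hζ hc p i j e f hf, PDGA.isInducedByBdual_connesHH, ?_⟩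
  intro p i k j l e e₁ e₂ e₃ x
  subst e₁ e₂
  exact LinearEquiv.apply_symm_apply (PDGA.capEquiv hcof hcomm hζ hcap hc rfl) _
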